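/- Let $X$ be a compact complex manifold of dimension $n$ and $E\to X$ a holomorphic vector bundle of rank $r\ge 1$ such that $\det E$ is ample (so $X$ is projective). For a smooth hermitian metric $h$ on $E$ let $\Theta_{E,h}=i\bar\partial(h^{-1}\partial h)=i\sum c_{jk\lambda\mu}\,dz_j\wedge d\bar z_k\otimes e_\lambda^*\otimes e_\mu$ be its Chern curvature (written with an $h$-orthonormal frame $(e_\lambda)$ at the given point), and put $\omega_h=\Theta_{\det E,\det h}=\mathrm{tr}_E\,\Theta_{E,h}$, $\Theta^\circ_{E,h}=\Theta_{E,h}-\frac1r\,\omega_h\otimes\mathrm{Id}_E$, and, for $t\in\mathbb R$, $\theta_t(h)=\Theta_{E,h}+t\,\omega_h\otimes\mathrm{Id}_E$. For $P=N,N^*,G$, $\theta_t(h)>_P0$ means, respectively: the hermitian form of $\theta_t(h)$ on $T_X\otimes E$ is positive definite (Nakano); the hermitian form of the transpose ${}^T\theta_t(h)$ on $T_X\otimes E^*$ is positive definite (dual Nakano); the hermitian form of $\theta_t(h)$ is positive on all nonzero decomposable tensors $\xi\otimes v\in T_X\otimes E$ (Griffiths). Let $\Phi_N(\theta)=\det_{T_X\otimes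 E}(\theta)^{1/r}$, $\Phi_{N^*}(\theta)=\det_{T_X\otimes E^*}({}^T\theta)^{1/r}$ (determinants in coordinates on $X$ and orthonormal frames of $E$, viewed as coefficients of $i\,dz_1\wedge d\bar z_1\wedge\dots\wedge i\,dz_n\wedge d\bar z_n$) and, for a fixed $s>0$, $\Phi_{G}(\theta)=\Phi_{G,s}(\theta)=\big(\int_{|v|_h=1}(\langle\theta v,v\rangle_h^n)^{-s}\,d\sigma(v)\big)^{-1/s}$, where $\sigma$ is the unitary invariant probability measure on the unit sphere of the fibre of $E$. For $\theta_t(h)>_P0$ define, with norms, determinants and cofactor matrices taken with respect to $h$ on $E$ and $\omega_h$ on $T_X$, $$\beta_{N,t,h}=\frac{\sqrt{n-1}+1}{r}\,\frac{|\Theta^\circ_{E,h}|\,|\theta_t(h)^{\rm cof}|}{\det\theta_t(h)},\qquad \beta_{N^*,t,h}=\frac{\sqrt{n-1}+1}{r}\,\frac{|\Theta^\circ_{E,h}|\,|({}^T\theta_t(h))^{\rm cof}|}{\det{}^T\theta_t(h)},$$ $$\beta_{G,t,h}=(\sqrt{n-1}+1)\,|\Theta^\circ_{E,h}|\Big(\int_{|v|_h=1}\frac{d\sigma(v)}{(\langle\theta_t(h)v,v\rangle_h^n)^s}\Big)^{-1}\int_{|v|_h=1}\frac{n\,\langle\theta_t(h)v,v\rangle_h^{n-1}\wedge\omega_h}{(\langle\theta_t(h)v,v\rangle_h^n)^{s+1}}\,d\sigma(v)$$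 (for $n=0$ the tensor $\Theta^\circ_{E,h}$ vanishes and these functions are $0$). Let $\Omega$ be a smooth positive volume form on $X$, let $P\in\{N,N^*,G\}$, and let $t\in\mathbb R$ be such that $E\otimes(\det E)^t>_P0$, i.e. $\theta_t(h_0)>_P0$ for some smooth hermitian metric $h_0$ on $E$. Then for every smooth hermitian metric $h$ on $E$ with $\theta_t(h)>_P0$: 1. $\beta_{P,t,h}$ is a continuous function $X\to[0,+\infty)$. 2. For every real $\beta>\sup_X\beta_{P,t,h}$ there is a neighbourhood $U$ of $h$ in the space of smooth hermitian metrics on $E$ with the $C^2$ topology such that every $h'\in U$ satisfies $\theta_t(h')>_P0$ and $\omega_{h'}>0$, and such that for all right-hand sides of order at most one, $f(z)=F(z,h(z),D_zh(z))>0$ and $g(z)=G(z,h(z),D_zh(z))\in\mathrm{Herm}^\circ_{h(z)}(E_z,E_z)$ (trace free $h$-hermitian endomorphisms) with $F,G$ differentiable in $(h,D_zh)$ for each fixed $z$, the system $$\Big(\frac{\omega_h^n}{\Omega}\Big)^{\beta}\,\Omega^{-1}\,\Phi_P\big(\Theta_{E,h}+t\,\omega_h\otimes\mathrm{Id}_E\big)=f,\qquad(\omega_h^n)^{-1}\big(\omega_h^{n-1}\wedge\Theta^\circ_{E,h}\big)=g$$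 has an elliptic linearization at every $h'\in U$: the derivative at $h'$ of the difference of the two sides is a real linear differential operator of order at most $2$ on smooth hermitian forms on $E$, and its principal symbol at every nonzero real cotangent vector at a point $z$ is a bijection from the hermitian forms on $E_z$ onto $\mathbb R\oplus\mathrm{Herm}^\circ_{h'(z)}(E_z,E_z)$. -/

import Mathlib

open Bundle MeasureTheory
open scoped Manifold ContDiff Matrix Topology ComplexOrder

noncomputable section

namespace YangMills

/-- The three positivity concepts: Nakano, dual Nakano, Griffiths. -/
inductive PositivityType
  | nakano
  | dualNakano
  | griffiths

/-! ### Linear algebra at one point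

At a point, `H` is the Gram matrix of the hermitian metric in a frame `e` of the bundle,
`H μ l = ⟨e l, e μ⟩`, so that `⟨v, w⟩ = star w ⬝ᵥ H *ᵥ v`. A curvature type tensor
`i ∑ c j k dz_j ∧ dz̄_k` with values in endomorphisms is the family of matrices
`c j k` in the same frame. No orthonormality of frames or coordinates is assumed. -/

section Pointwise

variable {n r : ℕ}

/-- Coefficients of the (1,1)-form `tr_E`, i.e. of the curvature of `det E`:
`i ∑ (traceForm c) j k dz_j ∧ dz̄_k`. -/
def traceForm (c : Fin n → Fin n → Matrix (Fin r) (Fin r) ℂ) : Matrix (Fin n) (Fin n) ℂ :=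
  Matrix.of fun j k => (c j k).trace

/-- `Θ + t tr_E Θ ⊗ Id`. -/
def twist (t : ℝ) (c : Fin n → Fin n → Matrix (Fin r) (Fin r) ℂ) :
    Fin n → Fin n → Matrix (Fin r) (Fin r) ℂ :=
  fun j k => c j k + ((t : ℂ) * (c j k).trace) • (1 : Matrix (Fin r) (Fin r) ℂ)

/-- `Θ° = Θ - (1/r) tr_E Θ ⊗ Id`. -/
def traceFree (c : Fin n → Fin n → Matrix (Fin r) (Fin r) ℂ) :
    Fin n → Fin n → Matrix (Fin r) (Fin r) ℂ :=
  twist (-(1 / (r : ℝ))) c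

/-- Gram matrix of the dual metric in the dual frame. -/
def dualMetric (H : Matrix (Fin r) (Fin r) ℂ) : Matrix (Fin r) (Fin r) ℂ := (H⁻¹)ᵀ

/-- The transposed tensor, with values in endomorphisms of the dual bundle. -/
def transposeTensor (c : Fin n → Fin n → Matrix (Fin r) (Fin r) ℂ) :
    Fin n → Fin n → Matrix (Fin r) (Fin r) ℂ :=
  fun j k => (c j k)ᵀ

/-- Matrix of the hermitian form on `T ⊗ E` attached to `c`; the value of the form at `γ` is
`star γ ⬝ᵥ formMatrix H c *ᵥ γ = ∑ ⟨c j k γ_j, γ_k⟩`. -/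
def formMatrix (H : Matrix (Fin r) (Fin r) ℂ) (c : Fin n → Fin n → Matrix (Fin r) (Fin r) ℂ) :
    Matrix (Fin n × Fin r) (Fin n × Fin r) ℂ :=
  Matrix.of fun a b => (H * c b.1 a.1) a.2 b.2

/-- The (real) value at `γ ∈ T ⊗ E` of the quadratic form attached to `c`. -/
def quadForm (H : Matrix (Fin r) (Fin r) ℂ) (c : Fin n → Fin n → Matrix (Fin r) (Fin r) ℂ)
    (γ : Fin n × Fin r → ℂ) : ℝ :=
  (star γ ⬝ᵥ formMatrix H c *ᵥ γ).re

/-- Positivity of the given type: on all nonzero tensors of `T ⊗ E` (Nakano), all nonzero tensors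
of `T ⊗ E*` for the transposed tensor (dual Nakano), all nonzero decomposable tensors
(Griffiths). -/
def IsPositive (H : Matrix (Fin r) (Fin r) ℂ)
    (c : Fin n → Fin n → Matrix (Fin r) (Fin r) ℂ) : PositivityType → Prop
  | .nakano => ∀ γ : Fin n × Fin r → ℂ, γ ≠ 0 → 0 < quadForm H c γ
  | .dualNakano => ∀ γ : Fin n × Fin r → ℂ, γ ≠ 0 →
      0 < quadForm (dualMetric H) (transposeTensor c) γ
  | .griffiths => ∀ (ξ : Fin n → ℂ) (v : Fin r → ℂ), ξ ≠ 0 → v ≠ 0 →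
      0 < quadForm H c (fun a => ξ a.1 * v a.2)

/-- `|v|²` for the metric `H`. -/
def normSqOf (H : Matrix (Fin r) (Fin r) ℂ) (v : Fin r → ℂ) : ℝ := (star v ⬝ᵥ H *ᵥ v).re

/-- The unitary invariant probability measure on the unit sphere `|v|_H = 1`: the image of the
normalized Lebesgue measure of the unit ball of `H` under `v ↦ v / |v|_H`. -/
def sphereMeasure (H : Matrix (Fin r) (Fin r) ℂ) : Measure (Fin r → ℂ) :=
  (ProbabilityTheory.cond volume {v : Fin r → ℂ | v ≠ 0 ∧ normSqOf H v ≤ 1}).map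
    fun v => (Real.sqrt (normSqOf H v))⁻¹ • v

/-- Coefficient matrix of the (1,1)-form `⟨c · v, v⟩`. -/
def vectorForm (H : Matrix (Fin r) (Fin r) ℂ) (c : Fin n → Fin n → Matrix (Fin r) (Fin r) ℂ)
    (v : Fin r → ℂ) : Matrix (Fin n) (Fin n) ℂ :=
  Matrix.of fun j k => star v ⬝ᵥ (H * c j k) *ᵥ v

/-- Coefficient of `α^n` with respect to `i dz_1 ∧ dz̄_1 ∧ … ∧ i dz_n ∧ dz̄_n`, where
`α = i ∑ α j k dz_j ∧ dz̄_k`. -/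
def topPower (α : Matrix (Fin n) (Fin n) ℂ) : ℝ := (n.factorial : ℝ) * α.det.re

/-- Coefficient of `n α^(n-1) ∧ η` with respect to `i dz_1 ∧ dz̄_1 ∧ … ∧ i dz_n ∧ dz̄_n`
(the derivative of `topPower` at `α` in the direction `η`). -/
def mixedPower (α η : Matrix (Fin n) (Fin n) ℂ) : ℝ :=
  (n.factorial : ℝ) * (α.adjugate * η).trace.re

/-- The coefficient of `Φ_N` with respect to `i dz_1 ∧ dz̄_1 ∧ … ∧ i dz_n ∧ dz̄_n`, namely
`det_{T ⊗ E}(c)^(1/r)`, the determinant being taken with respect to coordinates on `T` and an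
orthonormal frame of `E` (which is why one divides by `det(H)^n` in an arbitrary frame). -/
def phiNakano (H : Matrix (Fin r) (Fin r) ℂ)
    (c : Fin n → Fin n → Matrix (Fin r) (Fin r) ℂ) : ℝ :=
  ((formMatrix H c).det / H.det ^ n).re ^ (1 / (r : ℝ))

/-- The coefficient of `Φ_{G,s}`, namely `(∫_{|v|=1} (⟨c v, v⟩^n)^(-s) dσ(v))^(-1/s)`. -/
def phiGriffiths (s : ℝ) (H : Matrix (Fin r) (Fin r) ℂ)
    (c : Fin n → Fin n → Matrix (Fin r) (Fin r) ℂ) : ℝ :=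
  (∫ v, 1 / (topPower (vectorForm H c v)) ^ s ∂(sphereMeasure H)) ^ (-(1 / s))

/-- The coefficient of `Φ_P`, with `Φ_P = Φ_{G,s}` in the Griffiths case. -/
def phi (s : ℝ) (H : Matrix (Fin r) (Fin r) ℂ)
    (c : Fin n → Fin n → Matrix (Fin r) (Fin r) ℂ) : PositivityType → ℝ
  | .nakano => phiNakano H c
  | .dualNakano => phiNakano (dualMetric H) (transposeTensor c)
  | .griffiths => phiGriffiths s H c

/-- Gram matrix of the metric `ω ⊗ H` on `T ⊗ E`, where `ω = i ∑ W j k dz_j ∧ dz̄_k`. -/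
def gram (W : Matrix (Fin n) (Fin n) ℂ) (H : Matrix (Fin r) (Fin r) ℂ) :
    Matrix (Fin n × Fin r) (Fin n × Fin r) ℂ :=
  Matrix.of fun a b => W b.1 a.1 * H a.2 b.2

/-- The endomorphism of `T ⊗ E` representing the hermitian form of `c` with respect to the metric
`ω ⊗ H`; in orthonormal coordinates and frames it is the matrix of the hermitian form. -/
def repEndo (W : Matrix (Fin n) (Fin n) ℂ) (H : Matrix (Fin r) (Fin r) ℂ)
    (c : Fin n → Fin n → Matrix (Fin r) (Fin r) ℂ) :
    Matrix (Fin n × Fin r) (Fin n × Fin r) ℂ :=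
  (gram W H)⁻¹ * formMatrix H c

/-- Hilbert-Schmidt norm `(tr S²)^(1/2)` of an endomorphism `S` that is self-adjoint for some
hermitian inner product. -/
def selfAdjointNorm {ι : Type*} [Fintype ι] (S : Matrix ι ι ℂ) : ℝ :=
  Real.sqrt (S * S).trace.re

/-- `|θ^cof| / det θ`, computed in orthonormal coordinates and frames. -/
def cofactorRatio (W : Matrix (Fin n) (Fin n) ℂ) (H : Matrix (Fin r) (Fin r) ℂ)
    (θ : Fin n → Fin n → Matrix (Fin r) (Fin r) ℂ) : ℝ :=
  selfAdjointNorm (repEndo W H θ).adjugate / (repEndo W H θ).det.re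

/-- The distortion functions at a point, in terms of the metric `H` and the curvature `c`, with
`ω = tr_E Θ`, `θ = Θ + t ω ⊗ Id`:
* Nakano: `(√(n-1)+1)/r · |Θ°| |θ^cof| / det θ`;
* dual Nakano: the same with the transpose of `θ`;
* Griffiths: `(√(n-1)+1) |Θ°| (∫ (⟨θ v, v⟩^n)^(-s) dσ)⁻¹
  ∫ n ⟨θ v, v⟩^(n-1) ∧ ω / (⟨θ v, v⟩^n)^(s+1) dσ`. -/
def distortionAt (s t : ℝ) (H : Matrix (Fin r) (Fin r) ℂ)
    (c : Fin n → Fin n → Matrix (Fin r) (Fin r) ℂ) : PositivityType → ℝ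
  | .nakano => (Real.sqrt ((n : ℝ) - 1) + 1) / (r : ℝ) *
      (selfAdjointNorm (repEndo (traceForm c) H (traceFree c)) *
        cofactorRatio (traceForm c) H (twist t c))
  | .dualNakano => (Real.sqrt ((n : ℝ) - 1) + 1) / (r : ℝ) *
      (selfAdjointNorm (repEndo (traceForm c) H (traceFree c)) *
        cofactorRatio (traceForm c) (dualMetric H) (transposeTensor (twist t c)))
  | .griffiths => (Real.sqrt ((n : ℝ) - 1) + 1) *
      selfAdjointNorm (repEndo (traceForm c) H (traceFree c)) *
      (∫ v, 1 / (topPower (vectorForm H (twist t c) v)) ^ s ∂(sphereMeasure H))⁻¹ *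
      ∫ v, mixedPower (vectorForm H (twist t c) v) (traceForm c) /
        (topPower (vectorForm H (twist t c) v)) ^ (s + 1) ∂(sphereMeasure H)

/-- `(ω^n)⁻¹ (ω^(n-1) ∧ Θ°)`, i.e. `1/n` times the contraction of `Θ°` with
`ω = i ∑ (tr c j k) dz_j ∧ dz̄_k`. -/
def hermiteEinstein (c : Fin n → Fin n → Matrix (Fin r) (Fin r) ℂ) :
    Matrix (Fin r) (Fin r) ℂ :=
  (1 / (n : ℂ)) • ∑ j, ∑ k, ((traceForm c)⁻¹ k j) • traceFree c j k

/-- Hermitian endomorphisms with respect to `H` that are trace free. -/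
def traceFreeHermitian (H : Matrix (Fin r) (Fin r) ℂ) : Set (Matrix (Fin r) (Fin r) ℂ) :=
  {A | A.trace = 0 ∧ (H * A).IsHermitian}

/-- The pairs `(H, DH)` formed by a positive hermitian matrix and the first derivatives of a field
of hermitian matrices. -/
def metricJets (n r : ℕ) :
    Set ((Fin r → Fin r → ℂ) × ((Fin n → ℂ) →L[ℝ] (Fin r → Fin r → ℂ))) :=
  {J | (Matrix.of J.1).PosDef ∧ ∀ ζ, (Matrix.of (J.2 ζ)).IsHermitian}

end Pointwise

/-! ### Wirtinger derivatives on `ℂ^n` -/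

section Wirtinger

variable {n : ℕ}

/-- `∂f/∂z_j`. -/
def dz (j : Fin n) (f : (Fin n → ℂ) → ℂ) (p : Fin n → ℂ) : ℂ :=
  (1 / 2) * (fderiv ℝ f p (Pi.single j 1) - Complex.I * fderiv ℝ f p (Pi.single j Complex.I))

/-- `∂f/∂z̄_j`. -/
def dzbar (j : Fin n) (f : (Fin n → ℂ) → ℂ) (p : Fin n → ℂ) : ℂ :=
  (1 / 2) * (fderiv ℝ f p (Pi.single j 1) + Complex.I * fderiv ℝ f p (Pi.single j Complex.I))

end Wirtinger

/-! ### Hermitian metrics on a holomorphic vector bundle -/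

section Bundle

variable {n r : ℕ} {X : Type*} [TopologicalSpace X] [ChartedSpace (Fin n → ℂ) X]
  {E : X → Type*} [∀ x, AddCommGroup (E x)] [∀ x, Module ℂ (E x)]
  [TopologicalSpace (TotalSpace (Fin r → ℂ) E)] [∀ x, TopologicalSpace (E x)]
  [FiberBundle (Fin r → ℂ) E]

/-- The matrix at `y` of a family of sesquilinear forms on the fibres, in the holomorphic frame
given by the preferred trivialization at `x`. -/
def frameMatrix (u : ∀ x, E x → E x → ℂ) (x y : X) : Fin r → Fin r → ℂ :=
  fun μ l => u y ((trivializationAt (Fin r → ℂ) E x).symm y (Pi.single l 1))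
    ((trivializationAt (Fin r → ℂ) E x).symm y (Pi.single μ 1))

/-- The same matrix, as a function of the preferred holomorphic coordinates at `x`. -/
def localMatrix (u : ∀ x, E x → E x → ℂ) (x : X) : (Fin n → ℂ) → Fin r → Fin r → ℂ :=
  fun p => frameMatrix u x ((chartAt (Fin n → ℂ) x).symm p)

variable (n) in
/-- Smooth families of hermitian forms on the fibres of `E`. -/
structure IsSmoothHermitian (u : ∀ x, E x → E x → ℂ) : Prop where
  add_left : ∀ x v v' w, u x (v + v') w = u x v w + u x v' w
  smul_left : ∀ x (a : ℂ) v w, u x (a • v) w = a * u x v w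
  conj_symm : ∀ x v w, u x w v = star (u x v w)
  smooth : ∀ x μ l, ContMDiffOn 𝓘(ℝ, Fin n → ℂ) 𝓘(ℝ, ℂ) ∞
    (fun y => frameMatrix (r := r) u x y μ l) (trivializationAt (Fin r → ℂ) E x).baseSet

variable (n r) in
/-- Smooth hermitian metrics. -/
def IsHermitianMetric (h : ∀ x, E x → E x → ℂ) : Prop :=
  IsSmoothHermitian n (r := r) h ∧ ∀ x v, v ≠ 0 → 0 < (h x v v).re

/-- The matrix of `h` at `z` in the preferred frame at `z`. -/
def metricAt (h : ∀ x, E x → E x → ℂ) (z : X) : Matrix (Fin r) (Fin r) ℂ :=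
  Matrix.of (frameMatrix h z z)

/-- The matrix of coefficients of `dz_j` in the Chern connection form `h⁻¹ ∂h`. -/
def connectionMatrix (h : ∀ x, E x → E x → ℂ) (z : X) (j : Fin n) (p : Fin n → ℂ) :
    Matrix (Fin r) (Fin r) ℂ :=
  (Matrix.of (localMatrix h z p))⁻¹ *
    Matrix.of fun μ l => dz j (fun q => localMatrix h z q μ l) p

/-- The Chern curvature `Θ = i ∂̄(h⁻¹ ∂h) = i ∑ c j k dz_j ∧ dz̄_k` at `z`, in the preferred
coordinates and frame at `z`: `c j k = - ∂/∂z̄_k (h⁻¹ ∂h/∂z_j)`. -/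
def curvature (h : ∀ x, E x → E x → ℂ) (z : X) (j k : Fin n) : Matrix (Fin r) (Fin r) ℂ :=
  Matrix.of fun μ l =>
    - dzbar k (fun p => connectionMatrix h z j p μ l) (chartAt (Fin n → ℂ) z z)

variable (n r) in
/-- `Θ_{E,h} + t Θ_{det E, det h} ⊗ Id_E >_P 0`. -/
def IsTwistPositive (P : PositivityType) (t : ℝ) (h : ∀ x, E x → E x → ℂ) : Prop :=
  ∀ z, IsPositive (metricAt (r := r) h z) (twist t (curvature (n := n) h z)) P

variable (n r) in
/-- The distortion function `β_{P,t,h}`. -/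
def distortion (P : PositivityType) (s t : ℝ) (h : ∀ x, E x → E x → ℂ) (z : X) : ℝ :=
  distortionAt s t (metricAt (r := r) h z) (curvature (n := n) h z) P

variable (n) in
/-- A smooth positive volume form. `Ω y` is its coefficient with respect to
`i dz_1 ∧ dz̄_1 ∧ … ∧ i dz_n ∧ dz̄_n` in the preferred chart at `y`; the coefficient in the chart at
`x` is obtained with the squared modulus of the complex jacobian. -/
def IsVolumeForm (Ω : X → ℝ) : Prop :=
  (∀ y, 0 < Ω y) ∧ ∀ x, ContMDiffOn 𝓘(ℝ, Fin n → ℂ) 𝓘(ℝ, ℝ) ∞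
    (fun y => Ω y * ‖LinearMap.det (fderiv ℂ
      (fun p => chartAt (Fin n → ℂ) y ((chartAt (Fin n → ℂ) x).symm p))
      (chartAt (Fin n → ℂ) x y) : (Fin n → ℂ) →ₗ[ℂ] (Fin n → ℂ))‖ ^ 2)
    (chartAt (Fin n → ℂ) x).source

/-! ### The system of differential equations -/

variable (n r) in
/-- `Q_ℝ(h) = (ω_h^n / Ω)^β Ω⁻¹ Φ_P(Θ_{E,h} + t ω_h ⊗ Id)`, where `ω_h = Θ_{det E, det h}`. -/
def scalarOperator (P : PositivityType) (s t β : ℝ) (Ω : X → ℝ) (h : ∀ x, E x → E x → ℂ) (z : X) : ℝ :=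
  (topPower (traceForm (curvature (n := n) (r := r) h z)) / Ω z) ^ β * (Ω z)⁻¹ *
    phi s (metricAt (r := r) h z) (twist t (curvature (n := n) h z)) P

/-- The 1-jet `(h(z), D_z h(z))` in the preferred coordinates and frame at `z`. -/
def jetOne (h : ∀ x, E x → E x → ℂ) (z : X) :
    (Fin r → Fin r → ℂ) × ((Fin n → ℂ) →L[ℝ] (Fin r → Fin r → ℂ)) :=
  (localMatrix h z (chartAt (Fin n → ℂ) z z),
    fderiv ℝ (localMatrix h z) (chartAt (Fin n → ℂ) z z))

/-- Scalar right hand sides `f(z) = F(z, h(z), D_z h(z)) > 0`. -/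
def IsScalarRHS (n r : ℕ) {X : Type*}
    (F : X → (Fin r → Fin r → ℂ) × ((Fin n → ℂ) →L[ℝ] (Fin r → Fin r → ℂ)) → ℝ) : Prop :=
  ∀ z, DifferentiableOn ℝ (F z) (metricJets n r) ∧ ∀ J ∈ metricJets n r, 0 < F z J

/-- Endomorphism valued right hand sides `g(z) = G(z, h(z), D_z h(z))`, hermitian with respect to
`h(z)` and trace free. -/
def IsEndoRHS (n r : ℕ) {X : Type*}
    (G : X → (Fin r → Fin r → ℂ) × ((Fin n → ℂ) →L[ℝ] (Fin r → Fin r → ℂ)) →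
      Fin r → Fin r → ℂ) : Prop :=
  ∀ z, DifferentiableOn ℝ (G z) (metricJets n r) ∧
    ∀ J ∈ metricJets n r, Matrix.of (G z J) ∈ traceFreeHermitian (Matrix.of J.1)

/-- The operator whose vanishing is the system
`(ω_h^n / Ω)^β Ω⁻¹ Φ_P(Θ_{E,h} + t ω_h ⊗ Id) = f`, `(ω_h^n)⁻¹ (ω_h^(n-1) ∧ Θ°_{E,h}) = g`,
with `ω_h = Θ_{det E, det h}`, `f = F(z, h, D_z h)`, `g = G(z, h, D_z h)`. Endomorphisms are
written in the preferred frame at `z`. -/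
def systemOperator (P : PositivityType) (s t β : ℝ) (Ω : X → ℝ)
    (F : X → (Fin r → Fin r → ℂ) × ((Fin n → ℂ) →L[ℝ] (Fin r → Fin r → ℂ)) → ℝ)
    (G : X → (Fin r → Fin r → ℂ) × ((Fin n → ℂ) →L[ℝ] (Fin r → Fin r → ℂ)) →
      Fin r → Fin r → ℂ)
    (h : ∀ x, E x → E x → ℂ) (z : X) : ℝ × Matrix (Fin r) (Fin r) ℂ :=
  (scalarOperator n r P s t β Ω h z - F z (jetOne h z),
    hermiteEinstein (curvature (n := n) h z) - Matrix.of (G z (jetOne h z)))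

/-! ### Ellipticity of the linearization -/

variable (n) in
/-- `L` is a real linear differential operator of order at most two on smooth families of hermitian
forms. -/
structure IsSecondOrderLinear (L : (∀ x, E x → E x → ℂ) → X → ℝ × Matrix (Fin r) (Fin r) ℂ) : Prop where
  map_add : ∀ u v, IsSmoothHermitian n (r := r) u → IsSmoothHermitian n (r := r) v →
    L (u + v) = L u + L v
  map_smul : ∀ (a : ℝ) u, IsSmoothHermitian n (r := r) u → L (a • u) = a • L u
  order_le_two : ∀ u z, IsSmoothHermitian n (r := r) u →
    (∀ i ≤ 2, iteratedFDeriv ℝ i (localMatrix (n := n) (r := r) u z)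
      (chartAt (Fin n → ℂ) z z) = 0) → L u z = 0

/-- `σ` is the principal symbol (without the conventional factor `i²`) of the second order
operator `L` at the real cotangent vector `ξ` at `z`: `½ L(φ² u)(z) = σ(u(z))` whenever `φ` is a
smooth real function with `φ(z) = 0`, `dφ(z) = ξ`. -/
def HasPrincipalSymbol (L : (∀ x, E x → E x → ℂ) → X → ℝ × Matrix (Fin r) (Fin r) ℂ) (z : X)
    (ξ : TangentSpace 𝓘(ℝ, Fin n → ℂ) z →L[ℝ] ℝ)
    (σ : Matrix (Fin r) (Fin r) ℂ →ₗ[ℝ] ℝ × Matrix (Fin r) (Fin r) ℂ) : Prop :=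
  ∀ (φ : X → ℝ) (u : ∀ x, E x → E x → ℂ),
    ContMDiff 𝓘(ℝ, Fin n → ℂ) 𝓘(ℝ, ℝ) ∞ φ → φ z = 0 →
    (∀ ζ, mfderiv 𝓘(ℝ, Fin n → ℂ) 𝓘(ℝ, ℝ) φ z ζ = ξ ζ) →
    IsSmoothHermitian n (r := r) u →
    (1 / 2 : ℝ) • L (fun x v w => (φ x ^ 2 : ℝ) • u x v w) z = σ (metricAt u z)

variable (n r) in
/-- The nonlinear operator `Q` has an elliptic linearization at the metric `h`: the directional
derivatives of `Q` at `h` define a linear differential operator `dQ(h)` of order two, and for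
every nonzero real cotangent vector its principal symbol is bijective from the hermitian forms of
the fibre to `ℝ ⊕ Herm°_h`. -/
def HasEllipticLinearization (Q : (∀ x, E x → E x → ℂ) → X → ℝ × Matrix (Fin r) (Fin r) ℂ)
    (h : ∀ x, E x → E x → ℂ) : Prop :=
  ∃ L : (∀ x, E x → E x → ℂ) → X → ℝ × Matrix (Fin r) (Fin r) ℂ,
    (∀ u z, IsSmoothHermitian n (r := r) u →
      HasDerivAt (fun ε : ℝ => Q (h + ε • u) z) (L u z) 0) ∧
    IsSecondOrderLinear n L ∧
    ∀ (z : X) (ξ : TangentSpace 𝓘(ℝ, Fin n → ℂ) z →L[ℝ] ℝ), ξ ≠ 0 →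
      ∃ σ : Matrix (Fin r) (Fin r) ℂ →ₗ[ℝ] ℝ × Matrix (Fin r) (Fin r) ℂ,
        HasPrincipalSymbol L z ξ σ ∧
        Set.BijOn σ {W | W.IsHermitian} (Set.univ ×ˢ traceFreeHermitian (metricAt h z))

variable (n r) in
/-- `U` contains a neighbourhood of `h` in the space of smooth hermitian metrics, for the `C²`
topology (uniform convergence of the coefficients and their derivatives up to order two on compact
subsets of charts). -/
def IsC2Neighborhood (h : ∀ x, E x → E x → ℂ) (U : Set (∀ x, E x → E x → ℂ)) : Prop :=
  ∃ (S : Finset X) (K : X → Set X) (δ : ℝ), 0 < δ ∧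
    (∀ x ∈ S, IsCompact (K x) ∧ K x ⊆ (chartAt (Fin n → ℂ) x).source ∩
      (trivializationAt (Fin r → ℂ) E x).baseSet) ∧
    ∀ h', IsHermitianMetric n r h' →
      (∀ x ∈ S, ∀ y ∈ K x, ∀ i ≤ 2,
        ‖iteratedFDeriv ℝ i (localMatrix (n := n) (r := r) (h' - h) x)
          (chartAt (Fin n → ℂ) x y)‖ < δ) → h' ∈ U

/-! ### Ampleness of the determinant -/

variable (r) in
/-- A section of `(det E)^m` is given by its coefficients `σ y` in the preferred frame at `y`; this
is its coefficient at `y` in the preferred frame at `x`. -/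
def detPowerLocal [VectorBundle ℂ (Fin r → ℂ) E] (m : ℕ) (σ : X → ℂ) (x y : X) : ℂ :=
  LinearMap.det (((trivializationAt (Fin r → ℂ) E y).coordChangeL ℂ
    (trivializationAt (Fin r → ℂ) E x) y : (Fin r → ℂ) →L[ℂ] (Fin r → ℂ)) :
      (Fin r → ℂ) →ₗ[ℂ] (Fin r → ℂ)) ^ m * σ y

variable (n r) (E) in
/-- `det E` is ample: for some `m ≥ 1` there are holomorphic sections of `(det E)^m` that define a
holomorphic embedding of (the compact manifold) `X` in a projective space. -/
def IsDetAmple [VectorBundle ℂ (Fin r → ℂ) E] : Prop :=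
  ∃ (m N : ℕ) (σ : Fin (N + 1) → X → ℂ), 1 ≤ m ∧
    -- the sections are holomorphic
    (∀ i x, ContMDiffOn 𝓘(ℂ, Fin n → ℂ) 𝓘(ℂ, ℂ) ω (detPowerLocal r (E := E) m (σ i) x)
      (trivializationAt (Fin r → ℂ) E x).baseSet) ∧
    -- without common zero
    (∀ x, ∃ i, σ i x ≠ 0) ∧
    -- the map to projective space is injective
    (∀ x y, (∃ a : ℂ, ∀ i, σ i x = a * σ i y) → x = y) ∧
    -- and it is an immersion
    ∀ (x : X) (ξ : TangentSpace 𝓘(ℂ, Fin n → ℂ) x) (a : ℂ),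
      (∀ i, (mfderiv 𝓘(ℂ, Fin n → ℂ) 𝓘(ℂ, ℂ) (detPowerLocal r (E := E) m (σ i) x) x ξ : ℂ) =
        a * σ i x) → ξ = 0

end Bundle

end YangMills

end

noncomputable section

set_option linter.unusedSectionVars false

namespace YangMills

/-! ### Trace inequalities for endomorphisms self-adjoint with respect to an inner product -/

section TraceInequalities

variable {ι : Type*} [Fintype ι] [DecidableEq ι]

/-! At a point the left-hand sides of the system depend on the metric only through its Gram matrix H
and its curvature, and the curvature is a smooth function of the 2-jet of the metric
(`chernCurvature_eq_jetCurvature`). If φ vanishes at z with dφ = ξ, the 2-jet of φ²u at z consists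
only of the second derivatives ξ ⊗ ξ ⊗ w with w = 2u(z). Such a jet moves the curvature by -p ⊗ p̄ ⊗
H⁻¹w, where p is the (1,0) part of ξ (`jetCurvature_add_cotangent`). Hence the principal symbol is
the derivative of `pointOperator` in rank one directions. The right-hand sides see only the 1-jet
and do not contribute.

Write N for the square norm of p with respect to ω, S = H⁻¹w, τ = tr S, l for the logarithmic
derivative of Φ_P along p ⊗ p̄ ⊗ S, and C for the contraction of Θ° along ω⁻¹p. With Q > 0 the value
of the scalar left-hand side, the symbol is (-Q(βNτ + l(S) + tτ l(1)), (1/n)(τC - N(S - τ/r))), by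
`hasDerivAt_pointOperator`. The second component determines the trace free part of S from τ.
Substituted in the first, it leaves a scalar equation for τ with leading coefficient K = βN + (1/r +
t) l(1) + l(C)/N. So the symbol is bijective as soon as K > 0 (`bijOn_symbol`).

The distortion is designed to give K > 0 (`symbol_coefficient_pos`). One has l(1) ≥ 0 and 1 + rt >
0. Cauchy-Schwarz gives |C| ≤ N|Θ°| and |l(C)| ≤ N|C|D, where D is what remains of the distortion
after removing |Θ°| and the constant √(n-1)+1 (`abs_logFunctional_le`). Therefore l(C)/N ≥ -N|Θ°|D,
which is at least -N times the distortion. The constant matters here only through being at least 1.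

Two global arguments complete the proof. Taking traces, positivity of the twisted curvature yields
only (1 + rt)ω > 0. At a maximum of the norm of a nonzero holomorphic section of (det E)^m, the
diagonal coefficients of ω are nonnegative, which forces 1 + rt > 0 (`one_add_mul_pos`) and then ω >
0 everywhere. Secondly, the distortion is independent of frames and coordinates
(`distortionAt_changeFrame`), so near each point it is a continuous function of the 2-jet in one
fixed frame. This gives its continuity and, by compactness of X, a C² neighbourhood on which
positivity and the strict bound by β persist (`isC2Neighborhood_distortion_lt`).

In the Griffiths case the integrals live on spheres that vary with the metric. Polar coordinates
transfer them to a fixed compact sphere with an explicit density (`integral_sphereMeasure`), where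
one differentiates under the integral sign. -/

open scoped MatrixOrder in
theorem exists_eq_conjTranspose_mul_self {G : Matrix ι ι ℂ} (hG : G.PosDef) :
    ∃ B : Matrix ι ι ℂ, IsUnit B ∧ G = Bᴴ * B := by
  obtain ⟨B, hB⟩ := CStarAlgebra.nonneg_iff_eq_star_mul_self.mp hG.posSemidef.nonneg
  refine ⟨B, ?_, hB⟩
  have h := hG.isUnit
  rw [hB, Matrix.isUnit_iff_isUnit_det, Matrix.det_mul] at h
  rw [Matrix.isUnit_iff_isUnit_det]
  exact isUnit_of_mul_isUnit_right h

/-- An endomorphism that is self-adjoint for an inner product has a square of nonnegative trace. -/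
theorem trace_sq_nonneg {G Z : Matrix ι ι ℂ} (hG : G.PosDef) (hZ : (G * Z).IsHermitian) :
    0 ≤ (Z * Z).trace.re := by
  obtain ⟨B, hB, rfl⟩ := exists_eq_conjTranspose_mul_self hG
  have hd := (Matrix.isUnit_iff_isUnit_det _).1 hB
  have hd' : IsUnit (Bᴴ).det := by
    rw [Matrix.det_conjTranspose]; exact hd.star
  -- With G = B*B, conjugation by B turns an endomorphism self-adjoint for G into a hermitian matrix
  -- N, so that tr Z² = tr N*N.
  set N := B * Z * B⁻¹ with hN
  have h1 : Nᴴ = N := by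
    have h2 : Zᴴ * (Bᴴ * B) = Bᴴ * B * Z := by
      have := hZ.eq
      rw [Matrix.conjTranspose_mul, Matrix.conjTranspose_mul, Matrix.conjTranspose_conjTranspose]
        at this
      exact this
    have h3 : Nᴴ = (Bᴴ)⁻¹ * (Zᴴ * (Bᴴ * B)) * B⁻¹ := by
      rw [hN, Matrix.conjTranspose_mul, Matrix.conjTranspose_mul, Matrix.conjTranspose_nonsing_inv]
      simp only [Matrix.mul_assoc, Matrix.mul_nonsing_inv _ hd, Matrix.mul_one]
    rw [h3, h2, hN]
    simp only [← Matrix.mul_assoc, Matrix.nonsing_inv_mul _ hd', Matrix.one_mul]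
  have h4 : (Z * Z).trace = (Nᴴ * N).trace := by
    rw [h1, hN]
    have : B * Z * B⁻¹ * (B * Z * B⁻¹) = B * (Z * Z) * B⁻¹ := by
      simp only [Matrix.mul_assoc]
      rw [← Matrix.mul_assoc B⁻¹ B, Matrix.nonsing_inv_mul _ hd, Matrix.one_mul]
    rw [this, Matrix.trace_mul_cycle, Matrix.nonsing_inv_mul _ hd, Matrix.one_mul]
  rw [h4]
  exact (Complex.le_def.1 (Matrix.posSemidef_conjTranspose_mul_self N).trace_nonneg).1

/-- Cauchy-Schwarz inequality for endomorphisms that are self-adjoint for an inner product. -/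
theorem trace_mul_sq_le {G X Y : Matrix ι ι ℂ} (hG : G.PosDef) (hX : (G * X).IsHermitian)
    (hY : (G * Y).IsHermitian) :
    (X * Y).trace.re ^ 2 ≤ (X * X).trace.re * (Y * Y).trace.re := by
  -- The square of aX + Y has nonnegative trace for every real a. The discriminant of this quadratic
  -- polynomial gives the inequality.
  have key : ∀ a : ℝ, 0 ≤ (X * X).trace.re * (a * a) + 2 * (X * Y).trace.re * a
      + (Y * Y).trace.re := by
    intro a
    have h1 : (G * ((a : ℂ) • X + Y)).IsHermitian := by
      rw [Matrix.mul_add, Matrix.mul_smul]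
      refine Matrix.IsHermitian.add ?_ hY
      rw [Matrix.IsHermitian, Matrix.conjTranspose_smul, hX.eq]
      simp
    have h2 := trace_sq_nonneg hG h1
    have h3 : (((a : ℂ) • X + Y) * ((a : ℂ) • X + Y)).trace
        = (X * X).trace * ((a * a : ℝ) : ℂ) + ((2 * a : ℝ) : ℂ) * (X * Y).trace
          + (Y * Y).trace := by
      simp only [Matrix.mul_add, Matrix.add_mul, Matrix.trace_add, Matrix.smul_mul,
        Matrix.mul_smul, Matrix.trace_smul, smul_eq_mul]
      rw [Matrix.trace_mul_comm Y X]
      push_cast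
      ring
    rw [h3, Complex.add_re, Complex.add_re, Complex.re_mul_ofReal, Complex.re_ofReal_mul] at h2
    linarith
  have h := discrim_le_zero key
  rw [discrim] at h
  nlinarith

theorem abs_trace_mul_le {G X Y : Matrix ι ι ℂ} (hG : G.PosDef) (hX : (G * X).IsHermitian)
    (hY : (G * Y).IsHermitian) :
    |(X * Y).trace.re| ≤ selfAdjointNorm X * selfAdjointNorm Y := by
  rw [selfAdjointNorm, selfAdjointNorm, ← Real.sqrt_mul (trace_sq_nonneg hG hX)]
  exact Real.abs_le_sqrt (trace_mul_sq_le hG hX hY)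

omit [DecidableEq ι] in
theorem selfAdjointNorm_nonneg (X : Matrix ι ι ℂ) : 0 ≤ selfAdjointNorm X := Real.sqrt_nonneg _

theorem selfAdjointNorm_sq {G X : Matrix ι ι ℂ} (hG : G.PosDef) (hX : (G * X).IsHermitian) :
    selfAdjointNorm X ^ 2 = (X * X).trace.re := Real.sq_sqrt (trace_sq_nonneg hG hX)

theorem trace_mul_nonneg {P Q : Matrix ι ι ℂ} (hP : P.PosDef) (hQ : Q.PosSemidef) :
    0 ≤ (P * Q).trace.re := by
  obtain ⟨B, -, rfl⟩ := exists_eq_conjTranspose_mul_self hP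
  rw [Matrix.mul_assoc, Matrix.trace_mul_comm]
  exact (Complex.le_def.1 (hQ.mul_mul_conjTranspose_same B).trace_nonneg).1

theorem trace_mul_pos [Nonempty ι] {P Q : Matrix ι ι ℂ} (hP : P.PosDef) (hQ : Q.PosDef) :
    0 < (P * Q).trace.re := by
  obtain ⟨B, hB, rfl⟩ := exists_eq_conjTranspose_mul_self hP
  rw [Matrix.mul_assoc, Matrix.trace_mul_comm]
  exact (Complex.lt_def.1 (hQ.mul_mul_conjTranspose_same
    (Matrix.vecMul_injective_of_isUnit hB)).trace_pos).1

theorem adjugate_posDef {P : Matrix ι ι ℂ} (hP : P.PosDef) : P.adjugate.PosDef := by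
  have hd : IsUnit P.det := (Matrix.isUnit_iff_isUnit_det _).1 hP.isUnit
  have h : P.adjugate = P.det • P⁻¹ := by
    rw [Matrix.inv_def, smul_smul, Ring.mul_inverse_cancel _ hd, one_smul]
  rw [h]
  exact hP.inv.smul hP.det_pos

/-- `p p^*  ≤ (p^* W⁻¹ p) W`. -/
theorem posSemidef_smul_sub_vecMulVec {W : Matrix ι ι ℂ} (hW : W.PosDef) (p : ι → ℂ) :
    ((star p ⬝ᵥ W⁻¹ *ᵥ p) • W - Matrix.vecMulVec p (star p)).PosSemidef := by
  have hd : IsUnit W.det := (Matrix.isUnit_iff_isUnit_det _).1 hW.isUnit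
  have hN : star (star p ⬝ᵥ W⁻¹ *ᵥ p) = star p ⬝ᵥ W⁻¹ *ᵥ p := by
    have h := hW.inv.posSemidef.dotProduct_mulVec_nonneg p
    exact (IsSelfAdjoint.of_nonneg h)
  refine .of_dotProduct_mulVec_nonneg ?_ fun x => ?_
  · refine Matrix.IsHermitian.sub ?_ ?_
    · rw [Matrix.IsHermitian, Matrix.conjTranspose_smul, hN, hW.1.eq]
    · rw [Matrix.IsHermitian, Matrix.conjTranspose_vecMulVec, star_star]
  · obtain ⟨B, hB, hBW⟩ := exists_eq_conjTranspose_mul_self hW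
    have hdB := (Matrix.isUnit_iff_isUnit_det _).1 hB
    have hdB' : IsUnit (Bᴴ).det := by
      rw [Matrix.det_conjTranspose]; exact hdB.star
    -- For W = B*B, the vectors a and b reduce the claim to the Cauchy-Schwarz inequality |a*b|² ≤
    -- |a|²|b|² of the standard inner product.
    set a : ι → ℂ := (Bᴴ)⁻¹ *ᵥ p with ha
    set b : ι → ℂ := B *ᵥ x with hb
    have h1 : star p ⬝ᵥ W⁻¹ *ᵥ p = star a ⬝ᵥ a := by
      rw [hBW, Matrix.mul_inv_rev, ← Matrix.mulVec_mulVec, ← ha, ha, Matrix.star_mulVec,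
        Matrix.conjTranspose_nonsing_inv, Matrix.conjTranspose_conjTranspose,
        Matrix.dotProduct_mulVec]
    have h2 : star x ⬝ᵥ W *ᵥ x = star b ⬝ᵥ b := by
      rw [hBW, ← Matrix.mulVec_mulVec, hb, Matrix.star_mulVec, Matrix.dotProduct_mulVec]
    have h3 : star p ⬝ᵥ x = star a ⬝ᵥ b := by
      rw [ha, hb, Matrix.star_mulVec, Matrix.conjTranspose_nonsing_inv,
        Matrix.conjTranspose_conjTranspose, ← Matrix.dotProduct_mulVec, Matrix.mulVec_mulVec,
        Matrix.nonsing_inv_mul _ hdB, Matrix.one_mulVec]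
    have h4 : star x ⬝ᵥ p = star (star a ⬝ᵥ b) := by
      rw [← h3, Matrix.star_dotProduct]
    rw [Matrix.sub_mulVec, dotProduct_sub, Matrix.smul_mulVec, dotProduct_smul,
      Matrix.vecMulVec_mulVec, dotProduct_smul, h1, h2, h4, h3]
    have hcs := norm_inner_le_norm (𝕜 := ℂ) (WithLp.toLp 2 a : EuclideanSpace ℂ ι) (WithLp.toLp 2 b)
    have hin : ∀ u v : ι → ℂ, inner ℂ (WithLp.toLp 2 u : EuclideanSpace ℂ ι) (WithLp.toLp 2 v)
        = star u ⬝ᵥ v := by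
      intro u v
      rw [EuclideanSpace.inner_eq_star_dotProduct, dotProduct_comm]
    have hself : ∀ u : ι → ℂ, star u ⬝ᵥ u
        = ((‖(WithLp.toLp 2 u : EuclideanSpace ℂ ι)‖ ^ 2 : ℝ) : ℂ) := by
      intro u
      rw [← hin, inner_self_eq_norm_sq_to_K]; simp
    rw [hin] at hcs
    rw [hself a, hself b]
    simp only [smul_eq_mul, MulOpposite.smul_eq_mul_unop, MulOpposite.unop_op]
    have : (star a ⬝ᵥ b) * star (star a ⬝ᵥ b) = ((‖star a ⬝ᵥ b‖ ^ 2 : ℝ) : ℂ) := by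
      rw [Complex.star_def, Complex.mul_conj, Complex.normSq_eq_norm_sq]
    rw [mul_comm (star (star a ⬝ᵥ b)), this, ← Complex.ofReal_mul, ← Complex.ofReal_sub]
    rw [Complex.zero_le_real]
    have := pow_le_pow_left₀ (norm_nonneg _) hcs 2
    nlinarith

end TraceInequalities

section KroneckerNotation

open scoped Kronecker

/-! ### Curvature type tensors and their hermitian symmetry -/

section Tensors

variable {n r : ℕ}

/-- The hermitian symmetry of curvature tensors. -/
def IsHermitianTensor (H : Matrix (Fin r) (Fin r) ℂ)
    (c : Fin n → Fin n → Matrix (Fin r) (Fin r) ℂ) : Prop :=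
  ∀ j k, (H * c j k)ᴴ = H * c k j

/-- The tensor `p ⊗ p̄ ⊗ S`. -/
def rankOneTensor (p : Fin n → ℂ) (S : Matrix (Fin r) (Fin r) ℂ) :
    Fin n → Fin n → Matrix (Fin r) (Fin r) ℂ :=
  fun j k => (p j * star (p k)) • S

/-- The value of `c` on the vector with coordinates `star q`. -/
def contraction (q : Fin n → ℂ) (c : Fin n → Fin n → Matrix (Fin r) (Fin r) ℂ) :
    Matrix (Fin r) (Fin r) ℂ :=
  ∑ j, ∑ k, (star (q j) * q k) • c j k

theorem isUnit_det_of_posDef {ι : Type*} [Fintype ι] [DecidableEq ι] {H : Matrix ι ι ℂ}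
    (hH : H.PosDef) : IsUnit H.det := (Matrix.isUnit_iff_isUnit_det _).1 hH.isUnit

theorem IsHermitianTensor.star_trace {H : Matrix (Fin r) (Fin r) ℂ}
    {c : Fin n → Fin n → Matrix (Fin r) (Fin r) ℂ} (hH : H.PosDef) (hc : IsHermitianTensor H c)
    (j k : Fin n) : star (c j k).trace = (c k j).trace := by
  have hd := isUnit_det_of_posDef hH
  have h1 : c k j = H⁻¹ * ((c j k)ᴴ * H) := by
    have h := hc j k
    rw [Matrix.conjTranspose_mul, hH.1.eq] at h
    rw [h, ← Matrix.mul_assoc, Matrix.nonsing_inv_mul _ hd, Matrix.one_mul]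
  rw [h1, Matrix.trace_mul_comm, Matrix.mul_assoc, Matrix.mul_nonsing_inv _ hd, Matrix.mul_one,
    Matrix.trace_conjTranspose]

theorem IsHermitianTensor.twist {H : Matrix (Fin r) (Fin r) ℂ}
    {c : Fin n → Fin n → Matrix (Fin r) (Fin r) ℂ} (hH : H.PosDef) (hc : IsHermitianTensor H c)
    (t : ℝ) : IsHermitianTensor H (twist t c) := by
  intro j k
  simp only [YangMills.twist]
  rw [Matrix.mul_add, Matrix.mul_add, Matrix.conjTranspose_add, hc j k, Matrix.mul_smul,
    Matrix.mul_smul, Matrix.mul_one, Matrix.conjTranspose_smul, hH.1.eq, star_mul',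
    hc.star_trace hH]
  simp

theorem IsHermitianTensor.traceForm {H : Matrix (Fin r) (Fin r) ℂ}
    {c : Fin n → Fin n → Matrix (Fin r) (Fin r) ℂ} (hH : H.PosDef) (hc : IsHermitianTensor H c) :
    (traceForm c).IsHermitian := by
  ext j k
  simp only [YangMills.traceForm, Matrix.conjTranspose_apply, Matrix.of_apply]
  exact hc.star_trace hH k j

theorem dualMetric_posDef {H : Matrix (Fin r) (Fin r) ℂ} (hH : H.PosDef) :
    (dualMetric H).PosDef := hH.inv.transpose

/-- Hermitian symmetry says that c k j is the H-adjoint of c j k. Transposition together with the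
dual metric respects adjoints. -/
theorem IsHermitianTensor.dual {H : Matrix (Fin r) (Fin r) ℂ}
    {c : Fin n → Fin n → Matrix (Fin r) (Fin r) ℂ} (hH : H.PosDef) (hc : IsHermitianTensor H c) :
    IsHermitianTensor (dualMetric H) (transposeTensor c) := by
  have hd := isUnit_det_of_posDef hH
  intro j k
  have h : H⁻¹ * (c j k)ᴴ = c k j * H⁻¹ := by
    have h1 := hc j k
    rw [Matrix.conjTranspose_mul, hH.1.eq] at h1
    calc H⁻¹ * (c j k)ᴴ = H⁻¹ * ((c j k)ᴴ * H) * H⁻¹ := by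
          rw [Matrix.mul_assoc, Matrix.mul_assoc, Matrix.mul_nonsing_inv _ hd, Matrix.mul_one]
      _ = c k j * H⁻¹ := by
          rw [h1, ← Matrix.mul_assoc, Matrix.nonsing_inv_mul _ hd, Matrix.one_mul]
  simp only [dualMetric, transposeTensor, ← Matrix.transpose_mul]
  rw [← h]
  ext a b
  have h2 := congrFun (congrFun (congrArg Matrix.conjTranspose h) b) a
  simp only [Matrix.conjTranspose_mul, Matrix.conjTranspose_conjTranspose, hH.inv.1.eq] at h2
  simp only [Matrix.conjTranspose_apply, Matrix.transpose_apply]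
  rw [h, ← Matrix.conjTranspose_apply, Matrix.conjTranspose_mul, hH.inv.1.eq, h]

theorem traceForm_transposeTensor (c : Fin n → Fin n → Matrix (Fin r) (Fin r) ℂ) :
    traceForm (transposeTensor c) = traceForm c := by
  ext j k
  simp [traceForm, transposeTensor]

theorem trace_traceFree (hr : 1 ≤ r) (c : Fin n → Fin n → Matrix (Fin r) (Fin r) ℂ) (j k : Fin n) :
    (traceFree c j k).trace = 0 := by
  have : (r : ℂ) ≠ 0 := by exact_mod_cast (by omega : r ≠ 0)
  simp [traceFree, twist, Matrix.trace_add, Matrix.trace_smul]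
  field_simp
  ring

theorem formMatrix_isHermitian {H : Matrix (Fin r) (Fin r) ℂ}
    {c : Fin n → Fin n → Matrix (Fin r) (Fin r) ℂ} (hc : IsHermitianTensor H c) :
    (formMatrix H c).IsHermitian := by
  ext a b
  simp only [formMatrix, Matrix.conjTranspose_apply, Matrix.of_apply]
  rw [← hc a.1 b.1, Matrix.conjTranspose_apply]

theorem gram_eq_kronecker (W : Matrix (Fin n) (Fin n) ℂ) (H : Matrix (Fin r) (Fin r) ℂ) :
    gram W H = Wᵀ ⊗ₖ H := by
  ext a b
  simp [gram, Matrix.kroneckerMap_apply]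

theorem gram_posDef {W : Matrix (Fin n) (Fin n) ℂ} {H : Matrix (Fin r) (Fin r) ℂ}
    (hW : W.PosDef) (hH : H.PosDef) : (gram W H).PosDef := by
  rw [gram_eq_kronecker]
  exact hW.transpose.kronecker hH

theorem gram_mul_repEndo {W : Matrix (Fin n) (Fin n) ℂ} {H : Matrix (Fin r) (Fin r) ℂ}
    (hW : W.PosDef) (hH : H.PosDef) (c : Fin n → Fin n → Matrix (Fin r) (Fin r) ℂ) :
    gram W H * repEndo W H c = formMatrix H c := by
  rw [repEndo, ← Matrix.mul_assoc,
    Matrix.mul_nonsing_inv _ (isUnit_det_of_posDef (gram_posDef hW hH)), Matrix.one_mul]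

/-- The endomorphism attached to a curvature type tensor does not involve the metric of the
bundle. -/
theorem repEndo_apply {H : Matrix (Fin r) (Fin r) ℂ} (hH : IsUnit H.det)
    (W : Matrix (Fin n) (Fin n) ℂ) (c : Fin n → Fin n → Matrix (Fin r) (Fin r) ℂ)
    (a b : Fin n × Fin r) :
    repEndo W H c a b = ∑ m, W⁻¹ m a.1 * c b.1 m a.2 b.2 := by
  rw [repEndo, gram_eq_kronecker, Matrix.inv_kronecker, Matrix.mul_apply, Fintype.sum_prod_type]
  refine Finset.sum_congr rfl fun m _ => ?_
  have h : c b.1 m a.2 b.2 = ∑ l, H⁻¹ a.2 l * (H * c b.1 m) l b.2 := by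
    rw [← Matrix.mul_apply, ← Matrix.mul_assoc, Matrix.nonsing_inv_mul _ hH, Matrix.one_mul]
  rw [h, Finset.mul_sum]
  refine Finset.sum_congr rfl fun l _ => ?_
  rw [Matrix.kroneckerMap_apply, ← Matrix.transpose_nonsing_inv, Matrix.transpose_apply, formMatrix,
    Matrix.of_apply, mul_assoc]

/-! ### Rank one tensors and contraction along a covector -/

section RankOne

variable {W : Matrix (Fin n) (Fin n) ℂ} {H : Matrix (Fin r) (Fin r) ℂ}

theorem isHermitianTensor_rankOneTensor {S : Matrix (Fin r) (Fin r) ℂ} (hS : (H * S).IsHermitian)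
    (p : Fin n → ℂ) : IsHermitianTensor H (rankOneTensor p S) := by
  intro j k
  simp only [rankOneTensor, Matrix.mul_smul, Matrix.conjTranspose_smul]
  rw [hS.eq, star_mul', star_star, mul_comm]

theorem repEndo_rankOneTensor (hW : W.IsHermitian) (hH : IsUnit H.det) (p : Fin n → ℂ)
    (S : Matrix (Fin r) (Fin r) ℂ) (a b : Fin n × Fin r) :
    repEndo W H (rankOneTensor p S) a b = star ((W⁻¹ *ᵥ p) a.1) * p b.1 * S a.2 b.2 := by
  rw [repEndo_apply hH]
  simp only [rankOneTensor, Matrix.smul_apply, smul_eq_mul, Matrix.mulVec, dotProduct, star_sum,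
    star_mul', Finset.sum_mul]
  refine Finset.sum_congr rfl fun m _ => ?_
  rw [← hW.inv.apply a.1 m, star_star]
  ring

/-- In the trace pairing on T ⊗ E, the tensor p ⊗ p̄ ⊗ S represents the functional that contracts
with the vector ω-dual to p and pairs with S. Estimates on T ⊗ E thereby become estimates on E. -/
theorem trace_repEndo_mul_rankOneTensor (hW : W.IsHermitian) (hH : IsUnit H.det) (p : Fin n → ℂ)
    (c : Fin n → Fin n → Matrix (Fin r) (Fin r) ℂ) (S : Matrix (Fin r) (Fin r) ℂ) :
    (repEndo W H c * repEndo W H (rankOneTensor p S)).trace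
      = (contraction (W⁻¹ *ᵥ p) c * S).trace := by
  have hcomm : ∀ T : Fin n → Fin r → Fin r → Fin n → ℂ,
      ∑ a, ∑ b, ∑ d, ∑ m, T a b d m = ∑ m, ∑ b, ∑ d, ∑ a, T a b d m := by
    intro T
    calc ∑ a, ∑ b, ∑ d, ∑ m, T a b d m = ∑ a, ∑ b, ∑ m, ∑ d, T a b d m :=
          Finset.sum_congr rfl fun a _ => Finset.sum_congr rfl fun b _ => Finset.sum_comm
      _ = ∑ a, ∑ m, ∑ b, ∑ d, T a b d m := Finset.sum_congr rfl fun a _ => Finset.sum_comm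
      _ = ∑ m, ∑ a, ∑ b, ∑ d, T a b d m := Finset.sum_comm
      _ = ∑ m, ∑ b, ∑ a, ∑ d, T a b d m := Finset.sum_congr rfl fun a _ => Finset.sum_comm
      _ = _ := Finset.sum_congr rfl fun a _ => Finset.sum_congr rfl fun b _ => Finset.sum_comm
  have hleft : (repEndo W H c * repEndo W H (rankOneTensor p S)).trace
      = ∑ a, ∑ b, ∑ j, ∑ d, ∑ m, W⁻¹ m a * c j m b d * (star ((W⁻¹ *ᵥ p) j) * p a * S d b) := by
    simp only [Matrix.trace, Matrix.diag, Matrix.mul_apply, Fintype.sum_prod_type,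
      repEndo_rankOneTensor hW hH, repEndo_apply hH, Finset.sum_mul]
  rw [hleft, contraction]
  simp only [Finset.sum_mul, Matrix.trace_sum, Matrix.smul_mul, Matrix.trace_smul, smul_eq_mul]
  -- Only the order of summation changes: the sum over a must become innermost, where it forms the
  -- coordinate m of W⁻¹p.
  calc _ = ∑ j, ∑ a, ∑ b, ∑ d, ∑ m,
        W⁻¹ m a * c j m b d * (star ((W⁻¹ *ᵥ p) j) * p a * S d b) := by
        rw [Finset.sum_comm]
        refine (Finset.sum_congr rfl fun a _ => Finset.sum_comm).trans ?_
        rw [Finset.sum_comm]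
        exact Finset.sum_congr rfl fun a _ => Finset.sum_comm
    _ = _ := by
        refine Finset.sum_congr rfl fun j _ => ?_
        rw [hcomm]
        refine Finset.sum_congr rfl fun m _ => ?_
        simp only [Matrix.trace, Matrix.diag, Matrix.mul_apply, Finset.mul_sum]
        refine Finset.sum_congr rfl fun b _ => Finset.sum_congr rfl fun d _ => ?_
        have : (W⁻¹ *ᵥ p) m = ∑ a, W⁻¹ m a * p a := rfl
        rw [this, Finset.mul_sum, Finset.sum_mul]
        refine Finset.sum_congr rfl fun a _ => ?_
        ring

theorem isHermitian_contraction {c : Fin n → Fin n → Matrix (Fin r) (Fin r) ℂ}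
    (hc : IsHermitianTensor H c) (q : Fin n → ℂ) : (H * contraction q c).IsHermitian := by
  rw [Matrix.IsHermitian, contraction, Matrix.mul_sum, Matrix.conjTranspose_sum, Finset.sum_congr rfl
    fun j _ => by rw [Matrix.mul_sum, Matrix.conjTranspose_sum]]
  rw [Finset.sum_comm]
  refine Finset.sum_congr rfl fun j _ => ?_
  rw [Matrix.mul_sum]
  refine Finset.sum_congr rfl fun k _ => ?_
  rw [Matrix.mul_smul, Matrix.conjTranspose_smul, hc, Matrix.mul_smul, star_mul', star_star,
    mul_comm]

theorem trace_contraction_traceFree (hr : 1 ≤ r) (c : Fin n → Fin n → Matrix (Fin r) (Fin r) ℂ)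
    (q : Fin n → ℂ) : (contraction q (traceFree c)).trace = 0 := by
  simp [contraction, Matrix.trace_sum, Matrix.trace_smul, trace_traceFree hr]

theorem ofReal_re_dotProduct_inv (hW : W.PosDef) (p : Fin n → ℂ) :
    (((star p ⬝ᵥ W⁻¹ *ᵥ p).re : ℝ) : ℂ) = star p ⬝ᵥ W⁻¹ *ᵥ p := by
  have h := Complex.le_def.1 (hW.inv.posSemidef.dotProduct_mulVec_nonneg p)
  exact Complex.ext (by simp) (by simpa using h.2)

theorem contraction_rankOneTensor (hW : W.PosDef) (p : Fin n → ℂ) (S : Matrix (Fin r) (Fin r) ℂ) :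
    contraction (W⁻¹ *ᵥ p) (rankOneTensor p S) = (((star p ⬝ᵥ W⁻¹ *ᵥ p).re ^ 2 : ℝ) : ℂ) • S := by
  have h1 : ∑ k, (W⁻¹ *ᵥ p) k * star (p k) = star p ⬝ᵥ W⁻¹ *ᵥ p :=
    Finset.sum_congr rfl fun k _ => mul_comm _ _
  have h2 : ∑ j, star ((W⁻¹ *ᵥ p) j) * p j = star p ⬝ᵥ W⁻¹ *ᵥ p := by
    have h3 : star (star p ⬝ᵥ W⁻¹ *ᵥ p) = star p ⬝ᵥ W⁻¹ *ᵥ p := by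
      rw [← ofReal_re_dotProduct_inv hW]; simp
    rw [← h3, ← Matrix.star_dotProduct]
    rfl
  rw [Complex.ofReal_pow, ofReal_re_dotProduct_inv hW, sq]
  nth_rewrite 2 [← h1]
  rw [← h2, Finset.sum_mul, Finset.sum_smul, contraction]
  refine Finset.sum_congr rfl fun j _ => ?_
  rw [Finset.mul_sum, Finset.sum_smul]
  refine Finset.sum_congr rfl fun k _ => ?_
  rw [rankOneTensor, smul_smul]
  congr 1
  ring

theorem selfAdjointNorm_rankOneTensor (hW : W.PosDef) (hH : IsUnit H.det) (p : Fin n → ℂ)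
    (S : Matrix (Fin r) (Fin r) ℂ) :
    selfAdjointNorm (repEndo W H (rankOneTensor p S))
      = (star p ⬝ᵥ W⁻¹ *ᵥ p).re * selfAdjointNorm S := by
  have hN : 0 ≤ (star p ⬝ᵥ W⁻¹ *ᵥ p).re :=
    (Complex.le_def.1 (hW.inv.posSemidef.dotProduct_mulVec_nonneg p)).1
  rw [selfAdjointNorm, trace_repEndo_mul_rankOneTensor hW.1 hH, contraction_rankOneTensor hW,
    Matrix.smul_mul, Matrix.trace_smul, smul_eq_mul, Complex.re_ofReal_mul,
    Real.sqrt_mul (sq_nonneg _), Real.sqrt_sq hN, selfAdjointNorm]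

/-- Pair c with p ⊗ p̄ ⊗ C, where C is the contraction itself. The pairing is |C|² and the test
tensor has norm N|C|, so Cauchy-Schwarz and division by |C| give the bound. -/
theorem selfAdjointNorm_contraction_le (hW : W.PosDef) (hH : H.PosDef) (p : Fin n → ℂ)
    {c : Fin n → Fin n → Matrix (Fin r) (Fin r) ℂ} (hc : IsHermitianTensor H c) :
    selfAdjointNorm (contraction (W⁻¹ *ᵥ p) c)
      ≤ (star p ⬝ᵥ W⁻¹ *ᵥ p).re * selfAdjointNorm (repEndo W H c) := by
  set C := contraction (W⁻¹ *ᵥ p) c with hC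
  have hN : 0 ≤ (star p ⬝ᵥ W⁻¹ *ᵥ p).re :=
    (Complex.le_def.1 (hW.inv.posSemidef.dotProduct_mulVec_nonneg p)).1
  have hCh := isHermitian_contraction hc (W⁻¹ *ᵥ p)
  have h1 := abs_trace_mul_le (gram_posDef hW hH)
    (X := repEndo W H c) (Y := repEndo W H (rankOneTensor p C))
    (by rw [gram_mul_repEndo hW hH]; exact formMatrix_isHermitian hc)
    (by rw [gram_mul_repEndo hW hH]
        exact formMatrix_isHermitian (isHermitianTensor_rankOneTensor hCh p))
  rw [trace_repEndo_mul_rankOneTensor hW.1 (isUnit_det_of_posDef hH), ← hC,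
    selfAdjointNorm_rankOneTensor hW (isUnit_det_of_posDef hH), ← selfAdjointNorm_sq hH hCh,
    abs_of_nonneg (sq_nonneg _)] at h1
  rcases (selfAdjointNorm_nonneg C).eq_or_lt with h0 | h0
  · rw [← h0]
    exact mul_nonneg hN (selfAdjointNorm_nonneg _)
  · nlinarith

end RankOne

end Tensors

/-! ### The logarithmic derivative of the Nakano determinant -/

section NakanoFunctional

variable {n r : ℕ}

theorem im_star_dotProduct_mulVec {ι : Type*} [Fintype ι] {M : Matrix ι ι ℂ} (hM : M.IsHermitian)
    (x : ι → ℂ) : (star x ⬝ᵥ M *ᵥ x).im = 0 := by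
  have h : star (star x ⬝ᵥ M *ᵥ x) = star x ⬝ᵥ M *ᵥ x := by
    rw [← Matrix.star_dotProduct_star, star_star, Matrix.star_mulVec, hM.eq,
      ← Matrix.dotProduct_mulVec]
  have h1 := congrArg Complex.im h
  simp only [Complex.star_def, Complex.conj_im] at h1
  linarith

theorem posDef_of_re_pos {ι : Type*} [Fintype ι] {M : Matrix ι ι ℂ} (hM : M.IsHermitian)
    (h : ∀ x : ι → ℂ, x ≠ 0 → 0 < (star x ⬝ᵥ M *ᵥ x).re) : M.PosDef :=
  .of_dotProduct_mulVec_pos hM fun x hx =>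
    Complex.lt_def.2 ⟨h x hx, (im_star_dotProduct_mulVec hM x).symm⟩

theorem formMatrix_posDef {H : Matrix (Fin r) (Fin r) ℂ}
    {c : Fin n → Fin n → Matrix (Fin r) (Fin r) ℂ} (hc : IsHermitianTensor H c)
    (hpos : IsPositive H c .nakano) : (formMatrix H c).PosDef :=
  posDef_of_re_pos (formMatrix_isHermitian hc) hpos

/-- The derivative of `log Φ_N` in the direction `p ⊗ p̄ ⊗ S`. -/
def nakanoFunctional (H : Matrix (Fin r) (Fin r) ℂ)
    (θ : Fin n → Fin n → Matrix (Fin r) (Fin r) ℂ) (p : Fin n → ℂ)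
    (S : Matrix (Fin r) (Fin r) ℂ) : ℝ :=
  1 / (r : ℝ) * ((formMatrix H θ)⁻¹ * formMatrix H (rankOneTensor p S)).trace.re

/-- The form of p ⊗ p̄ ⊗ Id is a Kronecker product of semipositive forms, and the trace of a
positive times a semipositive matrix is nonnegative. -/
theorem nakanoFunctional_one_nonneg {H : Matrix (Fin r) (Fin r) ℂ} (hH : H.PosDef)
    {θ : Fin n → Fin n → Matrix (Fin r) (Fin r) ℂ} (hθ : IsHermitianTensor H θ)
    (hpos : IsPositive H θ .nakano) (p : Fin n → ℂ) : 0 ≤ nakanoFunctional H θ p 1 := by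
  refine mul_nonneg (by positivity) (trace_mul_nonneg (formMatrix_posDef hθ hpos).inv ?_)
  have : formMatrix H (rankOneTensor p 1) = Matrix.vecMulVec (star p) p ⊗ₖ H := by
    ext a b
    simp [formMatrix, rankOneTensor, Matrix.kroneckerMap_apply, Matrix.vecMulVec_apply, mul_comm]
  rw [this]
  exact (Matrix.posSemidef_vecMulVec_star_self p).kronecker hH.posSemidef

theorem selfAdjointNorm_smul {ι : Type*} [Fintype ι] {a : ℝ} (ha : 0 ≤ a) (X : Matrix ι ι ℂ) :
    selfAdjointNorm ((a : ℂ) • X) = a * selfAdjointNorm X := by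
  rw [selfAdjointNorm, selfAdjointNorm, Matrix.smul_mul, Matrix.mul_smul, smul_smul,
    Matrix.trace_smul, smul_eq_mul, ← Complex.ofReal_mul, Complex.re_ofReal_mul,
    Real.sqrt_mul (mul_nonneg ha ha), Real.sqrt_mul_self ha]

/-- The cofactor endomorphism is the determinant times the inverse, and the determinant is a
positive real. The ratio in the distortion is therefore the norm of the inverse of θ, which is what
Cauchy-Schwarz produces. -/
theorem cofactorRatio_eq {W : Matrix (Fin n) (Fin n) ℂ} {H : Matrix (Fin r) (Fin r) ℂ}
    (hW : W.PosDef) (hH : H.PosDef) {θ : Fin n → Fin n → Matrix (Fin r) (Fin r) ℂ}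
    (hθ : IsHermitianTensor H θ) (hpos : IsPositive H θ .nakano) :
    cofactorRatio W H θ = selfAdjointNorm (repEndo W H θ)⁻¹ := by
  have hF := formMatrix_posDef hθ hpos
  have hG := gram_posDef hW hH
  have hd : 0 < (repEndo W H θ).det := by
    rw [repEndo, Matrix.det_mul]
    exact mul_pos hG.inv.det_pos hF.det_pos
  have hdre : ((repEndo W H θ).det.re : ℂ) = (repEndo W H θ).det :=
    Complex.ext (by simp) (by simpa using (Complex.lt_def.1 hd).2)
  have hdpos : 0 < (repEndo W H θ).det.re := (Complex.lt_def.1 hd).1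
  have h : (repEndo W H θ).adjugate = (((repEndo W H θ).det.re : ℝ) : ℂ) • (repEndo W H θ)⁻¹ := by
    rw [Matrix.inv_def, smul_smul, hdre, Ring.mul_inverse_cancel _ hd.ne'.isUnit, one_smul]
  rw [cofactorRatio, h, selfAdjointNorm_smul hdpos.le, mul_div_cancel_left₀ _ hdpos.ne']

/-- The Gram matrix of ω ⊗ H cancels in the product of the inverse of θ with p ⊗ p̄ ⊗ S. The
functional is thus independent of W, and Cauchy-Schwarz may be applied for any choice of it. -/
theorem abs_nakanoFunctional_le {W : Matrix (Fin n) (Fin n) ℂ} {H : Matrix (Fin r) (Fin r) ℂ}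
    (hW : W.PosDef) (hH : H.PosDef) {θ : Fin n → Fin n → Matrix (Fin r) (Fin r) ℂ}
    (hθ : IsHermitianTensor H θ) (hpos : IsPositive H θ .nakano) (p : Fin n → ℂ)
    {S : Matrix (Fin r) (Fin r) ℂ} (hS : (H * S).IsHermitian) :
    |nakanoFunctional H θ p S|
      ≤ 1 / (r : ℝ) * (cofactorRatio W H θ
        * ((star p ⬝ᵥ W⁻¹ *ᵥ p).re * selfAdjointNorm S)) := by
  have hF := formMatrix_posDef hθ hpos
  have hG := gram_posDef hW hH
  have hdF := isUnit_det_of_posDef hF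
  have hdG := isUnit_det_of_posDef hG
  -- Both factors must be written as endomorphisms self-adjoint for the same inner product `gram W
  -- H`.
  have hX : (repEndo W H θ)⁻¹ = (formMatrix H θ)⁻¹ * gram W H := by
    rw [repEndo, Matrix.mul_inv_rev, Matrix.nonsing_inv_nonsing_inv _ hdG]
  have hprod : (formMatrix H θ)⁻¹ * formMatrix H (rankOneTensor p S)
      = (repEndo W H θ)⁻¹ * repEndo W H (rankOneTensor p S) := by
    rw [hX, Matrix.mul_assoc, gram_mul_repEndo hW hH]
  rw [nakanoFunctional, abs_mul, abs_of_nonneg (by positivity : (0 : ℝ) ≤ 1 / r), hprod,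
    cofactorRatio_eq hW hH hθ hpos, ← selfAdjointNorm_rankOneTensor hW (isUnit_det_of_posDef hH)]
  refine mul_le_mul_of_nonneg_left (abs_trace_mul_le hG ?_ ?_) (by positivity)
  · rw [hX, Matrix.IsHermitian, Matrix.conjTranspose_mul, Matrix.conjTranspose_mul,
      hF.inv.1.eq, hG.1.eq, Matrix.mul_assoc]
  · rw [gram_mul_repEndo hW hH]
    exact formMatrix_isHermitian (isHermitianTensor_rankOneTensor hS p)

end NakanoFunctional

/-! ### The linear algebra of the principal symbol -/

section SymbolAlgebra

variable {r : ℕ}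

theorem isHermitian_real_smul {a : ℝ} {A : Matrix (Fin r) (Fin r) ℂ} (hA : A.IsHermitian) :
    (a • A).IsHermitian := by
  rw [Matrix.IsHermitian, Matrix.conjTranspose_smul, hA.eq, star_trivial]

theorem trace_inv_mul_re {H w : Matrix (Fin r) (Fin r) ℂ} (hH : H.PosDef) (hw : w.IsHermitian) :
    (((H⁻¹ * w).trace.re : ℝ) : ℂ) = (H⁻¹ * w).trace := by
  have h : star (H⁻¹ * w).trace = (H⁻¹ * w).trace := by
    rw [← Matrix.trace_conjTranspose, Matrix.conjTranspose_mul, hw.eq, hH.inv.1.eq,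
      Matrix.trace_mul_comm]
  exact Complex.conj_eq_iff_re.1 h

/-- The linear system given by the principal symbol is invertible. -/
theorem bijOn_symbol {n : ℕ} (hn : 1 ≤ n) (hr : 1 ≤ r) {H C : Matrix (Fin r) (Fin r) ℂ}
    (hH : H.PosDef) (hC : C ∈ traceFreeHermitian H) {N Q β t : ℝ} (hN : 0 < N) (hQ : 0 < Q)
    (l : Matrix (Fin r) (Fin r) ℂ →ₗ[ℝ] ℝ)
    (hK : 0 < β * N + (1 / r + t) * l 1 + l C / N)
    (σ : Matrix (Fin r) (Fin r) ℂ → ℝ × Matrix (Fin r) (Fin r) ℂ)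
    (hσ : ∀ w : Matrix (Fin r) (Fin r) ℂ, w.IsHermitian → σ w =
      (-(Q * (β * N * (H⁻¹ * w).trace.re + l (H⁻¹ * w) + t * (H⁻¹ * w).trace.re * l 1)),
        (1 / (n : ℝ)) • ((H⁻¹ * w).trace.re • C
          - N • (H⁻¹ * w - ((H⁻¹ * w).trace.re / r) • (1 : Matrix (Fin r) (Fin r) ℂ))))) :
    Set.BijOn σ {w | w.IsHermitian} (Set.univ ×ˢ traceFreeHermitian H) := by
  have hd := isUnit_det_of_posDef hH
  have hnR : (0 : ℝ) < n := by exact_mod_cast hn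
  have hrR : (0 : ℝ) < r := by exact_mod_cast hr
  have hrC : (r : ℂ) ≠ 0 := by exact_mod_cast (by omega : r ≠ 0)
  have hHS : ∀ w, H * (H⁻¹ * w) = w := fun w => by
    rw [← Matrix.mul_assoc, Matrix.mul_nonsing_inv _ hd, Matrix.one_mul]
  have hSH : ∀ S, H⁻¹ * (H * S) = S := fun w => by
    rw [← Matrix.mul_assoc, Matrix.nonsing_inv_mul _ hd, Matrix.one_mul]
  have hone : ((1 : Matrix (Fin r) (Fin r) ℂ)).trace = (r : ℂ) := by simp
  refine ⟨?_, ?_, ?_⟩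
  · intro w hw
    rw [hσ w hw]
    refine ⟨Set.mem_univ _, ?_, ?_⟩
    · show Matrix.trace _ = 0
      simp only [Matrix.trace_smul, Matrix.trace_sub, hC.1, hone]
      rw [← trace_inv_mul_re hH hw]
      simp only [smul_zero, zero_sub, Complex.real_smul, Complex.ofReal_re]
      push_cast
      field_simp
      ring
    · show Matrix.IsHermitian _
      simp only [Matrix.mul_smul, Matrix.mul_sub, hHS, Matrix.mul_one]
      exact isHermitian_real_smul ((isHermitian_real_smul hC.2).sub
        (isHermitian_real_smul (Matrix.IsHermitian.sub hw (isHermitian_real_smul hH.1))))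
  · intro w₁ hw₁ w₂ hw₂ h12
    rw [hσ w₁ hw₁, hσ w₂ hw₂, Prod.mk.injEq] at h12
    set S₁ := H⁻¹ * w₁
    set S₂ := H⁻¹ * w₂
    set τ₁ := S₁.trace.re
    set τ₂ := S₂.trace.re
    obtain ⟨h1, h2⟩ := h12
    have h2' := smul_right_injective _ (by positivity : (1 / (n : ℝ)) ≠ 0) h2
    -- The second component determines the endomorphism up to its trace: a difference of two
    -- solutions is its trace times C/N + Id/r.
    have h3 : S₁ - S₂ = (τ₁ - τ₂) • ((1 / N) • C + (1 / (r : ℝ)) • (1 : Matrix (Fin r) (Fin r) ℂ)) := by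
      have h4 : N • (S₁ - S₂) = N • ((τ₁ - τ₂) • ((1 / N) • C
          + (1 / (r : ℝ)) • (1 : Matrix (Fin r) (Fin r) ℂ))) := by
        have h5 : N • (S₁ - S₂) = (τ₁ - τ₂) • C + (N * ((τ₁ - τ₂) / r)) • (1 : Matrix (Fin r) (Fin r) ℂ) := by
          have h7 : τ₁ • C - N • (S₁ - (τ₁ / r) • (1 : Matrix (Fin r) (Fin r) ℂ))
              = τ₂ • C - N • (S₂ - (τ₂ / r) • (1 : Matrix (Fin r) (Fin r) ℂ)) := h2'
          rw [sub_eq_sub_iff_add_eq_add] at h7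
          have h9 : N • S₁ - N • S₂ = τ₁ • C - τ₂ • C + ((N * (τ₁ / r)) • (1 : Matrix (Fin r) (Fin r) ℂ)
              - (N * (τ₂ / r)) • (1 : Matrix (Fin r) (Fin r) ℂ)) := by
            simp only [smul_sub, smul_smul] at h7
            rw [sub_eq_iff_eq_add]
            rw [← sub_eq_zero] at h7 ⊢
            rw [← neg_eq_zero, ← h7]
            abel
          rw [smul_sub, h9, sub_div, mul_sub, sub_smul, sub_smul]
        rw [h5]
        rw [smul_smul, smul_add, smul_smul, smul_smul]
        congr 2
        · field_simp
        · field_simp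
      exact smul_right_injective _ hN.ne' h4
    have h4 := mul_left_cancel₀ hQ.ne' (neg_injective h1)
    have h5 : l S₁ - l S₂ = (τ₁ - τ₂) * (l C / N + l 1 / r) := by
      rw [← map_sub, h3]
      simp only [map_smul, map_add, smul_eq_mul]
      ring
    -- Substitution in the scalar component leaves the difference of the traces multiplied by the
    -- coefficient that is assumed positive.
    have h6 : (τ₁ - τ₂) * (β * N + (1 / r + t) * l 1 + l C / N) = 0 := by
      linear_combination h4 - h5
    have h7 : τ₁ - τ₂ = 0 := (mul_eq_zero.1 h6).resolve_right hK.ne'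
    rw [h7, zero_smul, sub_eq_zero] at h3
    rw [← hHS w₁, ← hHS w₂]
    exact congrArg _ h3
  · rintro ⟨a, g⟩ ⟨-, hg⟩
    have hg1 : g.trace = 0 := hg.1
    have hg2 : (H * g).IsHermitian := hg.2
    set K := β * N + (1 / r + t) * l 1 + l C / N with hKdef
    -- Solving the second equation for the trace free part of S and inserting the result in the
    -- first gives Kτ = (n/N) l(g) - a/Q.
    set τ : ℝ := (n / N * l g - a / Q) / K with hτ
    set S : Matrix (Fin r) (Fin r) ℂ := (τ / r) • (1 : Matrix (Fin r) (Fin r) ℂ)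
      + (1 / N) • (τ • C - (n : ℝ) • g) with hS
    have htr : S.trace.re = τ := by
      have : S.trace = (τ : ℂ) := by
        simp only [hS, Matrix.trace_add, Matrix.trace_smul, Matrix.trace_sub, hC.1, hg1, hone]
        simp only [smul_zero, sub_zero, add_zero, Complex.real_smul]
        push_cast
        field_simp
      rw [this, Complex.ofReal_re]
    have hw : (H * S).IsHermitian := by
      simp only [hS, Matrix.mul_add, Matrix.mul_smul, Matrix.mul_sub, Matrix.mul_one]
      exact (isHermitian_real_smul hH.1).add (isHermitian_real_smul
        ((isHermitian_real_smul hC.2).sub (isHermitian_real_smul hg2)))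
    refine ⟨H * S, hw, ?_⟩
    rw [hσ _ hw, hSH, htr]
    refine Prod.ext ?_ ?_
    · have hlS : l S = τ / r * l 1 + 1 / N * (τ * l C - n * l g) := by
        simp only [hS, map_add, map_smul, map_sub, smul_eq_mul]
      have hτK : τ * K = n / N * l g - a / Q := div_mul_cancel₀ _ hK.ne'
      have : β * N * τ + l S + t * τ * l 1 = - (a / Q) := by
        rw [hlS]
        rw [hKdef] at hτK
        linear_combination hτK
      show -(Q * _) = a
      rw [this]
      field_simp
    · show (1 / (n : ℝ)) • (τ • C - N • (S - (τ / r) • (1 : Matrix (Fin r) (Fin r) ℂ))) = g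
      rw [hS, add_sub_cancel_left, smul_smul, mul_one_div_cancel hN.ne', one_smul,
        sub_sub_cancel, smul_smul, one_div_mul_cancel hnR.ne', one_smul]

end SymbolAlgebra

/-! ### Comparison of the positivity notions, and positivity of the trace -/

section Positivity

variable {n r : ℕ} {H : Matrix (Fin r) (Fin r) ℂ} {c : Fin n → Fin n → Matrix (Fin r) (Fin r) ℂ}

theorem star_dotProduct_formMatrix_mulVec_tmul (ξ : Fin n → ℂ) (v w : Fin r → ℂ) :
    star (fun a : Fin n × Fin r => ξ a.1 * w a.2) ⬝ᵥ
      formMatrix H c *ᵥ (fun a : Fin n × Fin r => ξ a.1 * v a.2)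
      = ∑ k, ∑ j, star (ξ k) * ξ j * (star w ⬝ᵥ (H * c j k) *ᵥ v) := by
  simp only [dotProduct, Matrix.mulVec, Fintype.sum_prod_type, formMatrix, Matrix.of_apply,
    Pi.star_apply, Finset.mul_sum, star_mul']
  refine Finset.sum_congr rfl fun k _ => ?_
  rw [Finset.sum_comm]
  refine Finset.sum_congr rfl fun j _ => Finset.sum_congr rfl fun a _ =>
    Finset.sum_congr rfl fun b _ => ?_
  ring

/-- A decomposable tensor can be read in two ways. Freezing ξ gives a form on E, as here, while
freezing v gives a (1,1)-form, as in `quadForm_tmul_eq_vectorForm`. The conjugate of ξ appears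
because `contraction` conjugates the index of dz. -/
theorem quadForm_tmul_eq_contraction (ξ : Fin n → ℂ) (v : Fin r → ℂ) :
    quadForm H c (fun a => ξ a.1 * v a.2)
      = (star v ⬝ᵥ (H * contraction (star ξ) c) *ᵥ v).re := by
  rw [quadForm, star_dotProduct_formMatrix_mulVec_tmul]
  congr 1
  simp only [contraction, Matrix.mul_sum, Matrix.sum_mulVec, dotProduct_sum, Matrix.mul_smul,
    Matrix.smul_mulVec, dotProduct_smul, smul_eq_mul, Pi.star_apply, star_star]
  rw [Finset.sum_comm]
  refine Finset.sum_congr rfl fun j _ => Finset.sum_congr rfl fun k _ => ?_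
  ring

theorem quadForm_tmul_eq_vectorForm (ξ : Fin n → ℂ) (v : Fin r → ℂ) :
    quadForm H c (fun a => ξ a.1 * v a.2) = (star ξ ⬝ᵥ (vectorForm H c v)ᵀ *ᵥ ξ).re := by
  rw [quadForm, star_dotProduct_formMatrix_mulVec_tmul]
  congr 1
  simp only [dotProduct, Matrix.mulVec, vectorForm, Matrix.transpose_apply, Matrix.of_apply,
    Pi.star_apply, Finset.mul_sum]
  refine Finset.sum_congr rfl fun j _ => Finset.sum_congr rfl fun k _ => ?_
  simp only [Finset.sum_mul, Finset.mul_sum]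
  refine Finset.sum_congr rfl fun a _ => Finset.sum_congr rfl fun b _ => ?_
  ring

theorem tmul_ne_zero {ξ : Fin n → ℂ} {v : Fin r → ℂ} (hξ : ξ ≠ 0) (hv : v ≠ 0) :
    (fun a : Fin n × Fin r => ξ a.1 * v a.2) ≠ 0 := by
  obtain ⟨j, hj⟩ := Function.ne_iff.1 hξ
  obtain ⟨l, hl⟩ := Function.ne_iff.1 hv
  exact fun h => mul_ne_zero hj hl (congrFun h (j, l))

/-- The metric identifies v with the dual vector conj(Hv), and the transposed tensor takes at ξ ⊗
conj(Hv) the value that c takes at ξ ⊗ v. -/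
theorem isPositive_griffiths_of_dualNakano (hH : H.PosDef)
    (h : IsPositive H c .dualNakano) : IsPositive H c .griffiths := by
  intro ξ v hξ hv
  have hd := isUnit_det_of_posDef hH
  have hu : star (H *ᵥ v) ≠ 0 := by
    rw [Ne, star_eq_zero]
    intro h0
    apply hv
    have := congrArg (H⁻¹ *ᵥ ·) h0
    simpa [Matrix.mulVec_mulVec, Matrix.nonsing_inv_mul _ hd] using this
  have h1 := h _ (tmul_ne_zero hξ hu)
  have h2 : ∀ j k, star (star (H *ᵥ v)) ⬝ᵥ (dualMetric H * transposeTensor c j k) *ᵥ star (H *ᵥ v)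
      = star v ⬝ᵥ (H * c j k) *ᵥ v := by
    intro j k
    rw [star_star, dualMetric, transposeTensor, ← Matrix.transpose_mul, Matrix.mulVec_transpose,
      dotProduct_comm, ← Matrix.dotProduct_mulVec, Matrix.mulVec_mulVec, Matrix.mul_assoc,
      Matrix.nonsing_inv_mul _ hd, Matrix.mul_one, Matrix.star_mulVec, hH.1.eq,
      ← Matrix.dotProduct_mulVec, Matrix.mulVec_mulVec]
  rw [quadForm, star_dotProduct_formMatrix_mulVec_tmul] at h1 ⊢
  simpa only [h2] using h1

theorem IsPositive.griffiths {P : PositivityType} (hH : H.PosDef) (h : IsPositive H c P) :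
    IsPositive H c .griffiths := by
  cases P with
  | nakano => exact fun ξ v hξ hv => h _ (tmul_ne_zero hξ hv)
  | dualNakano => exact isPositive_griffiths_of_dualNakano hH h
  | griffiths => exact h

theorem vectorForm_isHermitian (hc : IsHermitianTensor H c) (v : Fin r → ℂ) :
    (vectorForm H c v).IsHermitian := by
  ext j k
  simp only [vectorForm, Matrix.conjTranspose_apply, Matrix.of_apply]
  rw [← hc j k, ← Matrix.star_dotProduct_star, star_star, Matrix.star_mulVec,
    ← Matrix.dotProduct_mulVec, hc j k, hc k j]

theorem vectorForm_posDef (hc : IsHermitianTensor H c) (h : IsPositive H c .griffiths)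
    {v : Fin r → ℂ} (hv : v ≠ 0) : (vectorForm H c v).PosDef := by
  rw [← Matrix.PosDef.transpose_iff]
  refine posDef_of_re_pos (vectorForm_isHermitian hc v).transpose fun ξ hξ => ?_
  rw [← quadForm_tmul_eq_vectorForm]
  exact h ξ v hξ hv

/-- For each nonzero x, Griffiths positivity makes the contraction along x a positive endomorphism
for H. Its trace, which is the value of the trace form, is then positive. -/
theorem traceForm_posDef_of_griffiths (hr : 1 ≤ r) (hH : H.PosDef) (hc : IsHermitianTensor H c)
    (h : IsPositive H c .griffiths) : (traceForm c).PosDef := by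
  have : Nonempty (Fin r) := ⟨⟨0, hr⟩⟩
  refine posDef_of_re_pos (hc.traceForm hH) fun x hx => ?_
  have h1 : star x ⬝ᵥ traceForm c *ᵥ x = (contraction x c).trace := by
    simp only [dotProduct, Matrix.mulVec, traceForm, contraction, Matrix.trace_sum,
      Matrix.trace_smul, smul_eq_mul, Matrix.of_apply, Pi.star_apply, Finset.mul_sum]
    refine Finset.sum_congr rfl fun j _ => Finset.sum_congr rfl fun k _ => ?_
    ring
  have h2 : (H * contraction x c).PosDef := by
    refine posDef_of_re_pos (isHermitian_contraction hc x) fun v hv => ?_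
    have := h (star x) v (by simpa using hx) hv
    rwa [quadForm_tmul_eq_contraction, star_star] at this
  have h3 := trace_mul_pos hH.inv h2
  rwa [← Matrix.mul_assoc, Matrix.nonsing_inv_mul _ (isUnit_det_of_posDef hH), Matrix.one_mul,
    ← h1] at h3

theorem traceForm_twist (t : ℝ) (c : Fin n → Fin n → Matrix (Fin r) (Fin r) ℂ) :
    traceForm (twist t c) = (1 + r * t) • traceForm c := by
  ext j k
  simp [traceForm, twist, Matrix.trace_add, Matrix.trace_smul]
  ring

/-- This is all that can be said at one point: if 1 + rt were negative, the trace form would be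
negative definite. The sign is decided by a global argument. -/
theorem smul_traceForm_posDef (hr : 1 ≤ r) (hH : H.PosDef) (hc : IsHermitianTensor H c)
    {P : PositivityType} {t : ℝ} (h : IsPositive H (twist t c) P) :
    ((1 + r * t) • traceForm c).PosDef := by
  rw [← traceForm_twist]
  exact traceForm_posDef_of_griffiths hr hH (hc.twist hH t) (h.griffiths hH)

theorem traceForm_posDef (hr : 1 ≤ r) (hH : H.PosDef) (hc : IsHermitianTensor H c)
    {P : PositivityType} {t : ℝ} (ht : 0 < 1 + r * t) (h : IsPositive H (twist t c) P) :
    (traceForm c).PosDef := by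
  have h1 := (smul_traceForm_posDef hr hH hc h).smul (inv_pos.2 ht)
  rwa [smul_smul, inv_mul_cancel₀ ht.ne', one_smul] at h1

end Positivity

/-! ### Behaviour under changes of frame and of coordinates -/

section ChangeOfFrame

variable {n r : ℕ}

/-- The coefficients of a curvature type tensor after a change of frame `A` and a change of
coordinates with jacobian matrix `J`. -/
def changeFrame (A : Matrix (Fin r) (Fin r) ℂ) (J : Matrix (Fin n) (Fin n) ℂ)
    (c : Fin n → Fin n → Matrix (Fin r) (Fin r) ℂ) : Fin n → Fin n → Matrix (Fin r) (Fin r) ℂ :=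
  fun j k => ∑ a, ∑ b, (J a j * star (J b k)) • (A⁻¹ * c a b * A)

variable {A : Matrix (Fin r) (Fin r) ℂ} {J : Matrix (Fin n) (Fin n) ℂ}
  {H : Matrix (Fin r) (Fin r) ℂ} {c : Fin n → Fin n → Matrix (Fin r) (Fin r) ℂ}

theorem trace_changeFrame (hA : IsUnit A.det) (j k : Fin n) :
    (changeFrame A J c j k).trace = ∑ a, ∑ b, (J a j * star (J b k)) * (c a b).trace := by
  simp only [changeFrame, Matrix.trace_sum, Matrix.trace_smul, smul_eq_mul]
  refine Finset.sum_congr rfl fun a _ => Finset.sum_congr rfl fun b _ => ?_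
  rw [Matrix.trace_mul_comm, ← Matrix.mul_assoc, Matrix.mul_nonsing_inv _ hA, Matrix.one_mul]

theorem twist_changeFrame (hA : IsUnit A.det) (t : ℝ) :
    twist t (changeFrame A J c) = changeFrame A J (twist t c) := by
  funext j k
  rw [twist, trace_changeFrame hA]
  simp only [changeFrame, twist, Matrix.mul_add, Matrix.add_mul, smul_add, Finset.sum_add_distrib]
  congr 1
  simp only [Matrix.mul_smul, Matrix.smul_mul, Matrix.mul_one, Matrix.nonsing_inv_mul _ hA,
    Finset.mul_sum, Finset.sum_smul, smul_smul]
  refine Finset.sum_congr rfl fun a _ => Finset.sum_congr rfl fun b _ => ?_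
  congr 1
  ring

theorem traceForm_changeFrame (hA : IsUnit A.det) :
    traceForm (changeFrame A J c) = Jᵀ * traceForm c * J.map star := by
  ext j k
  simp only [traceForm, Matrix.of_apply, trace_changeFrame hA, Matrix.mul_apply,
    Matrix.transpose_apply, Matrix.map_apply, Finset.sum_mul]
  rw [Finset.sum_comm]
  refine Finset.sum_congr rfl fun a _ => Finset.sum_congr rfl fun b _ => ?_
  ring

theorem metric_mul_changeFrame (hA : IsUnit A.det) (j k : Fin n) :
    Aᴴ * H * A * changeFrame A J c j k
      = ∑ a, ∑ b, (J a j * star (J b k)) • (Aᴴ * (H * c a b) * A) := by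
  rw [changeFrame, Matrix.mul_sum]
  refine Finset.sum_congr rfl fun a _ => ?_
  rw [Matrix.mul_sum]
  refine Finset.sum_congr rfl fun b _ => ?_
  rw [Matrix.mul_smul]
  congr 1
  simp only [Matrix.mul_assoc]
  rw [← Matrix.mul_assoc A A⁻¹, Matrix.mul_nonsing_inv _ hA, Matrix.one_mul]

theorem conjTranspose_mul_mul_apply {m : ℕ} (A : Matrix (Fin m) (Fin m) ℂ)
    (M : Matrix (Fin m) (Fin m) ℂ) (x y : Fin m) :
    (Aᴴ * M * A) x y = ∑ l, ∑ i, star (A l x) * M l i * A i y := by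
  rw [Matrix.mul_assoc, Matrix.mul_apply]
  simp only [Matrix.conjTranspose_apply, Matrix.mul_apply, Finset.mul_sum, mul_assoc]

/-- All positivity notions are transported by this congruence, whose matrix J ⊗ A preserves
decomposable tensors. -/
theorem formMatrix_changeFrame (hA : IsUnit A.det) :
    formMatrix (Aᴴ * H * A) (changeFrame A J c) = (J ⊗ₖ A)ᴴ * formMatrix H c * (J ⊗ₖ A) := by
  ext x y
  rw [formMatrix, Matrix.of_apply, metric_mul_changeFrame hA]
  rw [Matrix.mul_assoc, Matrix.mul_apply]
  have h : ∀ z, (formMatrix H c * (J ⊗ₖ A)) z y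
      = ∑ a, ∑ i, (H * c a z.1) z.2 i * (J a y.1 * A i y.2) := fun z => by
    rw [Matrix.mul_apply, Fintype.sum_prod_type]
    rfl
  simp only [Matrix.conjTranspose_apply, h, Finset.mul_sum,
    Fintype.sum_prod_type, Matrix.sum_apply, Matrix.smul_apply, smul_eq_mul,
    conjTranspose_mul_mul_apply, Matrix.kroneckerMap_apply, star_mul']
  rw [Finset.sum_comm]
  refine Finset.sum_congr rfl fun b _ => ?_
  rw [Finset.sum_comm]
  refine Finset.sum_congr rfl fun l _ => Finset.sum_congr rfl fun a _ =>
    Finset.sum_congr rfl fun i _ => ?_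
  ring

theorem gram_changeFrame (hA : IsUnit A.det) :
    gram (traceForm (changeFrame A J c)) (Aᴴ * H * A)
      = (J ⊗ₖ A)ᴴ * gram (traceForm c) H * (J ⊗ₖ A) := by
  rw [gram_eq_kronecker, gram_eq_kronecker, traceForm_changeFrame hA, Matrix.conjTranspose_kronecker,
    ← Matrix.mul_kronecker_mul, ← Matrix.mul_kronecker_mul, Matrix.transpose_mul,
    Matrix.transpose_mul, Matrix.transpose_transpose, ← Matrix.mul_assoc]
  rfl

theorem isUnit_det_kronecker (hA : IsUnit A.det) (hJ : IsUnit J.det) : IsUnit (J ⊗ₖ A).det := by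
  rw [Matrix.det_kronecker]
  exact (hJ.pow _).mul (hA.pow _)

theorem isUnit_det_conjTranspose {ι : Type*} [Fintype ι] [DecidableEq ι] {B : Matrix ι ι ℂ}
    (hB : IsUnit B.det) : IsUnit (Bᴴ).det := by
  rw [Matrix.det_conjTranspose]; exact hB.star

/-- Form and Gram matrix both change by congruence with J ⊗ A, hence their quotient changes by
conjugation. The transformation of the Gram matrix is a hypothesis so that the result also serves
the dual bundle, where W still comes from the tensor on E. -/
theorem repEndo_changeFrame (hA : IsUnit A.det) (hJ : IsUnit J.det) (W : Matrix (Fin n) (Fin n) ℂ)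
    {G : Matrix (Fin r) (Fin r) ℂ} {W' : Matrix (Fin n) (Fin n) ℂ}
    (hG : gram W' (Aᴴ * G * A) = (J ⊗ₖ A)ᴴ * gram W G * (J ⊗ₖ A)) :
    repEndo W' (Aᴴ * G * A) (changeFrame A J c)
      = (J ⊗ₖ A)⁻¹ * repEndo W G c * (J ⊗ₖ A) := by
  have hB := isUnit_det_kronecker hA hJ
  rw [repEndo, repEndo, hG, formMatrix_changeFrame hA, Matrix.mul_inv_rev, Matrix.mul_inv_rev]
  simp only [Matrix.mul_assoc]
  rw [← Matrix.mul_assoc ((J ⊗ₖ A)ᴴ)⁻¹, Matrix.nonsing_inv_mul _ (isUnit_det_conjTranspose hB),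
    Matrix.one_mul]

theorem selfAdjointNorm_conj {ι : Type*} [Fintype ι] [DecidableEq ι] {B : Matrix ι ι ℂ}
    (hB : IsUnit B.det) (X : Matrix ι ι ℂ) :
    selfAdjointNorm (B⁻¹ * X * B) = selfAdjointNorm X := by
  have : B⁻¹ * X * B * (B⁻¹ * X * B) = B⁻¹ * (X * X) * B := by
    simp only [Matrix.mul_assoc]
    rw [← Matrix.mul_assoc B B⁻¹, Matrix.mul_nonsing_inv _ hB, Matrix.one_mul]
  rw [selfAdjointNorm, selfAdjointNorm, this, Matrix.trace_mul_cycle, Matrix.mul_nonsing_inv _ hB,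
    Matrix.one_mul]

/-- The adjugate reverses products, and the two determinant factors produced by the outer matrices
are inverse to each other. Spectral invariants of the cofactor endomorphism are thus independent of
frames. -/
theorem adjugate_conj {ι : Type*} [Fintype ι] [DecidableEq ι] {B : Matrix ι ι ℂ}
    (hB : IsUnit B.det) (X : Matrix ι ι ℂ) : (B⁻¹ * X * B).adjugate = B⁻¹ * X.adjugate * B := by
  have h1 : B.adjugate = B.det • B⁻¹ := by
    rw [Matrix.inv_def, smul_smul, Ring.mul_inverse_cancel _ hB, one_smul]
  have h2 : B⁻¹.adjugate = B⁻¹.det • B := by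
    have hB' : IsUnit B⁻¹.det := Matrix.isUnit_nonsing_inv_det _ hB
    have h3 := Matrix.inv_def B⁻¹
    rw [Matrix.nonsing_inv_nonsing_inv _ hB] at h3
    calc B⁻¹.adjugate = B⁻¹.det • (Ring.inverse B⁻¹.det • B⁻¹.adjugate) := by
          rw [smul_smul, Ring.mul_inverse_cancel _ hB', one_smul]
      _ = B⁻¹.det • B := congrArg _ h3.symm
  rw [Matrix.adjugate_mul_distrib, Matrix.adjugate_mul_distrib, h1, h2, Matrix.mul_smul, Matrix.mul_smul, Matrix.smul_mul,
    smul_smul, Matrix.mul_assoc, ← Matrix.det_mul, Matrix.nonsing_inv_mul _ hB, Matrix.det_one, one_smul]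

theorem cofactorRatio_conj {W W' : Matrix (Fin n) (Fin n) ℂ} {G : Matrix (Fin r) (Fin r) ℂ}
    (hA : IsUnit A.det) (hJ : IsUnit J.det)
    (hG : gram W' (Aᴴ * G * A) = (J ⊗ₖ A)ᴴ * gram W G * (J ⊗ₖ A)) :
    cofactorRatio W' (Aᴴ * G * A) (changeFrame A J c) = cofactorRatio W G c := by
  have hB := isUnit_det_kronecker hA hJ
  rw [cofactorRatio, cofactorRatio, repEndo_changeFrame hA hJ W hG, adjugate_conj hB,
    selfAdjointNorm_conj hB, Matrix.det_mul, Matrix.det_mul, mul_comm (Matrix.det _) (Matrix.det _),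
    mul_assoc, ← Matrix.det_mul, Matrix.nonsing_inv_mul _ hB, Matrix.det_one, mul_one]

theorem dualMetric_changeFrame (A H : Matrix (Fin r) (Fin r) ℂ) :
    dualMetric (Aᴴ * H * A) = (A⁻¹ᵀ)ᴴ * dualMetric H * A⁻¹ᵀ := by
  rw [dualMetric, dualMetric, Matrix.mul_inv_rev, Matrix.mul_inv_rev, Matrix.transpose_mul,
    Matrix.transpose_mul]
  congr 2
  rw [← Matrix.conjTranspose_nonsing_inv]
  rfl

theorem transposeTensor_changeFrame (hA : IsUnit A.det) :
    transposeTensor (changeFrame A J c) = changeFrame A⁻¹ᵀ J (transposeTensor c) := by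
  funext j k
  simp only [transposeTensor, changeFrame, Matrix.transpose_sum, Matrix.transpose_smul,
    Matrix.transpose_mul]
  have h : (A⁻¹ᵀ)⁻¹ = Aᵀ := by
    rw [← Matrix.transpose_nonsing_inv, Matrix.nonsing_inv_nonsing_inv _ hA]
  simp only [h, Matrix.mul_assoc]

theorem isUnit_det_inv_transpose (hA : IsUnit A.det) : IsUnit (A⁻¹ᵀ).det := by
  rw [Matrix.det_transpose]
  exact Matrix.isUnit_nonsing_inv_det _ hA

theorem quadForm_changeFrame (hA : IsUnit A.det) (γ : Fin n × Fin r → ℂ) :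
    quadForm (Aᴴ * H * A) (changeFrame A J c) γ = quadForm H c ((J ⊗ₖ A) *ᵥ γ) := by
  rw [quadForm, quadForm, formMatrix_changeFrame hA, Matrix.star_mulVec, ← Matrix.dotProduct_mulVec,
    Matrix.mulVec_mulVec, Matrix.mulVec_mulVec, Matrix.mul_assoc]

theorem kronecker_mulVec_tmul (ξ : Fin n → ℂ) (v : Fin r → ℂ) :
    (J ⊗ₖ A) *ᵥ (fun a => ξ a.1 * v a.2) = fun a => (J *ᵥ ξ) a.1 * (A *ᵥ v) a.2 := by
  funext a
  simp only [Matrix.mulVec, dotProduct, Fintype.sum_prod_type, Matrix.kroneckerMap_apply,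
    Finset.sum_mul_sum]
  refine Finset.sum_congr rfl fun b _ => Finset.sum_congr rfl fun d _ => ?_
  ring

theorem mulVec_ne_zero {ι : Type*} [Fintype ι] [DecidableEq ι] {B : Matrix ι ι ℂ}
    (hB : IsUnit B.det) {x : ι → ℂ} (hx : x ≠ 0) : B *ᵥ x ≠ 0 := by
  intro h
  apply hx
  have := congrArg (B⁻¹ *ᵥ ·) h
  simpa [Matrix.mulVec_mulVec, Matrix.nonsing_inv_mul _ hB] using this

theorem IsPositive.changeFrame (hA : IsUnit A.det) (hJ : IsUnit J.det) {P : PositivityType}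
    (h : IsPositive H c P) : IsPositive (Aᴴ * H * A) (changeFrame A J c) P := by
  cases P with
  | nakano =>
    intro γ hγ
    rw [quadForm_changeFrame hA]
    exact h _ (mulVec_ne_zero (isUnit_det_kronecker hA hJ) hγ)
  | dualNakano =>
    intro γ hγ
    have hA' := isUnit_det_inv_transpose hA
    rw [dualMetric_changeFrame, transposeTensor_changeFrame hA, quadForm_changeFrame hA']
    exact h _ (mulVec_ne_zero (isUnit_det_kronecker hA' hJ) hγ)
  | griffiths =>
    intro ξ v hξ hv
    rw [quadForm_changeFrame hA, kronecker_mulVec_tmul]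
    exact h _ _ (mulVec_ne_zero hJ hξ) (mulVec_ne_zero hA hv)

theorem vectorForm_changeFrame (hA : IsUnit A.det) (v : Fin r → ℂ) :
    vectorForm (Aᴴ * H * A) (changeFrame A J c) v
      = Jᵀ * vectorForm H c (A *ᵥ v) * J.map star := by
  have h : ∀ M : Matrix (Fin r) (Fin r) ℂ,
      star v ⬝ᵥ (Aᴴ * M * A) *ᵥ v = star (A *ᵥ v) ⬝ᵥ M *ᵥ (A *ᵥ v) := by
    intro M
    rw [Matrix.star_mulVec, ← Matrix.dotProduct_mulVec, Matrix.mulVec_mulVec, Matrix.mulVec_mulVec,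
      Matrix.mul_assoc]
  ext j k
  simp only [vectorForm, Matrix.of_apply, metric_mul_changeFrame hA, Matrix.sum_mulVec,
    dotProduct_sum, Matrix.smul_mulVec, dotProduct_smul, smul_eq_mul, h, Matrix.mul_apply,
    Matrix.transpose_apply, Matrix.map_apply, Finset.sum_mul]
  rw [Finset.sum_comm]
  refine Finset.sum_congr rfl fun a _ => Finset.sum_congr rfl fun b _ => ?_
  ring

theorem det_map_star (J : Matrix (Fin n) (Fin n) ℂ) : (J.map star).det = star J.det := by
  have : J.map star = (Jᴴ)ᵀ := rfl
  rw [this, Matrix.det_transpose, Matrix.det_conjTranspose]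

theorem topPower_changeFrame (α : Matrix (Fin n) (Fin n) ℂ) :
    topPower (Jᵀ * α * J.map star) = Complex.normSq J.det * topPower α := by
  have h : (Jᵀ * α * J.map star).det = ((Complex.normSq J.det : ℝ) : ℂ) * α.det := by
    rw [Matrix.det_mul, Matrix.det_mul, det_map_star, Matrix.det_transpose,
      ← Complex.mul_conj, Complex.star_def]
    ring
  rw [topPower, topPower, h, Complex.re_ofReal_mul]
  ring

/-- As `topPower` is multiplied by |det J|² under pullback, so is its derivative. In the proof this
comes from cyclicity of the trace and adj(J)J = det J. -/
theorem mixedPower_changeFrame (α η : Matrix (Fin n) (Fin n) ℂ) :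
    mixedPower (Jᵀ * α * J.map star) (Jᵀ * η * J.map star)
      = Complex.normSq J.det * mixedPower α η := by
  have h1 : (J.map star).adjugate * α.adjugate * (Jᵀ).adjugate * (Jᵀ * η * J.map star)
      = (J.map star).adjugate * α.adjugate * ((Jᵀ).adjugate * Jᵀ) * η * J.map star := by
    simp only [Matrix.mul_assoc]
  have h : ((Jᵀ * α * J.map star).adjugate * (Jᵀ * η * J.map star)).trace
      = ((Complex.normSq J.det : ℝ) : ℂ) * (α.adjugate * η).trace := by
    rw [Matrix.adjugate_mul_distrib, Matrix.adjugate_mul_distrib,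
      ← Matrix.mul_assoc (J.map star).adjugate, h1,
      Matrix.adjugate_mul, Matrix.trace_mul_comm, Matrix.det_transpose]
    simp only [← Matrix.mul_assoc, Matrix.mul_adjugate, Matrix.mul_smul, Matrix.smul_mul,
      Matrix.mul_one, Matrix.one_mul, Matrix.trace_smul, smul_eq_mul, det_map_star]
    rw [← Complex.mul_conj, Complex.star_def]
    ring
  rw [mixedPower, mixedPower, h, Complex.re_ofReal_mul]
  ring

end ChangeOfFrame

end KroneckerNotation

-- Calculus of matrix valued functions, entry by entry

attribute [local instance] Matrix.normedAddCommGroup Matrix.normedSpace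

section MatrixCalculus

variable {ι : Type*} [Fintype ι] [DecidableEq ι] {V : Type*} [NormedAddCommGroup V]
  [NormedSpace ℝ V] {k : WithTop ℕ∞}

theorem contDiffAt_matrix_iff {κ : Type*} [Fintype κ] {f : V → Matrix ι κ ℂ} {x : V} :
    ContDiffAt ℝ k f x ↔ ∀ i j, ContDiffAt ℝ k (fun y => f y i j) x := by
  have h1 : ContDiffAt ℝ k f x ↔ ∀ i, ContDiffAt ℝ k (fun y => f y i) x :=
    contDiffAt_pi (F' := fun _ : ι => κ → ℂ)
  rw [h1]
  exact forall_congr' fun i => contDiffAt_pi (F' := fun _ : κ => ℂ)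

theorem contDiffAt_matrix_mul {κ μ : Type*} [Fintype κ] [Fintype μ] {f : V → Matrix ι κ ℂ}
    {g : V → Matrix κ μ ℂ} {x : V} (hf : ContDiffAt ℝ k f x) (hg : ContDiffAt ℝ k g x)
    [DecidableEq κ] :
    ContDiffAt ℝ k (fun y => f y * g y) x := by
  rw [contDiffAt_matrix_iff] at hf hg ⊢
  intro i j
  simp only [Matrix.mul_apply]
  exact ContDiffAt.sum fun l _ => (hf i l).mul (hg l j)

theorem contDiffAt_matrix_det {f : V → Matrix ι ι ℂ} {x : V} (hf : ContDiffAt ℝ k f x) :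
    ContDiffAt ℝ k (fun y => (f y).det) x := by
  rw [contDiffAt_matrix_iff] at hf
  simp only [Matrix.det_apply]
  refine ContDiffAt.sum fun σ _ => ContDiffAt.const_smul _ ?_
  exact contDiffAt_prod fun i _ => hf _ _

theorem contDiffAt_matrix_adjugate {f : V → Matrix ι ι ℂ} {x : V} (hf : ContDiffAt ℝ k f x) :
    ContDiffAt ℝ k (fun y => (f y).adjugate) x := by
  rw [contDiffAt_matrix_iff]
  intro i j
  simp only [Matrix.adjugate_apply]
  refine contDiffAt_matrix_det ?_
  rw [contDiffAt_matrix_iff] at hf ⊢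
  intro a b
  by_cases h : a = j
  · subst h
    simpa using contDiffAt_const
  · simpa [Matrix.updateRow_ne h] using hf a b

theorem contDiffAt_matrix_inv {f : V → Matrix ι ι ℂ} {x : V} (hf : ContDiffAt ℝ k f x)
    (hx : IsUnit (f x).det) : ContDiffAt ℝ k (fun y => (f y)⁻¹) x := by
  simp only [Matrix.inv_def, Ring.inverse_eq_inv']
  have h1 := (contDiffAt_matrix_det hf).inv hx.ne_zero
  have h2 := contDiffAt_matrix_adjugate hf
  rw [contDiffAt_matrix_iff] at h2 ⊢
  exact fun i j => h1.smul (h2 i j)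

theorem contDiffAt_matrix_trace {f : V → Matrix ι ι ℂ} {x : V} (hf : ContDiffAt ℝ k f x) :
    ContDiffAt ℝ k (fun y => (f y).trace) x := by
  rw [contDiffAt_matrix_iff] at hf
  exact ContDiffAt.sum fun i _ => hf i i

theorem contDiffAt_star {f : V → ℂ} {x : V} (hf : ContDiffAt ℝ k f x) :
    ContDiffAt ℝ k (fun y => star (f y)) x :=
  Complex.conjCLE.contDiff.contDiffAt.comp x hf

theorem contDiffAt_re {f : V → ℂ} {x : V} (hf : ContDiffAt ℝ k f x) :
    ContDiffAt ℝ k (fun y => (f y).re) x :=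
  Complex.reCLM.contDiff.contDiffAt.comp x hf

end MatrixCalculus

/-! ### Differentiation under the integral sign over a compact set -/

section ParametricIntegral

variable {P V : Type*} [NormedAddCommGroup P] [NormedSpace ℝ P] [FiniteDimensional ℝ P]
  [NormedAddCommGroup V] [NormedSpace ℝ V]
  [MeasurableSpace V] [BorelSpace V] {S : Set V} [CompactSpace S]

/-- Differentiation under the integral sign over a compact set. -/
theorem hasFDerivAt_integral_of_contDiffAt (μ : Measure S) [IsFiniteMeasure μ] (K : P × V → ℝ)
    (x₀ : P) (h : ∀ u : S, ContDiffAt ℝ 1 K (x₀, u)) :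
    HasFDerivAt (fun x => ∫ u : S, K (x, u) ∂μ)
      (∫ u : S, (fderiv ℝ K (x₀, u)).comp (ContinuousLinearMap.inl ℝ P V) ∂μ) x₀ := by
  -- Compactness of S gives one neighbourhood of the parameter x₀ that works for all u
  -- simultaneously.
  have hev : ∀ᶠ x in 𝓝 x₀, ∀ u ∈ (Set.univ : Set S), ContDiffAt ℝ 1 K (x, u) := by
    refine isCompact_univ.eventually_forall_of_forall_eventually fun u _ => ?_
    have h1 := (h u).eventually (by simp)
    have h2 : Filter.Tendsto (fun z : P × S => (z.1, (z.2 : V))) (𝓝 (x₀, u)) (𝓝 (x₀, (u : V))) :=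
      (continuous_fst.prodMk (continuous_subtype_val.comp continuous_snd)).continuousAt
    exact h2.eventually h1
  have : ProperSpace P := FiniteDimensional.proper_real P
  obtain ⟨ε, hε, hball⟩ := Metric.nhds_basis_closedBall.eventually_iff.1 hev
  set B := Metric.closedBall x₀ ε with hB
  have hBc : IsCompact B := isCompact_closedBall _ _
  set D : P → S → P →L[ℝ] ℝ :=
    fun x u => (fderiv ℝ K (x, u)).comp (ContinuousLinearMap.inl ℝ P V) with hD
  have hDc : ContinuousOn (fun z : P × S => D z.1 z.2) (B ×ˢ Set.univ) := by
    intro z hz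
    have h1 : ContinuousAt (fderiv ℝ K) (z.1, (z.2 : V)) :=
      ((hball hz.1 z.2 trivial).fderiv_right (m := 0) (by simp)).continuousAt
    have h2 : ContinuousAt (fun z : P × S => (z.1, (z.2 : V))) z :=
      (continuous_fst.prodMk (continuous_subtype_val.comp continuous_snd)).continuousAt
    have h3 : ContinuousAt (fun z : P × S => fderiv ℝ K (z.1, (z.2 : V))) z :=
      ContinuousAt.comp (f := fun z : P × S => (z.1, (z.2 : V))) h1 h2
    exact (h3.clm_comp continuousAt_const).continuousWithinAt
  -- The partial derivative is continuous on the compact set B × S, so a constant dominates it. The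
  -- measure is finite, hence this constant is integrable.
  obtain ⟨M, hM⟩ := ((hBc.prod isCompact_univ).bddAbove_image hDc.norm)
  have hcont : ∀ x ∈ B, Continuous fun u : S => K (x, u) := by
    intro x hx
    rw [continuous_iff_continuousAt]
    intro u
    exact ContinuousAt.comp (f := fun u : S => (x, (u : V))) (hball hx u trivial).continuousAt
      (continuous_const.prodMk continuous_subtype_val).continuousAt
  have hx₀ : x₀ ∈ B := Metric.mem_closedBall_self hε.le
  refine hasFDerivAt_integral_of_dominated_of_fderiv_le (μ := μ) (F := fun x (u : S) => K (x, u)) (F' := D)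
    (bound := fun _ => M) (s := B) (Metric.closedBall_mem_nhds x₀ hε) ?_ ?_ ?_ ?_
    (integrable_const M) ?_
  · filter_upwards [Metric.closedBall_mem_nhds x₀ hε] with x hx
    exact (hcont x hx).aestronglyMeasurable
  · obtain ⟨C, hC⟩ := (isCompact_range (hcont x₀ hx₀)).isBounded.exists_norm_le
    exact Integrable.of_bound (hcont x₀ hx₀).aestronglyMeasurable C
      (Filter.Eventually.of_forall fun u => hC _ ⟨u, rfl⟩)
  · have : Continuous (D x₀) := by
      have := hDc.comp_continuous (f := fun u : S => (x₀, u)) (by fun_prop) (fun u => ⟨hx₀, trivial⟩)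
      exact this
    exact this.aestronglyMeasurable
  · exact Filter.Eventually.of_forall fun u x hx => hM ⟨(x, u), ⟨hx, trivial⟩, rfl⟩
  · refine Filter.Eventually.of_forall fun u x hx => ?_
    have h1 := ((hball hx u trivial).differentiableAt (by simp)).hasFDerivAt
    have h2 : HasFDerivAt (fun y : P => (y, (u : V))) (ContinuousLinearMap.inl ℝ P V) x :=
      hasFDerivAt_prodMk_left x (u : V)
    exact h1.comp x h2

end ParametricIntegral

/-! ### The invariant measure on the unit sphere of a varying metric -/

section SphereMeasure

variable {r : ℕ} {H : Matrix (Fin r) (Fin r) ℂ}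

/-- The radial projection on the unit sphere of `H`. -/
def sphereProj (H : Matrix (Fin r) (Fin r) ℂ) (v : Fin r → ℂ) : Fin r → ℂ :=
  (Real.sqrt (normSqOf H v))⁻¹ • v

theorem continuous_normSqOf (H : Matrix (Fin r) (Fin r) ℂ) : Continuous (normSqOf H) := by
  unfold normSqOf
  exact Complex.continuous_re.comp (Continuous.dotProduct continuous_star
    (continuous_const.matrix_mulVec continuous_id))

theorem measurable_sphereProj (H : Matrix (Fin r) (Fin r) ℂ) : Measurable (sphereProj H) := by
  have h1 : Measurable fun v => (Real.sqrt (normSqOf H v))⁻¹ :=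
    ((continuous_normSqOf H).measurable.sqrt).inv
  exact h1.smul measurable_id

theorem normSqOf_smul (H : Matrix (Fin r) (Fin r) ℂ) (a : ℝ) (v : Fin r → ℂ) :
    normSqOf H (a • v) = a ^ 2 * normSqOf H v := by
  have h : a • v = (a : ℂ) • v := by ext i; simp
  rw [normSqOf, normSqOf, h, Matrix.mulVec_smul, star_smul, smul_dotProduct, dotProduct_smul]
  simp only [Complex.star_def, Complex.conj_ofReal, smul_eq_mul]
  rw [Complex.re_ofReal_mul, Complex.re_ofReal_mul]
  ring

theorem normSqOf_pos (hH : H.PosDef) {v : Fin r → ℂ} (hv : v ≠ 0) : 0 < normSqOf H v :=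
  (Complex.lt_def.1 (hH.dotProduct_mulVec_pos hv)).1

theorem sphereProj_smul (H : Matrix (Fin r) (Fin r) ℂ) {a : ℝ} (ha : 0 < a) (v : Fin r → ℂ) :
    sphereProj H (a • v) = sphereProj H v := by
  rw [sphereProj, sphereProj, normSqOf_smul, Real.sqrt_mul (sq_nonneg a), Real.sqrt_sq ha.le,
    smul_smul]
  congr 1
  rw [mul_inv, mul_comm, ← mul_assoc, mul_inv_cancel₀ ha.ne', one_mul]

theorem normSqOf_sphereProj (h : ∀ v, v ≠ 0 → 0 < normSqOf H v) {v : Fin r → ℂ} (hv : v ≠ 0) :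
    normSqOf H (sphereProj H v) = 1 := by
  rw [sphereProj, normSqOf_smul, inv_pow, Real.sq_sqrt (h v hv).le, inv_mul_cancel₀ (h v hv).ne']

theorem sphereProj_ne_zero (h : ∀ v, v ≠ 0 → 0 < normSqOf H v) {v : Fin r → ℂ} (hv : v ≠ 0) :
    sphereProj H v ≠ 0 :=
  smul_ne_zero (inv_ne_zero (Real.sqrt_pos.2 (h v hv)).ne') hv

/-- The pointed unit ball of `H`. -/
def pointedBall (H : Matrix (Fin r) (Fin r) ℂ) : Set (Fin r → ℂ) := {v | v ≠ 0 ∧ normSqOf H v ≤ 1}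

theorem measurableSet_pointedBall (H : Matrix (Fin r) (Fin r) ℂ) :
    MeasurableSet (pointedBall H) :=
  (measurableSet_singleton _).compl.inter
    (measurableSet_le (continuous_normSqOf H).measurable measurable_const)

theorem sphereMeasure_eq (H : Matrix (Fin r) (Fin r) ℂ) :
    sphereMeasure H = ((volume (pointedBall H))⁻¹ •
      (volume.restrict (pointedBall H)).map (sphereProj H)) := by
  rw [sphereMeasure, ProbabilityTheory.cond, Measure.map_smul]
  rfl

theorem normSqOf_changeFrame (A H : Matrix (Fin r) (Fin r) ℂ) (v : Fin r → ℂ) :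
    normSqOf (Aᴴ * H * A) v = normSqOf H (A *ᵥ v) := by
  rw [normSqOf, normSqOf, Matrix.star_mulVec, ← Matrix.dotProduct_mulVec, Matrix.mulVec_mulVec,
    Matrix.mulVec_mulVec, Matrix.mul_assoc]

/-- The map v ↦ Av sends the pointed ball of A*HA onto that of H and commutes with the radial
projections. It multiplies Lebesgue measure by a constant, which the normalization cancels. -/
theorem map_sphereMeasure {A : Matrix (Fin r) (Fin r) ℂ} (hA : IsUnit A.det)
    (H : Matrix (Fin r) (Fin r) ℂ) :
    (sphereMeasure (Aᴴ * H * A)).map (fun v => A *ᵥ v) = sphereMeasure H := by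
  set f : (Fin r → ℂ) →ₗ[ℝ] (Fin r → ℂ) := (Matrix.mulVecLin A).restrictScalars ℝ with hf
  have hfm : Measurable fun v : Fin r → ℂ => A *ᵥ v := by
    have : Continuous fun v : Fin r → ℂ => A *ᵥ v := continuous_const.matrix_mulVec continuous_id
    exact this.measurable
  have hdet : LinearMap.det f ≠ 0 := by
    have hinj : Function.Injective f := by
      intro x y hxy
      exact Matrix.mulVec_injective_of_isUnit ((Matrix.isUnit_iff_isUnit_det _).2 hA) hxy
    have hb := LinearEquiv.ofInjectiveEndo f hinj
    have : f = (LinearEquiv.ofInjectiveEndo f hinj : (Fin r → ℂ) →ₗ[ℝ] (Fin r → ℂ)) := by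
      ext1; rfl
    rw [this]
    exact (LinearEquiv.isUnit_det' _).ne_zero
  have hmap := Measure.map_linearMap_addHaar_eq_smul_addHaar
    (volume : Measure (Fin r → ℂ)) hdet
  set k : ENNReal := ENNReal.ofReal |(LinearMap.det f)⁻¹| with hk
  have hk0 : k ≠ 0 := by
    rw [hk]; simpa using hdet
  have hkt : k ≠ ⊤ := ENNReal.ofReal_ne_top
  have hball : pointedBall (Aᴴ * H * A) = f ⁻¹' pointedBall H := by
    ext v
    have h0 : v ≠ 0 ↔ A *ᵥ v ≠ 0 := by
      refine ⟨fun h => mulVec_ne_zero hA h, fun h h0 => h (by rw [h0, Matrix.mulVec_zero])⟩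
    simp only [pointedBall, Set.mem_ofPred_eq, Set.mem_preimage, normSqOf_changeFrame, h0]
    rfl
  have hfm' : Measurable f := hfm
  have hvol : volume (pointedBall (Aᴴ * H * A)) = k * volume (pointedBall H) := by
    rw [hball, ← Measure.map_apply hfm' (measurableSet_pointedBall H), hmap]; rfl
  have hproj : (fun v => A *ᵥ v) ∘ sphereProj (Aᴴ * H * A) = sphereProj H ∘ f := by
    funext v
    simp only [Function.comp, sphereProj, normSqOf_changeFrame, Matrix.mulVec_smul]
    rfl
  rw [sphereMeasure_eq, sphereMeasure_eq, Measure.map_smul,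
    Measure.map_map hfm (measurable_sphereProj _), hproj,
    ← Measure.map_map (measurable_sphereProj H) hfm', hball,
    ← Measure.restrict_map hfm' (measurableSet_pointedBall H), ← hball, hmap,
    Measure.restrict_smul, Measure.map_smul, smul_smul, hvol]
  congr 1
  rw [ENNReal.mul_inv (Or.inl hk0) (Or.inl hkt), mul_comm k⁻¹, mul_assoc,
    ENNReal.inv_mul_cancel hk0 hkt, mul_one]

theorem integral_sphereMeasure_changeFrame {A : Matrix (Fin r) (Fin r) ℂ} (hA : IsUnit A.det)
    (H : Matrix (Fin r) (Fin r) ℂ) {f : (Fin r → ℂ) → ℝ} (hf : Measurable f) :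
    ∫ v, f (A *ᵥ v) ∂sphereMeasure (Aᴴ * H * A) = ∫ v, f v ∂sphereMeasure H := by
  have hfm : Measurable fun v : Fin r → ℂ => A *ᵥ v := by
    have : Continuous fun v : Fin r → ℂ => A *ᵥ v := continuous_const.matrix_mulVec continuous_id
    exact this.measurable
  rw [← map_sphereMeasure hA H, integral_map hfm.aemeasurable hf.aestronglyMeasurable]

/-- The density of the sphere measure of `H` on the standard sphere, up to a constant. -/
def sphereDensity (H : Matrix (Fin r) (Fin r) ℂ) (u : Fin r → ℂ) : ℝ := ((normSqOf H u) ^ r)⁻¹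

theorem finrank_real_pi_complex (r : ℕ) : Module.finrank ℝ (Fin r → ℂ) = 2 * r := by
  rw [Module.finrank_pi_fintype]
  simp [mul_comm]

theorem volumeIoiPow_apply_Iic (n : ℕ) (x : Set.Ioi (0 : ℝ)) :
    Measure.volumeIoiPow n (Set.Iic x) = ENNReal.ofReal (x.1 ^ (n + 1) / (n + 1)) := by
  rw [← Measure.volumeIoiPow_apply_Iio]
  have h0 : Measure.volumeIoiPow n {x} = 0 := by
    refine MeasureTheory.withDensity_absolutelyContinuous _ _ ?_
    rw [Measure.comap_apply _ Subtype.val_injective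
      (fun s hs => measurableSet_Ioi.subtype_image hs) _ (measurableSet_singleton _)]
    simp
  rw [← Set.Iio_union_right]
  exact le_antisymm ((measure_union_le _ _).trans (by rw [h0, add_zero]))
    (measure_mono Set.subset_union_left)

/-- These are polar coordinates with respect to the ambient norm of `Fin r → ℂ`. The ray through u
leaves the ball of H at radius ρ = |u|_H⁻¹, and the integral of x^(2r-1) up to ρ is ρ^(2r)/(2r).
Only positivity of `normSqOf` is assumed, because nearby matrices need not be hermitian when one
differentiates in H. -/
theorem volume_pointedBall_inter (hr : 1 ≤ r) (h : ∀ v, v ≠ 0 → 0 < normSqOf H v)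
    {s : Set (Fin r → ℂ)} (hs : MeasurableSet s) :
    volume (pointedBall H ∩ sphereProj H ⁻¹' s)
      = ∫⁻ u : Metric.sphere (0 : Fin r → ℂ) 1 in {u | sphereProj H u ∈ s},
        ENNReal.ofReal (sphereDensity H u / (2 * r)) ∂(volume : Measure (Fin r → ℂ)).toSphere := by
  have hne : ∀ u : Metric.sphere (0 : Fin r → ℂ) 1, (u : Fin r → ℂ) ≠ 0 := fun u =>
    ne_zero_of_mem_unit_sphere u
  set T : Set (Fin r → ℂ) := pointedBall H ∩ sphereProj H ⁻¹' s with hT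
  have hTm : MeasurableSet T := (measurableSet_pointedBall H).inter (measurable_sphereProj H hs)
  have hT0 : T ⊆ {0}ᶜ := fun v hv => hv.1.1
  have hmp := (volume : Measure (Fin r → ℂ)).measurePreserving_homeomorphUnitSphereProd
  set Q : Set (Metric.sphere (0 : Fin r → ℂ) 1 × Set.Ioi (0 : ℝ)) :=
    {q | sphereProj H q.1 ∈ s ∧ (q.2 : ℝ) ≤ (Real.sqrt (normSqOf H q.1))⁻¹} with hQ
  have hQm : MeasurableSet Q := by
    have h1 : Measurable fun q : Metric.sphere (0 : Fin r → ℂ) 1 × Set.Ioi (0 : ℝ) =>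
        sphereProj H q.1 :=
      (measurable_sphereProj H).comp (measurable_subtype_coe.comp measurable_fst)
    have h2 : Measurable fun q : Metric.sphere (0 : Fin r → ℂ) 1 × Set.Ioi (0 : ℝ) =>
        (Real.sqrt (normSqOf H q.1))⁻¹ :=
      (((continuous_normSqOf H).measurable.comp
        (measurable_subtype_coe.comp measurable_fst)).sqrt).inv
    exact (h1 hs).inter (measurableSet_le (measurable_subtype_coe.comp measurable_snd) h2)
  have hpre : (homeomorphUnitSphereProd (Fin r → ℂ)) ⁻¹' Q = Subtype.val ⁻¹' T := by
    ext v
    have hv : (v : Fin r → ℂ) ≠ 0 := v.2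
    obtain ⟨u, ρ, hρ, huv⟩ : ∃ u : Metric.sphere (0 : Fin r → ℂ) 1, ∃ ρ : Set.Ioi (0 : ℝ),
        homeomorphUnitSphereProd (Fin r → ℂ) v = (u, ρ) ∧ (v : Fin r → ℂ) = (ρ : ℝ) • (u : Fin r → ℂ) := by
      -- The polar decomposition writes v as its norm times a point of the fixed unit sphere.
      refine ⟨(homeomorphUnitSphereProd _ v).1, (homeomorphUnitSphereProd _ v).2, rfl, ?_⟩
      rw [homeomorphUnitSphereProd_apply_fst_coe, homeomorphUnitSphereProd_apply_snd_coe, smul_smul,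
        mul_inv_cancel₀ (norm_ne_zero_iff.2 hv), one_smul]
    have hρ0 : (0 : ℝ) < ρ := ρ.2
    have hu0 := h u (hne u)
    rw [Set.mem_preimage, hρ, Set.mem_preimage, huv]
    simp only [hQ, hT, Set.mem_ofPred_eq, Set.mem_inter_iff, Set.mem_preimage, pointedBall,
      sphereProj_smul H hρ0, normSqOf_smul]
    have h1 : ((ρ : ℝ) ≤ (Real.sqrt (normSqOf H u))⁻¹) ↔ (ρ : ℝ) ^ 2 * normSqOf H u ≤ 1 := by
      rw [← one_div, le_div_iff₀ (Real.sqrt_pos.2 hu0)]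
      have h2 : (ρ : ℝ) ^ 2 * normSqOf H u = (ρ * Real.sqrt (normSqOf H u)) ^ 2 := by
        rw [mul_pow, Real.sq_sqrt hu0.le]
      rw [h2, sq_le_one_iff₀ (by positivity)]
    rw [h1, ← huv]
    exact ⟨fun h => ⟨⟨hv, h.2⟩, h.1⟩, fun h => ⟨h.2, h.1.2⟩⟩
  have h1 : volume T = ((volume : Measure (Fin r → ℂ)).comap ((↑) : ({0}ᶜ : Set (Fin r → ℂ)) → _))
      (Subtype.val ⁻¹' T) := by
    rw [Measure.comap_apply _ Subtype.val_injective
      (fun s hs => (measurableSet_singleton _).compl.subtype_image hs) _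
      (measurable_subtype_coe hTm), Subtype.image_preimage_coe, Set.inter_eq_right.2 hT0]
  rw [h1, ← hpre, hmp.measure_preimage hQm.nullMeasurableSet, Measure.prod_apply hQm]
  have hSm : MeasurableSet {u : Metric.sphere (0 : Fin r → ℂ) 1 | sphereProj H u ∈ s} :=
    measurable_subtype_coe (measurable_sphereProj H hs)
  rw [← lintegral_indicator hSm]
  refine lintegral_congr fun u => ?_
  have hu0 := h u (hne u)
  by_cases hu : sphereProj H u ∈ s
  · rw [Set.indicator_of_mem (by exact hu)]
    have h2 : Prod.mk u ⁻¹' Q = Set.Iic ⟨(Real.sqrt (normSqOf H u))⁻¹,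
        inv_pos.2 (Real.sqrt_pos.2 hu0)⟩ := by
      ext ρ
      simp only [hQ, Set.mem_preimage, Set.mem_ofPred_eq, hu, true_and, Set.mem_Iic]
      rfl
    rw [h2, volumeIoiPow_apply_Iic, finrank_real_pi_complex]
    congr 1
    -- The natural subtraction 2r - 1, the exponent of the radial measure, is genuine since r ≥ 1.
    have h3 : 2 * r - 1 + 1 = 2 * r := by omega
    have h4 : ((2 * r - 1 : ℕ) : ℝ) + 1 = 2 * r := by exact_mod_cast h3
    rw [h3, h4, sphereDensity, inv_pow, pow_mul, Real.sq_sqrt hu0.le]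
  · rw [Set.indicator_of_notMem (by exact hu)]
    have h2 : Prod.mk u ⁻¹' Q = ∅ := by
      ext ρ
      simp only [hQ, Set.mem_preimage, Set.mem_ofPred_eq, hu, false_and, Set.mem_empty_iff_false]
    rw [h2, measure_empty]

theorem continuous_sphereDensity (h : ∀ v, v ≠ 0 → 0 < normSqOf H v) :
    Continuous fun u : Metric.sphere (0 : Fin r → ℂ) 1 => sphereDensity H u := by
  refine Continuous.inv₀ (((continuous_normSqOf H).comp continuous_subtype_val).pow r) fun u => ?_
  exact (pow_pos (h u (ne_zero_of_mem_unit_sphere u)) r).ne'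

theorem sphereDensity_pos (h : ∀ v, v ≠ 0 → 0 < normSqOf H v)
    (u : Metric.sphere (0 : Fin r → ℂ) 1) : 0 < sphereDensity H u :=
  inv_pos.2 (pow_pos (h u (ne_zero_of_mem_unit_sphere u)) r)

/-- The total mass of the density. -/
def sphereMass (H : Matrix (Fin r) (Fin r) ℂ) : ℝ :=
  ∫ u : Metric.sphere (0 : Fin r → ℂ) 1, sphereDensity H u ∂(volume : Measure (Fin r → ℂ)).toSphere

theorem integrable_of_continuous_sphere {f : Metric.sphere (0 : Fin r → ℂ) 1 → ℝ}
    (hf : Continuous f) : Integrable f (volume : Measure (Fin r → ℂ)).toSphere := by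
  obtain ⟨C, hC⟩ := (isCompact_range hf).isBounded.exists_norm_le
  exact Integrable.of_bound hf.aestronglyMeasurable C
    (Filter.Eventually.of_forall fun u => hC _ ⟨u, rfl⟩)

theorem sphereMass_pos (hr : 1 ≤ r) (h : ∀ v, v ≠ 0 → 0 < normSqOf H v) : 0 < sphereMass H := by
  have : Nonempty (Fin r) := ⟨⟨0, hr⟩⟩
  rw [sphereMass, integral_pos_iff_support_of_nonneg (fun u => (sphereDensity_pos h u).le)
    (integrable_of_continuous_sphere (continuous_sphereDensity h))]
  have : Function.support (fun u : Metric.sphere (0 : Fin r → ℂ) 1 => sphereDensity H u)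
      = Set.univ := Set.eq_univ_of_forall fun u => (sphereDensity_pos h u).ne'
  rw [this]
  exact (Measure.measure_univ_pos).2 (Measure.toSphere_ne_zero _)

/-- The integral for the sphere measure of `H` as an integral over a fixed sphere. -/
theorem integral_sphereMeasure (hr : 1 ≤ r) (h : ∀ v, v ≠ 0 → 0 < normSqOf H v)
    {f : (Fin r → ℂ) → ℝ} (hf : Measurable f) :
    ∫ v, f v ∂sphereMeasure H = (sphereMass H)⁻¹ *
      ∫ u : Metric.sphere (0 : Fin r → ℂ) 1, sphereDensity H u * f (sphereProj H u)
        ∂(volume : Measure (Fin r → ℂ)).toSphere := by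
  set μ := (volume : Measure (Fin r → ℂ)).toSphere with hμ
  have hrR : (0 : ℝ) < 2 * r := by
    have : (0 : ℝ) < r := by exact_mod_cast hr
    positivity
  set d : Metric.sphere (0 : Fin r → ℂ) 1 → NNReal :=
    fun u => Real.toNNReal (sphereDensity H u / (2 * r)) with hd
  have hdm : Measurable d := by
    have := (continuous_sphereDensity h).div_const (2 * (r : ℝ))
    exact this.measurable.real_toNNReal
  have hpm : Measurable fun u : Metric.sphere (0 : Fin r → ℂ) 1 => sphereProj H u :=
    (measurable_sphereProj H).comp measurable_subtype_coe
  have hmeas : (volume.restrict (pointedBall H)).map (sphereProj H)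
      = (μ.withDensity fun u => (d u : ENNReal)).map
        (fun u : Metric.sphere (0 : Fin r → ℂ) 1 => sphereProj H u) := by
    ext s hs
    rw [Measure.map_apply (measurable_sphereProj H) hs, Measure.map_apply hpm hs,
      Measure.restrict_apply (measurable_sphereProj H hs), Set.inter_comm,
      volume_pointedBall_inter hr h hs, withDensity_apply _ (hpm hs)]
    rfl
  -- The same formula for the whole space gives the normalizing volume, and the common factor 1/(2r)
  -- disappears from the quotient.
  have hvol : volume (pointedBall H) = ENNReal.ofReal (sphereMass H / (2 * r)) := by
    have h1 := volume_pointedBall_inter hr h (s := Set.univ) MeasurableSet.univ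
    simp only [Set.preimage_univ, Set.inter_univ, Set.mem_univ, Set.ofPred_true,
      Measure.restrict_univ] at h1
    rw [h1, ← ofReal_integral_eq_lintegral_ofReal, integral_div]
    · rfl
    · exact (integrable_of_continuous_sphere (continuous_sphereDensity h)).div_const _
    · exact Filter.Eventually.of_forall fun u => div_nonneg (sphereDensity_pos h u).le hrR.le
  rw [sphereMeasure_eq, integral_smul_measure, hmeas,
    integral_map hpm.aemeasurable hf.aestronglyMeasurable,
    integral_withDensity_eq_integral_smul hdm, hvol, ENNReal.toReal_inv,
    ENNReal.toReal_ofReal (div_nonneg (sphereMass_pos hr h).le hrR.le)]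
  have h2 : ∀ u : Metric.sphere (0 : Fin r → ℂ) 1, d u • f (sphereProj H u)
      = (2 * r : ℝ)⁻¹ * (sphereDensity H u * f (sphereProj H u)) := by
    intro u
    rw [NNReal.smul_def, hd, Real.coe_toNNReal _ (div_nonneg (sphereDensity_pos h u).le hrR.le),
      smul_eq_mul]
    ring
  simp only [h2]
  rw [integral_const_mul, smul_eq_mul, ← mul_assoc]
  congr 1
  have := (sphereMass_pos hr h).ne'
  field_simp

end SphereMeasure

/-! ### Integrability and positivity of integrals over the unit sphere -/

section SphereIntegrals

variable {r : ℕ} {H : Matrix (Fin r) (Fin r) ℂ}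

theorem isProbabilityMeasure_sphereMeasure (hr : 1 ≤ r) (h : ∀ v, v ≠ 0 → 0 < normSqOf H v) :
    IsProbabilityMeasure (sphereMeasure H) := by
  have h1 := integral_sphereMeasure hr h (f := fun _ => (1 : ℝ)) measurable_const
  simp only [mul_one] at h1
  change _ = (sphereMass H)⁻¹ * sphereMass H at h1
  rw [inv_mul_cancel₀ (sphereMass_pos hr h).ne', integral_const, smul_eq_mul, mul_one,
    measureReal_def] at h1
  exact ⟨(ENNReal.toReal_eq_one_iff _).1 h1⟩

theorem ae_sphereMeasure (h : ∀ v, v ≠ 0 → 0 < normSqOf H v) :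
    ∀ᵐ v ∂sphereMeasure H, normSqOf H v = 1 := by
  have hm : MeasurableSet {v | normSqOf H v = 1} :=
    (continuous_normSqOf H).measurable (measurableSet_singleton 1)
  rw [sphereMeasure_eq]
  refine Measure.ae_smul_measure ?_ _
  rw [ae_map_iff (measurable_sphereProj H).aemeasurable hm]
  filter_upwards [ae_restrict_mem (measurableSet_pointedBall H)] with v hv
  exact normSqOf_sphereProj h hv.1

theorem ne_zero_of_normSqOf_eq_one {v : Fin r → ℂ} (hv : normSqOf H v = 1) : v ≠ 0 := by
  rintro rfl
  simp [normSqOf] at hv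

theorem integrable_sphereMeasure (hr : 1 ≤ r) (h : ∀ v, v ≠ 0 → 0 < normSqOf H v)
    {f : (Fin r → ℂ) → ℝ} (hf : Measurable f) (hc : ContinuousOn f {0}ᶜ) :
    Integrable f (sphereMeasure H) := by
  have := isProbabilityMeasure_sphereMeasure hr h
  have hcont : Continuous fun u : Metric.sphere (0 : Fin r → ℂ) 1 => f (sphereProj H u) := by
    have hproj : Continuous fun u : Metric.sphere (0 : Fin r → ℂ) 1 => sphereProj H u := by
      have h0 : Continuous fun u : Metric.sphere (0 : Fin r → ℂ) 1 =>
          (Real.sqrt (normSqOf H u))⁻¹ :=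
        ((continuous_normSqOf H).comp continuous_subtype_val).sqrt.inv₀ fun u =>
          (Real.sqrt_pos.2 (h u (ne_zero_of_mem_unit_sphere u))).ne'
      exact h0.smul continuous_subtype_val
    exact hc.comp_continuous hproj fun u => sphereProj_ne_zero h (ne_zero_of_mem_unit_sphere u)
  obtain ⟨C, hC⟩ := (isCompact_range hcont).isBounded.exists_norm_le
  refine Integrable.of_bound hf.aestronglyMeasurable C ?_
  filter_upwards [ae_sphereMeasure h] with v hv
  have hv0 := ne_zero_of_normSqOf_eq_one hv
  -- A vector of the H-sphere is the radial projection of v/‖v‖, so the bound found on the fixed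
  -- compact sphere applies to it.
  have hn : 0 < ‖v‖⁻¹ := inv_pos.2 (norm_pos_iff.2 hv0)
  refine hC _ ⟨⟨‖v‖⁻¹ • v, ?_⟩, ?_⟩
  · rw [mem_sphere_zero_iff_norm, norm_smul, norm_inv, norm_norm,
      inv_mul_cancel₀ (norm_ne_zero_iff.2 hv0)]
  · show f (sphereProj H (‖v‖⁻¹ • v)) = f v
    rw [sphereProj_smul H hn, sphereProj, hv, Real.sqrt_one, inv_one, one_smul]

theorem integral_sphereMeasure_pos (hr : 1 ≤ r) (h : ∀ v, v ≠ 0 → 0 < normSqOf H v)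
    {f : (Fin r → ℂ) → ℝ} (hf : Measurable f) (hc : ContinuousOn f {0}ᶜ)
    (hpos : ∀ v, v ≠ 0 → 0 < f v) : 0 < ∫ v, f v ∂sphereMeasure H := by
  have hprob := isProbabilityMeasure_sphereMeasure hr h
  have hae : ∀ᵐ v ∂sphereMeasure H, 0 < f v := by
    filter_upwards [ae_sphereMeasure h] with v hv
    exact hpos v (ne_zero_of_normSqOf_eq_one hv)
  rw [integral_pos_iff_support_of_nonneg_ae (hae.mono fun v hv => hv.le)
    (integrable_sphereMeasure hr h hf hc)]
  have : sphereMeasure H (Function.support f) = sphereMeasure H Set.univ := by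
    refine measure_congr ?_
    filter_upwards [hae] with v hv
    exact propext ⟨fun _ => trivial, fun _ => hv.ne'⟩
  rw [this, measure_univ]
  exact one_pos

end SphereIntegrals

/-! ### Top powers and mixed powers of (1,1)-forms -/

section FormCalculus

variable {n r : ℕ} {V : Type*} [NormedAddCommGroup V] [NormedSpace ℝ V] {k : WithTop ℕ∞}

theorem contDiffAt_vectorForm {f : V → Matrix (Fin r) (Fin r) ℂ}
    {c : V → Fin n → Fin n → Matrix (Fin r) (Fin r) ℂ} {v : V → Fin r → ℂ} {x : V}
    (hf : ContDiffAt ℝ k f x) (hc : ContDiffAt ℝ k c x) (hv : ContDiffAt ℝ k v x) :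
    ContDiffAt ℝ k (fun y => vectorForm (f y) (c y) (v y)) x := by
  rw [contDiffAt_matrix_iff]
  intro j l
  have hc' : ContDiffAt ℝ k (fun y => c y j l) x := (contDiffAt_pi.1 ((contDiffAt_pi.1 hc) j)) l
  have hm := contDiffAt_matrix_iff.1 (contDiffAt_matrix_mul hf hc')
  have hv' := contDiffAt_pi.1 hv
  simp only [vectorForm, Matrix.of_apply, dotProduct, Matrix.mulVec, Pi.star_apply]
  exact ContDiffAt.sum fun a _ => (contDiffAt_star (hv' a)).mul
    (ContDiffAt.sum fun b _ => (hm a b).mul (hv' b))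

theorem contDiffAt_normSqOf {f : V → Matrix (Fin r) (Fin r) ℂ} {v : V → Fin r → ℂ} {x : V}
    (hf : ContDiffAt ℝ k f x) (hv : ContDiffAt ℝ k v x) :
    ContDiffAt ℝ k (fun y => normSqOf (f y) (v y)) x := by
  have hm := contDiffAt_matrix_iff.1 hf
  have hv' := contDiffAt_pi.1 hv
  simp only [normSqOf, dotProduct, Matrix.mulVec, Pi.star_apply]
  exact contDiffAt_re (ContDiffAt.sum fun a _ => (contDiffAt_star (hv' a)).mul
    (ContDiffAt.sum fun b _ => (hm a b).mul (hv' b)))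

theorem contDiffAt_topPower {α : V → Matrix (Fin n) (Fin n) ℂ} {x : V}
    (hα : ContDiffAt ℝ k α x) : ContDiffAt ℝ k (fun y => topPower (α y)) x :=
  contDiffAt_const.mul (contDiffAt_re (contDiffAt_matrix_det hα))

theorem contDiffAt_mixedPower {α η : V → Matrix (Fin n) (Fin n) ℂ} {x : V}
    (hα : ContDiffAt ℝ k α x) (hη : ContDiffAt ℝ k η x) :
    ContDiffAt ℝ k (fun y => mixedPower (α y) (η y)) x :=
  contDiffAt_const.mul (contDiffAt_re (contDiffAt_matrix_trace
    (contDiffAt_matrix_mul (contDiffAt_matrix_adjugate hα) hη)))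

theorem topPower_pos {α : Matrix (Fin n) (Fin n) ℂ} (hα : α.PosDef) : 0 < topPower α :=
  mul_pos (by exact_mod_cast n.factorial_pos) (Complex.lt_def.1 hα.det_pos).1

theorem mixedPower_nonneg {α η : Matrix (Fin n) (Fin n) ℂ} (hα : α.PosDef) (hη : η.PosSemidef) :
    0 ≤ mixedPower α η :=
  mul_nonneg (Nat.cast_nonneg _) (trace_mul_nonneg (adjugate_posDef hα) hη)

/-- This is Jacobi's formula. Factoring out α leaves det(1 + εM) = 1 + ε tr M + O(ε²) with M = α⁻¹η.
-/
theorem hasDerivAt_det_add_smul {ι : Type*} [Fintype ι] [DecidableEq ι] {α : Matrix ι ι ℂ}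
    (hα : IsUnit α.det) (η : Matrix ι ι ℂ) :
    HasDerivAt (fun ε : ℝ => (α + (ε : ℂ) • η).det) (α.adjugate * η).trace 0 := by
  have h1 : ∀ ε : ℂ, (α + ε • η).det = α.det * (1 + ε • (α⁻¹ * η)).det := by
    intro ε
    rw [← Matrix.det_mul, Matrix.mul_add, Matrix.mul_one, Matrix.mul_smul, ← Matrix.mul_assoc,
      Matrix.mul_nonsing_inv _ hα, Matrix.one_mul]
  have hadj : α.adjugate = α.det • α⁻¹ := by
    rw [Matrix.inv_def, smul_smul, Ring.mul_inverse_cancel _ hα, one_smul]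
  -- The polynomial q is the quotient by ε² of the terms of degree at least two in det(1 + εM).
  set q := (1 + (Polynomial.X : Polynomial ℂ) • (α⁻¹ * η).map Polynomial.C).det.divX.divX with hq
  have h2 : HasDerivAt (fun ε : ℂ => α.det * (1 + (α⁻¹ * η).trace * ε + q.eval ε * ε ^ 2))
      (α.det * (α⁻¹ * η).trace) 0 := by
    have h3 := (((hasDerivAt_id (0 : ℂ)).const_mul (α⁻¹ * η).trace).const_add 1).add
      ((q.hasDerivAt 0).mul (hasDerivAt_pow 2 (0 : ℂ)))
    refine (h3.const_mul α.det).congr_deriv ?_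
    simp
  have h4 : HasDerivAt (fun ε : ℂ => (α + ε • η).det) (α.adjugate * η).trace ((0 : ℝ) : ℂ) := by
    rw [hadj, Matrix.smul_mul, Matrix.trace_smul, smul_eq_mul, Complex.ofReal_zero]
    refine h2.congr_of_eventuallyEq (Filter.Eventually.of_forall fun ε => ?_)
    show (α + ε • η).det = _
    rw [h1, Matrix.det_one_add_smul]
  exact h4.comp_ofReal

theorem hasDerivAt_topPower_add_smul {α : Matrix (Fin n) (Fin n) ℂ} (hα : IsUnit α.det)
    (η : Matrix (Fin n) (Fin n) ℂ) :
    HasDerivAt (fun ε : ℝ => topPower (α + (ε : ℂ) • η)) (mixedPower α η) 0 := by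
  have h := hasDerivAt_det_add_smul hα η
  exact (Complex.reCLM.hasFDerivAt.comp_hasDerivAt _ h).const_mul _

end FormCalculus

/-! ### The logarithmic derivative of the Griffiths functional -/

section GriffithsFunctional

variable {n r : ℕ} {H : Matrix (Fin r) (Fin r) ℂ} {c : Fin n → Fin n → Matrix (Fin r) (Fin r) ℂ}

theorem continuous_vectorForm (H : Matrix (Fin r) (Fin r) ℂ)
    (c : Fin n → Fin n → Matrix (Fin r) (Fin r) ℂ) : Continuous (vectorForm H c) :=
  continuous_iff_continuousAt.2 fun _ => (contDiffAt_vectorForm (k := 0) contDiffAt_const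
    contDiffAt_const contDiffAt_id).continuousAt

theorem continuous_topPower : Continuous (topPower (n := n)) :=
  continuous_iff_continuousAt.2 fun _ => (contDiffAt_topPower (k := 0) contDiffAt_id).continuousAt

theorem continuous_mixedPower {Y : Type*} [TopologicalSpace Y] {α η : Y → Matrix (Fin n) (Fin n) ℂ}
    (hα : Continuous α) (hη : Continuous η) : Continuous fun y => mixedPower (α y) (η y) := by
  have h : Continuous fun y => ((α y).adjugate * η y).trace :=
    (hα.matrix_adjugate.matrix_mul hη).matrix_trace
  exact continuous_const.mul (Complex.continuous_re.comp h)

theorem measurable_inv_topPower (s : ℝ) (H : Matrix (Fin r) (Fin r) ℂ)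
    (c : Fin n → Fin n → Matrix (Fin r) (Fin r) ℂ) :
    Measurable fun v => 1 / (topPower (vectorForm H c v)) ^ s :=
  measurable_const.div ((continuous_topPower.comp (continuous_vectorForm H c)).measurable.pow_const s)

theorem measurable_mixedPower_div (s : ℝ) (H : Matrix (Fin r) (Fin r) ℂ)
    (c : Fin n → Fin n → Matrix (Fin r) (Fin r) ℂ)
    {η : (Fin r → ℂ) → Matrix (Fin n) (Fin n) ℂ} (hη : Continuous η) :
    Measurable fun v => mixedPower (vectorForm H c v) (η v) / (topPower (vectorForm H c v)) ^ s :=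
  (continuous_mixedPower (continuous_vectorForm H c) hη).measurable.div
    ((continuous_topPower.comp (continuous_vectorForm H c)).measurable.pow_const s)

theorem continuousOn_rpow_topPower (hc : IsHermitianTensor H c) (h : IsPositive H c .griffiths)
    (s : ℝ) : ContinuousOn (fun v => (topPower (vectorForm H c v)) ^ s) {0}ᶜ :=
  ((continuous_topPower.comp (continuous_vectorForm H c)).continuousOn).rpow_const
    fun _ hv => Or.inl (topPower_pos (vectorForm_posDef hc h hv)).ne'

theorem integrable_mixedPower_div (hr : 1 ≤ r) (hH : H.PosDef) (hc : IsHermitianTensor H c)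
    (h : IsPositive H c .griffiths) (s : ℝ)
    {η : (Fin r → ℂ) → Matrix (Fin n) (Fin n) ℂ} (hη : Continuous η) :
    Integrable (fun v => mixedPower (vectorForm H c v) (η v) / (topPower (vectorForm H c v)) ^ s)
      (sphereMeasure H) := by
  refine integrable_sphereMeasure hr (fun v hv => normSqOf_pos hH hv)
    (measurable_mixedPower_div s H c hη) ?_
  refine (continuous_mixedPower (continuous_vectorForm H c) hη).continuousOn.div
    (continuousOn_rpow_topPower hc h s) fun v hv => ?_
  exact (Real.rpow_pos_of_pos (topPower_pos (vectorForm_posDef hc h hv)) s).ne'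

theorem integral_inv_topPower_pos (hr : 1 ≤ r) (hH : H.PosDef) (hc : IsHermitianTensor H c)
    (h : IsPositive H c .griffiths) (s : ℝ) :
    0 < ∫ v, 1 / (topPower (vectorForm H c v)) ^ s ∂sphereMeasure H := by
  have hpos : ∀ v, v ≠ 0 → 0 < (topPower (vectorForm H c v)) ^ s := fun v hv =>
    Real.rpow_pos_of_pos (topPower_pos (vectorForm_posDef hc h hv)) s
  refine integral_sphereMeasure_pos hr (fun v hv => normSqOf_pos hH hv)
    (measurable_inv_topPower s H c) ?_ fun v hv => div_pos one_pos (hpos v hv)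
  exact continuousOn_const.div (continuousOn_rpow_topPower hc h s) fun v hv => (hpos v hv).ne'

/-- The derivative of `log Φ_{G,s}` in the direction `p ⊗ p̄ ⊗ S`. -/
def griffithsFunctional (s : ℝ) (H : Matrix (Fin r) (Fin r) ℂ)
    (θ : Fin n → Fin n → Matrix (Fin r) (Fin r) ℂ) (p : Fin n → ℂ)
    (S : Matrix (Fin r) (Fin r) ℂ) : ℝ :=
  (∫ v, 1 / (topPower (vectorForm H θ v)) ^ s ∂sphereMeasure H)⁻¹ *
    ∫ v, mixedPower (vectorForm H θ v) (vectorForm H (rankOneTensor p S) v) /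
      (topPower (vectorForm H θ v)) ^ (s + 1) ∂sphereMeasure H

theorem vectorForm_rankOneTensor (p : Fin n → ℂ) (S : Matrix (Fin r) (Fin r) ℂ) (v : Fin r → ℂ) :
    vectorForm H (rankOneTensor p S) v
      = (star v ⬝ᵥ (H * S) *ᵥ v) • Matrix.vecMulVec p (star p) := by
  ext j k
  simp only [vectorForm, rankOneTensor, Matrix.of_apply, Matrix.mul_smul, Matrix.smul_mulVec,
    dotProduct_smul, Matrix.smul_apply, Matrix.vecMulVec_apply, smul_eq_mul, Pi.star_apply]
  ring

theorem mixedPower_smul (α η : Matrix (Fin n) (Fin n) ℂ) (a : ℝ) :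
    mixedPower α ((a : ℂ) • η) = a * mixedPower α η := by
  rw [mixedPower, mixedPower, Matrix.mul_smul, Matrix.trace_smul, smul_eq_mul,
    Complex.re_ofReal_mul]
  ring

theorem mixedPower_sub (α η ζ : Matrix (Fin n) (Fin n) ℂ) :
    mixedPower α (η - ζ) = mixedPower α η - mixedPower α ζ := by
  simp only [mixedPower, Matrix.mul_sub, Matrix.trace_sub, Complex.sub_re]
  ring

theorem griffithsFunctional_one_nonneg (hr : 1 ≤ r) (hH : H.PosDef)
    {θ : Fin n → Fin n → Matrix (Fin r) (Fin r) ℂ} (hθ : IsHermitianTensor H θ)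
    (hpos : IsPositive H θ .griffiths) (s : ℝ) (p : Fin n → ℂ) :
    0 ≤ griffithsFunctional s H θ p 1 := by
  refine mul_nonneg (inv_nonneg.2 (integral_inv_topPower_pos hr hH hθ hpos s).le)
    (integral_nonneg_of_ae ?_)
  filter_upwards [ae_sphereMeasure fun v hv => normSqOf_pos hH hv] with v hv
  have hv0 := ne_zero_of_normSqOf_eq_one hv
  have hα := vectorForm_posDef hθ hpos hv0
  refine div_nonneg (mixedPower_nonneg hα ?_) (Real.rpow_pos_of_pos (topPower_pos hα) _).le
  rw [vectorForm_rankOneTensor, Matrix.mul_one]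
  exact (Matrix.posSemidef_vecMulVec_self_star p).smul (hH.posSemidef.dotProduct_mulVec_nonneg v)

/-- On the unit sphere the hermitian form of `S` is bounded by the norm of `S`. -/
theorem abs_re_form_le (hH : H.PosDef) {S : Matrix (Fin r) (Fin r) ℂ} (hS : (H * S).IsHermitian)
    {v : Fin r → ℂ} (hv : normSqOf H v = 1) :
    |(star v ⬝ᵥ (H * S) *ᵥ v).re| ≤ selfAdjointNorm S := by
  -- Y is the H-orthogonal projector on the line of v. It has norm 1, and ⟨Sv, v⟩ = tr(SY), so
  -- Cauchy-Schwarz applies.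
  set Y : Matrix (Fin r) (Fin r) ℂ := Matrix.vecMulVec v (star v) * H with hY
  have hv' : star v ⬝ᵥ H *ᵥ v = 1 :=
    Complex.ext hv (im_star_dotProduct_mulVec hH.1 v)
  have hYh : (H * Y).IsHermitian := by
    rw [Matrix.IsHermitian, hY, Matrix.conjTranspose_mul, Matrix.conjTranspose_mul,
      Matrix.conjTranspose_vecMulVec, star_star, hH.1.eq, Matrix.mul_assoc]
  have htr : ∀ M : Matrix (Fin r) (Fin r) ℂ, (M * Matrix.vecMulVec v (star v)).trace
      = star v ⬝ᵥ M *ᵥ v := by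
    intro M
    rw [Matrix.mul_vecMulVec, Matrix.trace_vecMulVec, dotProduct_comm]
  have h1 : (S * Y).trace = star v ⬝ᵥ (H * S) *ᵥ v := by
    rw [hY, ← Matrix.mul_assoc, Matrix.trace_mul_comm, ← Matrix.mul_assoc, htr]
  have h2 : (Y * Y).trace = 1 := by
    rw [hY, ← Matrix.mul_assoc, Matrix.mul_assoc (Matrix.vecMulVec v (star v)), Matrix.trace_mul_comm,
      ← Matrix.mul_assoc, ← Matrix.mul_assoc, htr, Matrix.mul_assoc, ← Matrix.mulVec_mulVec,
      ← Matrix.mulVec_mulVec, Matrix.vecMulVec_mulVec, hv']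
    simp [hv']
  have h3 := abs_trace_mul_le hH hS hYh
  rw [h1] at h3
  have h4 : selfAdjointNorm Y = 1 := by rw [selfAdjointNorm, h2]; simp
  rwa [h4, mul_one] at h3

/-- Two pointwise bounds are integrated over the sphere: |⟨Sv, v⟩| ≤ |S|, and p p* ≤ N W in the
order of hermitian forms. Since `mixedPower` is monotone in its second argument when the first is
positive, the second bound replaces p p* by N W. -/
theorem abs_griffithsFunctional_le (hr : 1 ≤ r) (hH : H.PosDef) {W : Matrix (Fin n) (Fin n) ℂ}
    (hW : W.PosDef) {θ : Fin n → Fin n → Matrix (Fin r) (Fin r) ℂ} (hθ : IsHermitianTensor H θ)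
    (hpos : IsPositive H θ .griffiths) (s : ℝ) (p : Fin n → ℂ) {S : Matrix (Fin r) (Fin r) ℂ}
    (hS : (H * S).IsHermitian) :
    |griffithsFunctional s H θ p S| ≤ (star p ⬝ᵥ W⁻¹ *ᵥ p).re * selfAdjointNorm S *
      ((∫ v, 1 / (topPower (vectorForm H θ v)) ^ s ∂sphereMeasure H)⁻¹ *
        ∫ v, mixedPower (vectorForm H θ v) W / (topPower (vectorForm H θ v)) ^ (s + 1)
          ∂sphereMeasure H) := by
  have hI := integral_inv_topPower_pos hr hH hθ hpos s
  rw [griffithsFunctional, abs_mul, abs_of_pos (inv_pos.2 hI), mul_left_comm]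
  refine mul_le_mul_of_nonneg_left ?_ (inv_pos.2 hI).le
  rw [← integral_const_mul]
  refine (abs_integral_le_integral_abs).trans (integral_mono_ae
    (integrable_mixedPower_div hr hH hθ hpos _ (continuous_vectorForm _ _)).abs
    ((integrable_mixedPower_div hr hH hθ hpos _ continuous_const).const_mul _) ?_)
  filter_upwards [ae_sphereMeasure fun v hv => normSqOf_pos hH hv] with v hv
  have hv0 := ne_zero_of_normSqOf_eq_one hv
  have hα := vectorForm_posDef hθ hpos hv0
  have htop : 0 < (topPower (vectorForm H θ v)) ^ (s + 1) :=
    Real.rpow_pos_of_pos (topPower_pos hα) _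
  have hre : star v ⬝ᵥ (H * S) *ᵥ v = (((star v ⬝ᵥ (H * S) *ᵥ v).re : ℝ) : ℂ) :=
    Complex.ext (by simp) (by simpa using im_star_dotProduct_mulVec hS v)
  have hp : 0 ≤ mixedPower (vectorForm H θ v) (Matrix.vecMulVec p (star p)) :=
    mixedPower_nonneg hα (Matrix.posSemidef_vecMulVec_self_star p)
  have hle : mixedPower (vectorForm H θ v) (Matrix.vecMulVec p (star p))
      ≤ (star p ⬝ᵥ W⁻¹ *ᵥ p).re * mixedPower (vectorForm H θ v) W := by
    have h1 := mixedPower_nonneg hα (posSemidef_smul_sub_vecMulVec hW p)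
    rw [mixedPower_sub, ← ofReal_re_dotProduct_inv hW, mixedPower_smul] at h1
    linarith
  rw [vectorForm_rankOneTensor, hre, mixedPower_smul, abs_div, abs_mul, abs_of_pos htop,
    abs_of_nonneg hp, ← mul_div_assoc]
  refine div_le_div_of_nonneg_right ?_ htop.le
  calc _ ≤ selfAdjointNorm S * ((star p ⬝ᵥ W⁻¹ *ᵥ p).re * mixedPower (vectorForm H θ v) W) :=
        mul_le_mul (abs_re_form_le hH hS hv) hle hp (selfAdjointNorm_nonneg S)
    _ = _ := by ring

theorem integral_inv_topPower_changeFrame {A : Matrix (Fin r) (Fin r) ℂ}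
    {J : Matrix (Fin n) (Fin n) ℂ} (hA : IsUnit A.det) (s : ℝ)
    (hc : IsHermitianTensor H c) (h : IsPositive H c .griffiths) (hH : H.PosDef) :
    ∫ v, 1 / (topPower (vectorForm (Aᴴ * H * A) (changeFrame A J c) v)) ^ s
        ∂sphereMeasure (Aᴴ * H * A)
      = ((Complex.normSq J.det) ^ s)⁻¹ *
        ∫ v, 1 / (topPower (vectorForm H c v)) ^ s ∂sphereMeasure H := by
  rw [← integral_sphereMeasure_changeFrame hA H (measurable_inv_topPower s H c),
    ← integral_const_mul]
  have hpos' : ∀ v, v ≠ 0 → 0 < normSqOf (Aᴴ * H * A) v := fun v hv => by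
    rw [normSqOf_changeFrame]; exact normSqOf_pos hH (mulVec_ne_zero hA hv)
  refine integral_congr_ae ?_
  filter_upwards [ae_sphereMeasure hpos'] with v hv
  have hv0 := mulVec_ne_zero hA (ne_zero_of_normSqOf_eq_one hv)
  rw [vectorForm_changeFrame hA, topPower_changeFrame, Real.mul_rpow (Complex.normSq_nonneg _)
    (topPower_pos (vectorForm_posDef hc h hv0)).le, one_div, one_div, mul_inv]

/-- The numerator contributes |det J|² and the denominator |det J|^(2(s+1)). What remains is the
factor of `integral_inv_topPower_changeFrame`, so the quotient of the two integrals is invariant. -/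
theorem integral_mixedPower_changeFrame {A : Matrix (Fin r) (Fin r) ℂ}
    {J : Matrix (Fin n) (Fin n) ℂ} (hA : IsUnit A.det) (hJ : IsUnit J.det) (s : ℝ)
    (hc : IsHermitianTensor H c) (h : IsPositive H c .griffiths) (hH : H.PosDef)
    (η : Matrix (Fin n) (Fin n) ℂ) :
    ∫ v, mixedPower (vectorForm (Aᴴ * H * A) (changeFrame A J c) v) (Jᵀ * η * J.map star) /
        (topPower (vectorForm (Aᴴ * H * A) (changeFrame A J c) v)) ^ (s + 1)
        ∂sphereMeasure (Aᴴ * H * A)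
      = ((Complex.normSq J.det) ^ s)⁻¹ *
        ∫ v, mixedPower (vectorForm H c v) η / (topPower (vectorForm H c v)) ^ (s + 1)
          ∂sphereMeasure H := by
  rw [← integral_sphereMeasure_changeFrame hA H (measurable_mixedPower_div (s + 1) H c
    continuous_const), ← integral_const_mul]
  have hpos' : ∀ v, v ≠ 0 → 0 < normSqOf (Aᴴ * H * A) v := fun v hv => by
    rw [normSqOf_changeFrame]; exact normSqOf_pos hH (mulVec_ne_zero hA hv)
  refine integral_congr_ae ?_
  filter_upwards [ae_sphereMeasure hpos'] with v hv
  have hv0 := mulVec_ne_zero hA (ne_zero_of_normSqOf_eq_one hv)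
  have hJ0 : 0 < Complex.normSq J.det := Complex.normSq_pos.2 hJ.ne_zero
  have htop := topPower_pos (vectorForm_posDef hc h hv0)
  rw [vectorForm_changeFrame hA, topPower_changeFrame, mixedPower_changeFrame, Real.mul_rpow hJ0.le
    htop.le, Real.rpow_add_one hJ0.ne']
  have h1 := (Real.rpow_pos_of_pos hJ0 s).ne'
  have h2 := (Real.rpow_pos_of_pos htop (s + 1)).ne'
  field_simp

end GriffithsFunctional

/-! ### Invariance of the distortion under changes of frame and coordinates -/

section DistortionInvariance

variable {n r : ℕ} {H : Matrix (Fin r) (Fin r) ℂ} {c : Fin n → Fin n → Matrix (Fin r) (Fin r) ℂ}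

/-- The distortion does not depend on frames and coordinates. -/
theorem distortionAt_changeFrame (hH : H.PosDef) (hc : IsHermitianTensor H c)
    {A : Matrix (Fin r) (Fin r) ℂ} {J : Matrix (Fin n) (Fin n) ℂ} (hA : IsUnit A.det)
    (hJ : IsUnit J.det) {P : PositivityType} (s : ℝ) {t : ℝ} (hP : IsPositive H (twist t c) P) :
    distortionAt s t (Aᴴ * H * A) (changeFrame A J c) P = distortionAt s t H c P := by
  have hnorm : selfAdjointNorm (repEndo (traceForm (changeFrame A J c)) (Aᴴ * H * A)
      (traceFree (changeFrame A J c))) = selfAdjointNorm (repEndo (traceForm c) H (traceFree c)) := by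
    rw [traceFree, traceFree, twist_changeFrame hA, repEndo_changeFrame hA hJ _ (gram_changeFrame hA),
      selfAdjointNorm_conj (isUnit_det_kronecker hA hJ)]
  cases P with
  | nakano =>
    have hcof : cofactorRatio (traceForm (changeFrame A J c)) (Aᴴ * H * A)
        (changeFrame A J (twist t c)) = cofactorRatio (traceForm c) H (twist t c) :=
      cofactorRatio_conj hA hJ (gram_changeFrame hA)
    rw [distortionAt, distortionAt, hnorm, twist_changeFrame hA, hcof]
  | dualNakano =>
    have hA' := isUnit_det_inv_transpose hA
    -- The dual frame changes by the inverse transpose of A, while the trace form is unaffected by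
    -- transposition. The dual case thus uses the same ω as the others.
    have hgram := gram_changeFrame (J := J) (H := dualMetric H) (c := transposeTensor c) hA'
    rw [← transposeTensor_changeFrame hA, traceForm_transposeTensor, traceForm_transposeTensor]
      at hgram
    have hcof : cofactorRatio (traceForm (changeFrame A J c)) ((A⁻¹ᵀ)ᴴ * dualMetric H * A⁻¹ᵀ)
        (changeFrame A⁻¹ᵀ J (transposeTensor (twist t c)))
        = cofactorRatio (traceForm c) (dualMetric H) (transposeTensor (twist t c)) :=
      cofactorRatio_conj hA' hJ hgram
    rw [distortionAt, distortionAt, hnorm, twist_changeFrame hA, transposeTensor_changeFrame hA,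
      dualMetric_changeFrame, hcof]
  | griffiths =>
    have hθ := hc.twist hH t
    have hJ0 : 0 < Complex.normSq J.det := Complex.normSq_pos.2 hJ.ne_zero
    have h1 := (Real.rpow_pos_of_pos hJ0 s).ne'
    simp only [distortionAt]
    rw [hnorm, twist_changeFrame hA, traceForm_changeFrame hA,
      integral_inv_topPower_changeFrame hA s hθ hP hH,
      integral_mixedPower_changeFrame hA hJ s hθ hP hH, mul_inv, inv_inv]
    field_simp

end DistortionInvariance

/-! ### Differentiability of integrals over the unit sphere of a varying metric -/

section SphereIntegralCalculus

variable {r : ℕ}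

theorem contDiffAt_sphereProj {V : Type*} [NormedAddCommGroup V] [NormedSpace ℝ V]
    {k : WithTop ℕ∞} {f : V → Matrix (Fin r) (Fin r) ℂ} {v : V → Fin r → ℂ} {x : V}
    (hf : ContDiffAt ℝ k f x) (hv : ContDiffAt ℝ k v x) (hpos : 0 < normSqOf (f x) (v x)) :
    ContDiffAt ℝ k (fun y => sphereProj (f y) (v y)) x :=
  ((((contDiffAt_normSqOf hf hv).sqrt hpos.ne')).inv (Real.sqrt_pos.2 hpos).ne').smul hv

theorem contDiffAt_sphereDensity {V : Type*} [NormedAddCommGroup V] [NormedSpace ℝ V]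
    {k : WithTop ℕ∞} {f : V → Matrix (Fin r) (Fin r) ℂ} {v : V → Fin r → ℂ} {x : V}
    (hf : ContDiffAt ℝ k f x) (hv : ContDiffAt ℝ k v x) (hpos : 0 < normSqOf (f x) (v x)) :
    ContDiffAt ℝ k (fun y => sphereDensity (f y) (v y)) x :=
  ((contDiffAt_normSqOf hf hv).pow r).inv (pow_pos hpos r).ne'

theorem forall_normSqOf_pos_of_sphere {H : Matrix (Fin r) (Fin r) ℂ}
    (h : ∀ u : Metric.sphere (0 : Fin r → ℂ) 1, 0 < normSqOf H u) :
    ∀ v, v ≠ 0 → 0 < normSqOf H v := by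
  intro v hv
  have hn : 0 < ‖v‖ := norm_pos_iff.2 hv
  have h1 := h ⟨‖v‖⁻¹ • v, by
    rw [mem_sphere_zero_iff_norm, norm_smul, norm_inv, norm_norm, inv_mul_cancel₀ hn.ne']⟩
  rw [normSqOf_smul] at h1
  exact pos_of_mul_pos_right h1 (by positivity)

/-- Homogeneity reduces positivity to a compact sphere. The neighbourhood is taken among all
matrices, so that derivatives in H can be ordinary Fréchet derivatives. -/
theorem eventually_normSqOf_pos {H : Matrix (Fin r) (Fin r) ℂ}
    (h : ∀ v, v ≠ 0 → 0 < normSqOf H v) :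
    ∀ᶠ H' in 𝓝 H, ∀ v, v ≠ 0 → 0 < normSqOf H' v := by
  have h1 : ∀ᶠ H' in 𝓝 H, ∀ u ∈ (Set.univ : Set (Metric.sphere (0 : Fin r → ℂ) 1)),
      0 < normSqOf H' u := by
    refine isCompact_univ.eventually_forall_of_forall_eventually fun u _ => ?_
    have hc : ContinuousAt (fun z : Matrix (Fin r) (Fin r) ℂ × Metric.sphere (0 : Fin r → ℂ) 1 =>
        normSqOf z.1 z.2) (H, u) := by
      have h2 : ContinuousAt (fun z : Matrix (Fin r) (Fin r) ℂ × (Fin r → ℂ) =>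
          normSqOf z.1 z.2) (H, (u : Fin r → ℂ)) :=
        (contDiffAt_normSqOf (k := 0) contDiffAt_fst contDiffAt_snd).continuousAt
      exact ContinuousAt.comp (x := (H, u)) (f := fun z : Matrix (Fin r) (Fin r) ℂ ×
        Metric.sphere (0 : Fin r → ℂ) 1 => (z.1, (z.2 : Fin r → ℂ)))
        (g := fun z : Matrix (Fin r) (Fin r) ℂ × (Fin r → ℂ) => normSqOf z.1 z.2) h2
        (continuous_fst.prodMk (continuous_subtype_val.comp continuous_snd)).continuousAt
    exact hc.eventually (lt_mem_nhds (h u (ne_zero_of_mem_unit_sphere u)))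
  filter_upwards [h1] with H' hH'
  exact forall_normSqOf_pos_of_sphere fun u => hH' u trivial

theorem contDiffAt_sphereIntegrand {Q : Type*} [NormedAddCommGroup Q] [NormedSpace ℝ Q]
    {f : Q → Matrix (Fin r) (Fin r) ℂ} {g : Q → (Fin r → ℂ) → ℝ} {x : Q}
    (hf : ContDiffAt ℝ 1 f x) (hpos : ∀ v, v ≠ 0 → 0 < normSqOf (f x) v)
    (hg : ∀ v, v ≠ 0 → ContDiffAt ℝ 1 (fun z : Q × (Fin r → ℂ) => g z.1 z.2) (x, v))
    {u : Fin r → ℂ} (hu : u ≠ 0) :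
    ContDiffAt ℝ 1 (fun z : Q × (Fin r → ℂ) =>
      sphereDensity (f z.1) z.2 * g z.1 (sphereProj (f z.1) z.2)) (x, u) := by
  have hf' : ContDiffAt ℝ 1 (fun z : Q × (Fin r → ℂ) => f z.1) (x, u) :=
    ContDiffAt.comp (x, u) (f := Prod.fst) (g := f) hf contDiffAt_fst
  have hsnd : ContDiffAt ℝ 1 (fun z : Q × (Fin r → ℂ) => z.2) (x, u) := contDiffAt_snd
  have hfst : ContDiffAt ℝ 1 (fun z : Q × (Fin r → ℂ) => z.1) (x, u) := contDiffAt_fst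
  have hproj := contDiffAt_sphereProj hf' hsnd (hpos u hu)
  refine (contDiffAt_sphereDensity hf' hsnd (hpos u hu)).mul ?_
  exact ContDiffAt.comp (x, u) (f := fun z : Q × (Fin r → ℂ) => (z.1, sphereProj (f z.1) z.2))
    (g := fun z : Q × (Fin r → ℂ) => g z.1 z.2) (hg _ (sphereProj_ne_zero hpos hu))
    (hfst.prodMk hproj)

/-- Integrals over the unit spheres of a varying metric are differentiable. -/
theorem differentiableAt_integral_sphereMeasure (hr : 1 ≤ r) {Q : Type*} [NormedAddCommGroup Q]
    [NormedSpace ℝ Q] [FiniteDimensional ℝ Q] {f : Q → Matrix (Fin r) (Fin r) ℂ}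
    {g : Q → (Fin r → ℂ) → ℝ} {x : Q} (hf : ContDiffAt ℝ 1 f x)
    (hpos : ∀ v, v ≠ 0 → 0 < normSqOf (f x) v) (hm : ∀ q, Measurable (g q))
    (hg : ∀ v, v ≠ 0 → ContDiffAt ℝ 1 (fun z : Q × (Fin r → ℂ) => g z.1 z.2) (x, v)) :
    DifferentiableAt ℝ (fun q => ∫ v, g q v ∂sphereMeasure (f q)) x := by
  have h1 := hasFDerivAt_integral_of_contDiffAt (volume : Measure (Fin r → ℂ)).toSphere
    (fun z : Q × (Fin r → ℂ) => sphereDensity (f z.1) z.2 * g z.1 (sphereProj (f z.1) z.2)) x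
    fun u => contDiffAt_sphereIntegrand hf hpos hg (ne_zero_of_mem_unit_sphere u)
  -- The integrand 1 gives the differentiability of the total mass, by which the integral is
  -- divided.
  have h2 := hasFDerivAt_integral_of_contDiffAt (volume : Measure (Fin r → ℂ)).toSphere
    (fun z : Q × (Fin r → ℂ) => sphereDensity (f z.1) z.2 * 1) x
    fun u => contDiffAt_sphereIntegrand (g := fun _ _ => (1 : ℝ)) hf hpos
      (fun _ _ => contDiffAt_const)
      (ne_zero_of_mem_unit_sphere u)
  simp only [mul_one] at h2
  have h3 : DifferentiableAt ℝ (fun q => (sphereMass (f q))⁻¹) x :=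
    h2.differentiableAt.inv (sphereMass_pos hr hpos).ne'
  refine (h3.mul h1.differentiableAt).congr_of_eventuallyEq ?_
  filter_upwards [hf.continuousAt.eventually (eventually_normSqOf_pos hpos)] with q hq
  exact integral_sphereMeasure hr hq (hm q)

/-- Here the metric stays fixed and only the integrand moves. This provides the value of the
derivative, whereas `differentiableAt_integral_sphereMeasure` provides its existence when both move.
-/
theorem hasDerivAt_integral_sphereMeasure (hr : 1 ≤ r) {H : Matrix (Fin r) (Fin r) ℂ}
    (hpos : ∀ v, v ≠ 0 → 0 < normSqOf H v) {g : ℝ → (Fin r → ℂ) → ℝ} {g' : (Fin r → ℂ) → ℝ}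
    (hm : ∀ ε, Measurable (g ε)) (hm' : Measurable g')
    (hg : ∀ v, v ≠ 0 → ContDiffAt ℝ 1 (fun z : ℝ × (Fin r → ℂ) => g z.1 z.2) (0, v))
    (hg' : ∀ v, v ≠ 0 → HasDerivAt (fun ε => g ε v) (g' v) 0) :
    HasDerivAt (fun ε => ∫ v, g ε v ∂sphereMeasure H) (∫ v, g' v ∂sphereMeasure H) 0 := by
  set K : ℝ × (Fin r → ℂ) → ℝ := fun z => sphereDensity H z.2 * g z.1 (sphereProj H z.2) with hK
  have hKc : ∀ u : Metric.sphere (0 : Fin r → ℂ) 1, ContDiffAt ℝ 1 K (0, u) := fun u =>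
    contDiffAt_sphereIntegrand (f := fun _ => H) contDiffAt_const hpos hg
      (ne_zero_of_mem_unit_sphere u)
  have h1 := (hasFDerivAt_integral_of_contDiffAt (volume : Measure (Fin r → ℂ)).toSphere
    K 0 hKc).hasDerivAt.const_mul (sphereMass H)⁻¹
  have hval : ∀ u : Metric.sphere (0 : Fin r → ℂ) 1,
      ((fderiv ℝ K (0, u)).comp (ContinuousLinearMap.inl ℝ ℝ (Fin r → ℂ))) 1
        = sphereDensity H u * g' (sphereProj H u) := by
    intro u
    have h2 := ((hKc u).differentiableAt (by simp)).hasFDerivAt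
    have h3 : HasFDerivAt (fun ε : ℝ => K (ε, u))
        ((fderiv ℝ K (0, u)).comp (ContinuousLinearMap.inl ℝ ℝ (Fin r → ℂ))) 0 :=
      HasFDerivAt.comp (f := fun ε : ℝ => (ε, (u : Fin r → ℂ))) (0 : ℝ) h2
        (hasFDerivAt_prodMk_left (𝕜 := ℝ) (0 : ℝ) (u : Fin r → ℂ))
    exact h3.hasDerivAt.unique
      ((hg' _ (sphereProj_ne_zero hpos (ne_zero_of_mem_unit_sphere u))).const_mul
        (sphereDensity H u))
  have hint : Integrable (fun u : Metric.sphere (0 : Fin r → ℂ) 1 =>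
      (fderiv ℝ K (0, u)).comp (ContinuousLinearMap.inl ℝ ℝ (Fin r → ℂ)))
      (volume : Measure (Fin r → ℂ)).toSphere := by
    have hc : Continuous (fun u : Metric.sphere (0 : Fin r → ℂ) 1 =>
        (fderiv ℝ K (0, u)).comp (ContinuousLinearMap.inl ℝ ℝ (Fin r → ℂ))) := by
      rw [continuous_iff_continuousAt]
      intro u
      have h4 : ContinuousAt (fderiv ℝ K) (0, (u : Fin r → ℂ)) :=
        ((hKc u).fderiv_right (m := 0) (by simp)).continuousAt
      have h5 : ContinuousAt (fun u : Metric.sphere (0 : Fin r → ℂ) 1 =>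
          fderiv ℝ K (0, (u : Fin r → ℂ))) u :=
        ContinuousAt.comp (f := fun u : Metric.sphere (0 : Fin r → ℂ) 1 =>
          ((0 : ℝ), (u : Fin r → ℂ))) h4 (by fun_prop)
      exact h5.clm_comp continuousAt_const
    obtain ⟨C, hC⟩ := (isCompact_range hc).isBounded.exists_norm_le
    exact Integrable.of_bound hc.aestronglyMeasurable C
      (Filter.Eventually.of_forall fun u => hC _ ⟨u, rfl⟩)
  rw [ContinuousLinearMap.integral_apply hint] at h1
  simp only [hval] at h1
  rw [← integral_sphereMeasure hr hpos hm'] at h1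
  refine h1.congr_of_eventuallyEq (Filter.Eventually.of_forall fun ε => ?_)
  exact integral_sphereMeasure hr hpos (hm ε)

end SphereIntegralCalculus

/-! ### Differentiability and logarithmic derivatives of the functionals Φ_N and Φ_G -/

section PhiCalculus

variable {n r : ℕ} {H : Matrix (Fin r) (Fin r) ℂ} {θ : Fin n → Fin n → Matrix (Fin r) (Fin r) ℂ}

theorem contDiffAt_formMatrix {V : Type*} [NormedAddCommGroup V] [NormedSpace ℝ V]
    {k : WithTop ℕ∞} {f : V → Matrix (Fin r) (Fin r) ℂ}
    {c : V → Fin n → Fin n → Matrix (Fin r) (Fin r) ℂ} {x : V}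
    (hf : ContDiffAt ℝ k f x) (hc : ContDiffAt ℝ k c x) :
    ContDiffAt ℝ k (fun y => formMatrix (f y) (c y)) x := by
  rw [contDiffAt_matrix_iff]
  intro a b
  have hc' : ContDiffAt ℝ k (fun y => c y b.1 a.1) x := (contDiffAt_pi.1 ((contDiffAt_pi.1 hc) b.1)) a.1
  exact contDiffAt_matrix_iff.1 (contDiffAt_matrix_mul hf hc') a.2 b.2

theorem formMatrix_add_smul (H : Matrix (Fin r) (Fin r) ℂ)
    (θ δ : Fin n → Fin n → Matrix (Fin r) (Fin r) ℂ) (ε : ℝ) :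
    formMatrix H (θ + ε • δ) = formMatrix H θ + (ε : ℂ) • formMatrix H δ := by
  ext a b
  simp [formMatrix, Matrix.mul_add]

theorem vectorForm_add_smul (H : Matrix (Fin r) (Fin r) ℂ)
    (θ δ : Fin n → Fin n → Matrix (Fin r) (Fin r) ℂ) (ε : ℝ) (v : Fin r → ℂ) :
    vectorForm H (θ + ε • δ) v = vectorForm H θ v + (ε : ℂ) • vectorForm H δ v := by
  ext j k
  simp [vectorForm, Matrix.mul_add, Matrix.add_mulVec, Matrix.smul_mulVec]

theorem det_ratio_pos (hH : H.PosDef) (hθ : IsHermitianTensor H θ) (hpos : IsPositive H θ .nakano) :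
    0 < (formMatrix H θ).det / H.det ^ n := by
  rw [div_eq_mul_inv]
  exact mul_pos (formMatrix_posDef hθ hpos).det_pos
    (by rw [← inv_pow, ← Ring.inverse_eq_inv', ← Matrix.det_nonsing_inv]
        exact pow_pos hH.inv.det_pos n)

theorem trace_adjugate_mul {ι : Type*} [Fintype ι] [DecidableEq ι] {F : Matrix ι ι ℂ}
    (hF : IsUnit F.det) (D : Matrix ι ι ℂ) : (F.adjugate * D).trace = F.det * (F⁻¹ * D).trace := by
  have hadj : F.adjugate = F.det • F⁻¹ := by
    rw [Matrix.inv_def, smul_smul, Ring.mul_inverse_cancel _ hF, one_smul]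
  rw [hadj, Matrix.smul_mul, Matrix.trace_smul, smul_eq_mul]

theorem differentiableAt_phiNakano (hH : H.PosDef) (hθ : IsHermitianTensor H θ)
    (hpos : IsPositive H θ .nakano) :
    DifferentiableAt ℝ (fun x : Matrix (Fin r) (Fin r) ℂ ×
      (Fin n → Fin n → Matrix (Fin r) (Fin r) ℂ) => phiNakano x.1 x.2) (H, θ) := by
  have h1 : ContDiffAt ℝ 1 (fun x : Matrix (Fin r) (Fin r) ℂ ×
      (Fin n → Fin n → Matrix (Fin r) (Fin r) ℂ) =>
      ((formMatrix x.1 x.2).det / x.1.det ^ n).re) (H, θ) := by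
    have h2 : ContDiffAt ℝ 1 (fun x : Matrix (Fin r) (Fin r) ℂ ×
      (Fin n → Fin n → Matrix (Fin r) (Fin r) ℂ) => (x.1.det ^ n)⁻¹) (H, θ) :=
      ((contDiffAt_matrix_det contDiffAt_fst).pow n).inv
        (pow_ne_zero _ (isUnit_det_of_posDef hH).ne_zero)
    simp only [div_eq_mul_inv]
    exact contDiffAt_re ((contDiffAt_matrix_det (contDiffAt_formMatrix contDiffAt_fst
      contDiffAt_snd)).mul h2)
  exact (h1.differentiableAt (by simp)).rpow_const
    (Or.inl (Complex.lt_def.1 (det_ratio_pos hH hθ hpos)).1.ne')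

theorem phiNakano_pos (hH : H.PosDef) (hθ : IsHermitianTensor H θ)
    (hpos : IsPositive H θ .nakano) : 0 < phiNakano H θ :=
  Real.rpow_pos_of_pos (Complex.lt_def.1 (det_ratio_pos hH hθ hpos)).1 _

/-- Jacobi's formula gives the logarithmic derivative of the determinant, and the exponent 1/r
contributes the factor. The normalization by det(H)^n is constant along the path. -/
theorem hasDerivAt_phiNakano (hH : H.PosDef) (hθ : IsHermitianTensor H θ)
    (hpos : IsPositive H θ .nakano) (δ : Fin n → Fin n → Matrix (Fin r) (Fin r) ℂ) :
    HasDerivAt (fun ε : ℝ => phiNakano H (θ + ε • δ))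
      (phiNakano H θ * (1 / (r : ℝ) * ((formMatrix H θ)⁻¹ * formMatrix H δ).trace.re)) 0 := by
  have hF := isUnit_det_of_posDef (formMatrix_posDef hθ hpos)
  have hρ := det_ratio_pos hH hθ hpos
  obtain ⟨ρ, hρC⟩ : ∃ ρ : ℝ, (formMatrix H θ).det / H.det ^ n = (ρ : ℂ) :=
    ⟨_, Complex.ext (Complex.ofReal_re _).symm
      ((Complex.lt_def.1 hρ).2.symm.trans (Complex.ofReal_im _).symm)⟩
  have hρ0 : 0 < ρ := by rwa [hρC, Complex.zero_lt_real] at hρ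
  have h1 : HasDerivAt (fun ε : ℝ => ((formMatrix H (θ + ε • δ)).det / H.det ^ n).re)
      (ρ * ((formMatrix H θ)⁻¹ * formMatrix H δ).trace.re) 0 := by
    have h2 := (hasDerivAt_det_add_smul hF (formMatrix H δ)).div_const (H.det ^ n)
    have h3 := Complex.reCLM.hasFDerivAt.comp_hasDerivAt _ h2
    have h4 : ((formMatrix H θ).adjugate * formMatrix H δ).trace / H.det ^ n
        = (ρ : ℂ) * ((formMatrix H θ)⁻¹ * formMatrix H δ).trace := by
      rw [trace_adjugate_mul hF, ← hρC, mul_div_right_comm]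
    rw [h4] at h3
    have h6 : Complex.reCLM ((ρ : ℂ) * ((formMatrix H θ)⁻¹ * formMatrix H δ).trace)
        = ρ * ((formMatrix H θ)⁻¹ * formMatrix H δ).trace.re := Complex.re_ofReal_mul _ _
    rw [h6] at h3
    simp only [formMatrix_add_smul]
    exact h3
  have h0 : ((formMatrix H (θ + (0 : ℝ) • δ)).det / H.det ^ n).re = ρ := by
    rw [zero_smul, add_zero, hρC, Complex.ofReal_re]
  have h5 := h1.rpow_const (p := 1 / (r : ℝ)) (Or.inl (by rw [h0]; exact hρ0.ne'))
  refine h5.congr_deriv ?_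
  rw [h0, phiNakano, hρC, Complex.ofReal_re, Real.rpow_sub_one hρ0.ne']
  generalize ((formMatrix H θ)⁻¹ * formMatrix H δ).trace.re = a
  field_simp

theorem contDiffAt_rpow_topPower {V : Type*} [NormedAddCommGroup V] [NormedSpace ℝ V]
    {f : V → Matrix (Fin r) (Fin r) ℂ} {c : V → Fin n → Fin n → Matrix (Fin r) (Fin r) ℂ}
    {v : V → Fin r → ℂ} {x : V} (hf : ContDiffAt ℝ 1 f x) (hc : ContDiffAt ℝ 1 c x)
    (hv : ContDiffAt ℝ 1 v x) (h : 0 < topPower (vectorForm (f x) (c x) (v x))) (s : ℝ) :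
    ContDiffAt ℝ 1 (fun y => (topPower (vectorForm (f y) (c y) (v y))) ^ s) x :=
  (contDiffAt_topPower (contDiffAt_vectorForm hf hc hv)).rpow_const_of_ne h.ne'

theorem differentiableAt_integral_inv_topPower (hr : 1 ≤ r) (hH : H.PosDef)
    (hθ : IsHermitianTensor H θ) (hpos : IsPositive H θ .griffiths) (s : ℝ) :
    DifferentiableAt ℝ (fun x : Matrix (Fin r) (Fin r) ℂ ×
      (Fin n → Fin n → Matrix (Fin r) (Fin r) ℂ) =>
      ∫ v, 1 / (topPower (vectorForm x.1 x.2 v)) ^ s ∂sphereMeasure x.1) (H, θ) := by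
  refine differentiableAt_integral_sphereMeasure hr (f := fun x : Matrix (Fin r) (Fin r) ℂ ×
      (Fin n → Fin n → Matrix (Fin r) (Fin r) ℂ) => x.1)
    (g := fun x v => 1 / (topPower (vectorForm x.1 x.2 v)) ^ s) contDiffAt_fst
    (fun v hv => normSqOf_pos hH hv) (fun x => measurable_inv_topPower s x.1 x.2) fun v hv => ?_
  have htop := topPower_pos (vectorForm_posDef hθ hpos hv)
  have h1 : ContDiffAt ℝ 1 (fun z : (Matrix (Fin r) (Fin r) ℂ ×
      (Fin n → Fin n → Matrix (Fin r) (Fin r) ℂ)) × (Fin r → ℂ) => z.1) ((H, θ), v) :=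
    contDiffAt_fst
  have h2 : ContDiffAt ℝ 1 (fun z : (Matrix (Fin r) (Fin r) ℂ ×
      (Fin n → Fin n → Matrix (Fin r) (Fin r) ℂ)) × (Fin r → ℂ) => z.2) ((H, θ), v) :=
    contDiffAt_snd
  exact contDiffAt_const.div (contDiffAt_rpow_topPower h1.fst h1.snd h2 htop s)
    (Real.rpow_pos_of_pos htop s).ne'

theorem continuousAt_integral_mixedPower (hr : 1 ≤ r) (hH : H.PosDef)
    (hθ : IsHermitianTensor H θ) (hpos : IsPositive H θ .griffiths) (s : ℝ)
    (η : Matrix (Fin n) (Fin n) ℂ) :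
    ContinuousAt (fun x : (Matrix (Fin r) (Fin r) ℂ ×
      (Fin n → Fin n → Matrix (Fin r) (Fin r) ℂ)) × Matrix (Fin n) (Fin n) ℂ =>
      ∫ v, mixedPower (vectorForm x.1.1 x.1.2 v) x.2 / (topPower (vectorForm x.1.1 x.1.2 v)) ^ s
        ∂sphereMeasure x.1.1) ((H, θ), η) := by
  have hfst : ContDiffAt ℝ 1 (fun x : (Matrix (Fin r) (Fin r) ℂ ×
      (Fin n → Fin n → Matrix (Fin r) (Fin r) ℂ)) × Matrix (Fin n) (Fin n) ℂ => x.1)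
      ((H, θ), η) := contDiffAt_fst
  refine (differentiableAt_integral_sphereMeasure hr (f := fun x : (Matrix (Fin r) (Fin r) ℂ ×
      (Fin n → Fin n → Matrix (Fin r) (Fin r) ℂ)) × Matrix (Fin n) (Fin n) ℂ => x.1.1)
    (g := fun x v => mixedPower (vectorForm x.1.1 x.1.2 v) x.2 /
      (topPower (vectorForm x.1.1 x.1.2 v)) ^ s) hfst.fst
    (fun v hv => normSqOf_pos hH hv)
    (fun x => measurable_mixedPower_div s x.1.1 x.1.2 continuous_const) fun v hv => ?_).continuousAt
  have htop := topPower_pos (vectorForm_posDef hθ hpos hv)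
  have h1 : ContDiffAt ℝ 1 (fun z : ((Matrix (Fin r) (Fin r) ℂ ×
      (Fin n → Fin n → Matrix (Fin r) (Fin r) ℂ)) × Matrix (Fin n) (Fin n) ℂ) × (Fin r → ℂ) => z.1)
      (((H, θ), η), v) := contDiffAt_fst
  have h2 : ContDiffAt ℝ 1 (fun z : ((Matrix (Fin r) (Fin r) ℂ ×
      (Fin n → Fin n → Matrix (Fin r) (Fin r) ℂ)) × Matrix (Fin n) (Fin n) ℂ) × (Fin r → ℂ) => z.2)
      (((H, θ), η), v) := contDiffAt_snd
  have h3 := h1.fst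
  exact (contDiffAt_mixedPower (contDiffAt_vectorForm h3.fst h3.snd h2) h1.snd).div
    (contDiffAt_rpow_topPower h3.fst h3.snd h2 htop s) (Real.rpow_pos_of_pos htop s).ne'

theorem differentiableAt_phiGriffiths (hr : 1 ≤ r) (hH : H.PosDef) (hθ : IsHermitianTensor H θ)
    (hpos : IsPositive H θ .griffiths) (s : ℝ) :
    DifferentiableAt ℝ (fun x : Matrix (Fin r) (Fin r) ℂ ×
      (Fin n → Fin n → Matrix (Fin r) (Fin r) ℂ) => phiGriffiths s x.1 x.2) (H, θ) :=
  (differentiableAt_integral_inv_topPower hr hH hθ hpos s).rpow_const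
    (Or.inl (integral_inv_topPower_pos hr hH hθ hpos s).ne')

/-- The exponents -s, inside the integral, and -1/s, outside, multiply to 1, so the logarithmic
derivative is a weighted mean of those of the top powers. -/
theorem hasDerivAt_phiGriffiths (hr : 1 ≤ r) (hH : H.PosDef) (hθ : IsHermitianTensor H θ)
    (hpos : IsPositive H θ .griffiths) {s : ℝ} (hs : 0 < s)
    (δ : Fin n → Fin n → Matrix (Fin r) (Fin r) ℂ) :
    HasDerivAt (fun ε : ℝ => phiGriffiths s H (θ + ε • δ))
      (phiGriffiths s H θ * ((∫ v, 1 / (topPower (vectorForm H θ v)) ^ s ∂sphereMeasure H)⁻¹ *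
        ∫ v, mixedPower (vectorForm H θ v) (vectorForm H δ v) /
          (topPower (vectorForm H θ v)) ^ (s + 1) ∂sphereMeasure H)) 0 := by
  have hI := integral_inv_topPower_pos hr hH hθ hpos s
  have h1 : HasDerivAt (fun ε : ℝ =>
      ∫ v, 1 / (topPower (vectorForm H (θ + ε • δ) v)) ^ s ∂sphereMeasure H)
      (∫ v, -s * (mixedPower (vectorForm H θ v) (vectorForm H δ v) /
          (topPower (vectorForm H θ v)) ^ (s + 1)) ∂sphereMeasure H) 0 := by
    refine hasDerivAt_integral_sphereMeasure hr (fun v hv => normSqOf_pos hH hv)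
      (g := fun ε v => 1 / (topPower (vectorForm H (θ + ε • δ) v)) ^ s)
      (fun ε => measurable_inv_topPower s H _)
      ((measurable_mixedPower_div (s + 1) H θ (continuous_vectorForm H δ)).const_mul _) ?_ ?_
    · intro v hv
      have htop := topPower_pos (vectorForm_posDef hθ hpos hv)
      have h0 : topPower (vectorForm H (θ + (0 : ℝ) • δ) v) = topPower (vectorForm H θ v) := by
        rw [zero_smul, add_zero]
      have hp : ContDiffAt ℝ 1 (fun z : ℝ × (Fin r → ℂ) => θ + z.1 • δ) (0, v) :=
        contDiffAt_const.add (contDiffAt_fst.smul contDiffAt_const)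
      refine contDiffAt_const.div (contDiffAt_rpow_topPower contDiffAt_const hp contDiffAt_snd
        (by simpa only [h0] using htop) s) ?_
      simpa only [h0] using (Real.rpow_pos_of_pos htop s).ne'
    · intro v hv
      have hα := vectorForm_posDef hθ hpos hv
      have htop := topPower_pos hα
      have h2 := hasDerivAt_topPower_add_smul (isUnit_det_of_posDef hα) (vectorForm H δ v)
      have h0 : topPower (vectorForm H θ v + ((0 : ℝ) : ℂ) • vectorForm H δ v)
          = topPower (vectorForm H θ v) := by simp
      have h3 := h2.rpow_const (p := -s) (Or.inl (by rw [h0]; exact htop.ne'))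
      have h4 : HasDerivAt (fun ε : ℝ => 1 / (topPower (vectorForm H (θ + ε • δ) v)) ^ s)
          (mixedPower (vectorForm H θ v) (vectorForm H δ v) * -s *
            topPower (vectorForm H θ v + ((0 : ℝ) : ℂ) • vectorForm H δ v) ^ (-s - 1)) 0 := by
        refine h3.congr_of_eventuallyEq ?_
        have hcont := h2.continuousAt
        -- The identity 1/x^s = x^(-s) for real powers is used for x > 0, which holds only for small
        -- ε.
        have : ∀ᶠ ε : ℝ in 𝓝 0, 0 < topPower (vectorForm H θ v + (ε : ℂ) • vectorForm H δ v) :=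
          hcont.eventually (lt_mem_nhds (htop.trans_eq h0.symm))
        filter_upwards [this] with ε hε
        rw [vectorForm_add_smul, Real.rpow_neg hε.le, one_div]
      refine h4.congr_deriv ?_
      rw [h0, show -s - 1 = -(s + 1) by ring, Real.rpow_neg htop.le]
      ring
  have h0 : (∫ v, 1 / (topPower (vectorForm H (θ + (0 : ℝ) • δ) v)) ^ s ∂sphereMeasure H)
      = ∫ v, 1 / (topPower (vectorForm H θ v)) ^ s ∂sphereMeasure H := by
    rw [zero_smul, add_zero]
  have h5 := h1.rpow_const (p := -(1 / s)) (Or.inl (by rw [h0]; exact hI.ne'))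
  refine h5.congr_deriv ?_
  rw [h0, integral_const_mul, phiGriffiths, Real.rpow_sub_one hI.ne']
  field_simp

end PhiCalculus

/-! ### Smoothness of the passage to the dual bundle, of the trace and of the twist -/

section DualCalculus

variable {n r : ℕ} {H : Matrix (Fin r) (Fin r) ℂ} {c : Fin n → Fin n → Matrix (Fin r) (Fin r) ℂ}

theorem contDiffAt_transpose {V : Type*} [NormedAddCommGroup V] [NormedSpace ℝ V]
    {k : WithTop ℕ∞} {m : ℕ} {f : V → Matrix (Fin m) (Fin m) ℂ} {x : V} (hf : ContDiffAt ℝ k f x) :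
    ContDiffAt ℝ k (fun y => (f y)ᵀ) x := by
  rw [contDiffAt_matrix_iff] at hf ⊢
  exact fun i j => hf j i

theorem contDiffAt_dualPair {k : WithTop ℕ∞} (hH : IsUnit H.det) :
    ContDiffAt ℝ k (fun x : Matrix (Fin r) (Fin r) ℂ ×
      (Fin n → Fin n → Matrix (Fin r) (Fin r) ℂ) => (dualMetric x.1, transposeTensor x.2))
      (H, c) := by
  have h1 : ContDiffAt ℝ k (fun x : Matrix (Fin r) (Fin r) ℂ ×
      (Fin n → Fin n → Matrix (Fin r) (Fin r) ℂ) => x.1) (H, c) := contDiffAt_fst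
  have h2 : ContDiffAt ℝ k (fun x : Matrix (Fin r) (Fin r) ℂ ×
      (Fin n → Fin n → Matrix (Fin r) (Fin r) ℂ) => x.2) (H, c) := contDiffAt_snd
  refine (contDiffAt_transpose (contDiffAt_matrix_inv h1 hH)).prodMk ?_
  exact contDiffAt_pi.2 fun j => contDiffAt_pi.2 fun l =>
    contDiffAt_transpose (contDiffAt_pi.1 (contDiffAt_pi.1 h2 j) l)

theorem contDiffAt_traceForm {V : Type*} [NormedAddCommGroup V] [NormedSpace ℝ V]
    {k : WithTop ℕ∞} {f : V → Fin n → Fin n → Matrix (Fin r) (Fin r) ℂ} {x : V}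
    (hf : ContDiffAt ℝ k f x) : ContDiffAt ℝ k (fun y => traceForm (f y)) x := by
  rw [contDiffAt_matrix_iff]
  exact fun i j => contDiffAt_matrix_trace (contDiffAt_pi.1 (contDiffAt_pi.1 hf i) j)

theorem contDiffAt_twist {V : Type*} [NormedAddCommGroup V] [NormedSpace ℝ V]
    {k : WithTop ℕ∞} {f : V → Fin n → Fin n → Matrix (Fin r) (Fin r) ℂ} {x : V}
    (hf : ContDiffAt ℝ k f x) (t : ℝ) : ContDiffAt ℝ k (fun y => twist t (f y)) x := by
  refine contDiffAt_pi.2 fun i => contDiffAt_pi.2 fun j => ?_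
  have h := contDiffAt_pi.1 (contDiffAt_pi.1 hf i) j
  refine h.add ?_
  rw [contDiffAt_matrix_iff]
  intro a b
  exact (contDiffAt_const.mul (contDiffAt_matrix_trace h)).mul contDiffAt_const

end DualCalculus

/-! ### Openness of positivity -/

section PositivityOpen

variable {n r : ℕ} {H : Matrix (Fin r) (Fin r) ℂ} {c : Fin n → Fin n → Matrix (Fin r) (Fin r) ℂ}

theorem continuous_quadForm {Y : Type*} [TopologicalSpace Y] {f : Y → Matrix (Fin r) (Fin r) ℂ}
    {g : Y → Fin n → Fin n → Matrix (Fin r) (Fin r) ℂ} {γ : Y → Fin n × Fin r → ℂ}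
    (hf : Continuous f) (hg : Continuous g) (hγ : Continuous γ) :
    Continuous fun y => quadForm (f y) (g y) (γ y) := by
  have h1 : Continuous fun y => formMatrix (f y) (g y) := by
    refine continuous_matrix fun a b => ?_
    have h2 : Continuous fun y => f y * g y b.1 a.1 :=
      hf.matrix_mul ((continuous_apply a.1).comp ((continuous_apply b.1).comp hg))
    exact h2.matrix_elem a.2 b.2
  exact Complex.continuous_re.comp ((hγ.star).dotProduct (h1.matrix_mulVec hγ))

theorem quadForm_smul (a : ℝ) (γ : Fin n × Fin r → ℂ) :
    quadForm H c (a • γ) = a ^ 2 * quadForm H c γ := by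
  have h : a • γ = (a : ℂ) • γ := by ext i; simp
  rw [quadForm, quadForm, h, Matrix.mulVec_smul, star_smul, smul_dotProduct, dotProduct_smul]
  simp only [Complex.star_def, Complex.conj_ofReal, smul_eq_mul]
  rw [Complex.re_ofReal_mul, Complex.re_ofReal_mul]
  ring

/-- By homogeneity it suffices to keep the form positive on a compact unit sphere, where continuity
is uniform. For Griffiths positivity a product of two spheres plays this role. -/
theorem eventually_isPositive_nakano (h : IsPositive H c .nakano) :
    ∀ᶠ x : Matrix (Fin r) (Fin r) ℂ × (Fin n → Fin n → Matrix (Fin r) (Fin r) ℂ) in 𝓝 (H, c),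
      IsPositive x.1 x.2 .nakano := by
  have h1 : ∀ᶠ x : Matrix (Fin r) (Fin r) ℂ × (Fin n → Fin n → Matrix (Fin r) (Fin r) ℂ) in
      𝓝 (H, c), ∀ γ ∈ Metric.sphere (0 : Fin n × Fin r → ℂ) 1, 0 < quadForm x.1 x.2 γ := by
    refine (isCompact_sphere _ _).eventually_forall_of_forall_eventually fun γ hγ => ?_
    have hc : Continuous fun z : (Matrix (Fin r) (Fin r) ℂ ×
        (Fin n → Fin n → Matrix (Fin r) (Fin r) ℂ)) × (Fin n × Fin r → ℂ) =>
        quadForm z.1.1 z.1.2 z.2 :=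
      continuous_quadForm (continuous_fst.comp continuous_fst) (continuous_snd.comp continuous_fst)
        continuous_snd
    exact hc.continuousAt.eventually (lt_mem_nhds (h γ (ne_zero_of_mem_unit_sphere ⟨γ, hγ⟩)))
  filter_upwards [h1] with x hx γ hγ
  have hn : 0 < ‖γ‖ := norm_pos_iff.2 hγ
  have h2 := hx (‖γ‖⁻¹ • γ) (by
    rw [mem_sphere_zero_iff_norm, norm_smul, norm_inv, norm_norm, inv_mul_cancel₀ hn.ne'])
  rw [quadForm_smul] at h2
  exact pos_of_mul_pos_right h2 (by positivity)

theorem eventually_isPositive_griffiths (h : IsPositive H c .griffiths) :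
    ∀ᶠ x : Matrix (Fin r) (Fin r) ℂ × (Fin n → Fin n → Matrix (Fin r) (Fin r) ℂ) in 𝓝 (H, c),
      IsPositive x.1 x.2 .griffiths := by
  have h1 : ∀ᶠ x : Matrix (Fin r) (Fin r) ℂ × (Fin n → Fin n → Matrix (Fin r) (Fin r) ℂ) in
      𝓝 (H, c), ∀ q ∈ Metric.sphere (0 : Fin n → ℂ) 1 ×ˢ Metric.sphere (0 : Fin r → ℂ) 1,
        0 < quadForm x.1 x.2 (fun a => q.1 a.1 * q.2 a.2) := by
    refine ((isCompact_sphere _ _).prod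
      (isCompact_sphere _ _)).eventually_forall_of_forall_eventually fun q hq => ?_
    have hc : Continuous fun z : (Matrix (Fin r) (Fin r) ℂ ×
        (Fin n → Fin n → Matrix (Fin r) (Fin r) ℂ)) × ((Fin n → ℂ) × (Fin r → ℂ)) =>
        quadForm z.1.1 z.1.2 (fun a => z.2.1 a.1 * z.2.2 a.2) :=
      continuous_quadForm (continuous_fst.comp continuous_fst) (continuous_snd.comp continuous_fst)
        (by fun_prop)
    exact hc.continuousAt.eventually (lt_mem_nhds (h q.1 q.2
      (ne_zero_of_mem_unit_sphere ⟨q.1, hq.1⟩) (ne_zero_of_mem_unit_sphere ⟨q.2, hq.2⟩)))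
  filter_upwards [h1] with x hx ξ v hξ hv
  have hn : 0 < ‖ξ‖ := norm_pos_iff.2 hξ
  have hm : 0 < ‖v‖ := norm_pos_iff.2 hv
  have h2 := hx (‖ξ‖⁻¹ • ξ, ‖v‖⁻¹ • v) ⟨by
    rw [mem_sphere_zero_iff_norm, norm_smul, norm_inv, norm_norm, inv_mul_cancel₀ hn.ne'], by
    rw [mem_sphere_zero_iff_norm, norm_smul, norm_inv, norm_norm, inv_mul_cancel₀ hm.ne']⟩
  have h3 : (fun a : Fin n × Fin r => (‖ξ‖⁻¹ • ξ) a.1 * (‖v‖⁻¹ • v) a.2)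
      = (‖ξ‖⁻¹ * ‖v‖⁻¹) • fun a : Fin n × Fin r => ξ a.1 * v a.2 := by
    ext a
    simp only [Pi.smul_apply, Complex.real_smul]
    push_cast
    ring
  simp only [h3, quadForm_smul] at h2
  exact pos_of_mul_pos_right h2 (by positivity)

theorem eventually_isPositive {P : PositivityType} (hH : IsUnit H.det) (h : IsPositive H c P) :
    ∀ᶠ x : Matrix (Fin r) (Fin r) ℂ × (Fin n → Fin n → Matrix (Fin r) (Fin r) ℂ) in 𝓝 (H, c),
      IsPositive x.1 x.2 P := by
  cases P with
  | nakano => exact eventually_isPositive_nakano h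
  | griffiths => exact eventually_isPositive_griffiths h
  | dualNakano =>
    have h1 : IsPositive (dualMetric H) (transposeTensor c) .nakano := h
    exact (contDiffAt_dualPair (k := 0) (c := c) hH).continuousAt.eventually
      (eventually_isPositive_nakano h1)

end PositivityOpen

/-! ### The three functionals treated uniformly -/

section PhiGeneral

variable {n r : ℕ} {H : Matrix (Fin r) (Fin r) ℂ} {θ : Fin n → Fin n → Matrix (Fin r) (Fin r) ℂ}
  {P : PositivityType}

theorem phi_pos (hr : 1 ≤ r) (hH : H.PosDef) (hθ : IsHermitianTensor H θ) (h : IsPositive H θ P)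
    (s : ℝ) : 0 < phi s H θ P := by
  cases P with
  | nakano => exact phiNakano_pos hH hθ h
  | dualNakano => exact phiNakano_pos (dualMetric_posDef hH) (hθ.dual hH) h
  | griffiths => exact Real.rpow_pos_of_pos (integral_inv_topPower_pos hr hH hθ h s) _

theorem differentiableAt_phi (hr : 1 ≤ r) (hH : H.PosDef) (hθ : IsHermitianTensor H θ)
    (h : IsPositive H θ P) (s : ℝ) :
    DifferentiableAt ℝ (fun x : Matrix (Fin r) (Fin r) ℂ ×
      (Fin n → Fin n → Matrix (Fin r) (Fin r) ℂ) => phi s x.1 x.2 P) (H, θ) := by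
  cases P with
  | nakano => exact differentiableAt_phiNakano hH hθ h
  | dualNakano =>
    have h1 := differentiableAt_phiNakano (dualMetric_posDef hH) (hθ.dual hH) h
    have h2 := (contDiffAt_dualPair (k := 1) (c := θ) (isUnit_det_of_posDef hH)).differentiableAt
      (by simp)
    exact DifferentiableAt.comp (H, θ) (f := fun x : Matrix (Fin r) (Fin r) ℂ ×
      (Fin n → Fin n → Matrix (Fin r) (Fin r) ℂ) => (dualMetric x.1, transposeTensor x.2))
      (g := fun x : Matrix (Fin r) (Fin r) ℂ ×
      (Fin n → Fin n → Matrix (Fin r) (Fin r) ℂ) => phiNakano x.1 x.2) h1 h2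
  | griffiths => exact differentiableAt_phiGriffiths hr hH hθ h s

/-- The logarithmic derivative of `Φ_P` in the direction `p ⊗ p̄ ⊗ S`. -/
def logFunctional (P : PositivityType) (s : ℝ) (H : Matrix (Fin r) (Fin r) ℂ)
    (θ : Fin n → Fin n → Matrix (Fin r) (Fin r) ℂ) (p : Fin n → ℂ) :
    Matrix (Fin r) (Fin r) ℂ → ℝ :=
  match P with
  | .nakano => nakanoFunctional H θ p
  | .dualNakano => fun S => nakanoFunctional (dualMetric H) (transposeTensor θ) p Sᵀ
  | .griffiths => griffithsFunctional s H θ p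

theorem transposeTensor_rankOneTensor (p : Fin n → ℂ) (S : Matrix (Fin r) (Fin r) ℂ) :
    transposeTensor (rankOneTensor p S) = rankOneTensor p Sᵀ := by
  funext j k
  simp [transposeTensor, rankOneTensor]

theorem hasDerivAt_phi (hr : 1 ≤ r) (hH : H.PosDef) (hθ : IsHermitianTensor H θ)
    (h : IsPositive H θ P) {s : ℝ} (hs : 0 < s) (p : Fin n → ℂ) (S : Matrix (Fin r) (Fin r) ℂ) :
    HasDerivAt (fun ε : ℝ => phi s H (θ + ε • rankOneTensor p S) P)
      (phi s H θ P * logFunctional P s H θ p S) 0 := by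
  cases P with
  | nakano => exact hasDerivAt_phiNakano hH hθ h _
  | dualNakano =>
    have h1 := hasDerivAt_phiNakano (dualMetric_posDef hH) (hθ.dual hH) h
      (transposeTensor (rankOneTensor p S))
    rw [transposeTensor_rankOneTensor] at h1
    refine h1.congr_of_eventuallyEq (Filter.Eventually.of_forall fun ε => ?_)
    rw [← transposeTensor_rankOneTensor]
    rfl
  | griffiths => exact hasDerivAt_phiGriffiths hr hH hθ h hs _

theorem rankOneTensor_add (p : Fin n → ℂ) (S T : Matrix (Fin r) (Fin r) ℂ) :
    rankOneTensor p (S + T) = rankOneTensor p S + rankOneTensor p T := by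
  funext j k; simp [rankOneTensor]

theorem rankOneTensor_smul (p : Fin n → ℂ) (a : ℝ) (S : Matrix (Fin r) (Fin r) ℂ) :
    rankOneTensor p (a • S) = a • rankOneTensor p S := by
  funext j k; simp [rankOneTensor, smul_comm a]

theorem fderiv_phi_rankOneTensor (hr : 1 ≤ r) (hH : H.PosDef) (hθ : IsHermitianTensor H θ)
    (h : IsPositive H θ P) {s : ℝ} (hs : 0 < s) (p : Fin n → ℂ) (S : Matrix (Fin r) (Fin r) ℂ) :
    fderiv ℝ (fun x : Matrix (Fin r) (Fin r) ℂ × (Fin n → Fin n → Matrix (Fin r) (Fin r) ℂ) =>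
      phi s x.1 x.2 P) (H, θ) (0, rankOneTensor p S) = phi s H θ P * logFunctional P s H θ p S := by
  have h1 := (differentiableAt_phi hr hH hθ h s).hasFDerivAt
  have h2 : HasDerivAt (fun ε : ℝ => ((H, θ + ε • rankOneTensor p S) :
      Matrix (Fin r) (Fin r) ℂ × (Fin n → Fin n → Matrix (Fin r) (Fin r) ℂ)))
      (0, rankOneTensor p S) 0 := by
    refine (hasDerivAt_const (0 : ℝ) H).prodMk ?_
    simpa using ((hasDerivAt_id (0 : ℝ)).smul_const (rankOneTensor p S)).const_add θ
  have h3 : HasFDerivAt (fun x : Matrix (Fin r) (Fin r) ℂ ×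
      (Fin n → Fin n → Matrix (Fin r) (Fin r) ℂ) => phi s x.1 x.2 P)
      (fderiv ℝ (fun x : Matrix (Fin r) (Fin r) ℂ × (Fin n → Fin n → Matrix (Fin r) (Fin r) ℂ) =>
      phi s x.1 x.2 P) (H, θ)) (H, θ + (0 : ℝ) • rankOneTensor p S) := by
    rwa [zero_smul, add_zero]
  have h4 : HasDerivAt (fun ε : ℝ => phi s H (θ + ε • rankOneTensor p S) P)
      (fderiv ℝ (fun x : Matrix (Fin r) (Fin r) ℂ × (Fin n → Fin n → Matrix (Fin r) (Fin r) ℂ) =>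
        phi s x.1 x.2 P) (H, θ) (0, rankOneTensor p S)) 0 :=
    HasFDerivAt.comp_hasDerivAt (l := fun x : Matrix (Fin r) (Fin r) ℂ ×
      (Fin n → Fin n → Matrix (Fin r) (Fin r) ℂ) => phi s x.1 x.2 P)
      (f := fun ε : ℝ => (H, θ + ε • rankOneTensor p S)) (0 : ℝ) h3 h2
  exact h4.unique (hasDerivAt_phi hr hH hθ h hs p S)

/-- `logFunctional` as a linear map. -/
theorem exists_logFunctional_eq (hr : 1 ≤ r) (hH : H.PosDef) (hθ : IsHermitianTensor H θ)
    (h : IsPositive H θ P) {s : ℝ} (hs : 0 < s) (p : Fin n → ℂ) :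
    ∃ l : Matrix (Fin r) (Fin r) ℂ →ₗ[ℝ] ℝ, ∀ S, l S = logFunctional P s H θ p S := by
  set D := fderiv ℝ (fun x : Matrix (Fin r) (Fin r) ℂ ×
    (Fin n → Fin n → Matrix (Fin r) (Fin r) ℂ) => phi s x.1 x.2 P) (H, θ) with hD
  have hval : ∀ S, D (0, rankOneTensor p S) = phi s H θ P * logFunctional P s H θ p S :=
    fun S => fderiv_phi_rankOneTensor hr hH hθ h hs p S
  have hpos := phi_pos hr hH hθ h s
  -- Linearity is inherited from the Fréchet derivative of Φ_P, into which S enters linearly through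
  -- p ⊗ p̄ ⊗ S.
  refine ⟨{ toFun := fun S => (phi s H θ P)⁻¹ * D (0, rankOneTensor p S)
            map_add' := fun S T => ?_
            map_smul' := fun a S => ?_ }, fun S => ?_⟩
  · have : ((0, rankOneTensor p (S + T)) : Matrix (Fin r) (Fin r) ℂ ×
        (Fin n → Fin n → Matrix (Fin r) (Fin r) ℂ))
        = (0, rankOneTensor p S) + (0, rankOneTensor p T) := by
      rw [rankOneTensor_add, Prod.mk_add_mk, add_zero]
    rw [this, map_add, mul_add]
  · have : ((0, rankOneTensor p (a • S)) : Matrix (Fin r) (Fin r) ℂ ×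
        (Fin n → Fin n → Matrix (Fin r) (Fin r) ℂ)) = a • (0, rankOneTensor p S) := by
      rw [rankOneTensor_smul, Prod.smul_mk, smul_zero]
    rw [this, map_smul, smul_eq_mul, RingHom.id_apply, smul_eq_mul]
    ring
  · show (phi s H θ P)⁻¹ * D (0, rankOneTensor p S) = _
    rw [hval, inv_mul_cancel_left₀ hpos.ne']

theorem logFunctional_one_nonneg (hr : 1 ≤ r) (hH : H.PosDef) (hθ : IsHermitianTensor H θ)
    (h : IsPositive H θ P) (s : ℝ) (p : Fin n → ℂ) : 0 ≤ logFunctional P s H θ p 1 := by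
  cases P with
  | nakano => exact nakanoFunctional_one_nonneg hH hθ h p
  | dualNakano =>
    show 0 ≤ nakanoFunctional (dualMetric H) (transposeTensor θ) p 1ᵀ
    rw [Matrix.transpose_one]
    exact nakanoFunctional_one_nonneg (dualMetric_posDef hH) (hθ.dual hH) h p
  | griffiths => exact griffithsFunctional_one_nonneg hr hH hθ h s p

end PhiGeneral

/-! ### The distortion controls the coefficient of the symbol -/

section DistortionBound

variable {n r : ℕ} {H : Matrix (Fin r) (Fin r) ℂ} {c : Fin n → Fin n → Matrix (Fin r) (Fin r) ℂ}
  {P : PositivityType}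

/-- The factor of the distortion function that bounds the logarithmic derivative of `Φ_P`. -/
def distortionFactor (P : PositivityType) (s t : ℝ) (H : Matrix (Fin r) (Fin r) ℂ)
    (c : Fin n → Fin n → Matrix (Fin r) (Fin r) ℂ) : ℝ :=
  match P with
  | .nakano => 1 / (r : ℝ) * cofactorRatio (traceForm c) H (twist t c)
  | .dualNakano => 1 / (r : ℝ) *
      cofactorRatio (traceForm c) (dualMetric H) (transposeTensor (twist t c))
  | .griffiths => (∫ v, 1 / (topPower (vectorForm H (twist t c) v)) ^ s ∂(sphereMeasure H))⁻¹ *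
      ∫ v, mixedPower (vectorForm H (twist t c) v) (traceForm c) /
        (topPower (vectorForm H (twist t c) v)) ^ (s + 1) ∂(sphereMeasure H)

/-- The three definitions share the constant and |Θ°|. The remaining factor is exactly what bounds
the logarithmic derivative of Φ_P in `abs_logFunctional_le`. -/
theorem distortionAt_eq (P : PositivityType) (s t : ℝ) (H : Matrix (Fin r) (Fin r) ℂ)
    (c : Fin n → Fin n → Matrix (Fin r) (Fin r) ℂ) :
    distortionAt s t H c P = (Real.sqrt ((n : ℝ) - 1) + 1) *
      selfAdjointNorm (repEndo (traceForm c) H (traceFree c)) * distortionFactor P s t H c := by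
  cases P <;> simp only [distortionAt, distortionFactor] <;> ring

theorem cofactorRatio_nonneg {W : Matrix (Fin n) (Fin n) ℂ}
    (hW : W.PosDef) (hH : H.PosDef) {θ : Fin n → Fin n → Matrix (Fin r) (Fin r) ℂ}
    (hθ : IsHermitianTensor H θ) (hpos : IsPositive H θ .nakano) : 0 ≤ cofactorRatio W H θ := by
  rw [cofactorRatio_eq hW hH hθ hpos]
  exact selfAdjointNorm_nonneg _

theorem distortionFactor_nonneg (hr : 1 ≤ r) (hH : H.PosDef) (hc : IsHermitianTensor H c)
    (hW : (traceForm c).PosDef) (s : ℝ) {t : ℝ} (h : IsPositive H (twist t c) P) :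
    0 ≤ distortionFactor P s t H c := by
  have hθ := hc.twist hH t
  cases P with
  | nakano => exact mul_nonneg (by positivity) (cofactorRatio_nonneg hW hH hθ h)
  | dualNakano =>
    exact mul_nonneg (by positivity)
      (cofactorRatio_nonneg hW (dualMetric_posDef hH) (hθ.dual hH) h)
  | griffiths =>
    refine mul_nonneg (inv_nonneg.2 (integral_inv_topPower_pos hr hH hθ h s).le)
      (integral_nonneg_of_ae ?_)
    filter_upwards [ae_sphereMeasure fun v hv => normSqOf_pos hH hv] with v hv
    have hα := vectorForm_posDef hθ h (ne_zero_of_normSqOf_eq_one hv)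
    exact div_nonneg (mixedPower_nonneg hα hW.posSemidef)
      (Real.rpow_pos_of_pos (topPower_pos hα) _).le

theorem distortionAt_nonneg (hr : 1 ≤ r) (hH : H.PosDef) (hc : IsHermitianTensor H c)
    (hW : (traceForm c).PosDef) (s : ℝ) {t : ℝ} (h : IsPositive H (twist t c) P) :
    0 ≤ distortionAt s t H c P := by
  rw [distortionAt_eq]
  have h1 := Real.sqrt_nonneg ((n : ℝ) - 1)
  exact mul_nonneg (mul_nonneg (by positivity) (selfAdjointNorm_nonneg _))
    (distortionFactor_nonneg hr hH hc hW s h)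

theorem selfAdjointNorm_transpose (S : Matrix (Fin r) (Fin r) ℂ) :
    selfAdjointNorm Sᵀ = selfAdjointNorm S := by
  rw [selfAdjointNorm, selfAdjointNorm, ← Matrix.transpose_mul, Matrix.trace_transpose]

theorem abs_logFunctional_le (hr : 1 ≤ r) (hH : H.PosDef) (hc : IsHermitianTensor H c)
    (hW : (traceForm c).PosDef) (s : ℝ) {t : ℝ} (h : IsPositive H (twist t c) P) (p : Fin n → ℂ)
    {S : Matrix (Fin r) (Fin r) ℂ} (hS : (H * S).IsHermitian) :
    |logFunctional P s H (twist t c) p S| ≤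
      (star p ⬝ᵥ (traceForm c)⁻¹ *ᵥ p).re * selfAdjointNorm S * distortionFactor P s t H c := by
  have hθ := hc.twist hH t
  cases P with
  | nakano =>
    refine (abs_nakanoFunctional_le hW hH hθ h p hS).trans_eq ?_
    simp only [distortionFactor]
    ring
  | dualNakano =>
    -- A single endomorphism is viewed as a constant tensor in dimension one, so that the duality of
    -- hermitian tensors applies.
    have hS' : (dualMetric H * Sᵀ).IsHermitian :=
      IsHermitianTensor.dual (n := 1) (c := fun _ _ => S) hH (fun _ _ => hS) 0 0
    refine (abs_nakanoFunctional_le hW (dualMetric_posDef hH) (hθ.dual hH) h p hS').trans_eq ?_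
    simp only [distortionFactor, selfAdjointNorm_transpose]
    ring
  | griffiths => exact abs_griffithsFunctional_le hr hH hW hθ h s p hS

/-- The coefficient that decides the invertibility of the symbol is positive. -/
theorem symbol_coefficient_pos (hr : 1 ≤ r) (hH : H.PosDef) (hc : IsHermitianTensor H c)
    (hW : (traceForm c).PosDef) (s : ℝ) {t β : ℝ} (ht : 0 < 1 + r * t)
    (h : IsPositive H (twist t c) P) (hβ : distortionAt s t H c P < β) {p : Fin n → ℂ}
    (hp : p ≠ 0) :
    0 < β * (star p ⬝ᵥ (traceForm c)⁻¹ *ᵥ p).re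
      + (1 / r + t) * logFunctional P s H (twist t c) p 1
      + logFunctional P s H (twist t c) p (contraction ((traceForm c)⁻¹ *ᵥ p) (traceFree c))
        / (star p ⬝ᵥ (traceForm c)⁻¹ *ᵥ p).re := by
  set N := (star p ⬝ᵥ (traceForm c)⁻¹ *ᵥ p).re with hN
  have hNpos : 0 < N := (Complex.lt_def.1 (hW.inv.dotProduct_mulVec_pos hp)).1
  have hrR : (0 : ℝ) < r := by exact_mod_cast hr
  have hfree : IsHermitianTensor H (traceFree c) := hc.twist hH _
  set C := contraction ((traceForm c)⁻¹ *ᵥ p) (traceFree c) with hC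
  have hCh : (H * C).IsHermitian := isHermitian_contraction hfree _
  have h1 := abs_logFunctional_le hr hH hc hW s h p hCh
  have h2 := selfAdjointNorm_contraction_le hW hH p hfree
  have hD := distortionFactor_nonneg hr hH hc hW s h
  set D := distortionFactor P s t H c
  set R := selfAdjointNorm (repEndo (traceForm c) H (traceFree c)) with hR
  have hR0 : 0 ≤ R := selfAdjointNorm_nonneg _
  -- Of the constant √(n-1)+1 only the bound ≥ 1 is needed.
  have h3 : R * D ≤ distortionAt s t H c P := by
    rw [distortionAt_eq, mul_assoc]
    have h4 := Real.sqrt_nonneg ((n : ℝ) - 1)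
    exact le_mul_of_one_le_left (mul_nonneg hR0 hD) (by linarith)
  -- The functional at C is at least -N|C|D, and |C| ≤ NR; one division by N leaves a bound linear
  -- in N, comparable with βN.
  have h5 : -(N * (R * D)) ≤ logFunctional P s H (twist t c) p C / N := by
    rw [le_div_iff₀ hNpos]
    have h6 : N * selfAdjointNorm C * D ≤ N * (N * R) * D :=
      mul_le_mul_of_nonneg_right (mul_le_mul_of_nonneg_left h2 hNpos.le) hD
    have h7 := (abs_le.1 h1).1
    nlinarith
  have h8 : 0 ≤ (1 / r + t) * logFunctional P s H (twist t c) p 1 := by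
    refine mul_nonneg ?_ (logFunctional_one_nonneg hr hH (hc.twist hH t) h s p)
    have : 1 / (r : ℝ) + t = (1 + r * t) / r := by field_simp
    rw [this]
    exact (div_pos ht hrR).le
  have h9 : N * (R * D) < β * N := by
    rw [mul_comm β]
    exact mul_lt_mul_of_pos_left (h3.trans_lt hβ) hNpos
  linarith

end DistortionBound

/-! ### Continuity of the distortion in the metric and the curvature -/

section DistortionContinuity

variable {n r : ℕ} {H : Matrix (Fin r) (Fin r) ℂ} {c : Fin n → Fin n → Matrix (Fin r) (Fin r) ℂ}
  {P : PositivityType}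

theorem continuous_selfAdjointNorm {ι : Type*} [Fintype ι] :
    Continuous (selfAdjointNorm (ι := ι)) := by
  unfold selfAdjointNorm
  exact Real.continuous_sqrt.comp (Complex.continuous_re.comp
    ((continuous_id.matrix_mul continuous_id).matrix_trace))

theorem contDiffAt_repEndo {V : Type*} [NormedAddCommGroup V] [NormedSpace ℝ V]
    {k : WithTop ℕ∞} {w : V → Matrix (Fin n) (Fin n) ℂ} {f : V → Matrix (Fin r) (Fin r) ℂ}
    {g : V → Fin n → Fin n → Matrix (Fin r) (Fin r) ℂ} {x : V} (hw : ContDiffAt ℝ k w x)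
    (hf : ContDiffAt ℝ k f x) (hg : ContDiffAt ℝ k g x) (hd : IsUnit (gram (w x) (f x)).det) :
    ContDiffAt ℝ k (fun y => repEndo (w y) (f y) (g y)) x := by
  refine contDiffAt_matrix_mul (contDiffAt_matrix_inv ?_ hd) (contDiffAt_formMatrix hf hg)
  rw [contDiffAt_matrix_iff] at hw hf ⊢
  exact fun a b => (hw b.1 a.1).mul (hf a.2 b.2)

theorem continuousAt_cofactorRatio {V : Type*} [NormedAddCommGroup V] [NormedSpace ℝ V]
    {w : V → Matrix (Fin n) (Fin n) ℂ} {f : V → Matrix (Fin r) (Fin r) ℂ}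
    {g : V → Fin n → Fin n → Matrix (Fin r) (Fin r) ℂ} {x : V} (hw : ContDiffAt ℝ 0 w x)
    (hf : ContDiffAt ℝ 0 f x) (hg : ContDiffAt ℝ 0 g x) (hW : (w x).PosDef) (hH : (f x).PosDef)
    (hθ : IsHermitianTensor (f x) (g x)) (hpos : IsPositive (f x) (g x) .nakano) :
    ContinuousAt (fun y => cofactorRatio (w y) (f y) (g y)) x := by
  have hG := gram_posDef hW hH
  have h1 := contDiffAt_repEndo hw hf hg (isUnit_det_of_posDef hG)
  have hd : 0 < (repEndo (w x) (f x) (g x)).det := by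
    rw [repEndo, Matrix.det_mul]
    exact mul_pos hG.inv.det_pos (formMatrix_posDef hθ hpos).det_pos
  refine ContinuousAt.div₀ ?_ (contDiffAt_re (contDiffAt_matrix_det h1)).continuousAt
    (Complex.lt_def.1 hd).1.ne'
  exact continuous_selfAdjointNorm.continuousAt.comp (contDiffAt_matrix_adjugate h1).continuousAt

theorem continuousAt_distortionFactor (hr : 1 ≤ r) (hH : H.PosDef) (hc : IsHermitianTensor H c)
    (hW : (traceForm c).PosDef) (s : ℝ) {t : ℝ} (h : IsPositive H (twist t c) P) :
    ContinuousAt (fun x : Matrix (Fin r) (Fin r) ℂ ×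
      (Fin n → Fin n → Matrix (Fin r) (Fin r) ℂ) => distortionFactor P s t x.1 x.2) (H, c) := by
  have h1 : ContDiffAt ℝ 0 (fun x : Matrix (Fin r) (Fin r) ℂ ×
      (Fin n → Fin n → Matrix (Fin r) (Fin r) ℂ) => x.1) (H, c) := contDiffAt_fst
  have h2 : ContDiffAt ℝ 0 (fun x : Matrix (Fin r) (Fin r) ℂ ×
      (Fin n → Fin n → Matrix (Fin r) (Fin r) ℂ) => x.2) (H, c) := contDiffAt_snd
  have h3 := contDiffAt_twist h2 t
  have h4 := contDiffAt_traceForm h2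
  have hθ := hc.twist hH t
  cases P with
  | nakano =>
    exact continuousAt_const.mul (continuousAt_cofactorRatio h4 h1 h3 hW hH hθ h)
  | dualNakano =>
    have h5 : ContDiffAt ℝ 0 (fun x : Matrix (Fin r) (Fin r) ℂ ×
      (Fin n → Fin n → Matrix (Fin r) (Fin r) ℂ) =>
      (dualMetric x.1, transposeTensor (twist t x.2))) (H, c) :=
      ContDiffAt.comp (H, c) (f := fun x : Matrix (Fin r) (Fin r) ℂ ×
        (Fin n → Fin n → Matrix (Fin r) (Fin r) ℂ) => (x.1, twist t x.2))
        (g := fun x : Matrix (Fin r) (Fin r) ℂ × (Fin n → Fin n → Matrix (Fin r) (Fin r) ℂ) =>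
          (dualMetric x.1, transposeTensor x.2))
        (contDiffAt_dualPair (isUnit_det_of_posDef hH)) (h1.prodMk h3)
    exact continuousAt_const.mul (continuousAt_cofactorRatio h4 h5.fst h5.snd hW
      (dualMetric_posDef hH) (hθ.dual hH) h)
  | griffiths =>
    have h5 : ContinuousAt (fun x : Matrix (Fin r) (Fin r) ℂ ×
        (Fin n → Fin n → Matrix (Fin r) (Fin r) ℂ) => (x.1, twist t x.2)) (H, c) :=
      (h1.prodMk h3).continuousAt
    have h6 := (differentiableAt_integral_inv_topPower hr hH hθ h s).continuousAt
    have h7 := continuousAt_integral_mixedPower hr hH hθ h (s + 1) (traceForm c)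
    have h8 := (ContinuousAt.comp (x := (H, c)) (f := fun x : Matrix (Fin r) (Fin r) ℂ ×
        (Fin n → Fin n → Matrix (Fin r) (Fin r) ℂ) => (x.1, twist t x.2)) h6 h5).inv₀
        (integral_inv_topPower_pos hr hH hθ h s).ne'
    exact h8.mul (ContinuousAt.comp (x := (H, c)) (f := fun x : Matrix (Fin r) (Fin r) ℂ ×
        (Fin n → Fin n → Matrix (Fin r) (Fin r) ℂ) => ((x.1, twist t x.2), traceForm x.2)) h7
        (h5.prodMk h4.continuousAt))

theorem continuousAt_distortionAt (hr : 1 ≤ r) (hH : H.PosDef) (hc : IsHermitianTensor H c)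
    (hW : (traceForm c).PosDef) (s : ℝ) {t : ℝ} (h : IsPositive H (twist t c) P) :
    ContinuousAt (fun x : Matrix (Fin r) (Fin r) ℂ ×
      (Fin n → Fin n → Matrix (Fin r) (Fin r) ℂ) => distortionAt s t x.1 x.2 P) (H, c) := by
  have h1 : ContDiffAt ℝ 0 (fun x : Matrix (Fin r) (Fin r) ℂ ×
      (Fin n → Fin n → Matrix (Fin r) (Fin r) ℂ) => x.1) (H, c) := contDiffAt_fst
  have h2 : ContDiffAt ℝ 0 (fun x : Matrix (Fin r) (Fin r) ℂ ×
      (Fin n → Fin n → Matrix (Fin r) (Fin r) ℂ) => x.2) (H, c) := contDiffAt_snd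
  simp only [distortionAt_eq]
  refine (continuousAt_const.mul (continuous_selfAdjointNorm.continuousAt.comp ?_)).mul
    (continuousAt_distortionFactor hr hH hc hW s h)
  exact (contDiffAt_repEndo (contDiffAt_traceForm h2) h1 (contDiffAt_twist h2 _)
    (isUnit_det_of_posDef (gram_posDef hW hH))).continuousAt

end DistortionContinuity

/-! ### Derivatives of products and inverses of matrix curves -/

section InverseCalculus

variable {ι : Type*} [Fintype ι] [DecidableEq ι]

theorem hasDerivAt_matrix_iff {f : ℝ → Matrix ι ι ℂ} {f' : Matrix ι ι ℂ} {x : ℝ} :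
    HasDerivAt f f' x ↔ ∀ i j, HasDerivAt (fun y => f y i j) (f' i j) x := by
  constructor
  · intro h i j
    exact hasDerivAt_pi.1 (hasDerivAt_pi.1 h i) j
  · intro h
    exact hasDerivAt_pi.2 fun i => hasDerivAt_pi.2 fun j => h i j

theorem hasDerivAt_matrix_mul {f g : ℝ → Matrix ι ι ℂ} {f' g' : Matrix ι ι ℂ} {x : ℝ}
    (hf : HasDerivAt f f' x) (hg : HasDerivAt g g' x) :
    HasDerivAt (fun y => f y * g y) (f' * g x + f x * g') x := by
  rw [hasDerivAt_matrix_iff] at hf hg ⊢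
  intro i j
  have h := HasDerivAt.fun_sum (u := Finset.univ)
    fun (k : ι) _ => (hf i k).mul (hg k j)
  simp only [Matrix.add_apply, Matrix.mul_apply, ← Finset.sum_add_distrib]
  exact h

/-- Differentiability comes from the cofactor formula; the value then follows by differentiating f
f⁻¹ = 1, valid near x. -/
theorem hasDerivAt_matrix_inv {f : ℝ → Matrix ι ι ℂ} {f' : Matrix ι ι ℂ} {x : ℝ}
    (hf : HasDerivAt f f' x) (hx : IsUnit (f x).det) :
    HasDerivAt (fun y => (f y)⁻¹) (-((f x)⁻¹ * f' * (f x)⁻¹)) x := by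
  have hdet : ∀ᶠ y in 𝓝 x, IsUnit (f y).det := by
    have h1 : ContinuousAt (fun y => (f y).det) x :=
      (Continuous.matrix_det continuous_id).continuousAt.comp hf.continuousAt
    filter_upwards [h1.eventually_ne hx.ne_zero] with y hy using hy.isUnit
  have h1 : DifferentiableAt ℝ (fun y => (f y)⁻¹) x := by
    have h2 : ContDiffAt ℝ 1 (fun M : Matrix ι ι ℂ => M⁻¹) (f x) :=
      contDiffAt_matrix_inv contDiffAt_id hx
    exact (h2.differentiableAt one_ne_zero).comp x hf.differentiableAt
  have h3 := hasDerivAt_matrix_mul hf h1.hasDerivAt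
  have h4 : HasDerivAt (fun y => f y * (f y)⁻¹) 0 x := by
    refine (hasDerivAt_const x (1 : Matrix ι ι ℂ)).congr_of_eventuallyEq ?_
    filter_upwards [hdet] with y hy using Matrix.mul_nonsing_inv _ hy
  have h5 := h3.unique h4
  have h6 : deriv (fun y => (f y)⁻¹) x = -((f x)⁻¹ * f' * (f x)⁻¹) := by
    have h7 : (f x)⁻¹ * (f' * (f x)⁻¹ + f x * deriv (fun y => (f y)⁻¹) x) = 0 :=
      (congrArg ((f x)⁻¹ * ·) h5).trans (Matrix.mul_zero _)
    rw [Matrix.mul_add, ← Matrix.mul_assoc, ← Matrix.mul_assoc, Matrix.nonsing_inv_mul _ hx,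
      Matrix.one_mul] at h7
    exact eq_neg_of_add_eq_zero_right h7
  exact h6 ▸ h1.hasDerivAt

end InverseCalculus

/-! ### The left-hand side at a point and its derivative in rank one directions -/

section PointOperator

variable {n r : ℕ} {H : Matrix (Fin r) (Fin r) ℂ} {c : Fin n → Fin n → Matrix (Fin r) (Fin r) ℂ}
  {P : PositivityType}

/-- The left-hand side of the system, as a function of the metric and the curvature at a point
where the volume form has the coefficient `o`. -/
def pointOperator (P : PositivityType) (s t β o : ℝ)
    (x : Matrix (Fin r) (Fin r) ℂ × (Fin n → Fin n → Matrix (Fin r) (Fin r) ℂ)) :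
    ℝ × Matrix (Fin r) (Fin r) ℂ :=
  ((topPower (traceForm x.2) / o) ^ β * o⁻¹ * phi s x.1 (YangMills.twist t x.2) P,
    hermiteEinstein x.2)

theorem twist_rankOneTensor (t : ℝ) (p : Fin n → ℂ) (S : Matrix (Fin r) (Fin r) ℂ) :
    YangMills.twist t (rankOneTensor p S)
      = rankOneTensor p (S + ((t : ℂ) * S.trace) • (1 : Matrix (Fin r) (Fin r) ℂ)) := by
  funext j k
  simp only [YangMills.twist, rankOneTensor, Matrix.trace_smul, smul_add, smul_smul, smul_eq_mul]
  congr 2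
  ring

theorem traceForm_rankOneTensor (p : Fin n → ℂ) (S : Matrix (Fin r) (Fin r) ℂ) :
    traceForm (rankOneTensor p S) = S.trace • Matrix.vecMulVec p (star p) := by
  ext j k
  simp [traceForm, rankOneTensor, Matrix.vecMulVec, mul_comm]

theorem traceForm_sub_smul (ε : ℝ) (R : Fin n → Fin n → Matrix (Fin r) (Fin r) ℂ) :
    traceForm (c - ε • R) = traceForm c - (ε : ℂ) • traceForm R := by
  ext j k
  simp [traceForm, Matrix.trace_sub, Matrix.trace_smul]

theorem twist_sub_smul (t ε : ℝ) (R : Fin n → Fin n → Matrix (Fin r) (Fin r) ℂ) :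
    YangMills.twist t (c - ε • R) = YangMills.twist t c - ε • YangMills.twist t R := by
  funext j k
  ext a b
  simp [YangMills.twist, Matrix.trace_sub, Matrix.trace_smul]
  ring

theorem differentiableAt_pointOperator (hr : 1 ≤ r) (hH : H.PosDef) (hc : IsHermitianTensor H c)
    (hW : (traceForm c).PosDef) {s t β o : ℝ} (ho : 0 < o)
    (h : IsPositive H (YangMills.twist t c) P) :
    DifferentiableAt ℝ (pointOperator P s t β o) (H, c) := by
  have h1 : ContDiffAt ℝ 1 (fun x : Matrix (Fin r) (Fin r) ℂ ×
      (Fin n → Fin n → Matrix (Fin r) (Fin r) ℂ) => x.1) (H, c) := contDiffAt_fst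
  have h2 : ContDiffAt ℝ 1 (fun x : Matrix (Fin r) (Fin r) ℂ ×
      (Fin n → Fin n → Matrix (Fin r) (Fin r) ℂ) => x.2) (H, c) := contDiffAt_snd
  have hWd := contDiffAt_traceForm h2
  have h3 : DifferentiableAt ℝ (fun x : Matrix (Fin r) (Fin r) ℂ ×
      (Fin n → Fin n → Matrix (Fin r) (Fin r) ℂ) => (topPower (traceForm x.2) / o) ^ β * o⁻¹)
      (H, c) := by
    have h4 := (contDiffAt_topPower hWd).differentiableAt one_ne_zero
    exact ((h4.mul_const o⁻¹).rpow_const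
      (Or.inl (mul_pos (topPower_pos hW) (inv_pos.2 ho)).ne')).mul_const _
  have h5 : DifferentiableAt ℝ (fun x : Matrix (Fin r) (Fin r) ℂ ×
      (Fin n → Fin n → Matrix (Fin r) (Fin r) ℂ) => phi s x.1 (YangMills.twist t x.2) P)
      (H, c) := by
    have h6 := differentiableAt_phi hr hH (hc.twist hH t) h s
    have h7 := (h1.prodMk (contDiffAt_twist h2 t)).differentiableAt one_ne_zero
    exact DifferentiableAt.comp (g := fun x : Matrix (Fin r) (Fin r) ℂ ×
      (Fin n → Fin n → Matrix (Fin r) (Fin r) ℂ) => phi s x.1 x.2 P)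
      (f := fun x : Matrix (Fin r) (Fin r) ℂ ×
      (Fin n → Fin n → Matrix (Fin r) (Fin r) ℂ) => (x.1, YangMills.twist t x.2)) (H, c) h6 h7
  have h8 : ContDiffAt ℝ 1 (fun x : Matrix (Fin r) (Fin r) ℂ ×
      (Fin n → Fin n → Matrix (Fin r) (Fin r) ℂ) => hermiteEinstein x.2) (H, c) := by
    have h9 := contDiffAt_matrix_iff.1 (contDiffAt_matrix_inv hWd (isUnit_det_of_posDef hW))
    have h10 := fun j k => contDiffAt_matrix_iff.1 (contDiffAt_pi.1 (contDiffAt_pi.1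
      (contDiffAt_twist h2 (-(1 / (r : ℝ)))) j) k)
    rw [contDiffAt_matrix_iff]
    intro a b
    simp only [hermiteEinstein, Matrix.smul_apply, Matrix.sum_apply, smul_eq_mul]
    exact contDiffAt_const.mul (ContDiffAt.sum fun j _ => ContDiffAt.sum fun k _ =>
      (h9 k j).mul (h10 j k a b))
  exact (h3.mul h5).prodMk (h8.differentiableAt one_ne_zero)

theorem trace_inv_mul_vecMulVec (W : Matrix (Fin n) (Fin n) ℂ) (p : Fin n → ℂ) :
    (W⁻¹ * Matrix.vecMulVec p (star p)).trace = star p ⬝ᵥ W⁻¹ *ᵥ p := by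
  rw [Matrix.mul_vecMulVec, Matrix.trace_vecMulVec, dotProduct_comm]

theorem inv_mul_vecMulVec_mul_inv {W : Matrix (Fin n) (Fin n) ℂ} (hW : W.IsHermitian)
    (p : Fin n → ℂ) (j k : Fin n) :
    (W⁻¹ * Matrix.vecMulVec p (star p) * W⁻¹) k j
      = star ((W⁻¹ *ᵥ p) j) * (W⁻¹ *ᵥ p) k := by
  have h : star p ᵥ* W⁻¹ = star (W⁻¹ *ᵥ p) := by
    rw [Matrix.star_mulVec, hW.inv.eq]
  rw [Matrix.mul_vecMulVec, Matrix.vecMulVec_mul, h, Matrix.vecMulVec_apply, mul_comm]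
  rfl

theorem mixedPower_smul_vecMulVec {W : Matrix (Fin n) (Fin n) ℂ} (hW : W.PosDef) (p : Fin n → ℂ)
    (a : ℝ) : mixedPower W (((a : ℝ) : ℂ) • Matrix.vecMulVec p (star p))
      = topPower W * (a * (star p ⬝ᵥ W⁻¹ *ᵥ p).re) := by
  have hdet : W.det = (W.det.re : ℂ) :=
    Complex.ext (by simp) (by simpa using (Complex.lt_def.1 hW.det_pos).2.symm)
  rw [mixedPower_smul, mixedPower, trace_adjugate_mul (isUnit_det_of_posDef hW),
    trace_inv_mul_vecMulVec, hdet, Complex.re_ofReal_mul, topPower]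
  ring

/-- Along the path, ω moves by -ετ p p* with τ = tr S. Hence log ω^n has derivative -τN, the inverse
of ω has derivative τ ω⁻¹p p*ω⁻¹, and Θ° has derivative -p ⊗ p̄ ⊗ (S - τ/r). The product rule
combines them: the moving inverse yields the contraction of Θ°, the moving Θ° yields N. Realness of
tr S keeps τ a real parameter. -/
theorem hasDerivAt_pointOperator (hr : 1 ≤ r) (hH : H.PosDef) (hc : IsHermitianTensor H c)
    (hW : (traceForm c).PosDef) {s t β o : ℝ} (hs : 0 < s) (ho : 0 < o)
    (h : IsPositive H (YangMills.twist t c) P) (p : Fin n → ℂ) {S : Matrix (Fin r) (Fin r) ℂ}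
    (hS : ((S.trace.re : ℝ) : ℂ) = S.trace) :
    HasDerivAt (fun ε : ℝ => pointOperator P s t β o (H, c - ε • rankOneTensor p S))
      (-((pointOperator P s t β o (H, c)).1 * (β * (star p ⬝ᵥ (traceForm c)⁻¹ *ᵥ p).re * S.trace.re
          + logFunctional P s H (YangMills.twist t c) p
            (S + ((t : ℂ) * S.trace) • (1 : Matrix (Fin r) (Fin r) ℂ)))),
        (1 / (n : ℝ)) • (S.trace.re • contraction ((traceForm c)⁻¹ *ᵥ p) (traceFree c)
          - (star p ⬝ᵥ (traceForm c)⁻¹ *ᵥ p).re •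
            (S - (S.trace.re / r) • (1 : Matrix (Fin r) (Fin r) ℂ)))) 0 := by
  set W := traceForm c with hWdef
  set N := (star p ⬝ᵥ W⁻¹ *ᵥ p).re with hN
  set τ := S.trace.re with hτ
  have hWu := isUnit_det_of_posDef hW
  have hpath : ∀ ε : ℝ, traceForm (c - ε • rankOneTensor p S)
      = W + (ε : ℂ) • (((-τ : ℝ) : ℂ) • Matrix.vecMulVec p (star p)) := fun ε => by
    rw [traceForm_sub_smul, traceForm_rankOneTensor, ← hS, sub_eq_add_neg, Complex.ofReal_neg,
      neg_smul, smul_neg]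
  have htop : HasDerivAt (fun ε : ℝ => topPower (traceForm (c - ε • rankOneTensor p S)))
      (topPower W * (-τ * N)) 0 := by
    simp only [hpath]
    rw [← mixedPower_smul_vecMulVec hW]
    exact hasDerivAt_topPower_add_smul hWu _
  have hT := topPower_pos hW
  have h0 : traceForm (c - (0 : ℝ) • rankOneTensor p S) = W := by rw [zero_smul, sub_zero]
  have h0' : YangMills.twist t (c - (0 : ℝ) • rankOneTensor p S) = YangMills.twist t c := by
    rw [zero_smul, sub_zero]
  refine HasDerivAt.prodMk ?_ ?_
  · have h1 : HasDerivAt (fun ε : ℝ =>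
        (topPower (traceForm (c - ε • rankOneTensor p S)) / o) ^ β)
        (topPower W * (-τ * N) / o * β * (topPower W / o) ^ (β - 1)) 0 := by
      have := (htop.div_const o).rpow_const (p := β) (Or.inl (by rw [h0]; positivity))
      rwa [h0] at this
    have h2 : HasDerivAt (fun ε : ℝ => phi s H (YangMills.twist t (c - ε • rankOneTensor p S)) P)
        (phi s H (YangMills.twist t c) P * logFunctional P s H (YangMills.twist t c) p
          (-(S + ((t : ℂ) * S.trace) • (1 : Matrix (Fin r) (Fin r) ℂ)))) 0 := by
      refine (hasDerivAt_phi hr hH (hc.twist hH t) h hs p _).congr_of_eventuallyEq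
        (Filter.Eventually.of_forall fun ε => ?_)
      have : YangMills.twist t (c - ε • rankOneTensor p S) = YangMills.twist t c + ε •
          rankOneTensor p (-(S + ((t : ℂ) * S.trace) • (1 : Matrix (Fin r) (Fin r) ℂ))) := by
        rw [twist_sub_smul, twist_rankOneTensor, sub_eq_add_neg, ← smul_neg]
        congr 2
        funext j k
        simp [rankOneTensor]
      show phi s H _ P = phi s H _ P
      rw [this]
    obtain ⟨l, hl⟩ := exists_logFunctional_eq hr hH (hc.twist hH t) h hs p
    refine ((h1.mul_const o⁻¹).mul h2).congr_deriv ?_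
    rw [h0, h0', ← hl, ← hl, map_neg]
    -- One factor of the power is split off so that the scalar value itself appears as a common
    -- factor of the derivative.
    have h3 : (topPower W / o) ^ β = (topPower W / o) ^ (β - 1) * (topPower W / o) := by
      rw [← Real.rpow_add_one (by positivity), sub_add_cancel]
    show _ = -((topPower W / o) ^ β * o⁻¹ * phi s H (YangMills.twist t c) P * _)
    rw [h3]
    ring
  · have hinv : HasDerivAt (fun ε : ℝ => (traceForm (c - ε • rankOneTensor p S))⁻¹)
        (τ • (W⁻¹ * Matrix.vecMulVec p (star p) * W⁻¹)) 0 := by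
      have h1 : HasDerivAt (fun ε : ℝ => traceForm (c - ε • rankOneTensor p S))
          (((-τ : ℝ) : ℂ) • Matrix.vecMulVec p (star p)) 0 := by
        simp only [hpath]
        have := ((hasDerivAt_id (0 : ℝ)).smul_const
          (((-τ : ℝ) : ℂ) • Matrix.vecMulVec p (star p))).const_add W
        rw [one_smul] at this
        exact this
      have h2 := hasDerivAt_matrix_inv h1 (by rw [h0]; exact hWu)
      refine h2.congr_deriv ?_
      rw [h0, Matrix.mul_smul, Matrix.smul_mul, ← neg_smul, ← Complex.ofReal_neg, neg_neg]
      rfl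
    refine hasDerivAt_matrix_iff.2 fun a b => ?_
    have hfree : ∀ j k, HasDerivAt (fun ε : ℝ => traceFree (c - ε • rankOneTensor p S) j k a b)
        (-((p j * star (p k)) * (S - (τ / r) • (1 : Matrix (Fin r) (Fin r) ℂ)) a b)) 0 := by
      intro j k
      have h1 : ∀ ε : ℝ, traceFree (c - ε • rankOneTensor p S) j k a b = traceFree c j k a b
          + (ε : ℂ) * (-((p j * star (p k)) *
            (S - (τ / r) • (1 : Matrix (Fin r) (Fin r) ℂ)) a b)) := by
        intro ε
        rw [traceFree, traceFree, twist_sub_smul, twist_rankOneTensor, ← hS]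
        simp [rankOneTensor]
        ring
      simp only [h1]
      have := (((hasDerivAt_id (0 : ℝ)).ofReal_comp).mul_const (-((p j * star (p k)) *
            (S - (τ / r) • (1 : Matrix (Fin r) (Fin r) ℂ)) a b))).const_add (traceFree c j k a b)
      simpa using this
    have h3 := fun j k => (hasDerivAt_matrix_iff.1 hinv k j).mul (hfree j k)
    have h4 := (HasDerivAt.fun_sum (u := Finset.univ) fun j _ =>
      HasDerivAt.fun_sum (u := Finset.univ) fun k _ => h3 j k).const_mul (1 / (n : ℂ))
    simp only [hermiteEinstein, Matrix.smul_apply, Matrix.sum_apply, smul_eq_mul]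
    refine h4.congr_deriv ?_
    rw [h0]
    have h5 : traceFree (c - (0 : ℝ) • rankOneTensor p S) = traceFree c := by
      rw [zero_smul, sub_zero]
    rw [h5]
    -- The contraction of p ⊗ p̄ with ω is N, whence the coefficient of the trace free part of S.
    have h6 : ∑ j, ∑ k, W⁻¹ k j * (p j * star (p k)) = (N : ℂ) := by
      rw [hN, ofReal_re_dotProduct_inv hW, Finset.sum_comm]
      simp only [dotProduct, Matrix.mulVec, Finset.mul_sum, Pi.star_apply]
      exact Finset.sum_congr rfl fun j _ => Finset.sum_congr rfl fun k _ => by ring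
    have h7 : ∀ j k, (τ • (W⁻¹ * Matrix.vecMulVec p (star p) * W⁻¹)) k j
        = (τ : ℂ) * (star ((W⁻¹ *ᵥ p) j) * (W⁻¹ *ᵥ p) k) := fun j k => by
      rw [Matrix.smul_apply, inv_mul_vecMulVec_mul_inv hW.1, Complex.real_smul]
    simp only [h7, Finset.sum_add_distrib, Matrix.sub_apply, Matrix.smul_apply, Complex.real_smul,
      contraction, Matrix.sum_apply, smul_eq_mul]
    rw [← h6]
    push_cast
    simp only [Finset.mul_sum, Finset.sum_mul]
    refine congrArg _ ?_
    rw [← Finset.sum_add_distrib, ← Finset.sum_sub_distrib]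
    refine Finset.sum_congr rfl fun j _ => ?_
    rw [← Finset.sum_add_distrib, ← Finset.sum_sub_distrib]
    exact Finset.sum_congr rfl fun k _ => by ring

/-- Ellipticity at a point: the derivative of the operator in the directions
`-p ⊗ p̄ ⊗ H⁻¹ w` of the curvature defines a bijective symbol. -/
theorem bijOn_fderiv_pointOperator (hr : 1 ≤ r) (hH : H.PosDef) (hc : IsHermitianTensor H c)
    (hW : (traceForm c).PosDef) {s t β o : ℝ} (hs : 0 < s) (ht : 0 < 1 + r * t) (ho : 0 < o)
    (h : IsPositive H (YangMills.twist t c) P) (hβ : distortionAt s t H c P < β) {p : Fin n → ℂ}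
    (hp : p ≠ 0) :
    Set.BijOn (fun w : Matrix (Fin r) (Fin r) ℂ => fderiv ℝ (pointOperator P s t β o) (H, c)
        (0, -rankOneTensor p (H⁻¹ * w)))
      {w | w.IsHermitian} (Set.univ ×ˢ traceFreeHermitian H) := by
  -- A nonzero covector exists only in positive dimension, so the factor 1/n in the system is
  -- meaningful.
  have hn : 1 ≤ n := by
    rcases Nat.eq_zero_or_pos n with h0 | h0
    · subst h0; exact absurd (Subsingleton.elim p 0) hp
    · exact h0
  obtain ⟨l, hl⟩ := exists_logFunctional_eq hr hH (hc.twist hH t) h hs p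
  have hK := symbol_coefficient_pos hr hH hc hW s ht h hβ hp
  rw [← hl, ← hl] at hK
  have hfree : IsHermitianTensor H (traceFree c) := hc.twist hH _
  have hQ : 0 < (pointOperator P s t β o (H, c)).1 :=
    mul_pos (mul_pos (Real.rpow_pos_of_pos (div_pos (topPower_pos hW) ho) _) (inv_pos.2 ho))
      (phi_pos hr hH (hc.twist hH t) h s)
  refine bijOn_symbol hn hr hH (C := contraction ((traceForm c)⁻¹ *ᵥ p) (traceFree c))
    ⟨trace_contraction_traceFree hr c _, isHermitian_contraction hfree _⟩
    (Complex.lt_def.1 (hW.inv.dotProduct_mulVec_pos hp)).1 hQ l hK _ fun w hw => ?_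
  have hS := trace_inv_mul_re hH hw
  have h1 := hasDerivAt_pointOperator hr hH hc hW (β := β) hs ho h p hS
  have h2 : HasDerivAt (fun ε : ℝ => ((H, c - ε • rankOneTensor p (H⁻¹ * w)) :
      Matrix (Fin r) (Fin r) ℂ × (Fin n → Fin n → Matrix (Fin r) (Fin r) ℂ)))
      (0, -rankOneTensor p (H⁻¹ * w)) 0 := by
    refine (hasDerivAt_const (0 : ℝ) H).prodMk ?_
    simpa using ((hasDerivAt_id (0 : ℝ)).smul_const (rankOneTensor p (H⁻¹ * w))).const_sub c
  have h3 : HasFDerivAt (pointOperator P s t β o) (fderiv ℝ (pointOperator P s t β o) (H, c))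
      (H, c - (0 : ℝ) • rankOneTensor p (H⁻¹ * w)) := by
    rw [zero_smul, sub_zero]
    exact (differentiableAt_pointOperator hr hH hc hW ho h).hasFDerivAt
  -- The abstract derivative of the operator and the explicit one along the same path coincide by
  -- uniqueness.
  have h4 := (HasFDerivAt.comp_hasDerivAt (l := pointOperator P s t β o)
    (f := fun ε : ℝ => (H, c - ε • rankOneTensor p (H⁻¹ * w))) (0 : ℝ) h3 h2).unique h1
  rw [← hl, ← hS, map_add] at h4
  have h5 : ((t : ℂ) * (((H⁻¹ * w).trace.re : ℝ) : ℂ)) • (1 : Matrix (Fin r) (Fin r) ℂ)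
      = (t * (H⁻¹ * w).trace.re) • (1 : Matrix (Fin r) (Fin r) ℂ) := by
    rw [← Complex.ofReal_mul]
    rfl
  rw [h5, map_smul, smul_eq_mul] at h4
  refine h4.trans (Prod.ext ?_ rfl)
  show -(_ * _) = -(_ * _)
  simp only [Complex.ofReal_re]
  ring

end PointOperator

/-! ### Fréchet derivatives of matrix valued functions on ℂ^n -/

section MatrixCalculus

variable {n r : ℕ} {p : Fin n → ℂ}
  {M N : (Fin n → ℂ) → Matrix (Fin r) (Fin r) ℂ}

/-- Restriction to lines transports the product and inverse rules for matrix curves to `fderiv`, by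
uniqueness of the derivative. -/
theorem hasDerivAt_line {F : Type*} [NormedAddCommGroup F] [NormedSpace ℝ F] {V : Type*}
    [NormedAddCommGroup V] [NormedSpace ℝ V] {f : V → F} {p : V}
    (hf : DifferentiableAt ℝ f p) (v : V) :
    HasDerivAt (fun ε : ℝ => f (p + ε • v)) (fderiv ℝ f p v) 0 := by
  have h1 : HasDerivAt (fun ε : ℝ => p + ε • v) v 0 := by
    simpa using ((hasDerivAt_id (0 : ℝ)).smul_const v).const_add p
  have h2 : HasFDerivAt f (fderiv ℝ f p) (p + (0 : ℝ) • v) := by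
    rw [zero_smul, add_zero]
    exact hf.hasFDerivAt
  exact HasFDerivAt.comp_hasDerivAt (l := f) (f := fun ε : ℝ => p + ε • v) (0 : ℝ) h2 h1

theorem differentiableAt_matrix_iff {f : (Fin n → ℂ) → Matrix (Fin r) (Fin r) ℂ} :
    DifferentiableAt ℝ f p ↔ ∀ i j, DifferentiableAt ℝ (fun y => f y i j) p := by
  constructor
  · intro h i j
    exact differentiableAt_pi.1 (differentiableAt_pi.1 h i) j
  · intro h
    exact differentiableAt_pi.2 fun i => differentiableAt_pi.2 fun j => h i j

theorem differentiableAt_matrix_mul (hM : DifferentiableAt ℝ M p) (hN : DifferentiableAt ℝ N p) :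
    DifferentiableAt ℝ (fun q => M q * N q) p := by
  rw [differentiableAt_matrix_iff] at *
  intro i j
  simp only [Matrix.mul_apply]
  exact DifferentiableAt.fun_sum fun k _ => (hM i k).mul (hN k j)

theorem differentiableAt_matrix_inv (hM : DifferentiableAt ℝ M p) (hp : IsUnit (M p).det) :
    DifferentiableAt ℝ (fun q => (M q)⁻¹) p := by
  have h2 : ContDiffAt ℝ 1 (fun M : Matrix (Fin r) (Fin r) ℂ => M⁻¹) (M p) :=
    contDiffAt_matrix_inv contDiffAt_id hp
  exact (h2.differentiableAt one_ne_zero).comp p hM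

theorem differentiableAt_conjTranspose (hM : DifferentiableAt ℝ M p) :
    DifferentiableAt ℝ (fun q => (M q)ᴴ) p := by
  rw [differentiableAt_matrix_iff] at *
  intro i j
  exact (hM j i).star

theorem fderiv_matrix_apply (hM : DifferentiableAt ℝ M p) (v : Fin n → ℂ) (i j : Fin r) :
    fderiv ℝ M p v i j = fderiv ℝ (fun q => M q i j) p v :=
  (hasDerivAt_matrix_iff.1 (hasDerivAt_line hM v) i j).unique
    (hasDerivAt_line (differentiableAt_matrix_iff.1 hM i j) v)

theorem fderiv_matrix_mul (hM : DifferentiableAt ℝ M p) (hN : DifferentiableAt ℝ N p)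
    (v : Fin n → ℂ) :
    fderiv ℝ (fun q => M q * N q) p v = fderiv ℝ M p v * N p + M p * fderiv ℝ N p v := by
  have h := hasDerivAt_matrix_mul (hasDerivAt_line hM v) (hasDerivAt_line hN v)
  simp only [zero_smul, add_zero] at h
  exact (hasDerivAt_line (differentiableAt_matrix_mul hM hN) v).unique h

theorem fderiv_matrix_inv (hM : DifferentiableAt ℝ M p) (hp : IsUnit (M p).det)
    (v : Fin n → ℂ) :
    fderiv ℝ (fun q => (M q)⁻¹) p v = -((M p)⁻¹ * fderiv ℝ M p v * (M p)⁻¹) := by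
  have h := hasDerivAt_matrix_inv (hasDerivAt_line hM v) (by simpa using hp)
  simp only [zero_smul, add_zero] at h
  exact (hasDerivAt_line (differentiableAt_matrix_inv hM hp) v).unique h

theorem fderiv_conjTranspose (hM : DifferentiableAt ℝ M p) (v : Fin n → ℂ) :
    fderiv ℝ (fun q => (M q)ᴴ) p v = (fderiv ℝ M p v)ᴴ := by
  refine (hasDerivAt_line (differentiableAt_conjTranspose hM) v).unique ?_
  exact hasDerivAt_matrix_iff.2 fun i j =>
    (hasDerivAt_matrix_iff.1 (hasDerivAt_line hM v) j i).star

end MatrixCalculus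

/-! ### Wirtinger derivatives of matrix valued functions -/

section WirtingerCalculus

variable {n r : ℕ}

/-- The `∂/∂z_j` component of a real linear map `u`. -/
def wirtinger (j : Fin n) (u : (Fin n → ℂ) → Matrix (Fin r) (Fin r) ℂ) :
    Matrix (Fin r) (Fin r) ℂ :=
  (1 / 2 : ℂ) • (u (Pi.single j 1) - Complex.I • u (Pi.single j Complex.I))

/-- The `∂/∂z̄_j` component of a real linear map `u`. -/
def wirtingerBar (j : Fin n) (u : (Fin n → ℂ) → Matrix (Fin r) (Fin r) ℂ) :
    Matrix (Fin r) (Fin r) ℂ :=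
  (1 / 2 : ℂ) • (u (Pi.single j 1) + Complex.I • u (Pi.single j Complex.I))

theorem map_single_eq (L : (Fin n → ℂ) →L[ℝ] Matrix (Fin r) (Fin r) ℂ) (a : Fin n) (w : ℂ) :
    L (Pi.single a w) = w • wirtinger a L + star w • wirtingerBar a L := by
  have h1 : (Pi.single a w : Fin n → ℂ)
      = w.re • (Pi.single a 1 : Fin n → ℂ) + w.im • (Pi.single a Complex.I : Fin n → ℂ) := by
    rw [← Pi.single_smul, ← Pi.single_smul, ← Pi.single_add]
    congr 1
    simp
  rw [h1, map_add, map_smul, map_smul, wirtinger, wirtingerBar]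
  ext i j
  simp only [Matrix.add_apply, Matrix.smul_apply, Matrix.sub_apply, smul_eq_mul, Complex.real_smul]
  nth_rewrite 3 4 [← Complex.re_add_im w]
  simp only [star_add, star_mul', Complex.star_def, Complex.conj_ofReal, Complex.conj_I]
  linear_combination ((w.im : ℂ) * L (Pi.single a Complex.I) i j) * Complex.I_sq

theorem map_eq_sum_wirtinger (L : (Fin n → ℂ) →L[ℝ] Matrix (Fin r) (Fin r) ℂ) (w : Fin n → ℂ) :
    L w = ∑ a, (w a • wirtinger a L + star (w a) • wirtingerBar a L) := by
  have h1 : w = ∑ a, Pi.single a (w a) := (Finset.univ_sum_single w).symm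
  conv_lhs => rw [h1]
  rw [map_sum]
  exact Finset.sum_congr rfl fun a _ => map_single_eq L a _

variable {p : Fin n → ℂ} {M N : (Fin n → ℂ) → Matrix (Fin r) (Fin r) ℂ}

theorem wirtinger_fderiv (hM : DifferentiableAt ℝ M p) (j : Fin n) :
    wirtinger j (fderiv ℝ M p) = Matrix.of fun a b => dz j (fun q => M q a b) p := by
  ext a b
  rw [wirtinger, Matrix.of_apply, dz, ← fderiv_matrix_apply hM, ← fderiv_matrix_apply hM]
  rfl

theorem wirtingerBar_fderiv (hM : DifferentiableAt ℝ M p) (j : Fin n) :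
    wirtingerBar j (fderiv ℝ M p) = Matrix.of fun a b => dzbar j (fun q => M q a b) p := by
  ext a b
  rw [wirtingerBar, Matrix.of_apply, dzbar, ← fderiv_matrix_apply hM,
    ← fderiv_matrix_apply hM]
  rfl

theorem wirtinger_mul (hM : DifferentiableAt ℝ M p) (hN : DifferentiableAt ℝ N p) (j : Fin n) :
    wirtinger j (fderiv ℝ (fun q => M q * N q) p)
      = wirtinger j (fderiv ℝ M p) * N p + M p * wirtinger j (fderiv ℝ N p) := by
  simp only [wirtinger, fderiv_matrix_mul hM hN, Matrix.smul_mul, Matrix.mul_smul,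
    Matrix.sub_mul, Matrix.mul_sub, smul_add, smul_sub]
  abel

theorem wirtingerBar_mul (hM : DifferentiableAt ℝ M p) (hN : DifferentiableAt ℝ N p) (j : Fin n) :
    wirtingerBar j (fderiv ℝ (fun q => M q * N q) p)
      = wirtingerBar j (fderiv ℝ M p) * N p + M p * wirtingerBar j (fderiv ℝ N p) := by
  simp only [wirtingerBar, fderiv_matrix_mul hM hN, Matrix.smul_mul, Matrix.mul_smul,
    Matrix.add_mul, Matrix.mul_add, smul_add]
  abel

theorem wirtingerBar_inv (hM : DifferentiableAt ℝ M p) (hp : IsUnit (M p).det) (j : Fin n) :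
    wirtingerBar j (fderiv ℝ (fun q => (M q)⁻¹) p)
      = -((M p)⁻¹ * wirtingerBar j (fderiv ℝ M p) * (M p)⁻¹) := by
  simp only [wirtingerBar, fderiv_matrix_inv hM hp, Matrix.smul_mul, Matrix.mul_smul,
    Matrix.add_mul, Matrix.mul_add, smul_add, smul_neg, neg_add]

theorem wirtinger_conjTranspose (hM : DifferentiableAt ℝ M p) (j : Fin n) :
    wirtinger j (fderiv ℝ (fun q => (M q)ᴴ) p) = (wirtingerBar j (fderiv ℝ M p))ᴴ := by
  simp only [wirtingerBar, wirtinger, fderiv_conjTranspose hM,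
    Matrix.conjTranspose_smul, Matrix.conjTranspose_add]
  simp [sub_eq_add_neg]

section Holomorphic

variable {ψ : (Fin n → ℂ) → Fin n → ℂ}

theorem fderiv_real_eq (hM : DifferentiableAt ℂ M p) (v : Fin n → ℂ) :
    fderiv ℝ M p v = fderiv ℂ M p v := by
  exact DFunLike.congr_fun (hM.hasFDerivAt.restrictScalars ℝ).fderiv v

theorem single_I (j : Fin n) : (Pi.single j Complex.I : Fin n → ℂ)
    = Complex.I • (Pi.single j (1 : ℂ) : Fin n → ℂ) := by
  rw [← Pi.single_smul, smul_eq_mul, mul_one]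

theorem wirtingerBar_eq_zero (hM : DifferentiableAt ℂ M p) (j : Fin n) :
    wirtingerBar j (fderiv ℝ M p) = 0 := by
  rw [wirtingerBar, fderiv_real_eq hM, fderiv_real_eq hM, single_I, map_smul, smul_smul,
    Complex.I_mul_I, neg_one_smul, add_neg_cancel, smul_zero]

theorem wirtinger_eq_fderiv (hM : DifferentiableAt ℂ M p) (j : Fin n) :
    wirtinger j (fderiv ℝ M p) = fderiv ℂ M p (Pi.single j 1) := by
  rw [wirtinger, fderiv_real_eq hM, fderiv_real_eq hM, single_I, map_smul, smul_smul,
    Complex.I_mul_I, neg_one_smul, sub_neg_eq_add, ← two_smul ℂ, smul_smul]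
  norm_num

/-- The complex jacobian matrix. -/
def jacobian (ψ : (Fin n → ℂ) → Fin n → ℂ) (p : Fin n → ℂ) : Matrix (Fin n) (Fin n) ℂ :=
  Matrix.of fun a j => fderiv ℂ ψ p (Pi.single j 1) a

theorem fderiv_comp_holomorphic (hψ : DifferentiableAt ℂ ψ p) (hM : DifferentiableAt ℝ M (ψ p))
    (v : Fin n → ℂ) :
    fderiv ℝ (fun q => M (ψ q)) p v = fderiv ℝ M (ψ p) (fderiv ℂ ψ p v) := by
  have h1 := hψ.restrictScalars ℝ
  have h2 : fderiv ℝ (fun q => M (ψ q)) p = (fderiv ℝ M (ψ p)).comp (fderiv ℝ ψ p) :=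
    fderiv_comp p hM h1
  rw [h2, hψ.fderiv_restrictScalars ℝ]
  rfl

/-- Under a holomorphic substitution the components along dz and dz̄ do not mix: the contributions
of `wirtingerBar` cancel because I² = -1. -/
theorem wirtinger_comp (hψ : DifferentiableAt ℂ ψ p) (hM : DifferentiableAt ℝ M (ψ p))
    (j : Fin n) :
    wirtinger j (fderiv ℝ (fun q => M (ψ q)) p)
      = ∑ a, jacobian ψ p a j • wirtinger a (fderiv ℝ M (ψ p)) := by
  rw [wirtinger, fderiv_comp_holomorphic hψ hM, fderiv_comp_holomorphic hψ hM, single_I,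
    map_smul, map_eq_sum_wirtinger, map_eq_sum_wirtinger, Finset.smul_sum,
    ← Finset.sum_sub_distrib, Finset.smul_sum]
  refine Finset.sum_congr rfl fun a _ => ?_
  ext i k
  simp only [jacobian, Matrix.of_apply, Matrix.smul_apply, Matrix.sub_apply, Matrix.add_apply,
    Pi.smul_apply, smul_eq_mul, star_mul', Complex.star_def, Complex.conj_I]
  linear_combination (-(1 / 2 : ℂ) * (fderiv ℂ ψ p (Pi.single j 1) a *
    wirtinger a (fderiv ℝ M (ψ p)) i k) + (1 / 2 : ℂ) * (starRingEnd ℂ)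
      (fderiv ℂ ψ p (Pi.single j 1) a) * wirtingerBar a (fderiv ℝ M (ψ p)) i k) * Complex.I_sq

theorem wirtingerBar_comp (hψ : DifferentiableAt ℂ ψ p) (hM : DifferentiableAt ℝ M (ψ p))
    (j : Fin n) :
    wirtingerBar j (fderiv ℝ (fun q => M (ψ q)) p)
      = ∑ a, star (jacobian ψ p a j) • wirtingerBar a (fderiv ℝ M (ψ p)) := by
  rw [wirtingerBar, fderiv_comp_holomorphic hψ hM, fderiv_comp_holomorphic hψ hM, single_I,
    map_smul, map_eq_sum_wirtinger, map_eq_sum_wirtinger, Finset.smul_sum,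
    ← Finset.sum_add_distrib, Finset.smul_sum]
  refine Finset.sum_congr rfl fun a _ => ?_
  ext i k
  simp only [jacobian, Matrix.of_apply, Matrix.smul_apply, Matrix.add_apply,
    Pi.smul_apply, smul_eq_mul, star_mul', Complex.star_def, Complex.conj_I]
  linear_combination ((1 / 2 : ℂ) * (fderiv ℂ ψ p (Pi.single j 1) a *
    wirtinger a (fderiv ℝ M (ψ p)) i k) - (1 / 2 : ℂ) * (starRingEnd ℂ)
      (fderiv ℂ ψ p (Pi.single j 1) a) * wirtingerBar a (fderiv ℝ M (ψ p)) i k) * Complex.I_sq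

end Holomorphic

end WirtingerCalculus

/-! ### The Chern curvature of a metric on a trivial bundle -/

section ChernCurvature

variable {n r : ℕ} {p : Fin n → ℂ} {M : (Fin n → ℂ) → Matrix (Fin r) (Fin r) ℂ}

/-- The coefficients of the Chern connection of the metric `M` on a trivial bundle. -/
def chernConnection (M : (Fin n → ℂ) → Matrix (Fin r) (Fin r) ℂ) (j : Fin n) (q : Fin n → ℂ) :
    Matrix (Fin r) (Fin r) ℂ :=
  (M q)⁻¹ * wirtinger j (fderiv ℝ M q)

/-- The coefficients of the Chern curvature of the metric `M` on a trivial bundle. -/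
def chernCurvature (M : (Fin n → ℂ) → Matrix (Fin r) (Fin r) ℂ) (p : Fin n → ℂ) :
    Fin n → Fin n → Matrix (Fin r) (Fin r) ℂ :=
  fun j k => -wirtingerBar k (fderiv ℝ (chernConnection M j) p)

variable (n r) in
/-- Two-jets of matrix valued functions on `ℂ^n`. -/
abbrev MetricJet :=
  (Fin r → Fin r → ℂ) × ((Fin n → ℂ) →L[ℝ] (Fin r → Fin r → ℂ)) ×
    ((Fin n → ℂ) →L[ℝ] (Fin n → ℂ) →L[ℝ] (Fin r → Fin r → ℂ))

/-- The two-jet of a function at a point. -/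
def metricJet (M : (Fin n → ℂ) → Fin r → Fin r → ℂ) (p : Fin n → ℂ) : MetricJet n r :=
  (M p, fderiv ℝ M p, fderiv ℝ (fderiv ℝ M) p)

/-- The mixed component `∂²/∂z̄_k∂z_j` of a real bilinear map. -/
def mixedPart (j k : Fin n) (B : (Fin n → ℂ) → (Fin n → ℂ) → Matrix (Fin r) (Fin r) ℂ) :
    Matrix (Fin r) (Fin r) ℂ :=
  wirtingerBar k fun v => wirtinger j (B v)

/-- The Chern curvature as a function of the two-jet of the metric. -/
def jetCurvature (J : MetricJet n r) : Fin n → Fin n → Matrix (Fin r) (Fin r) ℂ :=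
  fun j k => -((Matrix.of J.1)⁻¹ * mixedPart j k fun v w => Matrix.of (J.2.2 v w))
    + (Matrix.of J.1)⁻¹ * (wirtingerBar k fun v => Matrix.of (J.2.1 v)) * (Matrix.of J.1)⁻¹ *
      wirtinger j fun v => Matrix.of (J.2.1 v)

theorem contDiffAt_fderiv_entries (hM : ContDiffAt ℝ 2 M p) :
    ContDiffAt ℝ 1 (fderiv ℝ (F := Fin r → Fin r → ℂ) M) p :=
  ContDiffAt.fderiv_right (F := Fin r → Fin r → ℂ) (m := 1) (n := 2) hM (by norm_num)

theorem hasDerivAt_fderiv_line (hM : ContDiffAt ℝ 2 M p) (v w : Fin n → ℂ) :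
    HasDerivAt (fun ε : ℝ => fderiv ℝ M (p + ε • v) w)
      (Matrix.of (fderiv ℝ (fderiv ℝ (F := Fin r → Fin r → ℂ) M) p v w)) 0 := by
  have h1 := hasDerivAt_line ((contDiffAt_fderiv_entries hM).differentiableAt one_ne_zero) v
  exact h1.clm_apply (hasDerivAt_const (0 : ℝ) w) |>.congr_deriv (by rw [map_zero, add_zero]; rfl)

theorem differentiableAt_fderiv_apply (hM : ContDiffAt ℝ 2 M p) (w : Fin n → ℂ) :
    DifferentiableAt ℝ (fun q => fderiv ℝ M q w) p :=
  DifferentiableAt.clm_apply (G := Fin n → ℂ) (H := Fin r → Fin r → ℂ)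
    ((contDiffAt_fderiv_entries hM).differentiableAt one_ne_zero) (differentiableAt_const w)

theorem fderiv_fderiv_apply (hM : ContDiffAt ℝ 2 M p) (v w : Fin n → ℂ) :
    fderiv ℝ (fun q => fderiv ℝ M q w) p v
      = Matrix.of (fderiv ℝ (fderiv ℝ (F := Fin r → Fin r → ℂ) M) p v w) :=
  (hasDerivAt_line (differentiableAt_fderiv_apply hM w) v).unique (hasDerivAt_fderiv_line hM v w)

theorem differentiableAt_wirtinger (hM : ContDiffAt ℝ 2 M p) (j : Fin n) :
    DifferentiableAt ℝ (fun q => wirtinger j (fderiv ℝ M q)) p := by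
  have h1 := fun w => differentiableAt_matrix_iff.1 (differentiableAt_fderiv_apply hM w)
  refine differentiableAt_matrix_iff.2 fun a b => ?_
  exact ((h1 _ a b).sub ((h1 _ a b).const_mul Complex.I)).const_mul (1 / 2 : ℂ)

theorem fderiv_wirtinger (hM : ContDiffAt ℝ 2 M p) (j : Fin n) (v : Fin n → ℂ) :
    fderiv ℝ (fun q => wirtinger j (fderiv ℝ M q)) p v = wirtinger j fun w =>
      Matrix.of (fderiv ℝ (fderiv ℝ (F := Fin r → Fin r → ℂ) M) p v w) := by
  refine (hasDerivAt_line (differentiableAt_wirtinger hM j) v).unique ?_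
  have h1 := fun w => hasDerivAt_matrix_iff.1 (hasDerivAt_fderiv_line hM v w)
  refine hasDerivAt_matrix_iff.2 fun a b => ?_
  exact ((h1 _ a b).sub ((h1 _ a b).const_mul Complex.I)).const_mul (1 / 2 : ℂ)

theorem differentiableAt_chernConnection (hM : ContDiffAt ℝ 2 M p) (hp : IsUnit (M p).det)
    (j : Fin n) : DifferentiableAt ℝ (chernConnection M j) p :=
  differentiableAt_matrix_mul
    (differentiableAt_matrix_inv (hM.differentiableAt two_ne_zero) hp)
    (differentiableAt_wirtinger hM j)

/-- The product rule for h⁻¹∂h gives -h⁻¹∂̄∂h + h⁻¹(∂̄h)h⁻¹∂h, in which only the 2-jet occurs. Both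
the use of the C² topology and the order of the linearized operator rest on this. -/
theorem chernCurvature_eq_jetCurvature (hM : ContDiffAt ℝ 2 M p) (hp : IsUnit (M p).det) :
    chernCurvature M p = jetCurvature (metricJet M p) := by
  funext j k
  have hd := hM.differentiableAt two_ne_zero
  have h3 := wirtingerBar_mul (differentiableAt_matrix_inv hd hp)
    (differentiableAt_wirtinger hM j) k
  have h2 : (fderiv ℝ (fun q => wirtinger j (fderiv ℝ M q)) p : (Fin n → ℂ) → _) = fun v =>
      wirtinger j fun w => Matrix.of (fderiv ℝ (fderiv ℝ (F := Fin r → Fin r → ℂ) M) p v w) :=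
    funext fun v => fderiv_wirtinger hM j v
  rw [wirtingerBar_inv hd hp, h2] at h3
  show -wirtingerBar k (fderiv ℝ (fun q => (M q)⁻¹ * wirtinger j (fderiv ℝ M q)) p) = _
  rw [h3, Matrix.neg_mul, neg_add, neg_neg, add_comm]
  rfl

theorem conjTranspose_wirtinger {u : (Fin n → ℂ) → Matrix (Fin r) (Fin r) ℂ}
    (hu : ∀ v, (u v).IsHermitian) (j : Fin n) : (wirtinger j u)ᴴ = wirtingerBar j u := by
  simp only [wirtinger, wirtingerBar, Matrix.conjTranspose_smul,
    Matrix.conjTranspose_sub, (hu _).eq]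
  simp

theorem conjTranspose_mixedPart {B : (Fin n → ℂ) → (Fin n → ℂ) → Matrix (Fin r) (Fin r) ℂ}
    (hB : ∀ v w, (B v w).IsHermitian) (hsymm : ∀ v w, B v w = B w v) (j k : Fin n) :
    (mixedPart j k B)ᴴ = mixedPart k j B := by
  simp only [mixedPart, wirtingerBar, wirtinger, Matrix.conjTranspose_smul,
    Matrix.conjTranspose_add, Matrix.conjTranspose_sub, (hB _ _).eq,
    hsymm (Pi.single k 1) (Pi.single j 1), hsymm (Pi.single k Complex.I) (Pi.single j 1),
    hsymm (Pi.single k 1) (Pi.single j Complex.I),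
    hsymm (Pi.single k Complex.I) (Pi.single j Complex.I)]
  ext a b
  simp
  ring

/-- After multiplication by H the curvature reads -∂̄∂h + (∂̄h)h⁻¹∂h. The adjoint exchanges ∂ and ∂̄
on a hermitian matrix, and second derivatives commute. -/
theorem isHermitianTensor_jetCurvature {J : MetricJet n r} (hJ : (Matrix.of J.1).PosDef)
    (h1 : ∀ v, (Matrix.of (J.2.1 v)).IsHermitian) (h2 : ∀ v w, (Matrix.of (J.2.2 v w)).IsHermitian)
    (hsymm : ∀ v w, J.2.2 v w = J.2.2 w v) :
    IsHermitianTensor (Matrix.of J.1) (jetCurvature J) := by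
  have hd := isUnit_det_of_posDef hJ
  have h3 : ∀ j k, Matrix.of J.1 * jetCurvature J j k
      = -(mixedPart j k fun v w => Matrix.of (J.2.2 v w))
        + (wirtingerBar k fun v => Matrix.of (J.2.1 v)) * (Matrix.of J.1)⁻¹ *
          wirtinger j fun v => Matrix.of (J.2.1 v) := by
    intro j k
    rw [jetCurvature, Matrix.mul_add, Matrix.mul_neg, ← Matrix.mul_assoc,
      Matrix.mul_nonsing_inv _ hd, Matrix.one_mul]
    simp only [← Matrix.mul_assoc]
    rw [Matrix.mul_nonsing_inv _ hd, Matrix.one_mul]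
  have h4 : ∀ j, (wirtingerBar j fun v => Matrix.of (J.2.1 v))ᴴ
      = wirtinger j fun v => Matrix.of (J.2.1 v) := fun j => by
    rw [← conjTranspose_wirtinger h1, Matrix.conjTranspose_conjTranspose]
  intro j k
  rw [h3, h3, Matrix.conjTranspose_add, Matrix.conjTranspose_neg,
    conjTranspose_mixedPart h2 (fun v w => congrArg Matrix.of (hsymm v w)),
    Matrix.conjTranspose_mul, Matrix.conjTranspose_mul, h4, conjTranspose_wirtinger h1,
    hJ.1.inv.eq, Matrix.mul_assoc]

theorem contDiffAt_wirtinger {V : Type*} [NormedAddCommGroup V] [NormedSpace ℝ V]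
    {m : WithTop ℕ∞} {f : V → (Fin n → ℂ) → Matrix (Fin r) (Fin r) ℂ} {x : V}
    (hf : ∀ v, ContDiffAt ℝ m (fun y => f y v) x) (j : Fin n) :
    ContDiffAt ℝ m (fun y => wirtinger j (f y)) x := by
  refine contDiffAt_matrix_iff.2 fun a b => ?_
  have h1 := fun w => contDiffAt_matrix_iff.1 (hf w) a b
  exact contDiffAt_const.mul ((h1 _).sub (contDiffAt_const.mul (h1 _)))

theorem contDiffAt_wirtingerBar {V : Type*} [NormedAddCommGroup V] [NormedSpace ℝ V]
    {m : WithTop ℕ∞} {f : V → (Fin n → ℂ) → Matrix (Fin r) (Fin r) ℂ} {x : V}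
    (hf : ∀ v, ContDiffAt ℝ m (fun y => f y v) x) (j : Fin n) :
    ContDiffAt ℝ m (fun y => wirtingerBar j (f y)) x := by
  refine contDiffAt_matrix_iff.2 fun a b => ?_
  have h1 := fun w => contDiffAt_matrix_iff.1 (hf w) a b
  exact contDiffAt_const.mul ((h1 _).add (contDiffAt_const.mul (h1 _)))

theorem contDiffAt_jetCurvature {m : WithTop ℕ∞} {J : MetricJet n r}
    (hJ : IsUnit (Matrix.of J.1).det) :
    ContDiffAt ℝ m (jetCurvature (n := n) (r := r)) J := by
  have h1 : ContDiffAt ℝ m (fun J : MetricJet n r => Matrix.of J.1) J :=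
    contDiffAt_fst (E := Fin r → Fin r → ℂ)
  have h2 : ContDiffAt ℝ m (fun J : MetricJet n r => J.2) J := contDiffAt_snd
  have h3 : ContDiffAt ℝ m (fun J : MetricJet n r => J.2.1) J := h2.fst
  have h4 : ContDiffAt ℝ m (fun J : MetricJet n r => J.2.2) J := h2.snd
  have hinv := contDiffAt_matrix_inv h1 hJ
  have h5 : ∀ v, ContDiffAt ℝ m (fun J : MetricJet n r => Matrix.of (J.2.1 v)) J :=
    fun v => h3.clm_apply contDiffAt_const
  have h6 : ∀ v w, ContDiffAt ℝ m (fun J : MetricJet n r => Matrix.of (J.2.2 v w)) J :=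
    fun v w => (h4.clm_apply contDiffAt_const).clm_apply contDiffAt_const
  refine contDiffAt_pi.2 fun j => contDiffAt_pi.2 fun k => ?_
  exact (contDiffAt_matrix_mul hinv (contDiffAt_wirtingerBar
      (fun v => contDiffAt_wirtinger (h6 v) j) k)).neg.add
    (contDiffAt_matrix_mul (contDiffAt_matrix_mul (contDiffAt_matrix_mul hinv
      (contDiffAt_wirtingerBar h5 k)) hinv) (contDiffAt_wirtinger h5 j))

theorem isHermitian_fderiv (hM : DifferentiableAt ℝ M p)
    (hH : ∀ᶠ q in 𝓝 p, (M q).IsHermitian) (v : Fin n → ℂ) : (fderiv ℝ M p v).IsHermitian := by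
  rw [Matrix.IsHermitian, ← fderiv_conjTranspose hM]
  have h1 : (fun q => (M q)ᴴ) =ᶠ[𝓝 p] M := hH.mono fun q hq => hq.eq
  rw [h1.fderiv_eq]

theorem isHermitian_fderiv_fderiv (hM : ContDiffAt ℝ 2 M p)
    (hH : ∀ᶠ q in 𝓝 p, (M q).IsHermitian) (v w : Fin n → ℂ) :
    (Matrix.of (fderiv ℝ (fderiv ℝ (F := Fin r → Fin r → ℂ) M) p v w)).IsHermitian := by
  rw [← fderiv_fderiv_apply hM]
  refine isHermitian_fderiv (differentiableAt_fderiv_apply hM w) ?_ v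
  filter_upwards [hM.eventually (by norm_num), hH.eventually_nhds] with q hq hq'
  exact isHermitian_fderiv (hq.differentiableAt two_ne_zero) hq' w

theorem isHermitianTensor_chernCurvature (hM : ContDiffAt ℝ 2 M p)
    (hH : ∀ᶠ q in 𝓝 p, (M q).IsHermitian) (hp : (M p).PosDef) :
    IsHermitianTensor (M p) (chernCurvature M p) := by
  rw [chernCurvature_eq_jetCurvature hM (isUnit_det_of_posDef hp)]
  have hM' : ContDiffAt ℝ 2 (F := Fin r → Fin r → ℂ) M p := hM
  exact isHermitianTensor_jetCurvature (J := metricJet M p) hp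
    (isHermitian_fderiv (hM.differentiableAt two_ne_zero) hH) (isHermitian_fderiv_fderiv hM hH)
    fun v w => hM'.isSymmSndFDerivAt (by simp) v w

section Transition

variable {A : (Fin n → ℂ) → Matrix (Fin r) (Fin r) ℂ} {ψ : (Fin n → ℂ) → Fin n → ℂ}

/-- The factor A* is antiholomorphic, so ∂ does not see it; A, on the other hand, produces the
inhomogeneous term A⁻¹∂A. -/
theorem chernConnection_transition (hA : DifferentiableAt ℂ A p) (hψ : DifferentiableAt ℂ ψ p)
    (hM : DifferentiableAt ℝ M (ψ p)) (hAp : IsUnit (A p).det) (hMp : IsUnit (M (ψ p)).det)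
    {M' : (Fin n → ℂ) → Matrix (Fin r) (Fin r) ℂ}
    (h : M' =ᶠ[𝓝 p] fun q => (A q)ᴴ * M (ψ q) * A q) (j : Fin n) :
    chernConnection M' j p = (A p)⁻¹ * (∑ a, jacobian ψ p a j • chernConnection M a (ψ p)) * A p
      + (A p)⁻¹ * fderiv ℂ A p (Pi.single j 1) := by
  have hA' := hA.restrictScalars ℝ
  have hcomp : DifferentiableAt ℝ (fun q => M (ψ q)) p := hM.comp p (hψ.restrictScalars ℝ)
  have h1 := wirtinger_mul (differentiableAt_conjTranspose hA') hcomp j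
  have h2 := wirtinger_mul (differentiableAt_matrix_mul (differentiableAt_conjTranspose hA') hcomp)
    hA' j
  rw [wirtinger_conjTranspose hA', wirtingerBar_eq_zero hA, Matrix.conjTranspose_zero,
    Matrix.zero_mul, zero_add, wirtinger_comp hψ hM] at h1
  rw [h1, wirtinger_eq_fderiv hA] at h2
  have hAu : IsUnit (A p)ᴴ.det := isUnit_det_conjTranspose hAp
  rw [chernConnection, h.fderiv_eq, h2, h.eq_of_nhds, Matrix.mul_inv_rev, Matrix.mul_inv_rev,
    Matrix.mul_add]
  simp only [chernConnection, ← Matrix.mul_smul, ← Matrix.mul_sum]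
  refine congrArg₂ (· + ·) ?_ ?_
  · simp only [Matrix.mul_assoc]
    rw [Matrix.nonsing_inv_mul_cancel_left _ _ hAu]
  · simp only [Matrix.mul_assoc]
    rw [Matrix.nonsing_inv_mul_cancel_left _ _ hAu, Matrix.nonsing_inv_mul_cancel_left _ _ hMp]

/-- The inhomogeneous term A⁻¹∂A of the connection is holomorphic and killed by ∂̄. The matrix A and
the jacobian are holomorphic as well, so the curvature transforms as a tensor. -/
theorem chernCurvature_transition (hA : AnalyticAt ℂ A p) (hψ : AnalyticAt ℂ ψ p)
    (hM : ContDiffAt ℝ 2 M (ψ p)) (hAp : IsUnit (A p).det) (hMp : IsUnit (M (ψ p)).det)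
    {M' : (Fin n → ℂ) → Matrix (Fin r) (Fin r) ℂ}
    (h : M' =ᶠ[𝓝 p] fun q => (A q)ᴴ * M (ψ q) * A q) :
    chernCurvature M' p = changeFrame (A p) (jacobian ψ p) (chernCurvature M (ψ p)) := by
  funext j k
  have hAd := hA.differentiableAt
  have hψd := hψ.differentiableAt
  have hAr := hAd.restrictScalars ℝ
  have hψr : ContinuousAt ψ p := hψ.continuousAt
  have hdetA : ∀ᶠ q in 𝓝 p, IsUnit (A q).det := by
    have h1 : ContinuousAt (fun q => (A q).det) p :=
      (Continuous.matrix_det continuous_id).continuousAt.comp hAd.continuousAt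
    filter_upwards [h1.eventually_ne hAp.ne_zero] with q hq using hq.isUnit
  have hdetM : ∀ᶠ q in 𝓝 p, IsUnit (M (ψ q)).det := by
    have h1 : ContinuousAt (fun q => (M q).det) (ψ p) :=
      (Continuous.matrix_det continuous_id).continuousAt.comp hM.continuousAt
    filter_upwards [hψr.eventually (h1.eventually_ne hMp.ne_zero)] with q hq using hq.isUnit
  -- The entries of the jacobian are written as scalar matrices so that the product rule for
  -- matrices applies to them.
  have hconn : chernConnection M' j =ᶠ[𝓝 p] fun q =>
      (A q)⁻¹ * (∑ a, (jacobian ψ q a j • (1 : Matrix (Fin r) (Fin r) ℂ))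
        * chernConnection M a (ψ q)) * A q + (A q)⁻¹ * fderiv ℂ A q (Pi.single j 1) := by
    filter_upwards [hA.eventually_analyticAt, hψ.eventually_analyticAt,
      hψr.eventually (hM.eventually (by norm_num)), hdetA, hdetM, h.eventually_nhds]
      with q h1 h2 h3 h4 h5 h6
    rw [chernConnection_transition h1.differentiableAt h2.differentiableAt
      (h3.differentiableAt two_ne_zero) h4 h5 h6]
    simp only [Matrix.smul_mul, Matrix.one_mul]
  have hJ : ∀ a, DifferentiableAt ℂ
      (fun q => jacobian ψ q a j • (1 : Matrix (Fin r) (Fin r) ℂ)) p := by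
    intro a
    have h1 : DifferentiableAt ℂ (fun q => fderiv ℂ ψ q (Pi.single j 1)) p :=
      (hψ.fderiv.differentiableAt).clm_apply (differentiableAt_const _)
    exact (differentiableAt_pi.1 h1 a).smul_const _
  have hA1 : DifferentiableAt ℂ (fun q => fderiv ℂ A q (Pi.single j 1)) p :=
    (hA.fderiv.differentiableAt).clm_apply (differentiableAt_const _)
  have hc := fun a => differentiableAt_chernConnection hM hMp a
  have hcomp : ∀ a, DifferentiableAt ℝ (fun q => chernConnection M a (ψ q)) p :=
    fun a => (hc a).comp p (hψd.restrictScalars ℝ)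
  have hterm := fun a => differentiableAt_matrix_mul ((hJ a).restrictScalars ℝ) (hcomp a)
  have hsum : DifferentiableAt ℝ (fun q => ∑ a, (jacobian ψ q a j •
      (1 : Matrix (Fin r) (Fin r) ℂ)) * chernConnection M a (ψ q)) p :=
    DifferentiableAt.fun_sum fun a _ => hterm a
  have hinv := differentiableAt_matrix_inv hAr hAp
  have hinv0 : wirtingerBar k (fderiv ℝ (fun q => (A q)⁻¹) p) = 0 := by
    rw [wirtingerBar_inv hAr hAp, wirtingerBar_eq_zero hAd, Matrix.mul_zero, Matrix.zero_mul,
      neg_zero]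
  have hfirst := differentiableAt_matrix_mul (differentiableAt_matrix_mul hinv hsum) hAr
  have hsecond := differentiableAt_matrix_mul hinv (hA1.restrictScalars ℝ)
  have hadd : (fderiv ℝ (chernConnection M' j) p : (Fin n → ℂ) → _) = fderiv ℝ (fun q =>
      (A q)⁻¹ * (∑ a, (jacobian ψ q a j • (1 : Matrix (Fin r) (Fin r) ℂ))
        * chernConnection M a (ψ q)) * A q) p
      + (fderiv ℝ (fun q => (A q)⁻¹ * fderiv ℂ A q (Pi.single j 1)) p : (Fin n → ℂ) → _) := by
    rw [hconn.fderiv_eq]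
    exact congrArg DFunLike.coe (fderiv_fun_add hfirst hsecond)
  have hsum' : (fderiv ℝ (fun q => ∑ a, (jacobian ψ q a j •
      (1 : Matrix (Fin r) (Fin r) ℂ)) * chernConnection M a (ψ q)) p : (Fin n → ℂ) → _)
      = fun v => ∑ a, fderiv ℝ (fun q => (jacobian ψ q a j •
      (1 : Matrix (Fin r) (Fin r) ℂ)) * chernConnection M a (ψ q)) p v := by
    funext v
    refine (hasDerivAt_line hsum v).unique ?_
    exact HasDerivAt.fun_sum fun a _ => hasDerivAt_line (hterm a) v
  have hbaradd : ∀ u v : (Fin n → ℂ) → Matrix (Fin r) (Fin r) ℂ,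
      wirtingerBar k (u + v) = wirtingerBar k u + wirtingerBar k v := by
    intro u v
    simp only [wirtingerBar, Pi.add_apply, smul_add]
    abel
  have hbarsum : ∀ u : Fin n → (Fin n → ℂ) → Matrix (Fin r) (Fin r) ℂ,
      wirtingerBar k (fun v => ∑ a, u a v) = ∑ a, wirtingerBar k (u a) := by
    intro u
    simp only [wirtingerBar, Finset.smul_sum, smul_add, Finset.sum_add_distrib]
  show -wirtingerBar k (fderiv ℝ (chernConnection M' j) p) = _
  rw [hadd, hbaradd, wirtingerBar_mul hinv (hA1.restrictScalars ℝ), hinv0,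
    wirtingerBar_eq_zero hA1, Matrix.zero_mul, Matrix.mul_zero, add_zero, add_zero,
    wirtingerBar_mul (differentiableAt_matrix_mul hinv hsum) hAr, wirtingerBar_eq_zero hAd,
    Matrix.mul_zero, add_zero, wirtingerBar_mul hinv hsum, hinv0, Matrix.zero_mul, zero_add,
    hsum', hbarsum]
  have hbar : ∀ a, wirtingerBar k (fun v => fderiv ℝ (fun q => (jacobian ψ q a j •
      (1 : Matrix (Fin r) (Fin r) ℂ)) * chernConnection M a (ψ q)) p v)
      = ∑ b, (jacobian ψ p a j * star (jacobian ψ p b k)) •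
          wirtingerBar b (fderiv ℝ (chernConnection M a) (ψ p)) := by
    intro a
    have h1 := wirtingerBar_mul ((hJ a).restrictScalars ℝ) (hcomp a) k
    rw [wirtingerBar_eq_zero (hJ a), Matrix.zero_mul, zero_add, wirtingerBar_comp hψd (hc a),
      Matrix.smul_mul, Matrix.one_mul, Finset.smul_sum] at h1
    simp only [smul_smul] at h1
    exact h1
  rw [Finset.sum_congr rfl fun a _ => hbar a]
  simp only [changeFrame, chernCurvature, Matrix.mul_sum, Matrix.sum_mul, Matrix.mul_smul,
    Matrix.smul_mul, Matrix.mul_neg, Matrix.neg_mul, smul_neg, Finset.sum_neg_distrib]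

end Transition

end ChernCurvature

/-! ### Frames, transition matrices and curvature on the bundle -/

section BundleGeometry

variable {n r : ℕ} {X : Type*} [TopologicalSpace X] [ChartedSpace (Fin n → ℂ) X]
  {E : X → Type*} [∀ x, AddCommGroup (E x)] [∀ x, Module ℂ (E x)]
  [TopologicalSpace (TotalSpace (Fin r → ℂ) E)] [∀ x, TopologicalSpace (E x)]
  [FiberBundle (Fin r → ℂ) E]

theorem isManifold_real [IsManifold 𝓘(ℂ, Fin n → ℂ) ω X] : IsManifold 𝓘(ℝ, Fin n → ℂ) ∞ X := by
  refine isManifold_of_contDiffOn _ _ _ fun e e' he he' => ?_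
  have h1 := contMDiffOn_of_mem_contDiffGroupoid
    ((contDiffGroupoid ω 𝓘(ℂ, Fin n → ℂ)).compatible he he')
  rw [contMDiffOn_iff_contDiffOn] at h1
  simpa using (h1.restrict_scalars ℝ).of_le le_top

theorem contDiffAt_localMatrix [IsManifold 𝓘(ℂ, Fin n → ℂ) ω X] {u : ∀ x, E x → E x → ℂ}
    (hu : IsSmoothHermitian n (r := r) u) (x : X) {p : Fin n → ℂ}
    (hp : p ∈ (chartAt (Fin n → ℂ) x).target)
    (hp' : (chartAt (Fin n → ℂ) x).symm p ∈ (trivializationAt (Fin r → ℂ) E x).baseSet) :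
    ContDiffAt ℝ ∞ (localMatrix (n := n) (r := r) u x) p := by
  have := isManifold_real (n := n) (X := X)
  refine contDiffAt_pi.2 fun μ => contDiffAt_pi.2 fun l => ?_
  have h1 : ContMDiffAt 𝓘(ℝ, Fin n → ℂ) 𝓘(ℝ, Fin n → ℂ) ∞ (chartAt (Fin n → ℂ) x).symm p :=
    contMDiffOn_chart_symm.contMDiffAt ((chartAt (Fin n → ℂ) x).open_target.mem_nhds hp)
  have h2 := (hu.smooth x μ l).contMDiffAt
    ((trivializationAt (Fin r → ℂ) E x).open_baseSet.mem_nhds hp')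
  exact (h2.comp p h1).contDiffAt

/-- The matrix `A` with `e_l = ∑ m, A m l • e'_m`, where `e` and `e'` are the preferred frames at
`y` and at `x`. -/
def transitionMatrix [VectorBundle ℂ (Fin r → ℂ) E] (x y b : X) : Matrix (Fin r) (Fin r) ℂ :=
  LinearMap.toMatrix' (((trivializationAt (Fin r → ℂ) E y).coordChangeL ℂ
    (trivializationAt (Fin r → ℂ) E x) b : (Fin r → ℂ) →L[ℂ] (Fin r → ℂ)) :
      (Fin r → ℂ) →ₗ[ℂ] (Fin r → ℂ))

section Transition

variable [VectorBundle ℂ (Fin r → ℂ) E] {x y b : X}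

theorem isUnit_det_transitionMatrix (x y b : X) :
    IsUnit (transitionMatrix (E := E) (r := r) x y b).det := by
  rw [transitionMatrix, LinearMap.det_toMatrix']
  exact LinearEquiv.isUnit_det' ((trivializationAt (Fin r → ℂ) E y).coordChangeL ℂ
    (trivializationAt (Fin r → ℂ) E x) b).toLinearEquiv

theorem symm_eq_symm_coordChange (hx : b ∈ (trivializationAt (Fin r → ℂ) E x).baseSet)
    (hy : b ∈ (trivializationAt (Fin r → ℂ) E y).baseSet) (w : Fin r → ℂ) :
    (trivializationAt (Fin r → ℂ) E y).symm b w = (trivializationAt (Fin r → ℂ) E x).symm b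
      ((trivializationAt (Fin r → ℂ) E y).coordChangeL ℂ (trivializationAt (Fin r → ℂ) E x) b w) := by
  rw [Trivialization.coordChangeL_apply _ _ ⟨hy, hx⟩,
    (trivializationAt (Fin r → ℂ) E x).symm_apply_apply_mk hx]

theorem IsSmoothHermitian.map_sum {u : ∀ x, E x → E x → ℂ} (hu : IsSmoothHermitian n (r := r) u)
    {ι : Type*} (s : Finset ι) (a : ι → ℂ) (e : ι → E b) (w : E b) :
    u b (∑ m ∈ s, a m • e m) w = ∑ m ∈ s, a m * u b (e m) w := by
  classical
  have h0 : u b 0 w = 0 := by simpa using hu.smul_left b 0 0 w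
  induction s using Finset.induction_on with
  | empty => simpa using h0
  | insert m s hm ih =>
    rw [Finset.sum_insert hm, Finset.sum_insert hm, hu.add_left, hu.smul_left, ih]

theorem IsSmoothHermitian.map_sum_right {u : ∀ x, E x → E x → ℂ}
    (hu : IsSmoothHermitian n (r := r) u)
    {ι : Type*} (s : Finset ι) (a : ι → ℂ) (e : ι → E b) (v : E b) :
    u b v (∑ m ∈ s, a m • e m) = ∑ m ∈ s, star (a m) * u b v (e m) := by
  rw [hu.conj_symm, hu.map_sum, star_sum]
  refine Finset.sum_congr rfl fun m _ => ?_
  rw [star_mul', ← hu.conj_symm]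

theorem symm_eq_sum (hx : b ∈ (trivializationAt (Fin r → ℂ) E x).baseSet) (w : Fin r → ℂ) :
    (trivializationAt (Fin r → ℂ) E x).symm b w
      = ∑ m, w m • (trivializationAt (Fin r → ℂ) E x).symm b (Pi.single m 1) := by
  have h1 := (trivializationAt (Fin r → ℂ) E x).coe_symmₗ (R := ℂ) hx
  rw [← h1]
  conv_lhs => rw [← Finset.univ_sum_single w]
  rw [_root_.map_sum]
  refine Finset.sum_congr rfl fun m _ => ?_
  rw [← map_smul, ← Pi.single_smul, smul_eq_mul, mul_one]

theorem star_dotProduct_frameMatrix {u : ∀ x, E x → E x → ℂ}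
    (hu : IsSmoothHermitian n (r := r) u)
    (hx : b ∈ (trivializationAt (Fin r → ℂ) E x).baseSet) (v w : Fin r → ℂ) :
    star w ⬝ᵥ Matrix.of (frameMatrix u x b) *ᵥ v
      = u b ((trivializationAt (Fin r → ℂ) E x).symm b v)
          ((trivializationAt (Fin r → ℂ) E x).symm b w) := by
  rw [symm_eq_sum hx v, symm_eq_sum hx w, hu.map_sum_right]
  simp only [hu.map_sum, dotProduct, Matrix.mulVec, Pi.star_apply]
  refine Finset.sum_congr rfl fun m _ => ?_
  congr 1
  exact Finset.sum_congr rfl fun l _ => mul_comm _ _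

theorem frameMatrix_isHermitian {u : ∀ x, E x → E x → ℂ}
    (hu : IsSmoothHermitian n (r := r) u) (x b : X) :
    (Matrix.of (frameMatrix (r := r) u x b)).IsHermitian := by
  ext μ l
  rw [Matrix.conjTranspose_apply]
  exact (hu.conj_symm _ _ _).symm

/-- The quadratic form of the Gram matrix at v is the value of h on the vector with coordinates v,
and this vector is nonzero because the trivialization is injective on the fibre. -/
theorem frameMatrix_posDef {h : ∀ x, E x → E x → ℂ} (hh : IsHermitianMetric n r h)
    (hx : b ∈ (trivializationAt (Fin r → ℂ) E x).baseSet) :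
    (Matrix.of (frameMatrix (r := r) h x b)).PosDef := by
  refine posDef_of_re_pos (frameMatrix_isHermitian hh.1 x b) fun v hv => ?_
  rw [star_dotProduct_frameMatrix hh.1 hx]
  refine hh.2 b _ fun h0 => hv ?_
  have h1 := (trivializationAt (Fin r → ℂ) E x).linearMapAt_symmₗ (R := ℂ) hx v
  rwa [(trivializationAt (Fin r → ℂ) E x).coe_symmₗ (R := ℂ) hx, h0, map_zero, eq_comm] at h1

theorem metricAt_posDef {h : ∀ x, E x → E x → ℂ} (hh : IsHermitianMetric n r h) (z : X) :
    (metricAt (r := r) h z).PosDef :=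
  frameMatrix_posDef hh (FiberBundle.mem_baseSet_trivializationAt' z)

theorem frameMatrix_transition {u : ∀ x, E x → E x → ℂ} (hu : IsSmoothHermitian n (r := r) u)
    (hx : b ∈ (trivializationAt (Fin r → ℂ) E x).baseSet)
    (hy : b ∈ (trivializationAt (Fin r → ℂ) E y).baseSet) :
    Matrix.of (frameMatrix (r := r) u y b) = (transitionMatrix (E := E) x y b)ᴴ *
      Matrix.of (frameMatrix (r := r) u x b) * transitionMatrix (E := E) x y b := by
  ext μ l
  have h1 : ∀ l : Fin r, (trivializationAt (Fin r → ℂ) E y).symm b (Pi.single l 1)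
      = (trivializationAt (Fin r → ℂ) E x).symm b
        (transitionMatrix (E := E) x y b *ᵥ Pi.single l 1) := by
    intro l
    rw [symm_eq_symm_coordChange hx hy, transitionMatrix, LinearMap.toMatrix'_mulVec]
    rfl
  have h2 : ∀ B : Matrix (Fin r) (Fin r) ℂ, B μ l
      = star (Pi.single μ (1 : ℂ) : Fin r → ℂ) ⬝ᵥ B *ᵥ (Pi.single l 1) := by
    intro B
    simp
  rw [h2 (_ * _), Matrix.of_apply, frameMatrix, h1, h1, ← star_dotProduct_frameMatrix hu hx,
    Matrix.star_mulVec, ← Matrix.mulVec_mulVec, ← Matrix.mulVec_mulVec,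
    Matrix.dotProduct_mulVec _ (transitionMatrix x y b)ᴴ]

end Transition

section Holomorphic

variable [IsManifold 𝓘(ℂ, Fin n → ℂ) ω X]

theorem analyticAt_chart_transition {x y b : X} (hx : b ∈ (chartAt (Fin n → ℂ) x).source)
    (hy : b ∈ (chartAt (Fin n → ℂ) y).source) :
    AnalyticAt ℂ (fun q => chartAt (Fin n → ℂ) x ((chartAt (Fin n → ℂ) y).symm q))
      (chartAt (Fin n → ℂ) y b) := by
  have h1 : ContMDiffAt 𝓘(ℂ, Fin n → ℂ) 𝓘(ℂ, Fin n → ℂ) ω (chartAt (Fin n → ℂ) y).symm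
      (chartAt (Fin n → ℂ) y b) :=
    contMDiffOn_chart_symm.contMDiffAt ((chartAt (Fin n → ℂ) y).open_target.mem_nhds
      ((chartAt (Fin n → ℂ) y).map_source hy))
  have h2 : ContMDiffAt 𝓘(ℂ, Fin n → ℂ) 𝓘(ℂ, Fin n → ℂ) ω (chartAt (Fin n → ℂ) x)
      ((chartAt (Fin n → ℂ) y).symm (chartAt (Fin n → ℂ) y b)) := by
    rw [(chartAt (Fin n → ℂ) y).left_inv hy]
    exact contMDiffOn_chart.contMDiffAt ((chartAt (Fin n → ℂ) x).open_source.mem_nhds hx)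
  exact (h2.comp _ h1).contDiffAt.analyticAt

/-- The reverse change of charts composes with this one to the identity near the point, so the chain
rule gives a left inverse of the jacobian. -/
theorem isUnit_det_jacobian {x y b : X} (hx : b ∈ (chartAt (Fin n → ℂ) x).source)
    (hy : b ∈ (chartAt (Fin n → ℂ) y).source) :
    IsUnit (jacobian (fun q => chartAt (Fin n → ℂ) x ((chartAt (Fin n → ℂ) y).symm q))
      (chartAt (Fin n → ℂ) y b)).det := by
  set ψ := fun q => chartAt (Fin n → ℂ) x ((chartAt (Fin n → ℂ) y).symm q) with hψ
  set ψ' := fun q => chartAt (Fin n → ℂ) y ((chartAt (Fin n → ℂ) x).symm q) with hψ'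
  have h1 : ψ (chartAt (Fin n → ℂ) y b) = chartAt (Fin n → ℂ) x b := by
    simp only [hψ, (chartAt (Fin n → ℂ) y).left_inv hy]
  have h2 := (analyticAt_chart_transition hx hy).differentiableAt
  have h3 := (analyticAt_chart_transition hy hx).differentiableAt
  rw [← h1] at h3
  have h4 : (fun q => ψ' (ψ q)) =ᶠ[𝓝 (chartAt (Fin n → ℂ) y b)] id := by
    have hs : ContinuousAt (chartAt (Fin n → ℂ) y).symm (chartAt (Fin n → ℂ) y b) :=
      (chartAt (Fin n → ℂ) y).continuousAt_symm ((chartAt (Fin n → ℂ) y).map_source hy)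
    have hx' : (chartAt (Fin n → ℂ) x).source
        ∈ 𝓝 ((chartAt (Fin n → ℂ) y).symm (chartAt (Fin n → ℂ) y b)) := by
      rw [(chartAt (Fin n → ℂ) y).left_inv hy]
      exact (chartAt (Fin n → ℂ) x).open_source.mem_nhds hx
    filter_upwards [hs.eventually hx', (chartAt (Fin n → ℂ) y).open_target.mem_nhds
      ((chartAt (Fin n → ℂ) y).map_source hy)] with q hq hq'
    show chartAt (Fin n → ℂ) y ((chartAt (Fin n → ℂ) x).symm (chartAt (Fin n → ℂ) x
      ((chartAt (Fin n → ℂ) y).symm q))) = q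
    rw [(chartAt (Fin n → ℂ) x).left_inv hq, (chartAt (Fin n → ℂ) y).right_inv hq']
  have h5 : (fderiv ℂ ψ' (ψ (chartAt (Fin n → ℂ) y b))).comp
      (fderiv ℂ ψ (chartAt (Fin n → ℂ) y b)) = ContinuousLinearMap.id ℂ _ := by
    have h6 := h3.hasFDerivAt.comp _ h2.hasFDerivAt
    have h7 := h4.fderiv_eq (𝕜 := ℂ)
    rw [fderiv_id] at h7
    rw [← h7]
    exact h6.fderiv.symm
  have h6 : jacobian ψ (chartAt (Fin n → ℂ) y b)
      = LinearMap.toMatrix' (fderiv ℂ ψ (chartAt (Fin n → ℂ) y b) : (Fin n → ℂ) →ₗ[ℂ] (Fin n → ℂ)) := by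
    ext a j
    rw [LinearMap.toMatrix'_apply]
    simp only [jacobian, Matrix.of_apply]
    congr 2
  have h7 : LinearMap.toMatrix' (fderiv ℂ ψ' (ψ (chartAt (Fin n → ℂ) y b)) :
      (Fin n → ℂ) →ₗ[ℂ] (Fin n → ℂ)) *
      jacobian ψ (chartAt (Fin n → ℂ) y b) = 1 := by
    rw [h6, ← LinearMap.toMatrix'_comp, ← LinearMap.toMatrix'_id]
    exact congrArg (fun L : (Fin n → ℂ) →L[ℂ] (Fin n → ℂ) =>
      LinearMap.toMatrix' (L : (Fin n → ℂ) →ₗ[ℂ] (Fin n → ℂ))) h5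
  exact (Matrix.isUnit_iff_isUnit_det _).1 (IsUnit.of_mul_eq_one_right _ h7)

variable [VectorBundle ℂ (Fin r → ℂ) E] [ContMDiffVectorBundle ω (Fin r → ℂ) E 𝓘(ℂ, Fin n → ℂ)]

theorem analyticAt_transitionMatrix {x y : X}
    (hx : y ∈ (trivializationAt (Fin r → ℂ) E x).baseSet) :
    AnalyticAt ℂ (fun q => transitionMatrix (r := r) (E := E) x y
      ((chartAt (Fin n → ℂ) y).symm q)) (chartAt (Fin n → ℂ) y y) := by
  have hy := FiberBundle.mem_baseSet_trivializationAt' (F := Fin r → ℂ) (E := E) y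
  have h1 : ContMDiffAt 𝓘(ℂ, Fin n → ℂ) 𝓘(ℂ, Fin n → ℂ) ω (chartAt (Fin n → ℂ) y).symm
      (chartAt (Fin n → ℂ) y y) :=
    contMDiffOn_chart_symm.contMDiffAt ((chartAt (Fin n → ℂ) y).open_target.mem_nhds
      (mem_chart_target _ y))
  have h2 : ContMDiffAt 𝓘(ℂ, Fin n → ℂ) 𝓘(ℂ, (Fin r → ℂ) →L[ℂ] (Fin r → ℂ)) ω
      (fun b : X => ((trivializationAt (Fin r → ℂ) E y).coordChangeL ℂ
        (trivializationAt (Fin r → ℂ) E x) b : (Fin r → ℂ) →L[ℂ] (Fin r → ℂ)))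
      ((chartAt (Fin n → ℂ) y).symm (chartAt (Fin n → ℂ) y y)) := by
    rw [(chartAt (Fin n → ℂ) y).left_inv (mem_chart_source _ y)]
    exact contMDiffAt_coordChangeL hy hx
  have h3 := (h2.comp _ h1).contDiffAt
  have h4 : ∀ m l : Fin r, ContDiffAt ℂ ω (fun q => transitionMatrix (r := r) (E := E) x y
      ((chartAt (Fin n → ℂ) y).symm q) m l) (chartAt (Fin n → ℂ) y y) := by
    intro m l
    simp only [transitionMatrix, LinearMap.toMatrix'_apply]
    exact contDiffAt_pi.1 (h3.clm_apply contDiffAt_const) m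
  have h5 : ContDiffAt ℂ ω (F := Fin r → Fin r → ℂ) (fun q => transitionMatrix (r := r) (E := E)
      x y ((chartAt (Fin n → ℂ) y).symm q)) (chartAt (Fin n → ℂ) y y) :=
    contDiffAt_pi.2 fun m => contDiffAt_pi.2 fun l => h4 m l
  exact h5.analyticAt

/-- Only invertibility at z is required, because the perturbations h + εu are controlled only at the
point under study. Smoothness makes entrywise and matrix derivatives agree in a neighbourhood. -/
theorem curvature_eq_chernCurvature_of_isUnit {h : ∀ x, E x → E x → ℂ}
    (hh : IsSmoothHermitian n (r := r) h) {z : X} (hz : IsUnit (metricAt (r := r) h z).det) :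
    curvature (n := n) (r := r) h z
      = chernCurvature (fun q => Matrix.of (localMatrix (n := n) (r := r) h z q)) (chartAt (Fin n → ℂ) z z) := by
  have hsymm : (chartAt (Fin n → ℂ) z).symm (chartAt (Fin n → ℂ) z z) = z :=
    (chartAt (Fin n → ℂ) z).left_inv (mem_chart_source _ z)
  have hzb := FiberBundle.mem_baseSet_trivializationAt' (F := Fin r → ℂ) (E := E) z
  have hM : ContDiffAt ℝ ∞ (fun q => Matrix.of (localMatrix (n := n) (r := r) h z q))
      (chartAt (Fin n → ℂ) z z) :=
    contDiffAt_localMatrix hh z (mem_chart_target _ z) (by rwa [hsymm])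
  have hM2 : ContDiffAt ℝ 2 (fun q => Matrix.of (localMatrix (n := n) (r := r) h z q))
      (chartAt (Fin n → ℂ) z z) := hM.of_le (by norm_cast)
  have hdet : IsUnit (Matrix.of (localMatrix (n := n) (r := r) h z
      (chartAt (Fin n → ℂ) z z))).det := by
    rw [localMatrix, hsymm]
    exact hz
  have hconn : ∀ j, connectionMatrix (r := r) h z j =ᶠ[𝓝 (chartAt (Fin n → ℂ) z z)]
      chernConnection (fun q => Matrix.of (localMatrix (n := n) (r := r) h z q)) j := by
    intro j
    filter_upwards [hM2.eventually (by norm_num)] with q hq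
    rw [chernConnection, wirtinger_fderiv (hq.differentiableAt two_ne_zero)]
    rfl
  funext j k
  have h1 := differentiableAt_chernConnection hM2 hdet j
  ext μ l
  rw [chernCurvature, wirtingerBar_fderiv h1]
  simp only [curvature, Matrix.of_apply, Matrix.neg_apply, dzbar]
  have h2 : (fun p => connectionMatrix (r := r) h z j p μ l) =ᶠ[𝓝 (chartAt (Fin n → ℂ) z z)]
      fun p => chernConnection (fun q => Matrix.of (localMatrix (n := n) (r := r) h z q)) j p μ l :=
    (hconn j).mono fun q hq => congrFun (congrFun hq μ) l
  rw [h2.fderiv_eq]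

theorem curvature_eq_chernCurvature {h : ∀ x, E x → E x → ℂ} (hh : IsHermitianMetric n r h)
    (z : X) : curvature (n := n) (r := r) h z
      = chernCurvature (fun q => Matrix.of (localMatrix (n := n) (r := r) h z q))
        (chartAt (Fin n → ℂ) z z) :=
  curvature_eq_chernCurvature_of_isUnit hh.1 (isUnit_det_of_posDef (metricAt_posDef hh z))

theorem posDef_localMatrix {h : ∀ x, E x → E x → ℂ} (hh : IsHermitianMetric n r h) {x y : X}
    (hyc : y ∈ (chartAt (Fin n → ℂ) x).source)
    (hyb : y ∈ (trivializationAt (Fin r → ℂ) E x).baseSet) :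
    (Matrix.of (localMatrix (n := n) (r := r) h x (chartAt (Fin n → ℂ) x y))).PosDef := by
  rw [localMatrix, (chartAt (Fin n → ℂ) x).left_inv hyc]
  exact frameMatrix_posDef hh hyb

theorem contDiffAt_of_localMatrix {h : ∀ x, E x → E x → ℂ} (hh : IsSmoothHermitian n (r := r) h)
    {x y : X} (hyc : y ∈ (chartAt (Fin n → ℂ) x).source)
    (hyb : y ∈ (trivializationAt (Fin r → ℂ) E x).baseSet) :
    ContDiffAt ℝ 2 (fun q => Matrix.of (localMatrix (n := n) (r := r) h x q))
      (chartAt (Fin n → ℂ) x y) := by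
  have hM : ContDiffAt ℝ ∞ (fun q => Matrix.of (localMatrix (n := n) (r := r) h x q))
      (chartAt (Fin n → ℂ) x y) :=
    contDiffAt_localMatrix hh x ((chartAt (Fin n → ℂ) x).map_source hyc)
      (by rwa [(chartAt (Fin n → ℂ) x).left_inv hyc])
  exact hM.of_le (by norm_cast)

theorem isHermitianTensor_localCurvature {h : ∀ x, E x → E x → ℂ} (hh : IsHermitianMetric n r h)
    {x y : X} (hyc : y ∈ (chartAt (Fin n → ℂ) x).source)
    (hyb : y ∈ (trivializationAt (Fin r → ℂ) E x).baseSet) :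
    IsHermitianTensor (Matrix.of (localMatrix (n := n) (r := r) h x (chartAt (Fin n → ℂ) x y)))
      (chernCurvature (fun q => Matrix.of (localMatrix (n := n) (r := r) h x q)) (chartAt (Fin n → ℂ) x y)) :=
  isHermitianTensor_chernCurvature
    (M := fun q => Matrix.of (localMatrix (n := n) (r := r) h x q))
    (contDiffAt_of_localMatrix hh.1 hyc hyb)
    (Filter.Eventually.of_forall fun _ => frameMatrix_isHermitian hh.1 _ _)
    (posDef_localMatrix hh hyc hyb)

theorem isHermitianTensor_curvature {h : ∀ x, E x → E x → ℂ} (hh : IsHermitianMetric n r h)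
    (z : X) : IsHermitianTensor (metricAt (r := r) h z) (curvature (n := n) (r := r) h z) := by
  have h1 := isHermitianTensor_localCurvature hh (mem_chart_source (Fin n → ℂ) z)
    (FiberBundle.mem_baseSet_trivializationAt' (F := Fin r → ℂ) (E := E) z)
  rw [← curvature_eq_chernCurvature hh, localMatrix,
    (chartAt (Fin n → ℂ) z).left_inv (mem_chart_source _ z)] at h1
  exact h1

/-- The metric and the curvature at `y` in the preferred frame at `y`, in terms of the frame
at `x`. -/
theorem exists_changeFrame {x y : X} (hyc : y ∈ (chartAt (Fin n → ℂ) x).source)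
    (hyb : y ∈ (trivializationAt (Fin r → ℂ) E x).baseSet) :
    ∃ (A : Matrix (Fin r) (Fin r) ℂ) (J : Matrix (Fin n) (Fin n) ℂ), IsUnit A.det ∧ IsUnit J.det ∧
      ∀ h : ∀ x, E x → E x → ℂ, IsHermitianMetric n r h →
        metricAt (r := r) h y = Aᴴ * Matrix.of (localMatrix (n := n) (r := r) h x (chartAt (Fin n → ℂ) x y)) * A ∧
        curvature (n := n) (r := r) h y = changeFrame A J (chernCurvature (fun q => Matrix.of (localMatrix (n := n) (r := r) h x q))
          (chartAt (Fin n → ℂ) x y)) := by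
  have hyy := FiberBundle.mem_baseSet_trivializationAt' (F := Fin r → ℂ) (E := E) y
  have hsymm : (chartAt (Fin n → ℂ) y).symm (chartAt (Fin n → ℂ) y y) = y :=
    (chartAt (Fin n → ℂ) y).left_inv (mem_chart_source _ y)
  refine ⟨transitionMatrix (E := E) x y y, _, isUnit_det_transitionMatrix x y y,
    isUnit_det_jacobian hyc (mem_chart_source _ y), fun h hh => ⟨?_, ?_⟩⟩
  · rw [localMatrix, (chartAt (Fin n → ℂ) x).left_inv hyc]
    exact frameMatrix_transition hh.1 hyb hyy
  · rw [curvature_eq_chernCurvature hh]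
    have h1 := chernCurvature_transition
      (A := fun q => transitionMatrix (r := r) (E := E) x y ((chartAt (Fin n → ℂ) y).symm q))
      (M := fun q => Matrix.of (localMatrix (n := n) (r := r) h x q))
      (M' := fun q => Matrix.of (localMatrix (n := n) (r := r) h y q)) (analyticAt_transitionMatrix hyb)
      (analyticAt_chart_transition hyc (mem_chart_source _ y))
      (by rw [hsymm]; exact contDiffAt_of_localMatrix hh.1 hyc hyb)
      (isUnit_det_transitionMatrix _ _ _)
      (by rw [hsymm]; exact isUnit_det_of_posDef (posDef_localMatrix hh hyc hyb)) ?_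
    · simp only [hsymm] at h1
      exact h1
    · have hs : Filter.Tendsto (chartAt (Fin n → ℂ) y).symm (𝓝 (chartAt (Fin n → ℂ) y y))
          (𝓝 y) := by
        have := (chartAt (Fin n → ℂ) y).continuousAt_symm (mem_chart_target _ y)
        rwa [ContinuousAt, hsymm] at this
      filter_upwards [hs.eventually ((chartAt (Fin n → ℂ) x).open_source.mem_nhds hyc),
        hs.eventually ((trivializationAt (Fin r → ℂ) E x).open_baseSet.mem_nhds hyb),
        hs.eventually ((trivializationAt (Fin r → ℂ) E y).open_baseSet.mem_nhds hyy)]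
        with q h1 h2 h3
      simp only [localMatrix, (chartAt (Fin n → ℂ) x).left_inv h1]
      exact frameMatrix_transition hh.1 h2 h3

end Holomorphic

end BundleGeometry

/-! ### The 2-jet of the metric: continuity and norm -/

section JetContinuity

variable {n r : ℕ}

theorem continuousAt_metricJet {M : (Fin n → ℂ) → Fin r → Fin r → ℂ} {p : Fin n → ℂ}
    (hM : ContDiffAt ℝ 2 M p) : ContinuousAt (metricJet M) p := by
  have h1 : ContDiffAt ℝ 1 (fderiv ℝ M) p := hM.fderiv_right (by norm_num)
  have h2 : ContDiffAt ℝ 0 (fderiv ℝ (fderiv ℝ M)) p := h1.fderiv_right (by norm_num)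
  exact hM.continuousAt.prodMk (h1.continuousAt.prodMk h2.continuousAt)

theorem metricJet_sub {M N : (Fin n → ℂ) → Fin r → Fin r → ℂ} {p : Fin n → ℂ}
    (hM : ContDiffAt ℝ 2 M p) (hN : ContDiffAt ℝ 2 N p) :
    metricJet (M - N) p = metricJet M p - metricJet N p := by
  have h1 : fderiv ℝ (M - N) =ᶠ[𝓝 p] fderiv ℝ M - fderiv ℝ N := by
    filter_upwards [hM.eventually (by norm_num), hN.eventually (by norm_num)] with q h1 h2
    exact fderiv_sub (h1.differentiableAt two_ne_zero) (h2.differentiableAt two_ne_zero)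
  have h2 : fderiv ℝ (fderiv ℝ (M - N)) p
      = fderiv ℝ (fderiv ℝ M) p - fderiv ℝ (fderiv ℝ N) p := by
    rw [h1.fderiv_eq]
    exact fderiv_sub
      ((hM.fderiv_right (m := 1) (by norm_num)).differentiableAt one_ne_zero)
      ((hN.fderiv_right (m := 1) (by norm_num)).differentiableAt one_ne_zero)
  exact Prod.ext rfl (Prod.ext h1.eq_of_nhds h2)

theorem norm_metricJet_lt {M : (Fin n → ℂ) → Fin r → Fin r → ℂ} {p : Fin n → ℂ} {δ : ℝ}
    (h : ∀ i ≤ 2, ‖iteratedFDeriv ℝ i M p‖ < δ) : ‖metricJet M p‖ < δ := by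
  have h0 := h 0 (by norm_num)
  have h1 := h 1 (by norm_num)
  have h2 := h 2 le_rfl
  rw [norm_iteratedFDeriv_zero] at h0
  rw [norm_iteratedFDeriv_one] at h1
  rw [← norm_iteratedFDeriv_fderiv, norm_iteratedFDeriv_one] at h2
  exact max_lt h0 (max_lt h1 h2)

theorem continuousAt_metric_curvature {J : MetricJet n r} (hJ : (Matrix.of J.1).PosDef) :
    ContinuousAt (fun J : MetricJet n r => ((Matrix.of J.1, jetCurvature J) :
      Matrix (Fin r) (Fin r) ℂ × (Fin n → Fin n → Matrix (Fin r) (Fin r) ℂ))) J := by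
  have h1 : ContinuousAt (fun J : MetricJet n r => Matrix.of J.1) J := continuous_fst.continuousAt
  exact h1.prodMk
    (contDiffAt_jetCurvature (m := 0) (isUnit_det_of_posDef hJ)).continuousAt

theorem eventually_isPositive_jet {P : PositivityType} {t : ℝ} {J : MetricJet n r}
    (hJ : (Matrix.of J.1).PosDef) (h : IsPositive (Matrix.of J.1) (twist t (jetCurvature J)) P) :
    ∀ᶠ J' : MetricJet n r in 𝓝 J, IsPositive (Matrix.of J'.1) (twist t (jetCurvature J')) P := by
  have h1 : ContinuousAt (fun J : MetricJet n r => Matrix.of J.1) J := continuous_fst.continuousAt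
  have h2 : ContinuousAt (fun J : MetricJet n r => twist t (jetCurvature J)) J :=
    (contDiffAt_twist (contDiffAt_jetCurvature (m := 0) (isUnit_det_of_posDef hJ)) t).continuousAt
  exact (h1.prodMk h2).eventually (eventually_isPositive (isUnit_det_of_posDef hJ) h)

end JetContinuity

/-- One radius serves for all y near x although the centre f y moves. This uniformity turns an open
condition on jets into a C² condition on metrics. -/
theorem exists_forall_norm_sub_lt {Y V : Type*} [TopologicalSpace Y] [NormedAddCommGroup V]
    {q : V → Prop} {f : Y → V} {x : Y} (hq : ∀ᶠ J in 𝓝 (f x), q J) (hf : ContinuousAt f x) :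
    ∃ ε : ℝ, 0 < ε ∧ ∀ᶠ y in 𝓝 x, ∀ J, ‖J - f y‖ < ε → q J := by
  obtain ⟨ε, hε, hball⟩ := Metric.eventually_nhds_iff.1 hq
  refine ⟨ε / 2, half_pos hε, ?_⟩
  filter_upwards [hf.eventually (Metric.ball_mem_nhds _ (half_pos hε))] with y hy J hJ
  refine hball ?_
  rw [← dist_eq_norm] at hJ
  have h1 : dist (f y) (f x) < ε / 2 := hy
  linarith [dist_triangle J (f y) (f x)]

/-! ### Continuity of the distortion and C² neighbourhoods -/

section Neighborhood

variable {n r : ℕ} {X : Type*} [TopologicalSpace X] [ChartedSpace (Fin n → ℂ) X]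
  {E : X → Type*} [∀ x, AddCommGroup (E x)] [∀ x, Module ℂ (E x)]
  [TopologicalSpace (TotalSpace (Fin r → ℂ) E)] [∀ x, TopologicalSpace (E x)]
  [FiberBundle (Fin r → ℂ) E] [IsManifold 𝓘(ℂ, Fin n → ℂ) ω X]

/-- The two-jet of a metric at `y`, in the preferred coordinates and frame at `x`. -/
def localJet (h : ∀ x, E x → E x → ℂ) (x y : X) : MetricJet n r :=
  metricJet (localMatrix h x) (chartAt (Fin n → ℂ) x y)

variable [VectorBundle ℂ (Fin r → ℂ) E] [ContMDiffVectorBundle ω (Fin r → ℂ) E 𝓘(ℂ, Fin n → ℂ)]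

theorem continuousAt_localJet {h : ∀ x, E x → E x → ℂ} (hh : IsSmoothHermitian n (r := r) h)
    {x y : X} (hyc : y ∈ (chartAt (Fin n → ℂ) x).source)
    (hyb : y ∈ (trivializationAt (Fin r → ℂ) E x).baseSet) :
    ContinuousAt (fun y => (localJet h x y : MetricJet n r)) y :=
  ContinuousAt.comp (f := chartAt (Fin n → ℂ) x) (g := metricJet (localMatrix h x))
    (continuousAt_metricJet (contDiffAt_of_localMatrix hh hyc hyb))
    ((chartAt (Fin n → ℂ) x).continuousAt hyc)

theorem chernCurvature_eq_localJet {h : ∀ x, E x → E x → ℂ} (hh : IsHermitianMetric n r h)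
    {x y : X} (hyc : y ∈ (chartAt (Fin n → ℂ) x).source)
    (hyb : y ∈ (trivializationAt (Fin r → ℂ) E x).baseSet) :
    chernCurvature (fun q => Matrix.of (localMatrix (n := n) (r := r) h x q))
      (chartAt (Fin n → ℂ) x y) = jetCurvature (localJet h x y) :=
  chernCurvature_eq_jetCurvature (M := fun q => Matrix.of (localMatrix (n := n) (r := r) h x q))
    (contDiffAt_of_localMatrix hh.1 hyc hyb)
    (isUnit_det_of_posDef (posDef_localMatrix hh hyc hyb))

theorem metricAt_eq_localJet (h : ∀ x, E x → E x → ℂ) (x : X) :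
    metricAt h x = Matrix.of (localJet (n := n) (r := r) h x x).1 := by
  rw [localJet, metricJet, localMatrix, (chartAt (Fin n → ℂ) x).left_inv (mem_chart_source _ x)]
  rfl

theorem curvature_eq_localJet {h : ∀ x, E x → E x → ℂ} (hh : IsHermitianMetric n r h) (x : X) :
    curvature (n := n) (r := r) h x = jetCurvature (localJet h x x) := by
  rw [curvature_eq_chernCurvature hh, chernCurvature_eq_localJet hh (mem_chart_source _ x)
    (FiberBundle.mem_baseSet_trivializationAt' x)]

theorem isPositive_of_localJet {P : PositivityType} {t : ℝ} {h : ∀ x, E x → E x → ℂ}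
    (hh : IsHermitianMetric n r h) {x y : X} (hyc : y ∈ (chartAt (Fin n → ℂ) x).source)
    (hyb : y ∈ (trivializationAt (Fin r → ℂ) E x).baseSet)
    (hpos : IsPositive (Matrix.of (localJet (n := n) (r := r) h x y).1)
      (twist t (jetCurvature (localJet (n := n) (r := r) h x y))) P) :
    IsPositive (metricAt (r := r) h y) (twist t (curvature (n := n) h y)) P := by
  obtain ⟨A, J, hA, hJ, hAJ⟩ := exists_changeFrame (n := n) (r := r) (E := E) hyc hyb
  obtain ⟨h1, h2⟩ := hAJ h hh
  rw [h1, h2, chernCurvature_eq_localJet hh hyc hyb, twist_changeFrame hA]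
  exact hpos.changeFrame hA hJ

/-- The preferred frame at y may jump with y. Invariance allows the computation in the fixed frame
at x, where the 2-jet depends continuously on y. -/
theorem distortion_eq_localJet {P : PositivityType} (s : ℝ) {t : ℝ} {h : ∀ x, E x → E x → ℂ}
    (hh : IsHermitianMetric n r h) {x y : X} (hyc : y ∈ (chartAt (Fin n → ℂ) x).source)
    (hyb : y ∈ (trivializationAt (Fin r → ℂ) E x).baseSet)
    (hpos : IsPositive (Matrix.of (localJet (n := n) (r := r) h x y).1)
      (twist t (jetCurvature (localJet (n := n) (r := r) h x y))) P) :
    distortion n r P s t h y = distortionAt s t (Matrix.of (localJet (n := n) (r := r) h x y).1)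
      (jetCurvature (localJet (n := n) (r := r) h x y)) P := by
  obtain ⟨A, J, hA, hJ, hAJ⟩ := exists_changeFrame (n := n) (r := r) (E := E) hyc hyb
  obtain ⟨h1, h2⟩ := hAJ h hh
  have h3 := isHermitianTensor_localCurvature hh hyc hyb
  rw [chernCurvature_eq_localJet hh hyc hyb] at h2 h3
  rw [distortion, h1, h2]
  exact distortionAt_changeFrame (posDef_localMatrix hh hyc hyb) h3 hA hJ s hpos

theorem continuousAt_distortionAt_localJet (hr : 1 ≤ r) {P : PositivityType} (s : ℝ) {t : ℝ}
    {h : ∀ x, E x → E x → ℂ} (hh : IsHermitianMetric n r h) (hP : IsTwistPositive n r P t h)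
    (hW : ∀ z, (traceForm (curvature (n := n) (r := r) h z)).PosDef) (x : X) :
    ContinuousAt (fun J : MetricJet n r => distortionAt s t (Matrix.of J.1) (jetCurvature J) P)
      (localJet h x x) := by
  have hJ := metricAt_posDef hh x
  have hc := isHermitianTensor_curvature hh x
  have h1 := hP x
  have h2 := hW x
  rw [metricAt_eq_localJet (n := n)] at hJ hc h1
  rw [curvature_eq_localJet hh] at hc h1 h2
  exact ContinuousAt.comp (g := fun x : Matrix (Fin r) (Fin r) ℂ ×
    (Fin n → Fin n → Matrix (Fin r) (Fin r) ℂ) => distortionAt s t x.1 x.2 P)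
    (f := fun J : MetricJet n r => (Matrix.of J.1, jetCurvature J))
    (continuousAt_distortionAt hr hJ hc h2 s h1) (continuousAt_metric_curvature hJ)

theorem eventually_isPositive_localJet {P : PositivityType} {t : ℝ}
    {h : ∀ x, E x → E x → ℂ} (hh : IsHermitianMetric n r h) (hP : IsTwistPositive n r P t h)
    (x : X) :
    ∀ᶠ J : MetricJet n r in 𝓝 (localJet h x x),
      IsPositive (Matrix.of J.1) (twist t (jetCurvature J)) P := by
  have hJ := metricAt_posDef hh x
  have h1 := hP x
  rw [metricAt_eq_localJet (n := n)] at hJ h1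
  rw [curvature_eq_localJet hh] at h1
  exact eventually_isPositive_jet hJ h1

theorem continuous_distortion (hr : 1 ≤ r) {P : PositivityType} (s : ℝ) {t : ℝ}
    {h : ∀ x, E x → E x → ℂ} (hh : IsHermitianMetric n r h) (hP : IsTwistPositive n r P t h)
    (hW : ∀ z, (traceForm (curvature (n := n) (r := r) h z)).PosDef) :
    Continuous (distortion n r P s t h) := by
  refine continuous_iff_continuousAt.2 fun x => ?_
  have hxb := FiberBundle.mem_baseSet_trivializationAt' (F := Fin r → ℂ) (E := E) x
  have hjet := continuousAt_localJet hh.1 (mem_chart_source (Fin n → ℂ) x) hxb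
  have h1 : ContinuousAt (fun y => distortionAt s t
      (Matrix.of (localJet (n := n) (r := r) h x y).1) (jetCurvature (localJet (n := n) (r := r) h x y)) P) x :=
    ContinuousAt.comp (g := fun J : MetricJet n r =>
      distortionAt s t (Matrix.of J.1) (jetCurvature J) P) (f := fun y => localJet h x y)
      (continuousAt_distortionAt_localJet hr s hh hP hW x) hjet
  refine h1.congr ?_
  filter_upwards [hjet.eventually (eventually_isPositive_localJet hh hP x),
    (chartAt (Fin n → ℂ) x).open_source.mem_nhds (mem_chart_source _ x),
    (trivializationAt (Fin r → ℂ) E x).open_baseSet.mem_nhds hxb] with y h2 h3 h4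
  exact (distortion_eq_localJet s hh h3 h4 h2).symm

theorem distortion_nonneg (hr : 1 ≤ r) {P : PositivityType} (s : ℝ) {t : ℝ}
    {h : ∀ x, E x → E x → ℂ} (hh : IsHermitianMetric n r h) (hP : IsTwistPositive n r P t h)
    (hW : ∀ z, (traceForm (curvature (n := n) (r := r) h z)).PosDef) (z : X) :
    0 ≤ distortion n r P s t h z :=
  distortionAt_nonneg hr (metricAt_posDef hh z) (isHermitianTensor_curvature hh z) (hW z) s (hP z)

-- The conditions are open in the 2-jet. Near each point a common radius works on a compact
-- neighbourhood, finitely many of these cover X, and the smallest radius defines the C²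
-- neighbourhood.
set_option synthInstance.maxHeartbeats 200000 in
theorem isC2Neighborhood_distortion_lt [CompactSpace X] [T2Space X] (hr : 1 ≤ r)
    {P : PositivityType} (s : ℝ) {t β : ℝ} {h : ∀ x, E x → E x → ℂ} (hh : IsHermitianMetric n r h)
    (hP : IsTwistPositive n r P t h)
    (hW : ∀ z, (traceForm (curvature (n := n) (r := r) h z)).PosDef)
    (hβ : ∀ z, distortion n r P s t h z < β) :
    IsC2Neighborhood n r h {h' | IsHermitianMetric n r h' ∧ IsTwistPositive n r P t h' ∧
      ∀ z, distortion n r P s t h' z < β} := by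
  have key : ∀ x : X, ∃ (δ : ℝ) (K : Set X), 0 < δ ∧ IsCompact K ∧ K ∈ 𝓝 x ∧
      K ⊆ (chartAt (Fin n → ℂ) x).source ∩ (trivializationAt (Fin r → ℂ) E x).baseSet ∧
      ∀ y ∈ K, ∀ J : MetricJet n r, ‖J - localJet h x y‖ < δ →
        IsPositive (Matrix.of J.1) (twist t (jetCurvature J)) P ∧
          distortionAt s t (Matrix.of J.1) (jetCurvature J) P < β := by
    intro x
    have hxb := FiberBundle.mem_baseSet_trivializationAt' (F := Fin r → ℂ) (E := E) x
    have hjet := continuousAt_localJet hh.1 (mem_chart_source (Fin n → ℂ) x) hxb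
    have h1 := eventually_isPositive_localJet hh hP x
    have h2 : distortionAt s t (Matrix.of (localJet (n := n) (r := r) h x x).1)
        (jetCurvature (localJet (n := n) (r := r) h x x)) P < β := by
      rw [← distortion_eq_localJet s hh (mem_chart_source _ x) hxb h1.self_of_nhds]
      exact hβ x
    have h3 := (continuousAt_distortionAt_localJet hr s hh hP hW x).eventually_lt_const h2
    obtain ⟨ε, hε, hball⟩ := exists_forall_norm_sub_lt (V := MetricJet n r)
      (f := fun y => localJet h x y) (h1.and h3) hjet
    have h5 := Filter.inter_mem hball (Filter.inter_mem
      ((chartAt (Fin n → ℂ) x).open_source.mem_nhds (mem_chart_source _ x))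
      ((trivializationAt (Fin r → ℂ) E x).open_baseSet.mem_nhds hxb))
    obtain ⟨K, hKx, hKs, hKc⟩ := local_compact_nhds h5
    exact ⟨ε, K, hε, hKc, hKx, fun y hy => (hKs hy).2, fun y hy => (hKs hy).1⟩
  choose δ K hδ hKc hKx hKs hK using key
  obtain ⟨S, -, hS⟩ := isCompact_univ.elim_nhds_subcover K fun x _ => hKx x
  -- The minimum over the finite cover; if the cover is empty, X is empty and any positive number
  -- will do.
  obtain ⟨δ₀, hδ₀, hδS⟩ : ∃ δ₀ : ℝ, 0 < δ₀ ∧ ∀ x ∈ S, δ₀ ≤ δ x := by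
    rcases S.eq_empty_or_nonempty with h0 | h0
    · exact ⟨1, one_pos, by simp [h0]⟩
    · obtain ⟨x₀, hx₀, hmin⟩ := S.exists_min_image δ h0
      exact ⟨δ x₀, hδ x₀, hmin⟩
  refine ⟨S, K, δ₀, hδ₀, fun x _ => ⟨hKc x, hKs x⟩, fun h' hh' hsmall => ?_⟩
  have hgood : ∀ z, ∃ x, z ∈ K x ∧
      IsPositive (n := n) (Matrix.of (localJet (n := n) (r := r) h' x z).1)
        (twist t (jetCurvature (localJet (n := n) (r := r) h' x z))) P ∧
      distortionAt s t (Matrix.of (localJet (n := n) (r := r) h' x z).1)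
        (jetCurvature (localJet (n := n) (r := r) h' x z)) P < β := by
    intro z
    obtain ⟨x, hxS, hzK⟩ := Set.mem_iUnion₂.1 (hS (Set.mem_univ z))
    refine ⟨x, hzK, hK x z hzK _ ?_⟩
    have h2 := norm_metricJet_lt fun i hi => (hsmall x hxS z hzK i hi).trans_le (hδS x hxS)
    have h3 := metricJet_sub (M := localMatrix (n := n) (r := r) h' x)
      (N := localMatrix (n := n) (r := r) h x)
      (contDiffAt_of_localMatrix hh'.1 (hKs x hzK).1 (hKs x hzK).2)
      (contDiffAt_of_localMatrix hh.1 (hKs x hzK).1 (hKs x hzK).2)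
    exact h3 ▸ h2
  refine ⟨hh', fun z => ?_, fun z => ?_⟩
  · obtain ⟨x, hz, h1, -⟩ := hgood z
    exact isPositive_of_localJet hh' (hKs x hz).1 (hKs x hz).2 h1
  · obtain ⟨x, hz, h1, h2⟩ := hgood z
    rwa [distortion_eq_localJet s hh' (hKs x hz).1 (hKs x hz).2 h1]

end Neighborhood

/-! ### The maximum principle for metrics on a line bundle -/

section LocalMaximum

variable {n : ℕ} {p : Fin n → ℂ} {N : (Fin n → ℂ) → Matrix (Fin 1) (Fin 1) ℂ}

theorem hasDerivAt_re_line (hN : DifferentiableAt ℝ N p) (v : Fin n → ℂ) :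
    HasDerivAt (fun ε : ℝ => (N (p + ε • v) 0 0).re) (fderiv ℝ N p v 0 0).re 0 :=
  Complex.reCLM.hasFDerivAt.comp_hasDerivAt _ (hasDerivAt_matrix_iff.1 (hasDerivAt_line hN v) 0 0)

theorem tendsto_line (p v : Fin n → ℂ) : Filter.Tendsto (fun ε : ℝ => p + ε • v) (𝓝 0) (𝓝 p) := by
  have h1 : Continuous fun ε : ℝ => p + ε • v := by fun_prop
  simpa using h1.tendsto 0

theorem isLocalMax_line (hmax : IsLocalMax (fun q => (N q 0 0).re) p) (v : Fin n → ℂ) :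
    IsLocalMax (fun ε : ℝ => (N (p + ε • v) 0 0).re) 0 := by
  have h1 := (tendsto_line p v).eventually hmax
  simpa [IsLocalMax, IsMaxFilter] using h1

theorem fderiv_eq_zero_of_isLocalMax (hN : DifferentiableAt ℝ N p)
    (hH : ∀ᶠ q in 𝓝 p, (N q).IsHermitian) (hmax : IsLocalMax (fun q => (N q 0 0).re) p)
    (v : Fin n → ℂ) : fderiv ℝ N p v = 0 := by
  have h1 : (fderiv ℝ N p v 0 0).re = 0 :=
    (isLocalMax_line hmax v).hasDerivAt_eq_zero (hasDerivAt_re_line hN v)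
  have h2 : (fderiv ℝ N p v 0 0).im = 0 :=
    Complex.conj_eq_iff_im.1 ((isHermitian_fderiv hN hH v).apply 0 0)
  ext i j
  rw [Subsingleton.elim i 0, Subsingleton.elim j 0]
  exact Complex.ext h1 h2

/-- If the second derivative along a line were positive, the critical point would also be a local
minimum of the restriction. The restriction would then be locally constant, with second derivative
zero. -/
theorem second_derivative_nonpos (hN : ContDiffAt ℝ 2 N p)
    (hmax : IsLocalMax (fun q => (N q 0 0).re) p) (v : Fin n → ℂ) :
    (fderiv ℝ (fderiv ℝ (F := Fin 1 → Fin 1 → ℂ) N) p v v 0 0).re ≤ 0 := by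
  by_contra! hpos
  set g : ℝ → ℝ := fun ε => (N (p + ε • v) 0 0).re with hg
  have hloc := isLocalMax_line hmax v
  have h1 : ∀ᶠ ε in 𝓝 (0 : ℝ), deriv g ε = (fderiv ℝ N (p + ε • v) v 0 0).re := by
    filter_upwards [(tendsto_line p v).eventually (hN.eventually (by norm_num))] with ε hε
    have h2 := hasDerivAt_re_line (hε.differentiableAt two_ne_zero) v
    have h4 : HasDerivAt (fun δ : ℝ => (N (p + ε • v + δ • v) 0 0).re)
        (fderiv ℝ N (p + ε • v) v 0 0).re (ε - ε) := by rwa [sub_self]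
    have h5 := h4.comp_sub_const ε ε
    have h6 : (fun δ : ℝ => (N (p + ε • v + (δ - ε) • v) 0 0).re) = g := by
      funext δ
      rw [hg, add_assoc, ← add_smul, add_sub_cancel]
    rw [h6] at h5
    exact h5.deriv
  have h2 : HasDerivAt (deriv g)
      (fderiv ℝ (fderiv ℝ (F := Fin 1 → Fin 1 → ℂ) N) p v v 0 0).re 0 :=
    (Complex.reCLM.hasFDerivAt.comp_hasDerivAt _ (hasDerivAt_matrix_iff.1
      (hasDerivAt_fderiv_line hN v v) 0 0)).congr_of_eventuallyEq h1
  have hc : ContinuousAt g 0 :=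
    (hasDerivAt_re_line (hN.differentiableAt two_ne_zero) v).continuousAt
  have hmin := isLocalMin_of_deriv_deriv_pos (by rw [h2.deriv]; exact hpos)
    hloc.deriv_eq_zero hc
  have h3 : g =ᶠ[𝓝 0] fun _ => g 0 := by
    filter_upwards [hloc, hmin] with ε h4 h5
    exact le_antisymm h4 h5
  have h4 : deriv g =ᶠ[𝓝 0] fun _ => 0 := by
    have := h3.deriv
    simpa using this
  have h5 := h4.deriv_eq
  rw [h2.deriv, deriv_const] at h5
  exact hpos.ne' h5

/-- First derivatives vanish at the maximum, so the curvature reduces to -h⁻¹∂̄∂h. The operator 4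
∂²/∂z_j∂z̄_j is the Laplacian in the variable z_j, nonpositive at a maximum. -/
theorem chernCurvature_nonneg_of_isLocalMax (hN : ContDiffAt ℝ 2 N p)
    (hH : ∀ᶠ q in 𝓝 p, (N q).IsHermitian) (hp : 0 < (N p 0 0).re)
    (hmax : IsLocalMax (fun q => (N q 0 0).re) p) (j : Fin n) :
    0 ≤ (chernCurvature N p j j).trace.re := by
  have him : (N p 0 0).im = 0 := Complex.conj_eq_iff_im.1 (hH.self_of_nhds.apply 0 0)
  have hne : N p 0 0 ≠ 0 := fun h0 => by simp [h0] at hp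
  have hdet : IsUnit (N p).det := by
    rw [Matrix.det_fin_one]
    exact hne.isUnit
  have hinv : (N p)⁻¹ 0 0 = (N p 0 0)⁻¹ := by
    simp
  set B := fderiv ℝ (fderiv ℝ (F := Fin 1 → Fin 1 → ℂ) N) p with hB
  have hN' : ContDiffAt ℝ 2 (F := Fin 1 → Fin 1 → ℂ) N p := hN
  have hsymm : ∀ v w, B v w = B w v := fun v w => hN'.isSymmSndFDerivAt (by simp) v w
  have h0 : (wirtinger j fun v => fderiv ℝ N p v) = 0 := by
    simp only [wirtinger, fderiv_eq_zero_of_isLocalMax (hN.differentiableAt two_ne_zero) hH hmax]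
    simp
  have h1 : chernCurvature N p j j = -((N p)⁻¹ * mixedPart j j fun v w => Matrix.of (B v w)) := by
    rw [chernCurvature_eq_jetCurvature hN hdet]
    show -((N p)⁻¹ * mixedPart j j fun v w => Matrix.of (B v w)) + _ *
      (wirtinger j fun v => fderiv ℝ N p v) = _
    rw [h0, Matrix.mul_zero, add_zero]
  -- The mixed terms cancel by symmetry of the second derivative, leaving a quarter of the
  -- Laplacian.
  have h2 : (mixedPart j j fun v w => Matrix.of (B v w)) 0 0
      = (1 / 4 : ℂ) * (B (Pi.single j 1) (Pi.single j 1) 0 0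
        + B (Pi.single j Complex.I) (Pi.single j Complex.I) 0 0) := by
    simp only [mixedPart, wirtingerBar, wirtinger, Matrix.smul_apply, Matrix.add_apply,
      Matrix.sub_apply, Matrix.of_apply, smul_eq_mul, hsymm (Pi.single j Complex.I) (Pi.single j 1)]
    linear_combination (-(1 / 4 : ℂ) *
      B (Pi.single j Complex.I) (Pi.single j Complex.I) 0 0) * Complex.I_sq
  have h3 := second_derivative_nonpos hN hmax (Pi.single j 1)
  have h4 := second_derivative_nonpos hN hmax (Pi.single j Complex.I)
  have h5 : (N p 0 0)⁻¹ = (((N p 0 0).re⁻¹ : ℝ) : ℂ) := by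
    rw [Complex.ofReal_inv]
    congr 1
    exact Complex.ext (by simp) (by simpa using him)
  rw [h1, Matrix.trace_fin_one, Matrix.neg_apply, Matrix.mul_apply, Fin.sum_univ_one, hinv, h2, h5]
  have h6 : ((1 / 4 : ℂ)) = (((1 / 4 : ℝ)) : ℂ) := by push_cast; rfl
  rw [h6, Complex.neg_re, Complex.re_ofReal_mul, Complex.re_ofReal_mul, Complex.add_re]
  have h7 : (0 : ℝ) < (N p 0 0).re⁻¹ := inv_pos.2 hp
  have h8 : 1 / 4 * ((B (Pi.single j 1) (Pi.single j 1) 0 0).re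
      + (B (Pi.single j Complex.I) (Pi.single j Complex.I) 0 0).re) ≤ 0 := by
    have : (B (Pi.single j 1) (Pi.single j 1) 0 0).re ≤ 0 := h3
    have : (B (Pi.single j Complex.I) (Pi.single j Complex.I) 0 0).re ≤ 0 := h4
    linarith
  nlinarith

end LocalMaximum

/-! ### Curvature of powers of the determinant bundle -/

section DeterminantCurvature

variable {n r : ℕ} {p : Fin n → ℂ} {M : (Fin n → ℂ) → Matrix (Fin r) (Fin r) ℂ}

/-- The metric of the `m`-th power of the determinant bundle. -/
def detPowerMetric (m : ℕ) (M : (Fin n → ℂ) → Matrix (Fin r) (Fin r) ℂ) (q : Fin n → ℂ) :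
    Matrix (Fin 1) (Fin 1) ℂ :=
  Matrix.of fun _ _ => (M q).det ^ m

theorem hasDerivAt_det {ι : Type*} [Fintype ι] [DecidableEq ι] {f : ℝ → Matrix ι ι ℂ}
    {f' : Matrix ι ι ℂ} {x : ℝ} (hf : HasDerivAt f f' x) (hx : IsUnit (f x).det) :
    HasDerivAt (fun y => (f y).det) ((f x).adjugate * f').trace x := by
  have h1 : ContDiffAt ℝ 1 (fun A : Matrix ι ι ℂ => A.det) (f x) :=
    contDiffAt_matrix_det contDiffAt_id
  have h2 := (h1.differentiableAt one_ne_zero).hasFDerivAt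
  have h3 := h2.comp_hasDerivAt x hf
  have h4 : HasDerivAt (fun ε : ℝ => f x + (ε : ℂ) • f') f' 0 := by
    have := ((hasDerivAt_id (0 : ℝ)).smul_const f').const_add (f x)
    rw [one_smul] at this
    exact this
  have h5 : HasFDerivAt (fun A : Matrix ι ι ℂ => A.det)
      (fderiv ℝ (fun A : Matrix ι ι ℂ => A.det) (f x)) (f x + ((0 : ℝ) : ℂ) • f') := by
    rwa [Complex.ofReal_zero, zero_smul, add_zero]
  have h6 := (HasFDerivAt.comp_hasDerivAt (f := fun ε : ℝ => f x + (ε : ℂ) • f')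
    (l := fun A : Matrix ι ι ℂ => A.det) (0 : ℝ) h5 h4).unique (hasDerivAt_det_add_smul hx f')
  exact h3.congr_deriv h6

theorem contDiffAt_detPowerMetric {k : WithTop ℕ∞} (m : ℕ) (hM : ContDiffAt ℝ k M p) :
    ContDiffAt ℝ k (detPowerMetric m M) p :=
  contDiffAt_matrix_iff.2 fun _ _ => (contDiffAt_matrix_det hM).pow m

theorem inv_of_fin_one (a : ℂ) : (Matrix.of fun _ _ : Fin 1 => a)⁻¹ = Matrix.of fun _ _ => a⁻¹ := by
  ext i j
  rw [Subsingleton.elim i 0, Subsingleton.elim j 0]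
  simp

theorem fderiv_detPowerMetric (m : ℕ) (hM : DifferentiableAt ℝ M p) (hp : IsUnit (M p).det)
    (v : Fin n → ℂ) : fderiv ℝ (detPowerMetric m M) p v
      = Matrix.of fun _ _ => m * (M p).det ^ m * ((M p)⁻¹ * fderiv ℝ M p v).trace := by
  have h1 := hasDerivAt_det (hasDerivAt_line hM v) (by simpa using hp)
  have h2 : HasDerivAt (fun ε : ℝ => detPowerMetric m M (p + ε • v)) (Matrix.of fun _ _ =>
      m * (M p).det ^ m * ((M p)⁻¹ * fderiv ℝ M p v).trace) 0 := by
    refine hasDerivAt_matrix_iff.2 fun _ _ => (h1.pow m).congr_deriv ?_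
    rw [zero_smul, add_zero, trace_adjugate_mul hp, Matrix.of_apply]
    rcases m with _ | m
    · simp
    · rw [Nat.add_sub_cancel, pow_succ]
      have key : ∀ a d T : ℂ, a * d ^ m * (d * T) = a * (d ^ m * d) * T := fun a d T => by ring
      exact key _ _ _
  have h3 : DifferentiableAt ℝ (detPowerMetric m M) p := by
    have h4 : DifferentiableAt ℝ (fun q => (M q).det) p := by
      have h5 : ContDiffAt ℝ 1 (fun A : Matrix (Fin r) (Fin r) ℂ => A.det) (M p) :=
        contDiffAt_matrix_det contDiffAt_id
      exact (h5.differentiableAt one_ne_zero).comp p hM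
    exact differentiableAt_matrix_iff.2 fun _ _ => h4.pow m
  exact (hasDerivAt_line h3 v).unique h2

/-- This is the identity ∂ log det(h)^m = m tr(h⁻¹∂h), from which the curvature of (det E)^m is m
times the trace of that of E. -/
theorem chernConnection_detPowerMetric (m : ℕ) (hM : DifferentiableAt ℝ M p)
    (hp : IsUnit (M p).det) (j : Fin n) : chernConnection (detPowerMetric m M) j p
      = Matrix.of fun _ _ => m * (chernConnection M j p).trace := by
  have hne : (M p).det ^ m ≠ 0 := pow_ne_zero _ hp.ne_zero
  ext a b
  rw [chernConnection, wirtinger, fderiv_detPowerMetric m hM hp, fderiv_detPowerMetric m hM hp,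
    detPowerMetric, inv_of_fin_one, chernConnection, wirtinger]
  simp only [Matrix.mul_apply, Fin.sum_univ_one, Matrix.of_apply, Matrix.smul_apply,
    Matrix.sub_apply, smul_eq_mul, Matrix.mul_smul, Matrix.mul_sub, Matrix.trace_smul,
    Matrix.trace_sub]
  field_simp

theorem trace_chernCurvature_detPowerMetric (m : ℕ) (hM : ContDiffAt ℝ 2 M p)
    (hp : IsUnit (M p).det) (j k : Fin n) : (chernCurvature (detPowerMetric m M) p j k).trace
      = m * (chernCurvature M p j k).trace := by
  have hdet : ∀ᶠ q in 𝓝 p, IsUnit (M q).det := by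
    have h1 : ContinuousAt (fun q => (M q).det) p :=
      (Continuous.matrix_det continuous_id).continuousAt.comp hM.continuousAt
    filter_upwards [h1.eventually_ne hp.ne_zero] with q hq using hq.isUnit
  have h1 : chernConnection (detPowerMetric m M) j =ᶠ[𝓝 p]
      fun q => Matrix.of fun _ _ => m * (chernConnection M j q).trace := by
    filter_upwards [hM.eventually (by norm_num), hdet] with q h1 h2
    exact chernConnection_detPowerMetric m (h1.differentiableAt two_ne_zero) h2 j
  have h2 := differentiableAt_chernConnection hM hp j
  have h3 : ∀ v, fderiv ℝ (chernConnection (detPowerMetric m M) j) p v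
      = Matrix.of fun _ _ => m * (fderiv ℝ (chernConnection M j) p v).trace := by
    intro v
    have h4 := hasDerivAt_line h2 v
    have h5 : DifferentiableAt ℝ (fun q => (Matrix.of fun _ _ =>
        m * (chernConnection M j q).trace : Matrix (Fin 1) (Fin 1) ℂ)) p := by
      have h6 := differentiableAt_matrix_iff.1 h2
      exact differentiableAt_matrix_iff.2 fun _ _ =>
        (DifferentiableAt.fun_sum fun i _ => h6 i i).const_mul _
    rw [h1.fderiv_eq]
    refine (hasDerivAt_line h5 v).unique (hasDerivAt_matrix_iff.2 fun _ _ => ?_)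
    have h6 := hasDerivAt_matrix_iff.1 h4
    exact (HasDerivAt.fun_sum fun i _ => h6 i i).const_mul _
  simp only [chernCurvature, Matrix.trace_neg, wirtingerBar, h3, Matrix.trace_smul,
    Matrix.trace_add, Matrix.trace_fin_one, Matrix.of_apply, smul_eq_mul]
  ring

/-- The square norm of a holomorphic section of a power of the determinant bundle has no nonzero
local maximum where the curvature is negative. -/
theorem trace_chernCurvature_nonneg_of_isLocalMax {m : ℕ} (hm : 1 ≤ m) (hM : ContDiffAt ℝ 2 M p)
    (hpos : ∀ᶠ q in 𝓝 p, (M q).PosDef) {f : (Fin n → ℂ) → ℂ} (hf : AnalyticAt ℂ f p)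
    (hfp : f p ≠ 0) (hmax : IsLocalMax (fun q => (star (f q) * (M q).det ^ m * f q).re) p)
    (j : Fin n) : 0 ≤ (chernCurvature M p j j).trace.re := by
  have hMp := isUnit_det_of_posDef hpos.self_of_nhds
  set A : (Fin n → ℂ) → Matrix (Fin 1) (Fin 1) ℂ := fun q => Matrix.of fun _ _ => f q with hA
  -- Where f does not vanish, |f|² det(h)^m is the metric of the same line bundle in the frame given
  -- by the section. Its curvature is therefore unchanged, and the maximum principle applies to it.
  set N : (Fin n → ℂ) → Matrix (Fin 1) (Fin 1) ℂ :=
    fun q => (A q)ᴴ * detPowerMetric m M q * A q with hN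
  have hNq : ∀ q, N q 0 0 = star (f q) * (M q).det ^ m * f q := by
    intro q
    simp [hN, hA, detPowerMetric, Matrix.mul_apply]
  have hAa : AnalyticAt ℂ A p := by
    have h1 : ContDiffAt ℂ ω (F := Fin 1 → Fin 1 → ℂ) A p :=
      contDiffAt_pi.2 fun _ => contDiffAt_pi.2 fun _ => hf.contDiffAt
    exact h1.analyticAt
  have hAdet : IsUnit (A p).det := by
    rw [Matrix.det_fin_one]
    exact hfp.isUnit
  have hDdet : IsUnit (detPowerMetric m M p).det := by
    rw [Matrix.det_fin_one]
    exact hMp.pow m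
  have hAr : ContDiffAt ℝ 2 A p := by
    have h1 : ContDiffAt ℝ 2 f p := (hf.contDiffAt.restrict_scalars ℝ)
    exact contDiffAt_matrix_iff.2 fun _ _ => h1
  have hAs : ContDiffAt ℝ 2 (fun q => (A q)ᴴ) p :=
    contDiffAt_matrix_iff.2 fun i k => contDiffAt_star (contDiffAt_matrix_iff.1 hAr k i)
  have hNc : ContDiffAt ℝ 2 N p :=
    contDiffAt_matrix_mul (contDiffAt_matrix_mul hAs (contDiffAt_detPowerMetric m hM)) hAr
  have hdetpos : ∀ᶠ q in 𝓝 p, 0 < (M q).det := hpos.mono fun q hq => hq.det_pos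
  have hH : ∀ᶠ q in 𝓝 p, (N q).IsHermitian := by
    filter_upwards [hdetpos] with q hq
    ext i k
    rw [Subsingleton.elim i 0, Subsingleton.elim k 0, Matrix.conjTranspose_apply, hNq]
    have h1 : star ((M q).det) = (M q).det :=
      Complex.conj_eq_iff_im.2 (Complex.lt_def.1 hq).2.symm
    rw [star_mul', star_mul', star_star, star_pow, h1]
    ring
  have hp0 : 0 < (N p 0 0).re := by
    have h1 : 0 < N p 0 0 := by
      rw [hNq]
      have h2 : star (f p) * (M p).det ^ m * f p = (star (f p) * f p) * (M p).det ^ m := by ring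
      rw [h2]
      refine mul_pos ?_ (pow_pos hdetpos.self_of_nhds m)
      rw [Complex.star_def, ← Complex.normSq_eq_conj_mul_self]
      exact_mod_cast Complex.normSq_pos.2 hfp
    exact (Complex.lt_def.1 h1).1
  have h1 := chernCurvature_nonneg_of_isLocalMax hNc hH hp0
    (by simpa only [hNq] using hmax) j
  have h2 := chernCurvature_transition (A := A) (ψ := fun q => q) (M := detPowerMetric m M)
    (M' := N) hAa analyticAt_id (contDiffAt_detPowerMetric m hM) hAdet hDdet
    (Filter.EventuallyEq.refl _ _)
  have hJ : jacobian (fun q : Fin n → ℂ => q) p = 1 := by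
    ext a b
    have : fderiv ℂ (fun q : Fin n → ℂ => q) p = ContinuousLinearMap.id ℂ _ := fderiv_fun_id
    rw [jacobian, Matrix.of_apply, this, ContinuousLinearMap.id_apply, Matrix.one_apply,
      Pi.single_apply]
  rw [h2, trace_changeFrame hAdet, hJ] at h1
  simp only [Matrix.one_apply, ite_mul, one_mul, zero_mul, Finset.sum_ite_eq', Finset.mem_univ,
    if_true, apply_ite star, star_one, star_zero, mul_ite, mul_one, mul_zero,
    trace_chernCurvature_detPowerMetric m hM hMp] at h1
  have h3 : (0 : ℝ) < m := by exact_mod_cast hm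
  have h4 : ((m : ℂ) * (chernCurvature M p j j).trace).re
      = m * (chernCurvature M p j j).trace.re := by
    rw [← Complex.ofReal_natCast, Complex.re_ofReal_mul]
  have h5 : 0 ≤ m * (chernCurvature M p j j).trace.re := by
    rw [← h4]
    simpa [Finset.sum_ite, Finset.filter_eq'] using h1
  exact nonneg_of_mul_nonneg_right h5 h3

end DeterminantCurvature

/-! ### Ampleness fixes the sign of 1 + rt -/

section Ampleness

variable {n r : ℕ} {X : Type*} [TopologicalSpace X] [ChartedSpace (Fin n → ℂ) X]
  {E : X → Type*} [∀ x, AddCommGroup (E x)] [∀ x, Module ℂ (E x)]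
  [TopologicalSpace (TotalSpace (Fin r → ℂ) E)] [∀ x, TopologicalSpace (E x)]
  [FiberBundle (Fin r → ℂ) E] [VectorBundle ℂ (Fin r → ℂ) E]

variable (r) in
/-- The square norm of a section of `(det E)^m`. -/
def detPowerNorm (h : ∀ x, E x → E x → ℂ) (m : ℕ) (σ : X → ℂ) (y : X) : ℝ :=
  (star (σ y) * (metricAt (r := r) h y).det ^ m * σ y).re

/-- The norm is defined with the preferred frame at y. The determinants of the transition matrix
cancel, so it may be computed in the fixed frame at x, where it is continuous. -/
theorem detPowerNorm_eq {h : ∀ x, E x → E x → ℂ} (hh : IsSmoothHermitian n (r := r) h) (m : ℕ)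
    (σ : X → ℂ) {x y : X} (hx : y ∈ (trivializationAt (Fin r → ℂ) E x).baseSet) :
    detPowerNorm r h m σ y = (star (detPowerLocal r (E := E) m σ x y)
      * (Matrix.of (frameMatrix (r := r) h x y)).det ^ m * detPowerLocal r (E := E) m σ x y).re := by
  have h1 := frameMatrix_transition hh hx (FiberBundle.mem_baseSet_trivializationAt' y)
  have h2 : detPowerLocal r (E := E) m σ x y = (transitionMatrix (r := r) (E := E) x y y).det ^ m * σ y := by
    rw [transitionMatrix, LinearMap.det_toMatrix']
    rfl
  rw [detPowerNorm, metricAt, h1, h2, Matrix.det_mul, Matrix.det_mul, Matrix.det_conjTranspose,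
    star_mul', star_pow, mul_pow, mul_pow]
  congr 1
  ring

theorem continuous_detPowerNorm {h : ∀ x, E x → E x → ℂ} (hh : IsSmoothHermitian n (r := r) h)
    (m : ℕ) {σ : X → ℂ} (hσ : ∀ x, ContMDiffOn 𝓘(ℂ, Fin n → ℂ) 𝓘(ℂ, ℂ) ω
      (detPowerLocal r (E := E) m σ x) (trivializationAt (Fin r → ℂ) E x).baseSet) :
    Continuous (detPowerNorm r h m σ) := by
  refine continuous_iff_continuousAt.2 fun x => ?_
  have hx := (trivializationAt (Fin r → ℂ) E x).open_baseSet.mem_nhds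
    (FiberBundle.mem_baseSet_trivializationAt' (F := Fin r → ℂ) (E := E) x)
  have h1 : ContinuousAt (detPowerLocal r (E := E) m σ x) x := (hσ x).continuousOn.continuousAt hx
  have h2 : ContinuousAt (fun y => (Matrix.of (frameMatrix (r := r) h x y)).det) x := by
    have h3 : ContinuousAt (fun y => Matrix.of (frameMatrix (r := r) h x y)) x :=
      continuousAt_pi.2 fun μ => continuousAt_pi.2 fun l =>
        (hh.smooth x μ l).continuousOn.continuousAt hx
    exact (Continuous.matrix_det continuous_id).continuousAt.comp h3
  have h3 : ContinuousAt (fun y => (star (detPowerLocal r (E := E) m σ x y)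
      * (Matrix.of (frameMatrix (r := r) h x y)).det ^ m
        * detPowerLocal r (E := E) m σ x y).re) x :=
    Complex.continuous_re.continuousAt.comp ((h1.star.mul (h2.pow m)).mul h1)
  refine h3.congr ?_
  filter_upwards [hx] with y hy
  exact (detPowerNorm_eq hh m σ hy).symm

variable [IsManifold 𝓘(ℂ, Fin n → ℂ) ω X] [ContMDiffVectorBundle ω (Fin r → ℂ) E 𝓘(ℂ, Fin n → ℂ)]

/-- On the compact X, the norm of a section of (det E)^m that is not identically zero attains a
positive maximum. There the section is nonzero and `trace_chernCurvature_nonneg_of_isLocalMax`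
applies. -/
theorem exists_trace_curvature_nonneg [CompactSpace X] [Nonempty X]
    (hample : IsDetAmple n r E) {h : ∀ x, E x → E x → ℂ} (hh : IsHermitianMetric n r h) :
    ∃ z : X, ∀ j, 0 ≤ (curvature (n := n) (r := r) h z j j).trace.re := by
  obtain ⟨m, K, σ, hm, hσ, hzero, -, -⟩ := hample
  obtain ⟨i, hi⟩ := hzero (Classical.arbitrary X)
  have hcont := continuous_detPowerNorm hh.1 m (hσ i)
  obtain ⟨z, -, hz⟩ := isCompact_univ.exists_isMaxOn Set.univ_nonempty hcont.continuousOn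
  refine ⟨z, fun j => ?_⟩
  have hpos0 : ∀ y, 0 < (metricAt (r := r) h y).det := fun y => (metricAt_posDef hh y).det_pos
  have hρ : 0 < detPowerNorm r h m (σ i) (Classical.arbitrary X) := by
    have h1 : 0 < star (σ i (Classical.arbitrary X)) *
        (metricAt (r := r) h (Classical.arbitrary X)).det ^ m * σ i (Classical.arbitrary X) := by
      rw [mul_right_comm]
      refine mul_pos ?_ (pow_pos (hpos0 _) m)
      rw [Complex.star_def, ← Complex.normSq_eq_conj_mul_self]
      exact_mod_cast Complex.normSq_pos.2 hi
    exact (Complex.lt_def.1 h1).1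
  have hσz : σ i z ≠ 0 := by
    intro h0
    have h1 : detPowerNorm r h m (σ i) z = 0 := by simp [detPowerNorm, h0]
    have h2 : detPowerNorm r h m (σ i) (Classical.arbitrary X) ≤ detPowerNorm r h m (σ i) z :=
      hz (Set.mem_univ _)
    linarith
  have hzb := FiberBundle.mem_baseSet_trivializationAt' (F := Fin r → ℂ) (E := E) z
  have hsymm : (chartAt (Fin n → ℂ) z).symm (chartAt (Fin n → ℂ) z z) = z :=
    (chartAt (Fin n → ℂ) z).left_inv (mem_chart_source _ z)
  have htend : Filter.Tendsto (chartAt (Fin n → ℂ) z).symm (𝓝 (chartAt (Fin n → ℂ) z z))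
      (𝓝 z) := by
    have := (chartAt (Fin n → ℂ) z).continuousAt_symm (mem_chart_target _ z)
    rwa [ContinuousAt, hsymm] at this
  have hbase := htend.eventually ((trivializationAt (Fin r → ℂ) E z).open_baseSet.mem_nhds hzb)
  have hf : AnalyticAt ℂ (fun q => detPowerLocal r (E := E) m (σ i) z
      ((chartAt (Fin n → ℂ) z).symm q)) (chartAt (Fin n → ℂ) z z) := by
    have h1 : ContMDiffAt 𝓘(ℂ, Fin n → ℂ) 𝓘(ℂ, Fin n → ℂ) ω (chartAt (Fin n → ℂ) z).symm
        (chartAt (Fin n → ℂ) z z) :=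
      contMDiffOn_chart_symm.contMDiffAt ((chartAt (Fin n → ℂ) z).open_target.mem_nhds
        (mem_chart_target _ z))
    have h2 : ContMDiffAt 𝓘(ℂ, Fin n → ℂ) 𝓘(ℂ, ℂ) ω (detPowerLocal r (E := E) m (σ i) z)
        ((chartAt (Fin n → ℂ) z).symm (chartAt (Fin n → ℂ) z z)) := by
      rw [hsymm]
      exact (hσ i z).contMDiffAt ((trivializationAt (Fin r → ℂ) E z).open_baseSet.mem_nhds hzb)
    exact (h2.comp _ h1).contDiffAt.analyticAt
  have hfz : detPowerLocal r (E := E) m (σ i) z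
      ((chartAt (Fin n → ℂ) z).symm (chartAt (Fin n → ℂ) z z)) ≠ 0 := by
    rw [hsymm]
    have h1 := (isUnit_det_transitionMatrix (E := E) (r := r) z z z).ne_zero
    rw [transitionMatrix, LinearMap.det_toMatrix'] at h1
    exact mul_ne_zero (pow_ne_zero m h1) hσz
  have hM := contDiffAt_of_localMatrix hh.1 (mem_chart_source (Fin n → ℂ) z) hzb
  have h1 := trace_chernCurvature_nonneg_of_isLocalMax hm hM ?_ hf hfz ?_ j
  · rwa [curvature_eq_chernCurvature hh]
  · filter_upwards [hbase] with q hq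
    exact frameMatrix_posDef hh hq
  · have h2 : ∀ᶠ q in 𝓝 (chartAt (Fin n → ℂ) z z), detPowerNorm r h m (σ i)
        ((chartAt (Fin n → ℂ) z).symm q) = (star (detPowerLocal r (E := E) m (σ i) z
          ((chartAt (Fin n → ℂ) z).symm q)) *
          (Matrix.of (localMatrix (n := n) (r := r) h z q)).det ^ m *
          detPowerLocal r (E := E) m (σ i) z ((chartAt (Fin n → ℂ) z).symm q)).re := by
      filter_upwards [hbase] with q hq
      exact detPowerNorm_eq hh.1 m (σ i) hq
    filter_upwards [h2] with q hq
    rw [← hq, ← h2.self_of_nhds, hsymm]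
    exact hz (Set.mem_univ _)

/-- The diagonal entries of (1 + rt)ω are positive everywhere, and at some point those of ω are
nonnegative. A diagonal entry exists because n ≥ 1. -/
theorem one_add_mul_pos [CompactSpace X] [Nonempty X] (hr : 1 ≤ r) (hn : 1 ≤ n)
    (hample : IsDetAmple n r E) {P : PositivityType} {t : ℝ} {h : ∀ x, E x → E x → ℂ}
    (hh : IsHermitianMetric n r h) (hP : IsTwistPositive n r P t h) : 0 < 1 + r * t := by
  obtain ⟨z, hz⟩ := exists_trace_curvature_nonneg hample hh
  have h1 := smul_traceForm_posDef hr (metricAt_posDef hh z) (isHermitianTensor_curvature hh z)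
    (hP z)
  have h2 := (Complex.lt_def.1 (h1.diag_pos (i := ⟨0, hn⟩))).1
  have h3 : (((1 + r * t) • traceForm (curvature (n := n) (r := r) h z)) ⟨0, hn⟩ ⟨0, hn⟩).re
      = (1 + r * t) * (curvature (n := n) (r := r) h z ⟨0, hn⟩ ⟨0, hn⟩).trace.re := by
    simp [traceForm]
  rw [h3, Complex.zero_re] at h2
  exact pos_of_mul_pos_left h2 (hz _)

/-- The curvature of `det E` is positive. -/
theorem traceForm_curvature_posDef [CompactSpace X] (hr : 1 ≤ r) (hample : IsDetAmple n r E)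
    {P : PositivityType} {t : ℝ} {h : ∀ x, E x → E x → ℂ} (hh : IsHermitianMetric n r h)
    (hP : IsTwistPositive n r P t h) (z : X) :
    (traceForm (curvature (n := n) (r := r) h z)).PosDef := by
  have : Nonempty X := ⟨z⟩
  -- In dimension zero there are no nonzero tangent vectors and positivity is vacuous.
  rcases Nat.eq_zero_or_pos n with hn | hn
  · subst hn
    refine posDef_of_re_pos (Subsingleton.elim _ _) fun v hv => ?_
    exact absurd (Subsingleton.elim v 0) hv
  · exact traceForm_posDef hr (metricAt_posDef hh z) (isHermitianTensor_curvature hh z)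
      (one_add_mul_pos hr hn hample hh hP) (hP z)

end Ampleness

/-! ### Algebra of 2-jets -/

section JetAlgebra

variable {n r : ℕ} {p : Fin n → ℂ}

theorem metricJet_add {M N : (Fin n → ℂ) → Fin r → Fin r → ℂ}
    (hM : ContDiffAt ℝ 2 M p) (hN : ContDiffAt ℝ 2 N p) :
    metricJet (M + N) p = metricJet M p + metricJet N p := by
  have h1 : fderiv ℝ (M + N) =ᶠ[𝓝 p] fderiv ℝ M + fderiv ℝ N := by
    filter_upwards [hM.eventually (by norm_num), hN.eventually (by norm_num)] with q h1 h2
    exact fderiv_add (h1.differentiableAt two_ne_zero) (h2.differentiableAt two_ne_zero)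
  have h2 : fderiv ℝ (fderiv ℝ (M + N)) p
      = fderiv ℝ (fderiv ℝ M) p + fderiv ℝ (fderiv ℝ N) p := by
    rw [h1.fderiv_eq]
    exact fderiv_add
      ((hM.fderiv_right (m := 1) (by norm_num)).differentiableAt one_ne_zero)
      ((hN.fderiv_right (m := 1) (by norm_num)).differentiableAt one_ne_zero)
  exact Prod.ext rfl (Prod.ext h1.eq_of_nhds h2)

theorem metricJet_smul {M : (Fin n → ℂ) → Fin r → Fin r → ℂ} (hM : ContDiffAt ℝ 2 M p) (a : ℝ) :
    metricJet (a • M) p = a • metricJet M p := by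
  have h1 : fderiv ℝ (a • M) =ᶠ[𝓝 p] a • fderiv ℝ M := by
    filter_upwards [hM.eventually (by norm_num)] with q hq
    exact fderiv_const_smul (hq.differentiableAt two_ne_zero) a
  have h2 : fderiv ℝ (fderiv ℝ (a • M)) p = a • fderiv ℝ (fderiv ℝ M) p := by
    rw [h1.fderiv_eq]
    exact fderiv_const_smul
      ((hM.fderiv_right (m := 1) (by norm_num)).differentiableAt one_ne_zero) a
  exact Prod.ext rfl (Prod.ext h1.eq_of_nhds h2)

theorem fderiv_eq_zero_of_iteratedFDeriv {V W : Type*} [NormedAddCommGroup V] [NormedSpace ℝ V]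
    [NormedAddCommGroup W] [NormedSpace ℝ W] {f : V → W} {x : V}
    (h : ‖iteratedFDeriv ℝ 1 f x‖ = 0) : fderiv ℝ f x = 0 := by
  rw [← norm_eq_zero, ← norm_iteratedFDeriv_one, h]

theorem fderiv_fderiv_eq_zero {V W : Type*} [NormedAddCommGroup V] [NormedSpace ℝ V]
    [NormedAddCommGroup W] [NormedSpace ℝ W] {f : V → W} {x : V}
    (h : ∀ i ≤ 2, iteratedFDeriv ℝ i f x = 0) :
    f x = 0 ∧ fderiv ℝ f x = 0 ∧ fderiv ℝ (fderiv ℝ f) x = 0 := by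
  refine ⟨?_, ?_, ?_⟩
  · rw [← norm_eq_zero, ← norm_iteratedFDeriv_zero (𝕜 := ℝ), h 0 (by norm_num), norm_zero]
  · exact fderiv_eq_zero_of_iteratedFDeriv (by rw [h 1 (by norm_num), norm_zero])
  · exact fderiv_eq_zero_of_iteratedFDeriv
      (by rw [norm_iteratedFDeriv_fderiv, h 2 le_rfl, norm_zero])

theorem metricJet_eq_zero {M : (Fin n → ℂ) → Fin r → Fin r → ℂ}
    (h : ∀ i ≤ 2, iteratedFDeriv ℝ i M p = 0) : metricJet M p = 0 := by
  obtain ⟨h0, h1, h2⟩ := fderiv_fderiv_eq_zero h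
  exact Prod.ext h0 (Prod.ext h1 h2)

theorem fderiv_smul_of_eq_zero {V W : Type*} [NormedAddCommGroup V] [NormedSpace ℝ V]
    [NormedAddCommGroup W] [NormedSpace ℝ W] {f : V → ℝ} {g : V → W} {x : V}
    (hf : DifferentiableAt ℝ f x) (hg : DifferentiableAt ℝ g x) (h0 : f x = 0) :
    fderiv ℝ (fun y => f y • g y) x = (fderiv ℝ f x).smulRight (g x) := by
  rw [fderiv_fun_smul hf hg, h0, zero_smul, zero_add]

/-- The two-jet at a zero of `f` of the product of `f²` with a matrix valued function. -/
theorem metricJet_sq_smul {f : (Fin n → ℂ) → ℝ} {M : (Fin n → ℂ) → Fin r → Fin r → ℂ}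
    (hf : ContDiffAt ℝ 2 f p) (hM : ContDiffAt ℝ 2 M p) (h0 : f p = 0) :
    metricJet (fun q => f q ^ 2 • M q) p = (0, 0,
      (fderiv ℝ f p).smulRight ((fderiv ℝ f p).smulRight ((2 : ℝ) • M p))) := by
  have hf' := hf.differentiableAt two_ne_zero
  have hM' := hM.differentiableAt two_ne_zero
  -- The derivative of f²M still contains a factor f. Differentiating it at a zero of f leaves df
  -- times the other factor, which there equals 2 df ⊗ M.
  have h1 : fderiv ℝ (fun q => f q ^ 2 • M q) =ᶠ[𝓝 p] fun q =>
      f q • (f q • fderiv ℝ M q + (fderiv ℝ f q).smulRight ((2 : ℝ) • M q)) := by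
    filter_upwards [hf.eventually (by norm_num), hM.eventually (by norm_num)] with q h1 h2
    have h3 := h1.differentiableAt two_ne_zero
    rw [fderiv_fun_smul (h3.fun_pow 2) (h2.differentiableAt two_ne_zero), fderiv_fun_pow 2 h3]
    ext1 v
    simp only [add_apply, smul_apply,
      ContinuousLinearMap.smulRight_apply, smul_add, smul_smul, smul_eq_mul]
    congr 2
    · ring
    · push_cast; ring
  have hdf := (hf.fderiv_right (m := 1) (by norm_num)).differentiableAt one_ne_zero
  have hdM := (hM.fderiv_right (m := 1) (by norm_num)).differentiableAt one_ne_zero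
  have h2 : DifferentiableAt ℝ (fun q => (fderiv ℝ f q).smulRight ((2 : ℝ) • M q)) p :=
    DifferentiableAt.comp (f := fun q => (fderiv ℝ f q, (2 : ℝ) • M q)) p
      ((ContinuousLinearMap.smulRightL ℝ (Fin n → ℂ)
        (Fin r → Fin r → ℂ)).isBoundedBilinearMap.differentiableAt (fderiv ℝ f p, (2 : ℝ) • M p))
      (hdf.prodMk (hM'.fun_const_smul (2 : ℝ)))
  have h3 := fderiv_smul_of_eq_zero hf' ((hf'.smul hdM).add h2) h0
  refine Prod.ext ?_ (Prod.ext ?_ ?_)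
  · simp [metricJet, h0]
  · exact h1.eq_of_nhds.trans (by rw [h0]; exact zero_smul ℝ (_ : (Fin n → ℂ) →L[ℝ] (Fin r → Fin r → ℂ)))
  · refine (h1.fderiv_eq.trans h3).trans ?_
    simp [h0]

end JetAlgebra

/-! ### The (1,0) part of a real cotangent vector -/

section CotangentVector

variable {n r : ℕ}

theorem add_smul_zero {V : Type*} [AddCommGroup V] [Module ℝ V] (x : V) (ε : ℝ) :
    x + ε • (0 : V) = x := by
  rw [smul_zero, add_zero]

/-- The coefficients of `dz_j` in a real cotangent vector. -/
def cotangentCoeff (ξ : (Fin n → ℂ) →L[ℝ] ℝ) (j : Fin n) : ℂ :=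
  (1 / 2) * ((ξ (Pi.single j 1) : ℂ) - Complex.I * (ξ (Pi.single j Complex.I) : ℂ))

theorem cotangentCoeff_ne_zero {ξ : (Fin n → ℂ) →L[ℝ] ℝ} (h : ξ ≠ 0) : cotangentCoeff ξ ≠ 0 := by
  intro h0
  have h1 : ∀ j, ξ (Pi.single j 1) = 0 ∧ ξ (Pi.single j Complex.I) = 0 := by
    intro j
    have h2 := congrFun h0 j
    simp only [cotangentCoeff, Pi.zero_apply, mul_eq_zero, one_div, inv_eq_zero,
      OfNat.ofNat_ne_zero, false_or] at h2
    have h3 := congrArg Complex.re h2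
    have h4 := congrArg Complex.im h2
    simp at h3 h4
    exact ⟨h3, h4⟩
  refine h (ContinuousLinearMap.ext fun v => ?_)
  rw [← Finset.univ_sum_single v, _root_.map_sum, zero_apply]
  refine Finset.sum_eq_zero fun j _ => ?_
  have h2 : (Pi.single j (v j) : Fin n → ℂ)
      = (v j).re • (Pi.single j 1 : Fin n → ℂ) + (v j).im • (Pi.single j Complex.I : Fin n → ℂ) := by
    rw [← Pi.single_smul, ← Pi.single_smul, ← Pi.single_add]
    congr 1
    simp only [Complex.real_smul, mul_one]
    exact (Complex.re_add_im _).symm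
  rw [h2, map_add, map_smul, map_smul, (h1 j).1, (h1 j).2, smul_zero, smul_zero, add_zero]

/-- A real covector is p + p̄ with p of type (1,0), so the mixed component of ξ ⊗ ξ is p ⊗ p̄. -/
theorem mixedPart_cotangent (ξ : (Fin n → ℂ) →L[ℝ] ℝ) (w : Matrix (Fin r) (Fin r) ℂ)
    (j k : Fin n) : (mixedPart j k fun v v' => ξ v • ξ v' • w)
      = (cotangentCoeff ξ j * star (cotangentCoeff ξ k)) • w := by
  ext a b
  simp only [mixedPart, wirtinger, wirtingerBar, cotangentCoeff, Matrix.smul_apply,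
    Matrix.add_apply, Matrix.sub_apply, smul_eq_mul, Complex.real_smul, star_mul', star_sub]
  simp
  ring

/-- Adding a multiple of `ξ ⊗ ξ ⊗ w` to the second derivatives of a metric changes its
curvature by a rank one tensor. -/
theorem jetCurvature_add_cotangent {J : MetricJet n r} (ξ : (Fin n → ℂ) →L[ℝ] ℝ)
    (w : Fin r → Fin r → ℂ) (ε : ℝ) :
    jetCurvature (J + ε • ((0, 0, ξ.smulRight (ξ.smulRight w)) : MetricJet n r))
      = jetCurvature J
        + ε • -rankOneTensor (cotangentCoeff ξ) ((Matrix.of J.1)⁻¹ * Matrix.of w) := by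
  funext j k
  have h1 := mixedPart_cotangent ξ (Matrix.of w) j k
  have h2 : (mixedPart j k fun v v' => Matrix.of
      ((J.2.2 + ε • ξ.smulRight (ξ.smulRight w)) v v'))
      = (mixedPart j k fun v v' => Matrix.of (J.2.2 v v'))
        + ε • mixedPart j k fun v v' => ξ v • ξ v' • Matrix.of w := by
    ext a b
    simp [mixedPart, wirtinger, wirtingerBar]
    -- Linearity of the mixed component in the second derivative; first-order terms of the curvature
    -- are untouched by the perturbation.
    ring
  have h3 : (J + ε • ((0, 0, ξ.smulRight (ξ.smulRight w)) : MetricJet n r)).1 = J.1 := by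
    show J.1 + ε • (0 : Fin r → Fin r → ℂ) = J.1
    rw [smul_zero, add_zero]
  have h4 : (J + ε • ((0, 0, ξ.smulRight (ξ.smulRight w)) : MetricJet n r)).2.1 = J.2.1 := by
    show J.2.1 + ε • (0 : (Fin n → ℂ) →L[ℝ] (Fin r → Fin r → ℂ)) = J.2.1
    exact add_smul_zero _ _
  have h5 : (J + ε • ((0, 0, ξ.smulRight (ξ.smulRight w)) : MetricJet n r)).2.2
      = J.2.2 + ε • ξ.smulRight (ξ.smulRight w) := rfl
  rw [jetCurvature, h3, h4, h5, h2, h1]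
  simp only [Pi.add_apply, Pi.smul_apply, Pi.neg_apply, jetCurvature, rankOneTensor,
    Matrix.mul_add, Matrix.mul_smul, neg_add, smul_neg]
  abel

end CotangentVector

/-! ### The chain rule in a direction -/

section DirectionalDerivative

variable {V W U : Type*} [NormedAddCommGroup V] [NormedSpace ℝ V] [NormedAddCommGroup W]
  [NormedSpace ℝ W] [NormedAddCommGroup U] [NormedSpace ℝ U] {f : V → W} {g : W → U} {x : V}

/-- The derivative of `g ∘ f` at `x` in the direction `v`, by the chain rule. -/
def chainDeriv (g : W → U) (f : V → W) (x v : V) : U :=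
  fderiv ℝ g (f x) (fderiv ℝ f x v)

theorem chainDeriv_add (v w : V) :
    chainDeriv g f x (v + w) = chainDeriv g f x v + chainDeriv g f x w := by
  simp only [chainDeriv, map_add]

theorem chainDeriv_smul (a : ℝ) (v : V) : chainDeriv g f x (a • v) = a • chainDeriv g f x v := by
  simp only [chainDeriv, map_smul]

theorem chainDeriv_zero : chainDeriv g f x 0 = 0 := by
  simp only [chainDeriv, map_zero]

theorem add_zero_smul (x v : V) : x + (0 : ℝ) • v = x := by
  rw [zero_smul, add_zero]

theorem hasDerivAt_chainDeriv (hf : ContDiffAt ℝ 1 f x) (hg : DifferentiableAt ℝ g (f x))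
    (v : V) : HasDerivAt (fun ε : ℝ => g (f (x + ε • v))) (chainDeriv g f x v) 0 := by
  have h1 := hasDerivAt_line (hf.differentiableAt one_ne_zero) v
  exact HasFDerivAt.comp_hasDerivAt_of_eq (l := g) (0 : ℝ) hg.hasFDerivAt h1
    (by rw [zero_smul, add_zero])

/-- If f is affine along the line, its derivative in that direction can be read off. The full
derivative of the curvature map is then never needed for the symbol. -/
theorem chainDeriv_eq_of_line (hf : ContDiffAt ℝ 1 f x) {v : V} {w : W}
    (h : ∀ ε : ℝ, f (x + ε • v) = f x + ε • w) : chainDeriv g f x v = fderiv ℝ g (f x) w := by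
  have h1 := hasDerivAt_line (hf.differentiableAt one_ne_zero) v
  have h2 : HasDerivAt (fun ε : ℝ => f x + ε • w) w 0 := by
    simpa using ((hasDerivAt_id (0 : ℝ)).smul_const w).const_add (f x)
  rw [chainDeriv, h1.unique (h2.congr_of_eventuallyEq (Filter.Eventually.of_forall h))]

end DirectionalDerivative

/-! ### The linearized system as a function of the 2-jet -/

section JetOperator

variable {n r : ℕ} {P : PositivityType} {s t β o : ℝ} {J : MetricJet n r}

/-- The metric and the curvature as functions of the two-jet of the metric. -/
def jetGeometry (J : MetricJet n r) :
    Matrix (Fin r) (Fin r) ℂ × (Fin n → Fin n → Matrix (Fin r) (Fin r) ℂ) :=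
  (Matrix.of J.1, jetCurvature J)

theorem contDiffAt_jetGeometry (hJ : IsUnit (Matrix.of J.1).det) :
    ContDiffAt ℝ 1 (jetGeometry (n := n) (r := r)) J := by
  have h1 : ContDiffAt ℝ 1 (fun J : MetricJet n r => Matrix.of J.1) J :=
    contDiffAt_fst (E := Fin r → Fin r → ℂ)
  exact h1.prodMk (contDiffAt_jetCurvature (m := 1) hJ)

theorem jetGeometry_add_cotangent (ξ : (Fin n → ℂ) →L[ℝ] ℝ) (w : Fin r → Fin r → ℂ) (ε : ℝ) :
    jetGeometry (J + ε • ((0, 0, ξ.smulRight (ξ.smulRight w)) : MetricJet n r))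
      = jetGeometry J
        + ε • (0, -rankOneTensor (cotangentCoeff ξ) ((Matrix.of J.1)⁻¹ * Matrix.of w)) := by
  refine Prod.ext ?_ (jetCurvature_add_cotangent ξ w ε)
  show J.1 + ε • (0 : Fin r → Fin r → ℂ) = J.1 + ε • (0 : Fin r → Fin r → ℂ)
  rfl

/-- The derivative at the jet `J` of the difference of the two sides of the system. -/
def linearizedSystem (P : PositivityType) (s t β o : ℝ)
    (F : (Fin r → Fin r → ℂ) × ((Fin n → ℂ) →L[ℝ] (Fin r → Fin r → ℂ)) → ℝ)
    (G : (Fin r → Fin r → ℂ) × ((Fin n → ℂ) →L[ℝ] (Fin r → Fin r → ℂ)) → Fin r → Fin r → ℂ)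
    (J K : MetricJet n r) : ℝ × Matrix (Fin r) (Fin r) ℂ :=
  chainDeriv (pointOperator P s t β o) jetGeometry J K
    - (fderivWithin ℝ F (metricJets n r) (J.1, J.2.1) (K.1, K.2.1),
      Matrix.of (fderivWithin ℝ G (metricJets n r) (J.1, J.2.1) (K.1, K.2.1)))

variable {F : (Fin r → Fin r → ℂ) × ((Fin n → ℂ) →L[ℝ] (Fin r → Fin r → ℂ)) → ℝ}
  {G : (Fin r → Fin r → ℂ) × ((Fin n → ℂ) →L[ℝ] (Fin r → Fin r → ℂ)) → Fin r → Fin r → ℂ}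

theorem linearizedSystem_add (K K' : MetricJet n r) :
    linearizedSystem P s t β o F G J (K + K')
      = linearizedSystem P s t β o F G J K + linearizedSystem P s t β o F G J K' := by
  have h1 : (((K + K').1, (K + K').2.1) : (Fin r → Fin r → ℂ) ×
      ((Fin n → ℂ) →L[ℝ] (Fin r → Fin r → ℂ))) = (K.1, K.2.1) + (K'.1, K'.2.1) := rfl
  have h2 : chainDeriv (pointOperator P s t β o) jetGeometry J (K + K')
      = chainDeriv (pointOperator P s t β o) jetGeometry J K
        + chainDeriv (pointOperator P s t β o) jetGeometry J K' := chainDeriv_add K K'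
  rw [linearizedSystem, h1, h2, map_add (fderivWithin ℝ F _ _), map_add (fderivWithin ℝ G _ _)]
  exact add_sub_add_comm (α := ℝ × Matrix (Fin r) (Fin r) ℂ) _ _ (_, Matrix.of _) (_, Matrix.of _)

theorem linearizedSystem_smul (a : ℝ) (K : MetricJet n r) :
    linearizedSystem P s t β o F G J (a • K) = a • linearizedSystem P s t β o F G J K := by
  have h1 : (((a • K).1, (a • K).2.1) : (Fin r → Fin r → ℂ) ×
      ((Fin n → ℂ) →L[ℝ] (Fin r → Fin r → ℂ))) = a • (K.1, K.2.1) := rfl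
  have h2 : chainDeriv (pointOperator P s t β o) jetGeometry J (a • K)
      = a • chainDeriv (pointOperator P s t β o) jetGeometry J K := chainDeriv_smul a K
  rw [linearizedSystem, h1, h2, map_smul (fderivWithin ℝ F _ _), map_smul (fderivWithin ℝ G _ _)]
  exact (smul_sub (A := ℝ × Matrix (Fin r) (Fin r) ℂ) a _ (_, Matrix.of _)).symm

theorem linearizedSystem_zero : linearizedSystem P s t β o F G J 0 = 0 := by
  have h1 : chainDeriv (pointOperator P s t β o) (jetGeometry (n := n) (r := r)) J 0 = 0 :=
    chainDeriv_zero (V := MetricJet n r)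
  have h2 : (((0 : MetricJet n r).1, (0 : MetricJet n r).2.1) : (Fin r → Fin r → ℂ) ×
      ((Fin n → ℂ) →L[ℝ] (Fin r → Fin r → ℂ))) = 0 := rfl
  rw [linearizedSystem, h1, h2, map_zero (fderivWithin ℝ F _ _), map_zero (fderivWithin ℝ G _ _)]
  exact sub_zero (G := ℝ × Matrix (Fin r) (Fin r) ℂ) 0

/-- A jet concentrated in second derivatives is invisible to right-hand sides of order one. Only the
rank one variation of the curvature remains. -/
theorem linearizedSystem_cotangent (hJ : IsUnit (Matrix.of J.1).det)
    (ξ : (Fin n → ℂ) →L[ℝ] ℝ) (w : Fin r → Fin r → ℂ) :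
    linearizedSystem P s t β o F G J (0, 0, ξ.smulRight (ξ.smulRight w))
      = fderiv ℝ (pointOperator P s t β o) (jetGeometry J)
        (0, -rankOneTensor (cotangentCoeff ξ) ((Matrix.of J.1)⁻¹ * Matrix.of w)) := by
  have h1 : ((0, 0) : (Fin r → Fin r → ℂ) × ((Fin n → ℂ) →L[ℝ] (Fin r → Fin r → ℂ))) = 0 := rfl
  have h2 : chainDeriv (pointOperator P s t β o) jetGeometry J
      (0, 0, ξ.smulRight (ξ.smulRight w)) = fderiv ℝ (pointOperator P s t β o) (jetGeometry J)
        (0, -rankOneTensor (cotangentCoeff ξ) ((Matrix.of J.1)⁻¹ * Matrix.of w)) :=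
    chainDeriv_eq_of_line (contDiffAt_jetGeometry hJ) fun ε => jetGeometry_add_cotangent ξ w ε
  rw [linearizedSystem, h2, h1, map_zero (fderivWithin ℝ F _ _), map_zero (fderivWithin ℝ G _ _)]
  exact sub_zero (G := ℝ × Matrix (Fin r) (Fin r) ℂ) _

variable (P s t β o) in
/-- The principal symbol of the linearized system. -/
def systemSymbol (H : Matrix (Fin r) (Fin r) ℂ) (c : Fin n → Fin n → Matrix (Fin r) (Fin r) ℂ)
    (p : Fin n → ℂ) : Matrix (Fin r) (Fin r) ℂ →ₗ[ℝ] ℝ × Matrix (Fin r) (Fin r) ℂ where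
  toFun w := fderiv ℝ (pointOperator P s t β o) (H, c) (0, -rankOneTensor p (H⁻¹ * w))
  map_add' w w' := by
    rw [← map_add]
    congr 1
    refine Prod.ext (add_zero _).symm ?_
    funext j k
    simp only [rankOneTensor, Pi.neg_apply, Prod.mk_add_mk, Pi.add_apply, Matrix.mul_add, smul_add,
      neg_add]
  map_smul' a w := by
    rw [RingHom.id_apply, ← map_smul]
    congr 1
    refine Prod.ext (smul_zero a).symm ?_
    funext j k
    simp only [rankOneTensor, Pi.neg_apply, Prod.smul_mk, Pi.smul_apply, Matrix.mul_smul, smul_neg]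
    rw [smul_comm]

end JetOperator

/-! ### Perturbations of a metric and the derivative of the system -/

section Bundle

variable {n r : ℕ} {X : Type*} [TopologicalSpace X] [ChartedSpace (Fin n → ℂ) X]
  {E : X → Type*} [∀ x, AddCommGroup (E x)] [∀ x, Module ℂ (E x)]
  [TopologicalSpace (TotalSpace (Fin r → ℂ) E)] [∀ x, TopologicalSpace (E x)]
  [FiberBundle (Fin r → ℂ) E]

theorem IsSmoothHermitian.add {u v : ∀ x, E x → E x → ℂ} (hu : IsSmoothHermitian n (r := r) u)
    (hv : IsSmoothHermitian n (r := r) v) : IsSmoothHermitian n (r := r) (u + v) where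
  add_left x a b c := by
    simp only [Pi.add_apply, hu.add_left, hv.add_left]; ring
  smul_left x a b c := by
    simp only [Pi.add_apply, hu.smul_left, hv.smul_left]; ring
  conj_symm x a b := by
    simp only [Pi.add_apply, star_add, ← hu.conj_symm, ← hv.conj_symm]
  smooth x μ l := (hu.smooth x μ l).add (hv.smooth x μ l)

theorem IsSmoothHermitian.smul {u : ∀ x, E x → E x → ℂ} (hu : IsSmoothHermitian n (r := r) u)
    (a : ℝ) : IsSmoothHermitian n (r := r) (a • u) where
  add_left x v w y := by
    simp only [Pi.smul_apply, hu.add_left, smul_add]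
  smul_left x b v w := by
    simp only [Pi.smul_apply, hu.smul_left, Complex.real_smul]; ring
  conj_symm x v w := by
    simp only [Pi.smul_apply, Complex.real_smul, star_mul', ← hu.conj_symm, Complex.star_def,
      Complex.conj_ofReal]
  smooth x μ l := by
    have h1 : ContMDiffOn 𝓘(ℝ, Fin n → ℂ) 𝓘(ℝ, ℝ) ∞ (fun _ : X => a)
      (trivializationAt (Fin r → ℂ) E x).baseSet := contMDiffOn_const
    exact h1.smul (hu.smooth x μ l)

variable [IsManifold 𝓘(ℂ, Fin n → ℂ) ω X]

theorem contDiffAt_localMatrix_self {u : ∀ x, E x → E x → ℂ}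
    (hu : IsSmoothHermitian n (r := r) u) (z : X) :
    ContDiffAt ℝ 2 (localMatrix (n := n) (r := r) u z) (chartAt (Fin n → ℂ) z z) := by
  have h1 := contDiffAt_localMatrix hu z (mem_chart_target (Fin n → ℂ) z) (by
    rw [(chartAt (Fin n → ℂ) z).left_inv (mem_chart_source _ z)]
    exact FiberBundle.mem_baseSet_trivializationAt' z)
  exact h1.of_le (by norm_cast)

theorem localJet_add {u v : ∀ x, E x → E x → ℂ} (hu : IsSmoothHermitian n (r := r) u)
    (hv : IsSmoothHermitian n (r := r) v) (z : X) :
    (localJet (u + v) z z : MetricJet n r) = localJet u z z + localJet v z z :=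
  metricJet_add (contDiffAt_localMatrix_self hu z) (contDiffAt_localMatrix_self hv z)

theorem localJet_smul {u : ∀ x, E x → E x → ℂ} (hu : IsSmoothHermitian n (r := r) u) (a : ℝ)
    (z : X) : (localJet (a • u) z z : MetricJet n r) = a • localJet u z z :=
  metricJet_smul (contDiffAt_localMatrix_self hu z) a

variable [VectorBundle ℂ (Fin r → ℂ) E] [ContMDiffVectorBundle ω (Fin r → ℂ) E 𝓘(ℂ, Fin n → ℂ)]

theorem jetOne_mem_metricJets {h : ∀ x, E x → E x → ℂ} (hh : IsSmoothHermitian n (r := r) h)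
    {z : X} (hz : (metricAt (r := r) h z).PosDef) :
    (jetOne h z : (Fin r → Fin r → ℂ) × ((Fin n → ℂ) →L[ℝ] (Fin r → Fin r → ℂ)))
      ∈ metricJets n r := by
  refine ⟨?_, fun ζ => ?_⟩
  · rw [metricAt_eq_localJet (n := n)] at hz
    exact hz
  · exact isHermitian_fderiv (M := fun q => Matrix.of (localMatrix (n := n) (r := r) h z q))
      ((contDiffAt_localMatrix_self hh z).differentiableAt two_ne_zero)
      (Filter.Eventually.of_forall fun q => frameMatrix_isHermitian hh _ _) ζ

/-- Positivity at the single point z is enough, since each derivative of the operator is taken at a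
fixed point. -/
theorem eventually_posDef_metricAt {h u : ∀ x, E x → E x → ℂ}
    (hh : IsSmoothHermitian n (r := r) h) (hu : IsSmoothHermitian n (r := r) u) {z : X}
    (hz : (metricAt (r := r) h z).PosDef) :
    ∀ᶠ ε : ℝ in 𝓝 0, (metricAt (r := r) (h + ε • u) z).PosDef := by
  have h1 : Filter.Tendsto (fun ε : ℝ => metricAt (r := r) (h + ε • u) z) (𝓝 0)
      (𝓝 (metricAt (r := r) h z)) := by
    have h2 : Continuous fun ε : ℝ => metricAt (r := r) h z + ε • metricAt (r := r) u z := by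
      fun_prop
    have h3 := h2.tendsto 0
    rw [zero_smul, add_zero] at h3
    exact h3
  filter_upwards [h1.eventually (eventually_normSqOf_pos fun v hv => normSqOf_pos hz hv)]
    with ε hε
  exact posDef_of_re_pos (frameMatrix_isHermitian (hh.add (hu.smul ε)) z z) hε

theorem curvature_eq_localJet_of_posDef {h : ∀ x, E x → E x → ℂ}
    (hh : IsSmoothHermitian n (r := r) h) {z : X} (hz : (metricAt (r := r) h z).PosDef) :
    curvature (n := n) (r := r) h z = jetCurvature (localJet h z z) := by
  rw [curvature_eq_chernCurvature_of_isUnit hh (isUnit_det_of_posDef hz)]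
  rw [metricAt_eq_localJet (n := n)] at hz
  exact chernCurvature_eq_jetCurvature
    (M := fun q => Matrix.of (localMatrix (n := n) (r := r) h z q))
    (contDiffAt_localMatrix_self hh z) (isUnit_det_of_posDef hz)

theorem systemOperator_eq_pointOperator {P : PositivityType} {s t β : ℝ} {Ω : X → ℝ}
    {F : X → (Fin r → Fin r → ℂ) × ((Fin n → ℂ) →L[ℝ] (Fin r → Fin r → ℂ)) → ℝ}
    {G : X → (Fin r → Fin r → ℂ) × ((Fin n → ℂ) →L[ℝ] (Fin r → Fin r → ℂ)) →
      Fin r → Fin r → ℂ} {h : ∀ x, E x → E x → ℂ}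
    (hh : IsSmoothHermitian n (r := r) h) {z : X} (hz : (metricAt (r := r) h z).PosDef) :
    systemOperator P s t β Ω F G h z = pointOperator P s t β (Ω z) (jetGeometry (localJet (n := n) (r := r) h z z))
      - (F z (jetOne h z), Matrix.of (G z (jetOne h z))) := by
  rw [systemOperator, scalarOperator, curvature_eq_localJet_of_posDef hh hz,
    metricAt_eq_localJet (n := n)]
  rfl

theorem hasDerivAt_systemOperator {P : PositivityType} {s t β : ℝ} {Ω : X → ℝ}
    {F : X → (Fin r → Fin r → ℂ) × ((Fin n → ℂ) →L[ℝ] (Fin r → Fin r → ℂ)) → ℝ}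
    {G : X → (Fin r → Fin r → ℂ) × ((Fin n → ℂ) →L[ℝ] (Fin r → Fin r → ℂ)) →
      Fin r → Fin r → ℂ} (hF : IsScalarRHS n r F) (hG : IsEndoRHS n r G)
    {h u : ∀ x, E x → E x → ℂ} (hh : IsSmoothHermitian n (r := r) h)
    (hu : IsSmoothHermitian n (r := r) u) {z : X} (hz : (metricAt (r := r) h z).PosDef)
    (hd : DifferentiableAt ℝ (pointOperator P s t β (Ω z))
      (jetGeometry (localJet (n := n) (r := r) h z z))) :
    HasDerivAt (fun ε : ℝ => systemOperator P s t β Ω F G (h + ε • u) z)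
      (linearizedSystem P s t β (Ω z) (F z) (G z) (localJet h z z) (localJet u z z)) 0 := by
  have hpos := eventually_posDef_metricAt hh hu hz
  have hJ : IsUnit (Matrix.of (localJet (n := n) (r := r) h z z).1).det := by
    rw [← metricAt_eq_localJet (n := n)]
    exact isUnit_det_of_posDef hz
  have h1 := hasDerivAt_chainDeriv (V := MetricJet n r) (contDiffAt_jetGeometry hJ) hd
    (localJet u z z)
  set j₀ : (Fin r → Fin r → ℂ) × ((Fin n → ℂ) →L[ℝ] (Fin r → Fin r → ℂ)) := jetOne h z with hj₀
  set j₁ : (Fin r → Fin r → ℂ) × ((Fin n → ℂ) →L[ℝ] (Fin r → Fin r → ℂ)) := jetOne u z with hj₁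
  have hjet : ∀ ε : ℝ, jetOne (h + ε • u) z = j₀ + ε • j₁ := by
    intro ε
    have h2 := localJet_add hh (hu.smul ε) z
    rw [localJet_smul hu] at h2
    exact congrArg (fun J : MetricJet n r => (J.1, J.2.1)) h2
  have hmem : ∀ᶠ ε : ℝ in 𝓝 0, j₀ + ε • j₁ ∈ metricJets n r := by
    filter_upwards [hpos] with ε hε
    rw [← hjet]
    exact jetOne_mem_metricJets (hh.add (hu.smul ε)) hε
  have hline : HasDerivAt (fun ε : ℝ => j₀ + ε • j₁) j₁ 0 := by
    simpa using ((hasDerivAt_id (0 : ℝ)).smul_const j₁).const_add j₀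
  have h0 : j₀ = j₀ + (0 : ℝ) • j₁ := (add_zero_smul _ _).symm
  -- The right-hand sides are differentiable only within the set of metric jets. The line of 1-jets
  -- stays in that set for small ε, so the chain rule with a derivative within a set applies.
  have h2 := (((hF z).1 j₀ (jetOne_mem_metricJets hh hz)).hasFDerivWithinAt).comp_hasDerivAt_of_eq
    0 hline hmem h0
  have h3 := (((hG z).1 j₀ (jetOne_mem_metricJets hh hz)).hasFDerivWithinAt).comp_hasDerivAt_of_eq
    0 hline hmem h0
  have h4 : HasDerivAt (fun ε : ℝ => Matrix.of (G z (j₀ + ε • j₁)))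
    (Matrix.of (fderivWithin ℝ (G z) (metricJets n r) j₀ j₁)) 0 := h3
  refine (HasDerivAt.sub (F := ℝ × Matrix (Fin r) (Fin r) ℂ) h1 (h2.prodMk h4)).congr_of_eventuallyEq ?_
  filter_upwards [hpos] with ε hε
  rw [systemOperator_eq_pointOperator (hh.add (hu.smul ε)) hε, localJet_add hh (hu.smul ε),
    localJet_smul hu, hjet]
  rfl

end Bundle

/-! ### Ellipticity of the linearized system -/

section Ellipticity

variable {n r : ℕ} {X : Type*} [TopologicalSpace X] [ChartedSpace (Fin n → ℂ) X]
  {E : X → Type*} [∀ x, AddCommGroup (E x)] [∀ x, Module ℂ (E x)]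
  [TopologicalSpace (TotalSpace (Fin r → ℂ) E)] [∀ x, TopologicalSpace (E x)]
  [FiberBundle (Fin r → ℂ) E] [IsManifold 𝓘(ℂ, Fin n → ℂ) ω X]

theorem contDiffAt_comp_chart_symm {φ : X → ℝ}
    (hφ : ContMDiff 𝓘(ℝ, Fin n → ℂ) 𝓘(ℝ, ℝ) ∞ φ) (z : X) :
    ContDiffAt ℝ 2 (fun q => φ ((chartAt (Fin n → ℂ) z).symm q)) (chartAt (Fin n → ℂ) z z) := by
  have := isManifold_real (n := n) (X := X)
  have h1 : ContMDiffAt 𝓘(ℝ, Fin n → ℂ) 𝓘(ℝ, Fin n → ℂ) ∞ (chartAt (Fin n → ℂ) z).symm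
      (chartAt (Fin n → ℂ) z z) :=
    contMDiffOn_chart_symm.contMDiffAt ((chartAt (Fin n → ℂ) z).open_target.mem_nhds
      (mem_chart_target _ z))
  exact ((hφ _).comp _ h1).contDiffAt.of_le (by norm_cast)

theorem mfderiv_eq_fderiv_comp_chart_symm {φ : X → ℝ}
    (hφ : ContMDiff 𝓘(ℝ, Fin n → ℂ) 𝓘(ℝ, ℝ) ∞ φ) (z : X) (v : Fin n → ℂ) :
    mfderiv 𝓘(ℝ, Fin n → ℂ) 𝓘(ℝ, ℝ) φ z v
      = fderiv ℝ (fun q => φ ((chartAt (Fin n → ℂ) z).symm q)) (chartAt (Fin n → ℂ) z z) v := by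
  have h1 : MDifferentiableAt 𝓘(ℝ, Fin n → ℂ) 𝓘(ℝ, ℝ) φ z :=
    (hφ z).mdifferentiableAt (by simp)
  rw [h1.mfderiv]
  simp only [writtenInExtChartAt, extChartAt, mfld_simps, fderivWithin_univ]
  rfl

/-- The two-jet of the product of a form with the square of a function vanishing at `z`. -/
theorem localJet_sq_smul {φ : X → ℝ} (hφ : ContMDiff 𝓘(ℝ, Fin n → ℂ) 𝓘(ℝ, ℝ) ∞ φ) {z : X}
    (h0 : φ z = 0) {ξ : (Fin n → ℂ) →L[ℝ] ℝ}
    (hξ : ∀ v : Fin n → ℂ, mfderiv 𝓘(ℝ, Fin n → ℂ) 𝓘(ℝ, ℝ) φ z v = ξ v)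
    {u : ∀ x, E x → E x → ℂ} (hu : IsSmoothHermitian n (r := r) u) :
    (localJet (fun x v w => (φ x ^ 2 : ℝ) • u x v w) z z : MetricJet n r)
      = (0, 0, ξ.smulRight (ξ.smulRight ((2 : ℝ) • (localJet (n := n) (r := r) u z z).1))) := by
  have h1 : fderiv ℝ (fun q => φ ((chartAt (Fin n → ℂ) z).symm q)) (chartAt (Fin n → ℂ) z z)
      = ξ := ContinuousLinearMap.ext fun v => by
    rw [← mfderiv_eq_fderiv_comp_chart_symm hφ]
    exact hξ v
  have h2 := metricJet_sq_smul (contDiffAt_comp_chart_symm hφ z)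
    (contDiffAt_localMatrix_self hu z)
    (by rw [(chartAt (Fin n → ℂ) z).left_inv (mem_chart_source _ z), h0])
  rw [h1] at h2
  exact h2

variable [VectorBundle ℂ (Fin r → ℂ) E] [ContMDiffVectorBundle ω (Fin r → ℂ) E 𝓘(ℂ, Fin n → ℂ)]

/-- The pointwise bijectivity `bijOn_fderiv_pointOperator` is transported to the bundle. The sign of
1 + rt is asked only for n ≥ 1, the case in which nonzero cotangent vectors exist. -/
theorem hasEllipticLinearization_systemOperator (hr : 1 ≤ r) {P : PositivityType} {s t β : ℝ}
    (hs : 0 < s) (ht : 1 ≤ n → 0 < 1 + r * t) {Ω : X → ℝ} (hΩ : ∀ z, 0 < Ω z)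
    {h : ∀ x, E x → E x → ℂ} (hh : IsHermitianMetric n r h) (hP : IsTwistPositive n r P t h)
    (hW : ∀ z, (traceForm (curvature (n := n) (r := r) h z)).PosDef)
    (hβ : ∀ z, distortion n r P s t h z < β)
    {F : X → (Fin r → Fin r → ℂ) × ((Fin n → ℂ) →L[ℝ] (Fin r → Fin r → ℂ)) → ℝ}
    {G : X → (Fin r → Fin r → ℂ) × ((Fin n → ℂ) →L[ℝ] (Fin r → Fin r → ℂ)) →
      Fin r → Fin r → ℂ} (hF : IsScalarRHS n r F) (hG : IsEndoRHS n r G) :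
    HasEllipticLinearization n r (systemOperator (n := n) (r := r) P s t β Ω F G) h := by
  have hgeom : ∀ z, jetGeometry (localJet (n := n) (r := r) h z z)
      = (metricAt (r := r) h z, curvature (n := n) (r := r) h z) := fun z => by
    rw [jetGeometry, ← metricAt_eq_localJet (n := n), ← curvature_eq_localJet hh]
  have hdiff : ∀ z, DifferentiableAt ℝ (pointOperator P s t β (Ω z))
      (jetGeometry (localJet (n := n) (r := r) h z z)) := fun z => by
    rw [hgeom]
    exact differentiableAt_pointOperator hr (metricAt_posDef hh z)
      (isHermitianTensor_curvature hh z) (hW z) (hΩ z) (hP z)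
  have hdet : ∀ z, IsUnit (Matrix.of (localJet (n := n) (r := r) h z z).1).det := fun z => by
    rw [← metricAt_eq_localJet (n := n)]
    exact isUnit_det_of_posDef (metricAt_posDef hh z)
  refine ⟨fun u z => linearizedSystem P s t β (Ω z) (F z) (G z) (localJet h z z)
    (localJet u z z), fun u z hu => ?_, ⟨fun u v hu hv => ?_, fun a u hu => ?_,
    fun u z _ h0 => ?_⟩, fun z ξ hξ => ?_⟩
  · exact hasDerivAt_systemOperator hF hG hh.1 hu (metricAt_posDef hh z) (hdiff z)
  · funext z
    rw [localJet_add hu hv, linearizedSystem_add]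
    rfl
  · funext z
    rw [localJet_smul hu, linearizedSystem_smul]
    rfl
  · have h1 : (localJet u z z : MetricJet n r) = 0 := metricJet_eq_zero h0
    simp only [h1]
    exact linearizedSystem_zero
  · have hξ' : cotangentCoeff (n := n) ξ ≠ 0 := cotangentCoeff_ne_zero hξ
    have hn : 1 ≤ n := by
      rcases Nat.eq_zero_or_pos n with hn | hn
      · subst hn
        exact absurd (Subsingleton.elim _ _) hξ'
      · exact hn
    refine ⟨systemSymbol P s t β (Ω z) (metricAt h z) (curvature h z) (cotangentCoeff (n := n) ξ),
      fun φ u hφ h0 hφξ hu => ?_, bijOn_fderiv_pointOperator hr (metricAt_posDef hh z)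
        (isHermitianTensor_curvature hh z) (hW z) hs (ht hn) (hΩ z) (hP z) (hβ z) hξ'⟩
    have h1 := localJet_sq_smul (r := r) hφ h0 hφξ hu
    have h2 := linearizedSystem_cotangent (P := P) (s := s) (t := t) (β := β) (o := Ω z)
      (F := F z) (G := G z) (hdet z) ξ ((2 : ℝ) • (localJet (n := n) (r := r) u z z).1)
    rw [hgeom, ← metricAt_eq_localJet (n := n)] at h2
    have h3 : linearizedSystem P s t β (Ω z) (F z) (G z) (localJet h z z)
        (localJet (fun x v w => (φ x ^ 2 : ℝ) • u x v w) z z)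
        = systemSymbol P s t β (Ω z) (metricAt h z) (curvature h z) (cotangentCoeff (n := n) ξ)
          ((2 : ℝ) • metricAt u z) := by
      rw [metricAt_eq_localJet (n := n) u]
      exact (congrArg _ h1).trans h2
    rw [map_smul] at h3
    show (1 / 2 : ℝ) • linearizedSystem P s t β (Ω z) (F z) (G z) (localJet h z z)
        (localJet (fun x v w => (φ x ^ 2 : ℝ) • u x v w) z z) = _
    -- The factor 1/2 in the definition of the symbol compensates the factor 2 from the second
    -- derivative of φ².
    rw [h3, smul_smul]
    norm_num

end Ellipticity

end YangMills

end

/-! ### The main theorem -/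

theorem theorem3p8 {n r : ℕ} (hr : 1 ≤ r)
    {X : Type*} [TopologicalSpace X] [ChartedSpace (Fin n → ℂ) X]
    [IsManifold 𝓘(ℂ, Fin n → ℂ) ω X] [CompactSpace X] [T2Space X]
    {E : X → Type*} [∀ x, AddCommGroup (E x)] [∀ x, Module ℂ (E x)]
    [TopologicalSpace (TotalSpace (Fin r → ℂ) E)] [∀ x, TopologicalSpace (E x)]
    [FiberBundle (Fin r → ℂ) E] [VectorBundle ℂ (Fin r → ℂ) E]
    [ContMDiffVectorBundle ω (Fin r → ℂ) E 𝓘(ℂ, Fin n → ℂ)]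
    (hample : YangMills.IsDetAmple n r E)
    (Ω : X → ℝ) (hΩ : YangMills.IsVolumeForm n Ω)
    (P : YangMills.PositivityType) (s : ℝ) (hs : 0 < s) (t : ℝ)
    (ht : ∃ h₀ : ∀ x, E x → E x → ℂ, YangMills.IsHermitianMetric n r h₀ ∧
      YangMills.IsTwistPositive n r P t h₀) :
    ∀ h : ∀ x, E x → E x → ℂ, YangMills.IsHermitianMetric n r h →
      YangMills.IsTwistPositive n r P t h →
      Continuous (YangMills.distortion n r P s t h) ∧
      (∀ z, 0 ≤ YangMills.distortion n r P s t h z) ∧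
      ∀ β : ℝ, (⨆ z, YangMills.distortion n r P s t h z) < β →
        ∃ U : Set (∀ x, E x → E x → ℂ), YangMills.IsC2Neighborhood n r h U ∧
          ∀ h' ∈ U, YangMills.IsHermitianMetric n r h' ∧
            YangMills.IsTwistPositive n r P t h' ∧
            (∀ z, (YangMills.traceForm
              (YangMills.curvature (n := n) (r := r) h' z)).PosDef) ∧
            ∀ F G, YangMills.IsScalarRHS n r F → YangMills.IsEndoRHS n r G →
              YangMills.HasEllipticLinearization n r
                (YangMills.systemOperator (n := n) (r := r) P s t β Ω F G) h' := by
  intro h hh hP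
  have hW := YangMills.traceForm_curvature_posDef hr hample hh hP
  have hcont := YangMills.continuous_distortion hr s hh hP hW
  refine ⟨hcont, YangMills.distortion_nonneg hr s hh hP hW, fun β hβ => ?_⟩
  -- Compactness bounds the continuous distortion, so the real supremum is a genuine upper bound.
  have hlt : ∀ z, YangMills.distortion n r P s t h z < β := fun z =>
    (le_ciSup (isCompact_range hcont).bddAbove z).trans_lt hβ
  refine ⟨_, YangMills.isC2Neighborhood_distortion_lt hr s hh hP hW hlt,
    fun h' ⟨hh', hP', hlt'⟩ => ?_⟩
  have hW' := YangMills.traceForm_curvature_posDef hr hample hh' hP'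
  refine ⟨hh', hP', hW', fun F G hF hG => ?_⟩
  -- The sign of 1 + rt is obtained from a maximum on X and needs a point; for empty X every
  -- assertion is vacuous.
  rcases isEmpty_or_nonempty X with hX | hX
  · exact ⟨fun _ z => hX.elim z, fun _ z => hX.elim z,
      ⟨fun _ _ _ _ => funext fun z => hX.elim z, fun _ _ _ => funext fun z => hX.elim z,
        fun _ z => hX.elim z⟩, fun z => hX.elim z⟩
  · exact YangMills.hasEllipticLinearization_systemOperator hr hs
      (fun hn => YangMills.one_add_mul_pos hr hn hample hh' hP') hΩ.1 hh' hP' hW' hlt' hF hG
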